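/- Let $\mathbb K$ be a field of characteristic 2. For a finite index set and a vector $\underline N$ with entries in $\{1,2,\dots\}\cup\{\infty\}$, let $\mathcal O(\underline N)$ be the divided power algebra with basis $u^{(r)}$, $r_i<2^{N_i}$, let $\mathfrak{vect}(\underline N)=\{\sum f_i\partial_i\}$, $f_i\in\mathcal O(\underline N)$, be the Lie algebra of its distinguished derivations ($\partial_i u^{(r)}=u^{(r-e_i)}$), and let $\mathfrak{svect}(\underline N)$ be the subalgebra of divergence-free fields. For $\underline N=(N_1,N_2,N_3)$, let $\mathcal L(3;\underline N)=\mathfrak{svect}(3;\underline N)\oplus\mathcal O(3;\underline N)_1\oplus\mathcal O(3;\underline N)_2$, the elements of the second copy of $\mathcal O(3;\underline N)$ being barred, with the commutator of vector fields, the natural action of fields on functions, and $[f,g]=[\bar f,\bar g]=0$, $[f,\bar g]=\nabla f\times\nabla g$ (cross product). It is graded: if the standard degree ($\deg u_i=1$) is $i$, the degree is $2i$ on $\mathfrak{svect}$ and $2i-3$ on both copies of $\mathcal O$. Let Brown's algebra $D_4(3;\underline N)$ be the derived algebra of $\mathcal L(3;\underline N)/\mathcal L_{-3}$. In the Lie algebra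 $\mathfrak{vect}(9;\underline N)$ of vector fields in $z_1,z_2,z_3$ (of degree 2) and $p_1,p_2,p_3,q_1,q_2,q_3$ (of degree 1), put for $v\in\mathbb K^3$ $$w^z(v)=\sum v_i\partial_{z_i},\quad w^p(v)=\sum v_i\partial_{p_i},\quad w^q(v)=\sum v_i\partial_{q_i}+\sum (p\times v)_i\partial_{z_i},$$ $\mathfrak g_{-2}=w^z(\mathbb K^3)$, $\mathfrak g_{-1}=w^p(\mathbb K^3)+ w^q(\mathbb K^3)$, and let $\mathfrak{sl}(3)$ act by the linear fields $\ell(A)=\sum A_{ji}z_j\partial_{z_i}-\sum A_{ij}(p_j\partial_{p_i}+q_j\partial_{q_i})$. For a subalgebra $\mathfrak g_0\subset\mathfrak{vect}(9;\underline N)_0$ preserving $\mathfrak g_{-1}$ and $\mathfrak g_{-2}$, the complete (CTS) prolong with shearing vector $\underline N$ is $\bigoplus_{k\ge-2}\mathfrak g_k$, where, for $k\ge1$, $\mathfrak g_k$ consists of all $X\in\mathfrak{vect}(9;\underline N)_k$ such that $[X,\mathfrak g_{-1}]\subset\mathfrak g_{k-1}$ and $[X,\mathfrak g_{-2}]\subset\mathfrak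 g_{k-2}$. The complete prolong of the negative part is the one with the largest possible $\mathfrak g_0$. The following holds. 1. For every $\underline N=(N_1,N_2,N_3)$, the center of $\mathcal L(3;\underline N)$ is $\mathcal L_{-3}$, and $D_4(3;\underline N)$ is graded by the induced grading and simple. If $N_1=N_2=N_3=\infty$, then $D_4(3;\underline N)=\mathcal L(3;\underline N)/\mathcal L_{-3}$. 2. $D_4(3;(1,1,1))\cong\mathfrak o_\Pi^{(2)}(8)/\mathfrak c$, where $\mathfrak o_\Pi(8)$ preserves the bilinear form with matrix $\begin{pmatrix}0&1_4\\1_4&0\end{pmatrix}$, $\mathfrak o_\Pi^{(2)}(8)$ is its second derived algebra, and $\mathfrak c$ is the center of the latter. Under this isomorphism the grading of $D_4$ is the grading $r=(0011)$, in which the $i$-th positive (negative) Chevalley generator has degree $r_i$ (resp. $-r_i$); the Chevalley generators are $e^+_i=E^{i,i+1}+E^{5+i,4+i}$ for $i=1,2,3$, $e_4^+=E^{3,8}+E^{4,7}$, and $e_i^-=(e_i^+)^T$. 3. $w^z,w^p,w^q$, and $\ell|_{\mathfrak{sl}(3)}$ are injective, $\mathfrak g_{-1}=V\oplus\overline V$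 with $V=w^p(\mathbb K^3)$, $\overline V=w^q(\mathbb K^3)$, and $\mathfrak g_{-2}\oplus\mathfrak g_{-1}\oplus\mathfrak{sl}(3)$ is a Lie algebra in which $\mathfrak g_{-2}$ commutes with $\mathfrak g_{-1}$ and $\mathfrak g_{-2}$, $[V,V]=[\overline V,\overline V]=0$, and $[w^p(v),w^q(w)]=w^z(v\times w)$; here $\ell$ is a homomorphism on $\mathfrak{sl}(3)$, and $\mathfrak{sl}(3)$ acts tautologically on $V$ and $\overline V$, and by $A\mapsto-A^T$ on $\mathfrak g_{-2}\;(\simeq E^2V)$. 4. The components of the complete prolong of this non-positive part (with $\mathfrak g_0=\mathfrak{sl}(3)$) do not depend on the coordinates of $\underline N$ corresponding to $p$ and $q$: one may take $\underline N=(N_1,N_2,N_3,1,1,1,1,1,1)$. Its $\mathfrak g_1$ has dimension 12. Without restrictions on $\underline N$ (all entries $\infty$), this prolong is isomorphic, as a graded Lie algebra, to $D_4(3;(\infty,\infty,\infty))$. For any $\underline N=(N_1,N_2,N_3,1,\dots,1)$, its second derived algebra contains the whole non-positive part and is isomorphic, as a graded Lie algebra, to $D_4(3;(N_1,N_2,N_3))$.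 5. The components of the complete prolong of the negative part $\mathfrak g_{-2}\oplus\mathfrak g_{-1}$ do not depend on the coordinates of $\underline N$ corresponding to $p$ and $q$ either. For $\underline N=(N_1,N_2,N_3,1,\dots,1)$, this prolong is the desuperization of the Lie superalgebra $\mathfrak{vle}(3;\underline N|6)$: with $z$ even and $p,q$ odd, its even and odd parts, its bracket, and the squaring $X\mapsto X^2$ of odd vector fields form a Lie superalgebra in characteristic 2. Its degree 0 component is $\mathfrak{sl}(3)\oplus\mathfrak{gl}(2)$, acting on $\mathfrak g_{-1}=V\otimes\mathbb K^2$ in the natural way, $\mathfrak{sl}(3)$ being embedded by $\ell$; the module $\mathfrak g_{-1}$ over this component is irreducible; the degree 1 component has dimension 18. It contains, degree by degree, the complete prolong of the non-positive part with $\mathfrak g_0=\mathfrak{sl}(3)$ and the same $\underline N$. -/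

import Mathlib

set_option linter.unusedSectionVars false
set_option linter.unusedSimpArgs false

open scoped Matrix

/-! ## Divided powers -/

/-- The divided power algebra over `K` in the indeterminates indexed by `σ`: finite linear
combinations of the divided monomials `u^(r)`, `r : σ → ℕ`. -/
def DP (σ K : Type*) [Field K] : Type _ := (σ → ℕ) →₀ K

namespace DP

variable {σ K : Type*} [Field K]

noncomputable instance : AddCommGroup (DP σ K) := inferInstanceAs (AddCommGroup ((σ → ℕ) →₀ K))
noncomputable instance : Module K (DP σ K) := inferInstanceAs (Module K ((σ → ℕ) →₀ K))

/-- The coefficient of `u^(r)`. -/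
def coeff (r : σ → ℕ) : DP σ K →ₗ[K] K := Finsupp.lapply (M := K) r

/-- The term `a u^(r)`. -/
noncomputable def mono (r : σ → ℕ) (a : K) : DP σ K := Finsupp.single (M := K) r a

theorem ext {f g : DP σ K} (h : ∀ r, coeff r f = coeff r g) : f = g := Finsupp.ext h

theorem coeff_mono [DecidableEq (σ → ℕ)] (r s : σ → ℕ) (a : K) :
    coeff s (mono r a) = if r = s then a else 0 :=
  Finsupp.single_apply (M := K)

theorem mono_add (r : σ → ℕ) (a b : K) : (mono r (a + b) : DP σ K) = mono r a + mono r b :=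
  Finsupp.single_add _ _ _

theorem mono_zero (r : σ → ℕ) : (mono r (0 : K) : DP σ K) = 0 := Finsupp.single_zero _

theorem smul_mono (c : K) (r : σ → ℕ) (a : K) : c • (mono r a : DP σ K) = mono r (c * a) :=
  Finsupp.smul_single c r a

theorem induction {P : DP σ K → Prop} (f : DP σ K) (h0 : P 0)
    (ha : ∀ f g, P f → P g → P (f + g)) (hm : ∀ r a, P (mono r a)) : P f :=
  Finsupp.induction_linear f h0 ha hm

variable [Fintype σ]

/-- The binomial coefficient of multi-indices, `∏ i, binom (r i + s i) (r i)`. -/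
def binom (r s : σ → ℕ) : ℕ := ∏ i, (r i + s i).choose (r i)

theorem binom_comm (r s : σ → ℕ) : binom r s = binom s r := by
  unfold binom
  refine Finset.prod_congr rfl fun i _ => ?_
  rw [add_comm (s i) (r i)]
  exact Nat.choose_symm_add

/-- The product: `u^(r) u^(s) = binom (r + s) r u^(r + s)`, extended bilinearly. -/
noncomputable def mulLin (K : Type*) [Field K] : DP σ K →ₗ[K] DP σ K →ₗ[K] DP σ K :=
  Finsupp.lsum (M := K) (R := K) K fun r => LinearMap.toSpanSingleton K _ <|
    Finsupp.lsum (M := K) (R := K) K fun s =>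
      LinearMap.toSpanSingleton K (DP σ K) (mono (r + s) (binom r s : K))

noncomputable def mul (f g : DP σ K) : DP σ K := mulLin K f g

theorem mul_mono (r s : σ → ℕ) (a b : K) :
    mul (mono r a) (mono s b) = mono (r + s) (binom r s * (a * b)) := by
  have h1 : mulLin K (mono r a : DP σ K) = a • Finsupp.lsum (M := K) (R := K) K fun s =>
      LinearMap.toSpanSingleton K (DP σ K) (mono (r + s) (binom r s : K)) :=
    (Finsupp.lsum_single (M := K) (R := K) K _ r a).trans rfl
  have h2 : (Finsupp.lsum (M := K) (R := K) K fun s =>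
      LinearMap.toSpanSingleton K (DP σ K) (mono (r + s) (binom r s : K))) (Finsupp.single s b)
      = b • mono (r + s) (binom r s : K) :=
    (Finsupp.lsum_single (M := K) (R := K) K _ s b).trans rfl
  unfold mul
  rw [h1]
  change a • ((Finsupp.lsum (M := K) (R := K) K fun s =>
      LinearMap.toSpanSingleton K (DP σ K) (mono (r + s) (binom r s : K))) (Finsupp.single s b)) = _
  rw [h2, smul_mono, smul_mono]
  congr 1; ring

theorem add_mul' (f g h : DP σ K) : mul (f + g) h = mul f h + mul g h := by
  simp [mul]

theorem mul_add' (f g h : DP σ K) : mul f (g + h) = mul f g + mul f h := by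
  simp [mul]

theorem zero_mul' (f : DP σ K) : mul 0 f = 0 := by
  simp [mul]

theorem mul_zero' (f : DP σ K) : mul f 0 = 0 := by
  simp [mul]

theorem mul_comm' (f g : DP σ K) : mul f g = mul g f := by
  induction f using induction with
  | h0 => simp [zero_mul', mul_zero']
  | ha f₁ f₂ h₁ h₂ => simp only [add_mul', mul_add', h₁, h₂]
  | hm r a =>
    induction g using induction with
    | h0 => simp [zero_mul', mul_zero']
    | ha f₁ f₂ h₁ h₂ => simp only [add_mul', mul_add', h₁, h₂]
    | hm s b => rw [mul_mono, mul_mono, binom_comm, add_comm r, mul_comm a]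

theorem mul_assoc' (f g h : DP σ K) : mul (mul f g) h = mul f (mul g h) := by
  induction f using induction with
  | h0 => simp [zero_mul']
  | ha f₁ f₂ h₁ h₂ => simp only [add_mul', h₁, h₂]
  | hm r a =>
    induction g using induction with
    | h0 => simp [zero_mul', mul_zero']
    | ha f₁ f₂ h₁ h₂ => simp only [add_mul', mul_add', h₁, h₂]
    | hm s b =>
      induction h using induction with
      | h0 => simp [mul_zero']
      | ha f₁ f₂ h₁ h₂ => simp only [mul_add', h₁, h₂]
      | hm t c =>
        have key : binom r s * binom (r + s) t = binom s t * binom r (s + t) := by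
          unfold binom
          rw [← Finset.prod_mul_distrib, ← Finset.prod_mul_distrib]
          refine Finset.prod_congr rfl fun i _ => ?_
          have h := Nat.choose_mul (n := r i + s i + t i) (k := r i + s i) (s := r i) (by omega)
          have e1 : r i + s i + t i - r i = s i + t i := by omega
          have e2 : r i + s i - r i = s i := by omega
          rw [e1, e2] at h
          simp only [Pi.add_apply]
          rw [← add_assoc (r i)]
          nlinarith [h]
        have key' : (binom r s : K) * binom (r + s) t = binom s t * binom r (s + t) := by
          exact_mod_cast congrArg (Nat.cast : ℕ → K) key
        rw [mul_mono, mul_mono, mul_mono, mul_mono, add_assoc]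
        congr 1
        linear_combination (a * b * c) * key'

theorem one_mul' (f : DP σ K) : mul (mono 0 1) f = f := by
  induction f using induction with
  | h0 => simp [mul_zero']
  | ha f₁ f₂ h₁ h₂ => simp only [mul_add', h₁, h₂]
  | hm s b => rw [mul_mono]; simp [binom]

noncomputable instance : CommRing (DP σ K) :=
  { (inferInstance : AddCommGroup (DP σ K)) with
    mul := mul
    one := mono 0 1
    left_distrib := mul_add'
    right_distrib := add_mul'
    zero_mul := zero_mul'
    mul_zero := mul_zero'
    mul_assoc := mul_assoc'
    one_mul := one_mul'
    mul_one := fun f => by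
      change mul f (mono 0 1) = f
      rw [mul_comm', one_mul']
    mul_comm := mul_comm' }

theorem mono_mul_mono (r s : σ → ℕ) (a b : K) :
    (mono r a * mono s b : DP σ K) = mono (r + s) (binom r s * (a * b)) := mul_mono r s a b

theorem smul_mul (c : K) (f g : DP σ K) : (c • f) * g = c • (f * g) := by
  induction f using induction with
  | h0 => simp
  | ha f₁ f₂ h₁ h₂ => rw [smul_add, add_mul, h₁, h₂, add_mul, smul_add]
  | hm r a =>
    induction g using induction with
    | h0 => simp
    | ha f₁ f₂ h₁ h₂ => rw [mul_add, mul_add, h₁, h₂, smul_add]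
    | hm s b =>
      rw [smul_mono, mono_mul_mono, mono_mul_mono, smul_mono]
      congr 1; ring

theorem mul_smul (c : K) (f g : DP σ K) : f * (c • g) = c • (f * g) := by
  rw [mul_comm, smul_mul, mul_comm]

variable [DecidableEq σ]

/-- The distinguished partial derivative: `∂ᵢ u^(r) = u^(r - eᵢ)` (and `0` if `r i = 0`), that is,
the coefficient of `u^(r)` in `∂ᵢ f` is the coefficient of `u^(r + eᵢ)` in `f`. -/
noncomputable def pd (i : σ) : DP σ K →ₗ[K] DP σ K :=
  Finsupp.lcomapDomain (fun r => r + Pi.single i 1) (add_left_injective _)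

theorem coeff_pd (i : σ) (f : DP σ K) (r : σ → ℕ) :
    coeff r (pd i f) = coeff (r + Pi.single i 1) f := rfl

theorem pd_mono_zero {i : σ} {r : σ → ℕ} (h : r i = 0) (a : K) : pd i (mono r a) = 0 := by
  classical
  refine ext fun s => ?_
  rw [coeff_pd, coeff_mono, if_neg, map_zero]
  intro e
  have := congrFun e i
  simp [h] at this

theorem pd_mono_add (i : σ) (r : σ → ℕ) (a : K) :
    pd i (mono (r + Pi.single i 1) a) = mono r a := by
  classical
  refine ext fun s => ?_
  rw [coeff_pd, coeff_mono, coeff_mono]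
  simp

theorem eq_add_single {i : σ} {r : σ → ℕ} (h : r i ≠ 0) :
    ∃ r' : σ → ℕ, r = r' + Pi.single i 1 := by
  refine ⟨r - Pi.single i 1, ?_⟩
  funext j
  by_cases hj : j = i
  · subst hj; simp; omega
  · simp [hj]

theorem binom_step {r R s S : σ → ℕ} {i : σ} (hr : ∀ j, j ≠ i → R j = r j)
    (hs : ∀ j, j ≠ i → S j = s j) (hri : R i = r i + 1) (hsi : S i = s i + 1) :
    binom R S = binom r S + binom R s := by
  have e : ∀ r s : σ → ℕ, binom r s =
      (r i + s i).choose (r i) * ∏ j ∈ Finset.univ.erase i, (r j + s j).choose (r j) := fun r s =>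
    (Finset.mul_prod_erase _ (fun j => (r j + s j).choose (r j)) (Finset.mem_univ i)).symm
  have e' : ∀ f g : σ → ℕ, (∀ j, j ≠ i → f j = g j) →
      ∏ j ∈ Finset.univ.erase i, f j = ∏ j ∈ Finset.univ.erase i, g j := fun f g h =>
    Finset.prod_congr rfl fun j hj => h j (Finset.ne_of_mem_erase hj)
  rw [e R S, e r S, e R s, e' _ (fun j => (r j + s j).choose (r j)),
    e' (fun j => (r j + S j).choose (r j)) (fun j => (r j + s j).choose (r j)),
    e' (fun j => (R j + s j).choose (R j)) (fun j => (r j + s j).choose (r j)), ← add_mul,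
    hri, hsi]
  · congr 1
    have := Nat.choose_succ_succ (r i + s i + 1) (r i)
    rw [show r i + 1 + (s i + 1) = (r i + s i + 1) + 1 by ring,
      show r i + (s i + 1) = r i + s i + 1 by ring,
      show r i + 1 + s i = r i + s i + 1 by ring]
    exact this
  all_goals intro j hj; simp [hr j hj, hs j hj]

theorem binom_single_left (r s : σ → ℕ) (i : σ) :
    binom (r + Pi.single i 1) (s + Pi.single i 1) =
      binom r (s + Pi.single i 1) + binom (r + Pi.single i 1) s := by
  apply binom_step (i := i)
  · intro j hj; simp [hj]
  · intro j hj; simp [hj]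
  · simp
  · simp

theorem binom_zero_left {r s : σ → ℕ} {i : σ} (h : r i = 0) :
    binom r (s + Pi.single i 1) = binom r s := by
  unfold binom
  refine Finset.prod_congr rfl fun j _ => ?_
  by_cases hj : j = i
  · subst hj; simp [h]
  · simp [hj]

theorem pd_mul (i : σ) (f g : DP σ K) : pd i (f * g) = pd i f * g + f * pd i g := by
  induction f using induction with
  | h0 => simp
  | ha f₁ f₂ h₁ h₂ => rw [add_mul, map_add, h₁, h₂, map_add]; ring
  | hm r a =>
    induction g using induction with
    | h0 => simp
    | ha f₁ f₂ h₁ h₂ => rw [mul_add, map_add, h₁, h₂, map_add]; ring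
    | hm s b =>
      rw [mono_mul_mono]
      by_cases hr : r i = 0
      · rw [pd_mono_zero hr, zero_mul, zero_add]
        by_cases hs : s i = 0
        · rw [pd_mono_zero hs, mul_zero, pd_mono_zero (by simp [hr, hs])]
        · obtain ⟨s, rfl⟩ := eq_add_single hs
          rw [← add_assoc, pd_mono_add, pd_mono_add, mono_mul_mono, binom_zero_left hr]
      · obtain ⟨r, rfl⟩ := eq_add_single hr
        by_cases hs : s i = 0
        · rw [pd_mono_zero hs, mul_zero, add_zero, add_right_comm, pd_mono_add, pd_mono_add,
            mono_mul_mono, binom_comm, binom_zero_left hs, binom_comm]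
        · obtain ⟨s, rfl⟩ := eq_add_single hs
          rw [← add_assoc, pd_mono_add, pd_mono_add, pd_mono_add, mono_mul_mono, mono_mul_mono,
            binom_single_left, ← add_assoc, add_right_comm r s, ← mono_add]
          congr 1; push_cast; ring

theorem pd_comm (i j : σ) (f : DP σ K) : pd i (pd j f) = pd j (pd i f) := by
  refine ext fun r => ?_
  rw [coeff_pd, coeff_pd, coeff_pd, coeff_pd, add_right_comm]

theorem pd_iterate_mul [CharP K 2] (i : σ) (n : ℕ) (f g : DP σ K) :
    (pd i)^[2 ^ n] (f * g) = (pd i)^[2 ^ n] f * g + f * (pd i)^[2 ^ n] g := by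
  induction n generalizing f g with
  | zero => simpa using pd_mul i f g
  | succ n ih =>
    have e : ∀ h : DP σ K, (pd i)^[2 ^ (n + 1)] h = (pd i)^[2 ^ n] ((pd i)^[2 ^ n] h) := fun h => by
      rw [pow_succ, mul_two, Function.iterate_add_apply]
    have two : ∀ x : DP σ K, x + x = 0 := fun x => by
      rw [← two_smul K x, CharTwo.two_eq_zero, zero_smul]
    have ladd : ∀ (m : ℕ) (x y : DP σ K), (pd i)^[m] (x + y) = (pd i)^[m] x + (pd i)^[m] y := by
      intro m x y
      exact iterate_map_add (pd i) m x y
    rw [e, e, e, ih, ladd, ih, ih]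
    linear_combination two ((pd i)^[2 ^ n] f * (pd i)^[2 ^ n] g)

/-! ### Shearing vectors and homogeneous functions -/

/-- `𝒪(σ; N)`: the span of the `u^(r)` with `r i < 2 ^ N i` for all `i`, where each `N i` is a positive
integer or infinity. -/
def shear (K : Type*) [Field K] (N : σ → WithTop ℕ+) : Submodule K (DP σ K) where
  carrier := {f | ∀ r, coeff r f ≠ 0 → ∀ i, ∀ n : ℕ+, N i = n → r i < 2 ^ (n : ℕ)}
  zero_mem' := by intro r h; simp at h
  add_mem' := by
    intro f g hf hg r h
    by_cases h' : coeff r f = 0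
    · exact hg r (by simpa [h'] using h)
    · exact hf r h'
  smul_mem' := by
    intro c f hf r h
    exact hf r (fun e => h (by simp [e]))

theorem coeff_pd_iterate (i : σ) (m : ℕ) (f : DP σ K) (r : σ → ℕ) :
    coeff r ((pd i)^[m] f) = coeff (r + Pi.single i m) f := by
  induction m generalizing f with
  | zero => simp
  | succ m ih =>
    rw [Function.iterate_succ_apply, ih, coeff_pd, add_assoc, ← Pi.single_add]

theorem mem_shear_iff (N : σ → WithTop ℕ+) (f : DP σ K) :
    f ∈ shear K N ↔ ∀ i, ∀ n : ℕ+, N i = n → (pd i)^[2 ^ (n : ℕ)] f = 0 := by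
  constructor
  · intro h i n hn
    refine ext fun r => ?_
    rw [coeff_pd_iterate, map_zero]
    by_contra hc
    have := h _ hc i n hn
    simp at this
  · intro h r hr i n hn
    by_contra hlt
    push Not at hlt
    have e := congrArg (coeff (r - Pi.single i (2 ^ (n : ℕ)))) (h i n hn)
    rw [coeff_pd_iterate, map_zero] at e
    apply hr
    rw [← e]
    congr 1
    congr 1
    funext j
    by_cases hj : j = i
    · subst hj; simp; omega
    · simp [hj]

theorem shear_mul [CharP K 2] {N : σ → WithTop ℕ+} {f g : DP σ K}
    (hf : f ∈ shear K N) (hg : g ∈ shear K N) : f * g ∈ shear K N := by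
  rw [mem_shear_iff] at *
  intro i n hn
  rw [pd_iterate_mul, hf i n hn, hg i n hn]; simp

theorem shear_pd {N : σ → WithTop ℕ+} {f : DP σ K} (i : σ)
    (hf : f ∈ shear K N) : pd i f ∈ shear K N := by
  intro r hr j n hn
  have := hf _ hr j n hn
  simp only [Pi.add_apply] at this
  omega

/-- Functions that are homogeneous of degree `d` if `deg uᵢ = w i`. -/
def hom (K : Type*) [Field K] (w : σ → ℤ) (d : ℤ) : Submodule K (DP σ K) where
  carrier := {f | ∀ r, coeff r f ≠ 0 → ∑ i, w i * r i = d}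
  zero_mem' := by intro r h; simp at h
  add_mem' := by
    intro f g hf hg r h
    by_cases h' : coeff r f = 0
    · exact hg r (by simpa [h'] using h)
    · exact hf r h'
  smul_mem' := by
    intro c f hf r h
    exact hf r (fun e => h (by simp [e]))

theorem hom_pd {w : σ → ℤ} {d : ℤ} {f : DP σ K} (i : σ) (hf : f ∈ hom K w d) :
    pd i f ∈ hom K w (d - w i) := by
  intro r hr
  have := hf _ hr
  rw [← this]
  simp [mul_add, Finset.sum_add_distrib, Pi.single_apply]

theorem exists_coeff_mul {f g : DP σ K} {t : σ → ℕ} (h : coeff t (f * g) ≠ 0) :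
    ∃ r s, coeff r f ≠ 0 ∧ coeff s g ≠ 0 ∧ r + s = t := by
  classical
  have key : ∀ f : DP σ K, f = ∑ r ∈ Finsupp.support (M := K) f, mono r (coeff r f) := fun f =>
    (Finsupp.sum_single (M := K) f).symm
  rw [key f, key g, Finset.sum_mul_sum, map_sum] at h
  obtain ⟨r, hr, h⟩ := Finset.exists_ne_zero_of_sum_ne_zero h
  rw [map_sum] at h
  obtain ⟨s, hs, h⟩ := Finset.exists_ne_zero_of_sum_ne_zero h
  rw [mono_mul_mono, coeff_mono] at h
  exact ⟨r, s, Finsupp.mem_support_iff.mp hr, Finsupp.mem_support_iff.mp hs,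
    by_contra fun e => h (if_neg e)⟩

theorem hom_mul {w : σ → ℤ} {d e : ℤ} {f g : DP σ K} (hf : f ∈ hom K w d) (hg : g ∈ hom K w e) :
    f * g ∈ hom K w (d + e) := by
  intro t ht
  obtain ⟨r, s, hr, hs, rfl⟩ := exists_coeff_mul ht
  rw [← hf r hr, ← hg s hs]
  simp [mul_add, Finset.sum_add_distrib]

end DP

/-! ## Vector fields -/

/-- Distinguished derivations `∑ i, X i ∂ᵢ` of the divided power algebra, given by their
coefficients. -/
def VF (σ K : Type*) [Field K] : Type _ := σ → DP σ K

namespace VF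

variable {σ K : Type*} [Field K]

noncomputable instance : AddCommGroup (VF σ K) := inferInstanceAs (AddCommGroup (σ → DP σ K))
noncomputable instance : Module K (VF σ K) := inferInstanceAs (Module K (σ → DP σ K))

theorem ext {X Y : VF σ K} (h : ∀ i, X i = Y i) : X = Y := funext h

@[simp] theorem add_apply (X Y : VF σ K) (i : σ) : (X + Y) i = X i + Y i := rfl
@[simp] theorem sub_apply (X Y : VF σ K) (i : σ) : (X - Y) i = X i - Y i := rfl
@[simp] theorem neg_apply (X : VF σ K) (i : σ) : (-X) i = -X i := rfl
@[simp] theorem zero_apply (i : σ) : (0 : VF σ K) i = 0 := rfl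
@[simp] theorem smul_apply (c : K) (X : VF σ K) (i : σ) : (c • X) i = c • X i := rfl

variable [Fintype σ] [DecidableEq σ]

/-- The action of `∑ i, X i ∂ᵢ` on functions. -/
noncomputable def act (X : VF σ K) : DP σ K →ₗ[K] DP σ K where
  toFun f := ∑ i, X i * DP.pd i f
  map_add' f g := by simp [mul_add, Finset.sum_add_distrib]
  map_smul' c f := by simp [DP.mul_smul, Finset.smul_sum]

theorem act_apply (X : VF σ K) (f : DP σ K) : X.act f = ∑ i, X i * DP.pd i f := rfl

theorem act_add_left (X Y : VF σ K) (f : DP σ K) : (X + Y).act f = X.act f + Y.act f := by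
  simp [act_apply, add_mul, Finset.sum_add_distrib]

theorem act_smul_left (c : K) (X : VF σ K) (f : DP σ K) : (c • X).act f = c • X.act f := by
  simp [act_apply, DP.smul_mul, Finset.smul_sum]

theorem act_mul (X : VF σ K) (f g : DP σ K) : X.act (f * g) = X.act f * g + f * X.act g := by
  simp only [act_apply, DP.pd_mul, Finset.sum_mul, Finset.mul_sum, ← Finset.sum_add_distrib]
  exact Finset.sum_congr rfl fun i _ => by ring

/-- The commutator of vector fields. -/
noncomputable instance : Bracket (VF σ K) (VF σ K) :=
  ⟨fun X Y j => X.act (Y j) - Y.act (X j)⟩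

theorem lie_apply (X Y : VF σ K) (j : σ) : ⁅X, Y⁆ j = X.act (Y j) - Y.act (X j) := rfl

theorem act_lie (X Y : VF σ K) (f : DP σ K) :
    ⁅X, Y⁆.act f = X.act (Y.act f) - Y.act (X.act f) := by
  have h : ∀ X Y : VF σ K, X.act (Y.act f) =
      ∑ j, X.act (Y j) * DP.pd j f + ∑ j, ∑ i, Y j * (X i * DP.pd i (DP.pd j f)) := by
    intro X Y
    rw [act_apply Y, map_sum, ← Finset.sum_add_distrib]
    refine Finset.sum_congr rfl fun j _ => ?_
    rw [act_mul, act_apply X (DP.pd j f), Finset.mul_sum]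
  rw [h, h, act_apply ⁅X, Y⁆, Finset.sum_comm (γ := σ)]
  have e : ∑ x, ∑ y, Y y * (X x * DP.pd x (DP.pd y f)) =
      ∑ x, ∑ y, X x * (Y y * DP.pd y (DP.pd x f)) :=
    Finset.sum_congr rfl fun x _ => Finset.sum_congr rfl fun y _ => by
      rw [DP.pd_comm x y]; ring
  rw [e, add_sub_add_right_eq_sub, ← Finset.sum_sub_distrib]
  exact Finset.sum_congr rfl fun j _ => by rw [lie_apply, sub_mul]

noncomputable instance : LieRing (VF σ K) where
  add_lie X Y Z := ext fun j => by
    simp only [lie_apply, add_apply, act_add_left, map_add]; ring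
  lie_add X Y Z := ext fun j => by
    simp only [lie_apply, add_apply, act_add_left, map_add]; ring
  lie_self X := ext fun j => by simp [lie_apply]
  leibniz_lie X Y Z := ext fun j => by
    simp only [lie_apply, add_apply, act_lie, map_sub]; ring

noncomputable instance : LieAlgebra K (VF σ K) where
  lie_smul c X Y := ext fun j => by
    simp only [lie_apply, smul_apply, act_smul_left, map_smul, smul_sub]

/-- `𝔳𝔢𝔠𝔱(σ; N)`: the vector fields with coefficients in `𝒪(σ; N)`. -/
def shear (K : Type*) [Field K] (N : σ → WithTop ℕ+) : Submodule K (VF σ K) where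
  carrier := {X | ∀ j, X j ∈ DP.shear K N}
  zero_mem' := fun _ => Submodule.zero_mem _
  add_mem' := fun hX hY j => Submodule.add_mem _ (hX j) (hY j)
  smul_mem' := fun c _ hX j => Submodule.smul_mem _ c (hX j)

theorem act_shear [CharP K 2] {N : σ → WithTop ℕ+} {X : VF σ K} {f : DP σ K}
    (hX : X ∈ shear K N) (hf : f ∈ DP.shear K N) : X.act f ∈ DP.shear K N :=
  Submodule.sum_mem _ fun i _ => DP.shear_mul (hX i) (DP.shear_pd i hf)

theorem lie_shear [CharP K 2] {N : σ → WithTop ℕ+} {X Y : VF σ K}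
    (hX : X ∈ shear K N) (hY : Y ∈ shear K N) : ⁅X, Y⁆ ∈ shear K N := fun j =>
  Submodule.sub_mem _ (act_shear hX (hY j)) (act_shear hY (hX j))

/-- Vector fields that are homogeneous of degree `k` if `deg uᵢ = w i` and `deg ∂ᵢ = - w i`. -/
def hom (K : Type*) [Field K] (w : σ → ℤ) (k : ℤ) : Submodule K (VF σ K) where
  carrier := {X | ∀ j, X j ∈ DP.hom K w (k + w j)}
  zero_mem' := fun _ => Submodule.zero_mem _
  add_mem' := fun hX hY j => Submodule.add_mem _ (hX j) (hY j)
  smul_mem' := fun c _ hX j => Submodule.smul_mem _ c (hX j)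

theorem act_hom {w : σ → ℤ} {k d : ℤ} {X : VF σ K} {f : DP σ K}
    (hX : X ∈ hom K w k) (hf : f ∈ DP.hom K w d) : X.act f ∈ DP.hom K w (k + d) :=
  Submodule.sum_mem _ fun i _ => by
    have := DP.hom_mul (hX i) (DP.hom_pd i hf)
    rwa [show k + w i + (d - w i) = k + d by ring] at this

theorem lie_hom {w : σ → ℤ} {k l : ℤ} {X Y : VF σ K}
    (hX : X ∈ hom K w k) (hY : Y ∈ hom K w l) : ⁅X, Y⁆ ∈ hom K w (k + l) := fun j => by
  refine Submodule.sub_mem _ ?_ ?_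
  · have := act_hom hX (hY j)
    rwa [← add_assoc] at this
  · have := act_hom hY (hX j)
    rwa [← add_assoc, add_comm l k] at this

/-- The square of a vector field `X` as a derivation: the vector field `∑ j, X (X j) ∂ⱼ`. In
characteristic 2 this is the squaring of the Lie superalgebra of vector fields on a superspace, for odd `X`. -/
noncomputable def sq (X : VF σ K) : VF σ K := fun j => X.act (X j)

end VF

/-! ## Brown's algebras -/

section Brown

variable (K : Type*) [Field K]

/-- `𝔰𝔳𝔢𝔠𝔱(3)`: divergence-free vector fields in three indeterminates. -/
noncomputable def svect : LieSubalgebra K (VF (Fin 3) K) where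
  carrier := {X | ∑ i, DP.pd i (X i) = 0}
  zero_mem' := by simp
  add_mem' := by
    intro X Y hX hY
    change ∑ i, DP.pd i (X i) = 0 at hX
    change ∑ i, DP.pd i (Y i) = 0 at hY
    change ∑ i, DP.pd i (X i + Y i) = 0
    simp [Finset.sum_add_distrib, hX, hY]
  smul_mem' := by
    intro c X hX
    change ∑ i, DP.pd i (X i) = 0 at hX
    change ∑ i, DP.pd i (c • X i) = 0
    simp [← Finset.smul_sum, hX]
  lie_mem' := by
    intro X Y hX hY
    have key : ∀ X Y : VF (Fin 3) K, ∑ j, DP.pd j (X.act (Y j)) =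
        X.act (∑ j, DP.pd j (Y j)) + ∑ j, ∑ i, DP.pd j (X i) * DP.pd i (Y j) := by
      intro X Y
      rw [map_sum, ← Finset.sum_add_distrib]
      refine Finset.sum_congr rfl fun j _ => ?_
      simp only [VF.act_apply, map_sum, DP.pd_mul, Finset.sum_add_distrib]
      rw [add_comm]
      congr 1
      exact Finset.sum_congr rfl fun i _ => by rw [DP.pd_comm]
    change ∑ i, DP.pd i (X i) = 0 at hX
    change ∑ i, DP.pd i (Y i) = 0 at hY
    change ∑ i, DP.pd i (X.act (Y i) - Y.act (X i)) = 0
    simp only [map_sub, Finset.sum_sub_distrib]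
    rw [key, key, hX, hY, map_zero, map_zero, zero_add, zero_add, Finset.sum_comm, sub_eq_zero]
    exact Finset.sum_congr rfl fun i _ => Finset.sum_congr rfl fun j _ => mul_comm _ _

variable {K} in
/-- `∇f × ∇g`, where `∇f = ∑ i, (∂ᵢ f) ∂ᵢ` and `×` is the cross product of vector fields. -/
noncomputable def gradCross (f g : DP (Fin 3) K) : svect K :=
  ⟨(crossProduct (fun i => DP.pd i f) (fun i => DP.pd i g) : Fin 3 → DP (Fin 3) K), by
    change ∑ i, DP.pd i (crossProduct (fun i => DP.pd i f) (fun i => DP.pd i g) i) = 0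
    simp only [Fin.sum_univ_three, cross_apply, Matrix.cons_val, map_sub, DP.pd_mul]
    rw [DP.pd_comm 1 0 f, DP.pd_comm 1 0 g, DP.pd_comm 2 0 f, DP.pd_comm 2 0 g,
      DP.pd_comm 2 1 f, DP.pd_comm 2 1 g]
    ring⟩

/-- The space `𝔰𝔳𝔢𝔠𝔱(3) ⊕ 𝒪(3)₁ ⊕ 𝒪(3)₂` underlying Brown's algebra (without restrictions on the
degrees of the divided powers). -/
def BrownSpace : Type _ := svect K × DP (Fin 3) K × DP (Fin 3) K

namespace BrownSpace

noncomputable instance : AddCommGroup (BrownSpace K) :=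
  inferInstanceAs (AddCommGroup (svect K × DP (Fin 3) K × DP (Fin 3) K))
noncomputable instance : Module K (BrownSpace K) :=
  inferInstanceAs (Module K (svect K × DP (Fin 3) K × DP (Fin 3) K))

variable {K}

/-- The component in `𝔰𝔳𝔢𝔠𝔱(3)`. -/
def vf (x : BrownSpace K) : VF (Fin 3) K := x.1.1
/-- The component in the first copy of `𝒪(3)`. -/
def fst (x : BrownSpace K) : DP (Fin 3) K := x.2.1
/-- The component in the second copy of `𝒪(3)`. -/
def snd (x : BrownSpace K) : DP (Fin 3) K := x.2.2

theorem ext {x y : BrownSpace K} (h1 : ∀ i, x.vf i = y.vf i) (h2 : x.fst = y.fst)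
    (h3 : x.snd = y.snd) : x = y :=
  Prod.ext (Subtype.ext (funext h1)) (Prod.ext h2 h3)

@[simp] theorem vf_add (x y : BrownSpace K) : (x + y).vf = x.vf + y.vf := rfl
@[simp] theorem fst_add (x y : BrownSpace K) : (x + y).fst = x.fst + y.fst := rfl
@[simp] theorem snd_add (x y : BrownSpace K) : (x + y).snd = x.snd + y.snd := rfl
@[simp] theorem vf_smul (c : K) (x : BrownSpace K) : (c • x).vf = c • x.vf := rfl
@[simp] theorem fst_smul (c : K) (x : BrownSpace K) : (c • x).fst = c • x.fst := rfl
@[simp] theorem snd_smul (c : K) (x : BrownSpace K) : (c • x).snd = c • x.snd := rfl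
@[simp] theorem vf_zero : (0 : BrownSpace K).vf = 0 := rfl
@[simp] theorem fst_zero : (0 : BrownSpace K).fst = 0 := rfl
@[simp] theorem snd_zero : (0 : BrownSpace K).snd = 0 := rfl

/-- The bracket: the commutator on vector fields, the natural action of vector fields on functions,
`[f, g] = [f̄, ḡ] = 0`, and `[f, ḡ] = ∇f × ∇g`. -/
noncomputable instance : Bracket (BrownSpace K) (BrownSpace K) :=
  ⟨fun x y => (⁅x.1, y.1⁆ + gradCross x.fst y.snd - gradCross y.fst x.snd,
    x.vf.act y.fst - y.vf.act x.fst, x.vf.act y.snd - y.vf.act x.snd)⟩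

theorem vf_lie (x y : BrownSpace K) :
    ⁅x, y⁆.vf = ⁅x.vf, y.vf⁆ + (gradCross x.fst y.snd).1 - (gradCross y.fst x.snd).1 := rfl
theorem fst_lie (x y : BrownSpace K) : ⁅x, y⁆.fst = x.vf.act y.fst - y.vf.act x.fst := rfl
theorem snd_lie (x y : BrownSpace K) : ⁅x, y⁆.snd = x.vf.act y.snd - y.vf.act x.snd := rfl

theorem div_vf (x : BrownSpace K) :
    DP.pd 0 (x.vf 0) + DP.pd 1 (x.vf 1) + DP.pd 2 (x.vf 2) = 0 := by
  have := x.1.2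
  change ∑ i, DP.pd i (x.vf i) = 0 at this
  rwa [Fin.sum_univ_three] at this

theorem gradCross_zero (f g : DP (Fin 3) K) :
    (gradCross f g).1 0 = DP.pd 1 f * DP.pd 2 g - DP.pd 2 f * DP.pd 1 g := by
  change crossProduct (fun i => DP.pd i f) (fun i => DP.pd i g) 0 = _
  simp [cross_apply]
theorem gradCross_one (f g : DP (Fin 3) K) :
    (gradCross f g).1 1 = DP.pd 2 f * DP.pd 0 g - DP.pd 0 f * DP.pd 2 g := by
  change crossProduct (fun i => DP.pd i f) (fun i => DP.pd i g) 1 = _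
  simp [cross_apply]
theorem gradCross_two (f g : DP (Fin 3) K) :
    (gradCross f g).1 2 = DP.pd 0 f * DP.pd 1 g - DP.pd 1 f * DP.pd 0 g := by
  change crossProduct (fun i => DP.pd i f) (fun i => DP.pd i g) 2 = _
  simp [cross_apply]

theorem gradCross_add_left (f g h : DP (Fin 3) K) :
    (gradCross (f + g) h).1 = (gradCross f h).1 + (gradCross g h).1 := by
  refine VF.ext fun i => ?_
  fin_cases i <;> simp [gradCross_zero, gradCross_one, gradCross_two] <;> ring

theorem gradCross_add_right (f g h : DP (Fin 3) K) :
    (gradCross f (g + h)).1 = (gradCross f g).1 + (gradCross f h).1 := by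
  refine VF.ext fun i => ?_
  fin_cases i <;> simp [gradCross_zero, gradCross_one, gradCross_two] <;> ring

theorem gradCross_sub_left (f g h : DP (Fin 3) K) :
    (gradCross (f - g) h).1 = (gradCross f h).1 - (gradCross g h).1 := by
  refine VF.ext fun i => ?_
  fin_cases i <;> simp [gradCross_zero, gradCross_one, gradCross_two] <;> ring

theorem gradCross_sub_right (f g h : DP (Fin 3) K) :
    (gradCross f (g - h)).1 = (gradCross f g).1 - (gradCross f h).1 := by
  refine VF.ext fun i => ?_
  fin_cases i <;> simp [gradCross_zero, gradCross_one, gradCross_two] <;> ring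

theorem act_sub_left (X Y : VF (Fin 3) K) (f : DP (Fin 3) K) :
    (X - Y).act f = X.act f - Y.act f := by
  simp [VF.act_apply, sub_mul, Finset.sum_sub_distrib]

theorem gradCross_smul_left (c : K) (f g : DP (Fin 3) K) :
    (gradCross (c • f) g).1 = c • (gradCross f g).1 := by
  refine VF.ext fun i => ?_
  fin_cases i <;>
    simp [gradCross_zero, gradCross_one, gradCross_two, DP.smul_mul, smul_sub]

theorem gradCross_smul_right (c : K) (f g : DP (Fin 3) K) :
    (gradCross f (c • g)).1 = c • (gradCross f g).1 := by
  refine VF.ext fun i => ?_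
  fin_cases i <;>
    simp [gradCross_zero, gradCross_one, gradCross_two, DP.mul_smul, smul_sub]

/-- Divergence-free vector fields are derivations of the bracket `∇f × ∇g`. -/
theorem lie_gradCross (x : BrownSpace K) (f g : DP (Fin 3) K) :
    ⁅x.vf, (gradCross f g).1⁆ =
      (gradCross (x.vf.act f) g).1 + (gradCross f (x.vf.act g)).1 := by
  have hd := div_vf x
  refine VF.ext fun i => ?_
  fin_cases i
  all_goals
    simp only [Fin.zero_eta, Fin.mk_one, Fin.reduceFinMk, VF.lie_apply, VF.add_apply,
      gradCross_zero, gradCross_one, gradCross_two, map_sub, VF.act_mul]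
    simp only [VF.act_apply, Fin.sum_univ_three, gradCross_zero, gradCross_one, gradCross_two,
      map_add, DP.pd_mul]
    rw [DP.pd_comm 1 0 f, DP.pd_comm 1 0 g, DP.pd_comm 2 0 f, DP.pd_comm 2 0 g,
      DP.pd_comm 2 1 f, DP.pd_comm 2 1 g]
  · linear_combination (-(DP.pd 1 f * DP.pd 2 g - DP.pd 2 f * DP.pd 1 g)) * hd
  · linear_combination (-(DP.pd 2 f * DP.pd 0 g - DP.pd 0 f * DP.pd 2 g)) * hd
  · linear_combination (-(DP.pd 0 f * DP.pd 1 g - DP.pd 1 f * DP.pd 0 g)) * hd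

theorem gradCross_lie (x : BrownSpace K) (f g : DP (Fin 3) K) :
    ⁅(gradCross f g).1, x.vf⁆ =
      -((gradCross (x.vf.act f) g).1 + (gradCross f (x.vf.act g)).1) := by
  rw [← lie_skew, lie_gradCross]

theorem gradCross_self (f : DP (Fin 3) K) : (gradCross f f).1 = 0 := by
  refine VF.ext fun i => ?_
  fin_cases i <;> simp [gradCross_zero, gradCross_one, gradCross_two] <;> ring

variable [CharP K 2]

theorem add_self (f : DP (Fin 3) K) : f + f = 0 := by
  rw [← two_smul K f, CharTwo.two_eq_zero, zero_smul]

noncomputable instance : LieRing (BrownSpace K) where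
  add_lie x y z := by
    refine ext (fun i => ?_) ?_ ?_
    · simp only [vf_lie, vf_add, fst_add, snd_add, add_lie, gradCross_add_left,
        gradCross_add_right, VF.add_apply, VF.sub_apply]; ring
    · simp only [fst_lie, vf_add, fst_add, VF.act_add_left, map_add]; ring
    · simp only [snd_lie, vf_add, snd_add, VF.act_add_left, map_add]; ring
  lie_add x y z := by
    refine ext (fun i => ?_) ?_ ?_
    · simp only [vf_lie, vf_add, fst_add, snd_add, lie_add, gradCross_add_left,
        gradCross_add_right, VF.add_apply, VF.sub_apply]; ring
    · simp only [fst_lie, vf_add, fst_add, VF.act_add_left, map_add]; ring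
    · simp only [snd_lie, vf_add, snd_add, VF.act_add_left, map_add]; ring
  lie_self x := by
    refine ext (fun i => ?_) ?_ ?_
    · simp [vf_lie]
    · simp [fst_lie]
    · simp [snd_lie]
  leibniz_lie x y z := by
    have h2 : (2 : DP (Fin 3) K) = 0 := by
      rw [← one_add_one_eq_two]; exact add_self 1
    refine ext (fun i => ?_) ?_ ?_
    · have j := congrFun (leibniz_lie x.vf y.vf z.vf) i
      have l1 := lie_gradCross x y.fst z.snd
      have l2 := lie_gradCross x z.fst y.snd
      have l3 := lie_gradCross y x.fst z.snd
      have l4 := lie_gradCross y z.fst x.snd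
      have l5 := gradCross_lie z x.fst y.snd
      have l6 := gradCross_lie z y.fst x.snd
      simp only [vf_lie, vf_add, fst_lie, snd_lie, lie_add, lie_sub, add_lie, sub_lie,
        gradCross_sub_left, gradCross_sub_right, l1, l2, l3, l4, l5, l6, VF.add_apply, VF.sub_apply, VF.neg_apply] at j ⊢
      linear_combination j
    · simp only [fst_lie, vf_lie, fst_add, act_sub_left, VF.act_add_left, VF.act_lie, map_sub]
      simp only [VF.act_apply, Fin.sum_univ_three, gradCross_zero, gradCross_one, gradCross_two]
      rw [← sub_eq_zero]
      ring_nf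
      simp only [h2, mul_zero, add_zero, sub_zero]
    · simp only [snd_lie, vf_lie, snd_add, act_sub_left, VF.act_add_left, VF.act_lie, map_sub]
      simp only [VF.act_apply, Fin.sum_univ_three, gradCross_zero, gradCross_one, gradCross_two]
      rw [← sub_eq_zero]
      ring_nf
      simp only [h2, mul_zero, add_zero, sub_zero]

noncomputable instance : LieAlgebra K (BrownSpace K) where
  lie_smul c x y := by
    refine ext (fun i => ?_) ?_ ?_
    · simp only [vf_lie, vf_smul, fst_smul, snd_smul, lie_smul, gradCross_smul_left,
        gradCross_smul_right, VF.add_apply, VF.sub_apply, VF.smul_apply, smul_add, smul_sub]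
    · simp only [fst_lie, vf_smul, fst_smul, VF.act_smul_left, map_smul, smul_sub]
    · simp only [snd_lie, vf_smul, snd_smul, VF.act_smul_left, map_smul, smul_sub]

end BrownSpace

end Brown

section Graded

variable (K : Type*) [Field K]

/-- A grading of a Lie algebra by the integers. -/
structure IsLieGrading {L : Type*} [LieRing L] [LieAlgebra K L] (g : ℤ → Submodule K L) : Prop where
  isInternal : DirectSum.IsInternal g
  lie_mem : ∀ {i j : ℤ} {x y : L}, x ∈ g i → y ∈ g j → ⁅x, y⁆ ∈ g (i + j)

variable [CharP K 2] (N : Fin 3 → WithTop ℕ+)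

theorem gradCross_mem_shear {N : Fin 3 → WithTop ℕ+} {f g : DP (Fin 3) K}
    (hf : f ∈ DP.shear K N) (hg : g ∈ DP.shear K N) : (gradCross f g).1 ∈ VF.shear K N := by
  intro i
  have h : ∀ j k, DP.pd j f * DP.pd k g ∈ DP.shear K N := fun j k =>
    DP.shear_mul (DP.shear_pd j hf) (DP.shear_pd k hg)
  fin_cases i
  · exact BrownSpace.gradCross_zero f g ▸ Submodule.sub_mem _ (h 1 2) (h 2 1)
  · exact BrownSpace.gradCross_one f g ▸ Submodule.sub_mem _ (h 2 0) (h 0 2)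
  · exact BrownSpace.gradCross_two f g ▸ Submodule.sub_mem _ (h 0 1) (h 1 0)

/-- Brown's algebra `ℒ(3; N) = 𝔰𝔳𝔢𝔠𝔱(3; N) ⊕ 𝒪(3; N)₁ ⊕ 𝒪(3; N)₂`. -/
def brownL : LieSubalgebra K (BrownSpace K) where
  carrier := {x | x.vf ∈ VF.shear K N ∧ x.fst ∈ DP.shear K N ∧ x.snd ∈ DP.shear K N}
  zero_mem' := ⟨Submodule.zero_mem _, Submodule.zero_mem _, Submodule.zero_mem _⟩
  add_mem' := fun hx hy => ⟨Submodule.add_mem _ hx.1 hy.1, Submodule.add_mem _ hx.2.1 hy.2.1,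
    Submodule.add_mem _ hx.2.2 hy.2.2⟩
  smul_mem' := fun c _ hx => ⟨Submodule.smul_mem _ c hx.1, Submodule.smul_mem _ c hx.2.1,
    Submodule.smul_mem _ c hx.2.2⟩
  lie_mem' := fun {x y} hx hy => by
    refine ⟨?_, ?_, ?_⟩
    · rw [BrownSpace.vf_lie]
      exact Submodule.sub_mem _ (Submodule.add_mem _ (VF.lie_shear hx.1 hy.1)
        (gradCross_mem_shear K hx.2.1 hy.2.2)) (gradCross_mem_shear K hy.2.1 hx.2.2)
    · rw [BrownSpace.fst_lie]
      exact Submodule.sub_mem _ (VF.act_shear hx.1 hy.2.1) (VF.act_shear hy.1 hx.2.1)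
    · rw [BrownSpace.snd_lie]
      exact Submodule.sub_mem _ (VF.act_shear hx.1 hy.2.2) (VF.act_shear hy.1 hx.2.2)

/-- The homogeneous component of degree `k` of `ℒ(3; N)`: an element of standard degree `i` has degree
`2 i` if it lies in `𝔰𝔳𝔢𝔠𝔱(3; N)` and degree `2 i - 3` if it lies in one of the copies of `𝒪(3; N)`. -/
def brownLPart (k : ℤ) : Submodule K (brownL K N) where
  carrier := {x | x.1.vf ∈ VF.hom K (fun _ => 2) k ∧ x.1.fst ∈ DP.hom K (fun _ => 2) (k + 3) ∧
    x.1.snd ∈ DP.hom K (fun _ => 2) (k + 3)}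
  zero_mem' := ⟨Submodule.zero_mem _, Submodule.zero_mem _, Submodule.zero_mem _⟩
  add_mem' := fun hx hy => ⟨Submodule.add_mem _ hx.1 hy.1, Submodule.add_mem _ hx.2.1 hy.2.1,
    Submodule.add_mem _ hx.2.2 hy.2.2⟩
  smul_mem' := fun c _ hx => ⟨Submodule.smul_mem _ c hx.1, Submodule.smul_mem _ c hx.2.1,
    Submodule.smul_mem _ c hx.2.2⟩

theorem pd_eq_zero_of_hom_zero {f : DP (Fin 3) K} (hf : f ∈ DP.hom K (fun _ => 2) 0) (i : Fin 3) :
    DP.pd i f = 0 := by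
  refine DP.ext fun r => ?_
  by_contra hr
  have h : ∑ j, (2 : ℤ) * ((r + Pi.single i 1 : Fin 3 → ℕ) j : ℤ) = 0 :=
    hf (r + Pi.single i 1) (by simpa [DP.coeff_pd] using hr)
  have h1 : ∑ j, (2 : ℤ) * ((r + Pi.single i 1 : Fin 3 → ℕ) j : ℤ) =
      2 * ∑ j, (r j : ℤ) + 2 := by
    simp [mul_add, Finset.sum_add_distrib, Finset.mul_sum, Pi.single_apply]
  have h2 : (0 : ℤ) ≤ ∑ j, (r j : ℤ) := Finset.sum_nonneg fun j _ => by positivity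
  omega

theorem vf_eq_zero_of_hom {X : VF (Fin 3) K} (hX : X ∈ VF.hom K (fun _ => 2) (-3)) : X = 0 := by
  refine VF.ext fun j => DP.ext fun r => ?_
  by_contra hr
  have h : ∑ j, (2 : ℤ) * (r j : ℤ) = -3 + 2 := hX j r hr
  have h1 : ∑ j, (2 : ℤ) * (r j : ℤ) = 2 * ∑ j, (r j : ℤ) := by rw [Finset.mul_sum]
  omega

/-- `ℒ₋₃`, the lowest component of `ℒ(3; N)`, spanned by the two copies of the constant functions. -/
noncomputable def brownLow : LieIdeal K (brownL K N) where
  toSubmodule := brownLPart K N (-3)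
  lie_mem := by
    intro x m hm
    obtain ⟨h1, h2, h3⟩ := hm
    have e1 := vf_eq_zero_of_hom K h1
    have e2 := pd_eq_zero_of_hom_zero K h2
    have e3 := pd_eq_zero_of_hom_zero K h3
    have : ⁅x, m⁆ = 0 := by
      refine Subtype.ext (BrownSpace.ext (fun i => ?_) ?_ ?_)
      · change (BrownSpace.vf ⁅x.1, m.1⁆) i = 0
        rw [BrownSpace.vf_lie]
        fin_cases i <;> simp [e1, e2, e3, BrownSpace.gradCross_zero, BrownSpace.gradCross_one,
          BrownSpace.gradCross_two]
      · change BrownSpace.fst ⁅x.1, m.1⁆ = 0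
        simp [BrownSpace.fst_lie, VF.act_apply, e1, e2]
      · change BrownSpace.snd ⁅x.1, m.1⁆ = 0
        simp [BrownSpace.snd_lie, VF.act_apply, e1, e3]
    rw [this]
    exact Submodule.zero_mem _

/-- `D₄(3; N)`: the derived algebra of `ℒ(3; N) / ℒ₋₃`. -/
noncomputable abbrev D4 : LieIdeal K (brownL K N ⧸ brownLow K N) :=
  LieAlgebra.derivedSeries K (brownL K N ⧸ brownLow K N) 1

/-- The component of degree `k` of `D₄(3; N)`. -/
noncomputable def D4Part (k : ℤ) : Submodule K (D4 K N) :=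
  ((brownLPart K N k).map (brownLow K N).toSubmodule.mkQ).comap (D4 K N).toSubmodule.subtype

end Graded

/-! ## The orthogonal algebra -/

attribute [local instance 100] LieRing.ofAssociativeRing

section Orthogonal

variable (K : Type*) [Field K]

/-- `𝔬_Π(8)`: the matrices preserving the form `Π₈ = (0 1; 1 0)` with blocks of size 4. -/
abbrev oPi : LieSubalgebra K (Matrix (Fin 4 ⊕ Fin 4) (Fin 4 ⊕ Fin 4) K) :=
  skewAdjointMatricesLieSubalgebra (Matrix.fromBlocks 0 1 1 0)

/-- The second derived algebra of `𝔬_Π(8)`. -/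
abbrev oPi2 : LieIdeal K (oPi K) := LieAlgebra.derivedSeries K (oPi K) 2

/-- `𝔬_Π^(2)(8) / 𝔠`, where `𝔠` is the center. -/
abbrev oPi2ModCenter : Type _ := oPi2 K ⧸ LieAlgebra.center K (oPi2 K)

/-- The Chevalley generators `e_i^+`: `E^{i,i+1} + E^{4+i+1,4+i}` for `i = 1, 2, 3`, and
`E^{3,8} + E^{4,7}` for `i = 4` (rows and columns numbered by `1, ..., 8`). -/
def chevalley : Fin 4 → Matrix (Fin 4 ⊕ Fin 4) (Fin 4 ⊕ Fin 4) K :=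
  ![Matrix.single (.inl 0) (.inl 1) 1 + Matrix.single (.inr 1) (.inr 0) 1,
    Matrix.single (.inl 1) (.inl 2) 1 + Matrix.single (.inr 2) (.inr 1) 1,
    Matrix.single (.inl 2) (.inl 3) 1 + Matrix.single (.inr 3) (.inr 2) 1,
    Matrix.single (.inl 2) (.inr 3) 1 + Matrix.single (.inl 3) (.inr 2) 1]

/-- Homogeneity with respect to the grading given by a vector `r`, `deg e_i^± = ± r i`
(where `e_i^-` is the transpose of `e_i^+`): the smallest family of subspaces indexed by the degree that
contains the Chevalley generators in these degrees and is closed under the bracket. -/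
inductive ChevalleyHom (r : Fin 4 → ℤ) :
    ℤ → Matrix (Fin 4 ⊕ Fin 4) (Fin 4 ⊕ Fin 4) K → Prop
  | pos (i : Fin 4) : ChevalleyHom r (r i) (chevalley K i)
  | neg (i : Fin 4) : ChevalleyHom r (-r i) (chevalley K i)ᵀ
  | zero (k : ℤ) : ChevalleyHom r k 0
  | add {k : ℤ} {x y : Matrix (Fin 4 ⊕ Fin 4) (Fin 4 ⊕ Fin 4) K} :
      ChevalleyHom r k x → ChevalleyHom r k y → ChevalleyHom r k (x + y)
  | smul {k : ℤ} (c : K) {x : Matrix (Fin 4 ⊕ Fin 4) (Fin 4 ⊕ Fin 4) K} :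
      ChevalleyHom r k x → ChevalleyHom r k (c • x)
  | lie {k l : ℤ} {x y : Matrix (Fin 4 ⊕ Fin 4) (Fin 4 ⊕ Fin 4) K} :
      ChevalleyHom r k x → ChevalleyHom r l y → ChevalleyHom r (k + l) ⁅x, y⁆

/-- Homogeneity of degree `k` in `𝔬_Π^(2)(8) / 𝔠` with respect to the grading given by `r`. -/
def oPiHom (r : Fin 4 → ℤ) (k : ℤ) (y : oPi2ModCenter K) : Prop :=
  ∃ M : oPi2 K, ChevalleyHom K r k M.1.1 ∧ LieSubmodule.Quotient.mk M = y

end Orthogonal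

/-! ## Complete prolongs -/

section Prolong

/-- The indices of the nine indeterminates: three of degree 2 (in this order: `z`), and two triples
of degree 1 (`p` and `q`). -/
abbrev Idx : Type := Fin 3 ⊕ (Fin 3 ⊕ Fin 3)

/-- The degrees of the indeterminates. -/
def wt : Idx → ℤ := Sum.elim (fun _ => 2) (fun _ => 1)

/-- The shearing vector `(N₁, N₂, N₃, 1, ..., 1)`. -/
def withOnes (N : Fin 3 → WithTop ℕ+) : Idx → WithTop ℕ+ :=
  Sum.elim N (fun _ => ((1 : ℕ+) : WithTop ℕ+))

variable (K : Type*) [Field K]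

/-- The constant functions. -/
noncomputable def DP.const {σ : Type*} : K →ₗ[K] DP σ K := Finsupp.lsingle (M := K) 0

theorem DP.const_smul {σ : Type*} (c a : K) :
    DP.const (σ := σ) K (c * a) = c • DP.const K a := by rw [← smul_eq_mul, map_smul]

/-- The indeterminate with index `i`. -/
noncomputable def DP.var {σ : Type*} [DecidableEq σ] (i : σ) : DP σ K := DP.mono (Pi.single i 1) 1

variable {K} in
/-- The vector field `∑ a i ∂_{z i} + ∑ b i ∂_{p i} + ∑ c i ∂_{q i}`. -/
noncomputable def mkVF (a b c : Fin 3 → DP Idx K) : VF Idx K := Sum.elim a (Sum.elim b c)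

@[simp] theorem mkVF_inl (a b c : Fin 3 → DP Idx K) (i : Fin 3) : mkVF a b c (.inl i) = a i := rfl
@[simp] theorem mkVF_inr_inl (a b c : Fin 3 → DP Idx K) (i : Fin 3) :
    mkVF a b c (.inr (.inl i)) = b i := rfl
@[simp] theorem mkVF_inr_inr (a b c : Fin 3 → DP Idx K) (i : Fin 3) :
    mkVF a b c (.inr (.inr i)) = c i := rfl

/-- The fields `∑ v i ∂_{z i}`, spanning the component of degree `-2`. -/
noncomputable def wz : (Fin 3 → K) →ₗ[K] VF Idx K where
  toFun v := mkVF (fun i => DP.const K (v i)) 0 0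
  map_add' v w := VF.ext fun i => by rcases i with i | i | i <;> simp
  map_smul' c v := VF.ext fun i => by rcases i with i | i | i <;> simp [DP.const_smul]

/-- The fields `∑ v i ∂_{p i}`, spanning the copy `V` of the tautological module in degree `-1`. -/
noncomputable def wp : (Fin 3 → K) →ₗ[K] VF Idx K where
  toFun v := mkVF 0 (fun i => DP.const K (v i)) 0
  map_add' v w := VF.ext fun i => by rcases i with i | i | i <;> simp
  map_smul' c v := VF.ext fun i => by rcases i with i | i | i <;> simp [DP.const_smul]

/-- The fields `∑ v i ∂_{q i} + ∑ (p × v) i ∂_{z i}`, spanning the other copy of the tautological module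
in degree `-1`. -/
noncomputable def wq : (Fin 3 → K) →ₗ[K] VF Idx K where
  toFun v := mkVF
    (crossProduct (fun j => DP.var K (.inr (.inl j))) (fun j => DP.const K (v j)))
    0 (fun i => DP.const K (v i))
  map_add' v w := VF.ext fun i => by
    rcases i with i | i | i
    · fin_cases i <;> simp [cross_apply] <;> ring
    · simp
    · simp
  map_smul' c v := VF.ext fun i => by
    rcases i with i | i | i
    · fin_cases i <;> simp [cross_apply, smul_sub, DP.mul_smul, DP.const_smul]
    · simp
    · simp [DP.const_smul]

/-- The linear vector field by which a matrix `A` acts: `A` acts tautologically on the two copies of `V`,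
and by `- Aᵀ` on the component of degree `-2`. -/
noncomputable def lin : Matrix (Fin 3) (Fin 3) K →ₗ[K] VF Idx K where
  toFun A := mkVF (fun i => ∑ j, A j i • DP.var K (.inl j))
    (fun i => -∑ j, A i j • DP.var K (.inr (.inl j)))
    (fun i => -∑ j, A i j • DP.var K (.inr (.inr j)))
  map_add' A B := VF.ext fun i => by
    rcases i with i | i | i <;> simp [add_smul, Finset.sum_add_distrib, add_comm]
  map_smul' c A := VF.ext fun i => by
    rcases i with i | i | i <;> simp [mul_smul, Finset.smul_sum]

/-- `𝔤₋₂`. -/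
noncomputable def gm2 : Submodule K (VF Idx K) := LinearMap.range (wz K)

/-- `𝔤₋₁ = V ⊕ V̄`. -/
noncomputable def gm1 : Submodule K (VF Idx K) := LinearMap.range (wp K) ⊔ LinearMap.range (wq K)

/-- `𝔤₀ = 𝔰𝔩(3)`. -/
noncomputable def g0sl : Submodule K (VF Idx K) :=
  (LinearMap.ker (Matrix.traceLinearMap (Fin 3) K K)).map (lin K)

/-- The largest possible `𝔤₀`: all vector fields of degree 0 that preserve `𝔤₋₁` and `𝔤₋₂`. -/
noncomputable def g0max (N : Idx → WithTop ℕ+) : Submodule K (VF Idx K) where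
  carrier := {X | X ∈ VF.shear K N ∧ X ∈ VF.hom K wt 0 ∧
    (∀ Y ∈ gm1 K, ⁅X, Y⁆ ∈ gm1 K) ∧ ∀ Y ∈ gm2 K, ⁅X, Y⁆ ∈ gm2 K}
  zero_mem' := ⟨Submodule.zero_mem _, Submodule.zero_mem _,
    fun Y _ => by rw [zero_lie]; exact Submodule.zero_mem _,
    fun Y _ => by rw [zero_lie]; exact Submodule.zero_mem _⟩
  add_mem' := fun hx hy => ⟨Submodule.add_mem _ hx.1 hy.1, Submodule.add_mem _ hx.2.1 hy.2.1,
    fun Y h => by rw [add_lie]; exact Submodule.add_mem _ (hx.2.2.1 Y h) (hy.2.2.1 Y h),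
    fun Y h => by rw [add_lie]; exact Submodule.add_mem _ (hx.2.2.2 Y h) (hy.2.2.2 Y h)⟩
  smul_mem' := fun c _ hx => ⟨Submodule.smul_mem _ c hx.1, Submodule.smul_mem _ c hx.2.1,
    fun Y h => by rw [smul_lie]; exact Submodule.smul_mem _ c (hx.2.2.1 Y h),
    fun Y h => by rw [smul_lie]; exact Submodule.smul_mem _ c (hx.2.2.2 Y h)⟩

variable {K} in
/-- The vector fields of degree `k` with coefficients in `𝒪(N)` whose brackets with `𝔤₋₁` and with `𝔤₋₂` lie
in `A` and in `B`, respectively. -/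
noncomputable def prolongStep (N : Idx → WithTop ℕ+) (k : ℤ) (A B : Submodule K (VF Idx K)) :
    Submodule K (VF Idx K) where
  carrier := {X | X ∈ VF.shear K N ∧ X ∈ VF.hom K wt k ∧
    (∀ Y ∈ gm1 K, ⁅X, Y⁆ ∈ A) ∧ ∀ Y ∈ gm2 K, ⁅X, Y⁆ ∈ B}
  zero_mem' := ⟨Submodule.zero_mem _, Submodule.zero_mem _,
    fun Y _ => by rw [zero_lie]; exact Submodule.zero_mem _,
    fun Y _ => by rw [zero_lie]; exact Submodule.zero_mem _⟩
  add_mem' := fun hx hy => ⟨Submodule.add_mem _ hx.1 hy.1, Submodule.add_mem _ hx.2.1 hy.2.1,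
    fun Y h => by rw [add_lie]; exact Submodule.add_mem _ (hx.2.2.1 Y h) (hy.2.2.1 Y h),
    fun Y h => by rw [add_lie]; exact Submodule.add_mem _ (hx.2.2.2 Y h) (hy.2.2.2 Y h)⟩
  smul_mem' := fun c _ hx => ⟨Submodule.smul_mem _ c hx.1, Submodule.smul_mem _ c hx.2.1,
    fun Y h => by rw [smul_lie]; exact Submodule.smul_mem _ c (hx.2.2.1 Y h),
    fun Y h => by rw [smul_lie]; exact Submodule.smul_mem _ c (hx.2.2.2 Y h)⟩

variable {K} in
/-- The components of the complete prolong of `𝔤₋₂ ⊕ 𝔤₋₁ ⊕ 𝔤₀` in `𝔳𝔢𝔠𝔱(9; N)`, numbered from `0`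
(that is, the component with number `n` has degree `n - 2`). -/
noncomputable def prolongAux (N : Idx → WithTop ℕ+) (g0 : Submodule K (VF Idx K)) :
    ℕ → Submodule K (VF Idx K)
  | 0 => gm2 K
  | 1 => gm1 K
  | 2 => g0
  | n + 3 => prolongStep N (n + 1) (prolongAux N g0 (n + 2)) (prolongAux N g0 (n + 1))

/-! ### The brackets of the generating fields -/

theorem DP.pd_const (i : Idx) (a : K) : DP.pd i (DP.const K a) = 0 :=
  DP.pd_mono_zero (K := K) (i := i) (r := (0 : Idx → ℕ)) rfl a

theorem DP.pd_var (i j : Idx) : DP.pd i (DP.var K j) = if i = j then 1 else 0 := by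
  by_cases h : i = j
  · subst h
    rw [if_pos rfl]
    have := DP.pd_mono_add (K := K) i 0 1
    rwa [zero_add] at this
  · rw [if_neg h]
    exact DP.pd_mono_zero (by simp [h]) 1

theorem DP.mul_const (f : DP Idx K) (a : K) : f * DP.const K a = a • f := by
  have : DP.const (σ := Idx) K a = a • (1 : DP Idx K) := by
    change DP.mono 0 a = a • DP.mono 0 1
    rw [DP.smul_mono, mul_one]
  rw [this, DP.mul_smul, mul_one]

theorem DP.const_mul (f : DP Idx K) (a : K) : DP.const K a * f = a • f := by
  rw [mul_comm, DP.mul_const]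

theorem DP.const_eq (a : K) : DP.const (σ := Idx) K a = a • (1 : DP Idx K) := by
  rw [← DP.const_mul, mul_one]

theorem act_mkVF (a b c : Fin 3 → DP Idx K) (f : DP Idx K) :
    (mkVF a b c).act f = ∑ i, a i * DP.pd (.inl i) f +
      (∑ i, b i * DP.pd (.inr (.inl i)) f + ∑ i, c i * DP.pd (.inr (.inr i)) f) := by
  rw [VF.act_apply, Fintype.sum_sum_type, Fintype.sum_sum_type]
  rfl

theorem wz_def (v : Fin 3 → K) : wz K v = mkVF (fun i => DP.const K (v i)) 0 0 := rfl
theorem wp_def (v : Fin 3 → K) : wp K v = mkVF 0 (fun i => DP.const K (v i)) 0 := rfl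
theorem wq_def (v : Fin 3 → K) : wq K v = mkVF
    (crossProduct (fun j => DP.var K (.inr (.inl j))) (fun j => DP.const K (v j)))
    0 (fun i => DP.const K (v i)) := rfl
theorem lin_def (A : Matrix (Fin 3) (Fin 3) K) : lin K A =
    mkVF (fun i => ∑ j, A j i • DP.var K (.inl j))
      (fun i => -∑ j, A i j • DP.var K (.inr (.inl j)))
      (fun i => -∑ j, A i j • DP.var K (.inr (.inr j))) := rfl

theorem lie_wz_wz (v w : Fin 3 → K) : ⁅wz K v, wz K w⁆ = 0 := by
  refine VF.ext fun i => ?_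
  rcases i with i | i | i <;> simp [VF.lie_apply, act_mkVF, wz_def, DP.pd_const]

theorem lie_wz_wp (v w : Fin 3 → K) : ⁅wz K v, wp K w⁆ = 0 := by
  refine VF.ext fun i => ?_
  rcases i with i | i | i <;> simp [VF.lie_apply, act_mkVF, wz_def, wp_def, DP.pd_const]

theorem lie_wp_wp (v w : Fin 3 → K) : ⁅wp K v, wp K w⁆ = 0 := by
  refine VF.ext fun i => ?_
  rcases i with i | i | i <;> simp [VF.lie_apply, act_mkVF, wp_def, DP.pd_const]

theorem lie_wz_wq (v w : Fin 3 → K) : ⁅wz K v, wq K w⁆ = 0 := by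
  refine VF.ext fun i => ?_
  rcases i with i | i | i
  · fin_cases i <;>
      simp [VF.lie_apply, act_mkVF, wz_def, wq_def, DP.pd_const, cross_apply, DP.pd_var, DP.pd_mul]
  · simp [VF.lie_apply, act_mkVF, wz_def, wq_def, DP.pd_const]
  · simp [VF.lie_apply, act_mkVF, wz_def, wq_def, DP.pd_const]

theorem lie_wq_wq (v w : Fin 3 → K) : ⁅wq K v, wq K w⁆ = 0 := by
  refine VF.ext fun i => ?_
  rcases i with i | i | i
  · fin_cases i <;>
      simp [VF.lie_apply, act_mkVF, wq_def, DP.pd_const, cross_apply, DP.pd_var, DP.pd_mul]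
  · simp [VF.lie_apply, act_mkVF, wq_def, DP.pd_const]
  · simp [VF.lie_apply, act_mkVF, wq_def, DP.pd_const]

theorem DP.const_mul_const (a b : K) :
    DP.const (σ := Idx) K (a * b) = DP.const K a * DP.const K b := by
  rw [DP.const_mul, DP.const_smul]

theorem lin_def' (A : Matrix (Fin 3) (Fin 3) K) : lin K A =
    mkVF (fun i => ∑ j, DP.const K (A j i) * DP.var K (.inl j))
      (fun i => -∑ j, DP.const K (A i j) * DP.var K (.inr (.inl j)))
      (fun i => -∑ j, DP.const K (A i j) * DP.var K (.inr (.inr j))) := by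
  simp only [DP.const_mul]
  rfl

theorem lie_wp_wq (v w : Fin 3 → K) : ⁅wp K v, wq K w⁆ = wz K (crossProduct v w) := by
  refine VF.ext fun i => ?_
  rcases i with i | i | i
  · fin_cases i <;>
      simp [VF.lie_apply, act_mkVF, wp_def, wq_def, wz_def, DP.pd_const, cross_apply, DP.pd_var,
        DP.pd_mul, Fin.sum_univ_three, DP.const_mul_const] <;> ring
  · simp [VF.lie_apply, act_mkVF, wp_def, wq_def, wz_def, DP.pd_const]
  · simp [VF.lie_apply, act_mkVF, wp_def, wq_def, wz_def, DP.pd_const]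

theorem lie_lin_wz (A : Matrix (Fin 3) (Fin 3) K) (v : Fin 3 → K) :
    ⁅lin K A, wz K v⁆ = wz K (-A.transpose.mulVec v) := by
  refine VF.ext fun i => ?_
  rcases i with i | i | i
  · simp [VF.lie_apply, act_mkVF, wz_def, lin_def', DP.pd_const, DP.pd_var, Fin.sum_univ_three,
      DP.const_mul_const, Matrix.mulVec, dotProduct, DP.pd_mul]
    ring
  · simp [VF.lie_apply, act_mkVF, wz_def, lin_def', DP.pd_const, DP.pd_var, DP.pd_mul]
  · simp [VF.lie_apply, act_mkVF, wz_def, lin_def', DP.pd_const, DP.pd_var, DP.pd_mul]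

theorem lie_lin_wp (A : Matrix (Fin 3) (Fin 3) K) (v : Fin 3 → K) :
    ⁅lin K A, wp K v⁆ = wp K (A.mulVec v) := by
  refine VF.ext fun i => ?_
  rcases i with i | i | i
  · simp [VF.lie_apply, act_mkVF, wp_def, lin_def', DP.pd_const, DP.pd_var, DP.pd_mul]
  · simp [VF.lie_apply, act_mkVF, wp_def, lin_def', DP.pd_const, DP.pd_var, Fin.sum_univ_three,
      DP.const_mul_const, Matrix.mulVec, dotProduct, DP.pd_mul]
    ring
  · simp [VF.lie_apply, act_mkVF, wp_def, lin_def', DP.pd_const, DP.pd_var, DP.pd_mul]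

theorem lie_lin_wq {A : Matrix (Fin 3) (Fin 3) K} (hA : A.trace = 0) (v : Fin 3 → K) :
    ⁅lin K A, wq K v⁆ = wq K (A.mulVec v) := by
  have h : DP.const (σ := Idx) K (A 0 0) + DP.const K (A 1 1) + DP.const K (A 2 2) = 0 := by
    rw [← map_add, ← map_add, ← Matrix.trace_fin_three, hA, map_zero]
  refine VF.ext fun i => ?_
  rcases i with i | i | i
  · fin_cases i
    all_goals
      simp [VF.lie_apply, act_mkVF, wq_def, lin_def', DP.pd_const, DP.pd_var, Fin.sum_univ_three,
        DP.const_mul_const, Matrix.mulVec, dotProduct, DP.pd_mul, cross_apply]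
    · linear_combination (DP.var K (.inr (.inl 2)) * DP.const K (v 1) -
        DP.var K (.inr (.inl 1)) * DP.const K (v 2)) * h
    · linear_combination (DP.var K (.inr (.inl 0)) * DP.const K (v 2) -
        DP.var K (.inr (.inl 2)) * DP.const K (v 0)) * h
    · linear_combination (DP.var K (.inr (.inl 1)) * DP.const K (v 0) -
        DP.var K (.inr (.inl 0)) * DP.const K (v 1)) * h
  · simp [VF.lie_apply, act_mkVF, wq_def, lin_def', DP.pd_const, DP.pd_var, DP.pd_mul]
  · simp [VF.lie_apply, act_mkVF, wq_def, lin_def', DP.pd_const, DP.pd_var, Fin.sum_univ_three,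
      DP.const_mul_const, Matrix.mulVec, dotProduct, DP.pd_mul]
    ring

theorem lie_lin_lin (A B : Matrix (Fin 3) (Fin 3) K) :
    ⁅lin K A, lin K B⁆ = lin K (A * B - B * A) := by
  refine VF.ext fun i => ?_
  rcases i with i | i | i
  all_goals
    simp [VF.lie_apply, act_mkVF, lin_def', DP.pd_var, DP.pd_const, DP.pd_mul, Fin.sum_univ_three,
      Matrix.mul_apply, DP.const_mul_const]
    ring

theorem const_shear (N : Idx → WithTop ℕ+) (a : K) : DP.const K a ∈ DP.shear K N := by
  classical
  intro r hr i n _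
  change DP.coeff r (DP.mono 0 a) ≠ 0 at hr
  rw [DP.coeff_mono] at hr
  have h : (0 : Idx → ℕ) = r := by_contra fun e => hr (if_neg e)
  rw [← h]
  exact Nat.two_pow_pos _

theorem const_hom (a : K) : DP.const K a ∈ DP.hom K wt 0 := by
  classical
  intro r hr
  change DP.coeff r (DP.mono 0 a) ≠ 0 at hr
  rw [DP.coeff_mono] at hr
  have h : (0 : Idx → ℕ) = r := by_contra fun e => hr (if_neg e)
  rw [← h]
  simp

theorem var_shear (N : Idx → WithTop ℕ+) (j : Idx) : DP.var K j ∈ DP.shear K N := by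
  classical
  intro r hr i n _
  change DP.coeff r (DP.mono _ 1) ≠ 0 at hr
  rw [DP.coeff_mono] at hr
  have h : (Pi.single j 1 : Idx → ℕ) = r := by_contra fun e => hr (if_neg e)
  rw [← h]
  have h1 : (Pi.single j 1 : Idx → ℕ) i ≤ 1 := by
    rw [Pi.single_apply]; split <;> omega
  exact lt_of_le_of_lt h1 (Nat.one_lt_two_pow n.pos.ne')

theorem var_hom (j : Idx) : DP.var K j ∈ DP.hom K wt (wt j) := by
  classical
  intro r hr
  change DP.coeff r (DP.mono _ 1) ≠ 0 at hr
  rw [DP.coeff_mono] at hr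
  have h : (Pi.single j 1 : Idx → ℕ) = r := by_contra fun e => hr (if_neg e)
  rw [← h]
  simp [Pi.single_apply]

variable {K} in
theorem mkVF_mem_shear {N : Idx → WithTop ℕ+} {a b c : Fin 3 → DP Idx K}
    (ha : ∀ i, a i ∈ DP.shear K N) (hb : ∀ i, b i ∈ DP.shear K N) (hc : ∀ i, c i ∈ DP.shear K N) :
    mkVF a b c ∈ VF.shear K N
  | .inl i => ha i
  | .inr (.inl i) => hb i
  | .inr (.inr i) => hc i

variable {K} in
theorem mkVF_mem_hom {k : ℤ} {a b c : Fin 3 → DP Idx K} (ha : ∀ i, a i ∈ DP.hom K wt (k + 2))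
    (hb : ∀ i, b i ∈ DP.hom K wt (k + 1)) (hc : ∀ i, c i ∈ DP.hom K wt (k + 1)) :
    mkVF a b c ∈ VF.hom K wt k
  | .inl i => ha i
  | .inr (.inl i) => hb i
  | .inr (.inr i) => hc i

theorem gm2_le (N : Idx → WithTop ℕ+) {X : VF Idx K} (hX : X ∈ gm2 K) :
    X ∈ VF.shear K N ∧ X ∈ VF.hom K wt (-2) := by
  obtain ⟨v, rfl⟩ := hX
  rw [wz_def]
  exact ⟨mkVF_mem_shear (fun i => const_shear K N (v i)) (fun _ => Submodule.zero_mem _)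
    (fun _ => Submodule.zero_mem _), mkVF_mem_hom (fun i => const_hom K (v i))
    (fun _ => Submodule.zero_mem _) (fun _ => Submodule.zero_mem _)⟩

variable {K} in
theorem cross_mem (S : Submodule K (DP Idx K)) {a b : Fin 3 → DP Idx K}
    (h : ∀ i j, a i * b j ∈ S) (i : Fin 3) : crossProduct a b i ∈ S := by
  rw [cross_apply]
  fin_cases i
  · exact S.sub_mem (h 1 2) (h 2 1)
  · exact S.sub_mem (h 2 0) (h 0 2)
  · exact S.sub_mem (h 0 1) (h 1 0)

theorem gm1_le [CharP K 2] (N : Idx → WithTop ℕ+) {X : VF Idx K} (hX : X ∈ gm1 K) :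
    X ∈ VF.shear K N ∧ X ∈ VF.hom K wt (-1) := by
  obtain ⟨Y, ⟨v, rfl⟩, Z, ⟨w, rfl⟩, rfl⟩ := Submodule.mem_sup.mp hX
  have h1 : wp K v ∈ VF.shear K N := by
    rw [wp_def]
    exact mkVF_mem_shear (fun _ => Submodule.zero_mem _) (fun i => const_shear K N (v i))
      (fun _ => Submodule.zero_mem _)
  have h2 : wp K v ∈ VF.hom K wt (-1) := by
    rw [wp_def]
    exact mkVF_mem_hom (fun _ => Submodule.zero_mem _) (fun i => const_hom K (v i))
      (fun _ => Submodule.zero_mem _)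
  have h3 : wq K w ∈ VF.shear K N := by
    rw [wq_def]
    exact mkVF_mem_shear (cross_mem _ fun i j => DP.shear_mul (var_shear K N _) (const_shear K N _))
      (fun _ => Submodule.zero_mem _) (fun i => const_shear K N (w i))
  have h4 : wq K w ∈ VF.hom K wt (-1) := by
    rw [wq_def]
    refine mkVF_mem_hom (cross_mem _ fun i j => ?_)
      (fun _ => Submodule.zero_mem _) (fun i => const_hom K (w i))
    have e := DP.hom_mul (var_hom K (.inr (.inl i))) (const_hom K (w j))
    rwa [show wt (.inr (.inl i)) + 0 = -1 + 2 from rfl] at e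
  exact ⟨Submodule.add_mem _ h1 h3, Submodule.add_mem _ h2 h4⟩

theorem lin_shear_hom (N : Idx → WithTop ℕ+) (A : Matrix (Fin 3) (Fin 3) K) :
    lin K A ∈ VF.shear K N ∧ lin K A ∈ VF.hom K wt 0 := by
  rw [lin_def]
  refine ⟨mkVF_mem_shear (fun i => ?_) (fun i => ?_) (fun i => ?_),
    mkVF_mem_hom (fun i => ?_) (fun i => ?_) (fun i => ?_)⟩
  · exact Submodule.sum_mem _ fun j _ => Submodule.smul_mem _ _ (var_shear K N _)
  · exact Submodule.neg_mem _ (Submodule.sum_mem _ fun j _ =>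
      Submodule.smul_mem _ _ (var_shear K N _))
  · exact Submodule.neg_mem _ (Submodule.sum_mem _ fun j _ =>
      Submodule.smul_mem _ _ (var_shear K N _))
  · rw [zero_add]
    exact Submodule.sum_mem _ fun j _ => Submodule.smul_mem _ _ (var_hom K (.inl j))
  · rw [zero_add]
    exact Submodule.neg_mem _ (Submodule.sum_mem _ fun j _ =>
      Submodule.smul_mem _ _ (var_hom K (.inr (.inl j))))
  · rw [zero_add]
    exact Submodule.neg_mem _ (Submodule.sum_mem _ fun j _ =>
      Submodule.smul_mem _ _ (var_hom K (.inr (.inr j))))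

theorem lie_gm1_gm1 {X Y : VF Idx K} (hX : X ∈ gm1 K) (hY : Y ∈ gm1 K) : ⁅X, Y⁆ ∈ gm2 K := by
  obtain ⟨_, ⟨a, rfl⟩, _, ⟨b, rfl⟩, rfl⟩ := Submodule.mem_sup.mp hX
  obtain ⟨_, ⟨c, rfl⟩, _, ⟨d, rfl⟩, rfl⟩ := Submodule.mem_sup.mp hY
  rw [add_lie, lie_add, lie_add, lie_wp_wp, lie_wq_wq, lie_wp_wq, ← lie_skew, lie_wp_wq, zero_add,
    add_zero]
  exact Submodule.add_mem _ ⟨_, rfl⟩ (Submodule.neg_mem _ ⟨_, rfl⟩)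

theorem lie_gm2_gm1 {X Y : VF Idx K} (hX : X ∈ gm2 K) (hY : Y ∈ gm1 K) : ⁅X, Y⁆ = 0 := by
  obtain ⟨a, rfl⟩ := hX
  obtain ⟨_, ⟨c, rfl⟩, _, ⟨d, rfl⟩, rfl⟩ := Submodule.mem_sup.mp hY
  rw [lie_add, lie_wz_wp, lie_wz_wq, zero_add]

theorem lie_gm2_gm2 {X Y : VF Idx K} (hX : X ∈ gm2 K) (hY : Y ∈ gm2 K) : ⁅X, Y⁆ = 0 := by
  obtain ⟨a, rfl⟩ := hX
  obtain ⟨b, rfl⟩ := hY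
  rw [lie_wz_wz]

/-- Admissible components `𝔤₀`: Lie subalgebras of the largest possible one. -/
structure IsDegreeZero (N : Idx → WithTop ℕ+) (g0 : Submodule K (VF Idx K)) : Prop where
  le : g0 ≤ g0max K N
  lie_mem : ∀ {X Y : VF Idx K}, X ∈ g0 → Y ∈ g0 → ⁅X, Y⁆ ∈ g0

theorem isDegreeZero_g0sl (N : Idx → WithTop ℕ+) : IsDegreeZero K N (g0sl K) where
  le := by
    rintro _ ⟨A, hA, rfl⟩
    have hA' : A.trace = 0 := hA
    obtain ⟨h1, h2⟩ := lin_shear_hom K N A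
    refine ⟨h1, h2, fun Y hY => ?_, ?_⟩
    · obtain ⟨_, ⟨c, rfl⟩, _, ⟨d, rfl⟩, rfl⟩ := Submodule.mem_sup.mp hY
      rw [lie_add, lie_lin_wp, lie_lin_wq K hA']
      exact Submodule.add_mem_sup ⟨_, rfl⟩ ⟨_, rfl⟩
    · rintro _ ⟨v, rfl⟩
      rw [lie_lin_wz]
      exact ⟨_, rfl⟩
  lie_mem := by
    rintro _ _ ⟨A, _, rfl⟩ ⟨B, _, rfl⟩
    rw [lie_lin_lin]
    refine ⟨_, ?_, rfl⟩
    change (A * B - B * A).trace = 0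
    rw [Matrix.trace_sub, Matrix.trace_mul_comm, sub_self]

theorem isDegreeZero_g0max [CharP K 2] (N : Idx → WithTop ℕ+) :
    IsDegreeZero K N (g0max K N) where
  le := le_rfl
  lie_mem := by
    intro X Y hX hY
    refine ⟨VF.lie_shear hX.1 hY.1, VF.lie_hom hX.2.1 hY.2.1, fun Z hZ => ?_, fun Z hZ => ?_⟩
    · rw [lie_lie]
      exact Submodule.sub_mem _ (hX.2.2.1 _ (hY.2.2.1 _ hZ)) (hY.2.2.1 _ (hX.2.2.1 _ hZ))
    · rw [lie_lie]
      exact Submodule.sub_mem _ (hX.2.2.2 _ (hY.2.2.2 _ hZ)) (hY.2.2.2 _ (hX.2.2.2 _ hZ))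

variable {K} [CharP K 2] {N : Idx → WithTop ℕ+} {g0 : Submodule K (VF Idx K)}

theorem prolongAux_le (h : IsDegreeZero K N g0) : ∀ (n : ℕ) {X : VF Idx K},
    X ∈ prolongAux N g0 n → X ∈ VF.shear K N ∧ X ∈ VF.hom K wt ((n : ℤ) - 2)
  | 0, _, hX => gm2_le K N hX
  | 1, _, hX => gm1_le K N hX
  | 2, _, hX => ⟨(h.le hX).1, (h.le hX).2.1⟩
  | n + 3, X, hX => ⟨hX.1, by
      have e : (((n + 3 : ℕ) : ℤ) - 2) = (n : ℤ) + 1 := by push_cast; ring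
      rw [e]
      exact hX.2.1⟩

theorem prolongAux_lie_gm1 (h : IsDegreeZero K N g0) : ∀ (n : ℕ) {X Y : VF Idx K},
    X ∈ prolongAux N g0 (n + 2) → Y ∈ gm1 K → ⁅X, Y⁆ ∈ prolongAux N g0 (n + 1)
  | 0, _, Y, hX, hY => (h.le hX).2.2.1 Y hY
  | _ + 1, _, Y, hX, hY => hX.2.2.1 Y hY

theorem prolongAux_lie_gm2 (h : IsDegreeZero K N g0) : ∀ (n : ℕ) {X Y : VF Idx K},
    X ∈ prolongAux N g0 (n + 2) → Y ∈ gm2 K → ⁅X, Y⁆ ∈ prolongAux N g0 n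
  | 0, _, Y, hX, hY => (h.le hX).2.2.2 Y hY
  | _ + 1, _, Y, hX, hY => hX.2.2.2 Y hY

variable (K) in
theorem lie_mem_comm (S : Submodule K (VF Idx K)) {X Y : VF Idx K} (h : ⁅X, Y⁆ ∈ S) : ⁅Y, X⁆ ∈ S := by
  rw [← lie_skew]
  exact S.neg_mem h

theorem prolongAux_lie (h : IsDegreeZero K N g0) (t : ℕ) : ∀ (m n : ℕ) {X Y : VF Idx K}, m + n = t →
    X ∈ prolongAux N g0 m → Y ∈ prolongAux N g0 n → ⁅X, Y⁆ ∈ prolongAux N g0 (m + n - 2) := by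
  induction t using Nat.strong_induction_on with
  | _ t ih =>
    intro m n X Y hmn hX hY
    match m, n, hX, hY with
    | 0, 0, hX, hY => rw [lie_gm2_gm2 K hX hY]; exact Submodule.zero_mem _
    | 0, 1, hX, hY => rw [lie_gm2_gm1 K hX hY]; exact Submodule.zero_mem _
    | 1, 0, hX, hY => rw [← lie_skew, lie_gm2_gm1 K hY hX, neg_zero]; exact Submodule.zero_mem _
    | 1, 1, hX, hY => exact lie_gm1_gm1 K hX hY
    | 0, n + 2, hX, hY =>
      rw [show 0 + (n + 2) - 2 = n by omega]
      exact lie_mem_comm K _ (prolongAux_lie_gm2 h n hY hX)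
    | 1, n + 2, hX, hY =>
      rw [show 1 + (n + 2) - 2 = n + 1 by omega]
      exact lie_mem_comm K _ (prolongAux_lie_gm1 h n hY hX)
    | m + 2, 0, hX, hY => exact prolongAux_lie_gm2 h m hX hY
    | m + 2, 1, hX, hY =>
      rw [show m + 2 + 1 - 2 = m + 1 by omega]
      exact prolongAux_lie_gm1 h m hX hY
    | m + 2, n + 2, hX, hY =>
      obtain ⟨s1, d1⟩ := prolongAux_le h _ hX
      obtain ⟨s2, d2⟩ := prolongAux_le h _ hY
      by_cases hk : m + n = 0
      · obtain rfl : m = 0 := by omega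
        obtain rfl : n = 0 := by omega
        exact h.lie_mem hX hY
      · obtain ⟨k, hk⟩ := Nat.exists_eq_succ_of_ne_zero hk
        rw [show m + 2 + (n + 2) - 2 = k + 3 by omega]
        refine ⟨VF.lie_shear s1 s2, ?_, fun Z hZ => ?_, fun Z hZ => ?_⟩
        · have e := VF.lie_hom d1 d2
          rwa [show ((m + 2 : ℕ) : ℤ) - 2 + (((n + 2 : ℕ) : ℤ) - 2) = (k : ℤ) + 1 by
            push_cast; omega] at e
        · rw [lie_lie]
          refine Submodule.sub_mem _ ?_ (lie_mem_comm K _ ?_)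
          · have e := ih (m + 2 + (n + 1)) (by omega) (m + 2) (n + 1) rfl hX
              (prolongAux_lie_gm1 h n hY hZ)
            rwa [show m + 2 + (n + 1) - 2 = k + 2 by omega] at e
          · have e := ih (m + 1 + (n + 2)) (by omega) (m + 1) (n + 2) rfl
              (prolongAux_lie_gm1 h m hX hZ) hY
            rwa [show m + 1 + (n + 2) - 2 = k + 2 by omega] at e
        · rw [lie_lie]
          refine Submodule.sub_mem _ ?_ (lie_mem_comm K _ ?_)
          · have e := ih (m + 2 + n) (by omega) (m + 2) n rfl hX (prolongAux_lie_gm2 h n hY hZ)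
            rwa [show m + 2 + n - 2 = k + 1 by omega] at e
          · have e := ih (m + (n + 2)) (by omega) m (n + 2) rfl (prolongAux_lie_gm2 h m hX hZ) hY
            rwa [show m + (n + 2) - 2 = k + 1 by omega] at e

variable (N g0) in
/-- The complete prolong of `𝔤₋₂ ⊕ 𝔤₋₁ ⊕ 𝔤₀` in `𝔳𝔢𝔠𝔱(9; N)`. -/
noncomputable def prolongLie (h : IsDegreeZero K N g0) : LieSubalgebra K (VF Idx K) where
  toSubmodule := ⨆ n, prolongAux N g0 n
  lie_mem' := by
    intro X Y hX hY
    change X ∈ ⨆ n, prolongAux N g0 n at hX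
    change Y ∈ ⨆ n, prolongAux N g0 n at hY
    change ⁅X, Y⁆ ∈ ⨆ n, prolongAux N g0 n
    induction hX using Submodule.iSup_induction' with
    | mem m X hX =>
      induction hY using Submodule.iSup_induction' with
      | mem n Y hY => exact Submodule.mem_iSup_of_mem _ (prolongAux_lie h _ m n rfl hX hY)
      | zero => rw [lie_zero]; exact Submodule.zero_mem _
      | add Y Z _ _ hY hZ => rw [lie_add]; exact Submodule.add_mem _ hY hZ
    | zero => rw [zero_lie]; exact Submodule.zero_mem _
    | add Y Z _ _ hY hZ => rw [add_lie]; exact Submodule.add_mem _ hY hZ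

variable (K N) in
/-- The complete prolong of the non-positive part with `𝔤₀ = 𝔰𝔩(3)`. -/
noncomputable def brownProlong : LieSubalgebra K (VF Idx K) :=
  prolongLie N (g0sl K) (isDegreeZero_g0sl K N)

variable (K N) in
/-- The complete prolong of the negative part. -/
noncomputable def negProlong : LieSubalgebra K (VF Idx K) :=
  prolongLie N (g0max K N) (isDegreeZero_g0max K N)

variable (K) in
/-- The desuperization of `𝔳𝔩𝔢(3; N|6)`: the complete prolong of the negative part in the Lie algebra of
vector fields in three even indeterminates `z` and six odd indeterminates `p`, `q`. -/
noncomputable abbrev vle (N : Fin 3 → WithTop ℕ+) : LieSubalgebra K (VF Idx K) :=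
  negProlong K (withOnes N)

end Prolong

/-! ## Lie superalgebras in characteristic 2 -/

section Super

/-- The parities of the indeterminates: `z` are even, `p` and `q` are odd. -/
def parity : Idx → ZMod 2 := Sum.elim (fun _ => 0) (fun _ => 1)

/-- The vector fields of parity `ε`. -/
def VF.ofParity (K : Type*) [Field K] (ε : ZMod 2) : Submodule K (VF Idx K) where
  carrier := {X | ∀ j r, DP.coeff r (X j) ≠ 0 → ∑ i, parity i * r i + parity j = ε}
  zero_mem' := fun j r h => absurd (map_zero (DP.coeff r)) h
  add_mem' := by
    intro X Y hX hY j r h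
    by_cases h' : DP.coeff r (X j) = 0
    · exact hY j r (by simpa [h'] using h)
    · exact hX j r h'
  smul_mem' := by
    intro c X hX j r h
    exact hX j r (fun e => h (by simp [e]))

/-- The structure of a Lie superalgebra in characteristic 2, with the squaring `sq` of odd elements, on
a Lie algebra `L`, which is the desuperization of that Lie superalgebra. The bracket of odd
elements is the polarization of the squaring. -/
structure LieSuperStructure (K L : Type*) [Field K] [LieRing L] [LieAlgebra K L] where
  /-- The even part. -/
  even : Submodule K L
  /-- The odd part. -/
  odd : Submodule K L
  isCompl : IsCompl even odd
  even_lie_even : ∀ x ∈ even, ∀ y ∈ even, ⁅x, y⁆ ∈ even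
  even_lie_odd : ∀ x ∈ even, ∀ y ∈ odd, ⁅x, y⁆ ∈ odd
  /-- The squaring of odd elements. -/
  sq : odd → even
  sq_smul : ∀ (a : K) (x : odd), sq (a • x) = a ^ 2 • sq x
  sq_add : ∀ x y : odd, (sq (x + y) : L) = sq x + sq y + ⁅(x : L), (y : L)⁆
  sq_lie : ∀ (x : odd) (y : L), ⁅(sq x : L), y⁆ = ⁅(x : L), ⁅(x : L), y⁆⁆

end Super

/-! ## Divided power algebras in characteristic 2 -/

/-! Everything is compared inside vector fields in nine indeterminates. An element `(D, f, g)` of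
Brown's algebra is realized by a field whose coefficients are polynomials in `p`, `q` built from `D`
and the derivatives of `f` and `g`. The polynomials are dictated by one requirement: brackets with
`∂ₖ`, with `uₖ` and with the barred `uₖ` must become brackets with the fields `wz`, `wp`, `wq`. A
field that vanishes at the origin and commutes with the negative part is zero
(`eq_zero_of_lie_negative`); by induction on the degree this turns the requirement into the
homomorphism property of `theta` (`compat_of_degLE`). The terms free of `p` and `q` give back `D`,
`∇f` and `∇g`, so the kernel consists of the two copies of the constants, which is the center `ℒ₋₃`.

Without restrictions on `N` the image of `theta` is the whole prolong with `𝔤₀ = 𝔰𝔩(3)`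
(`map_theta_homPart`). Given a field `X` of the prolong, its brackets with `𝔤₋₂` are realized by
induction; they satisfy integrability conditions, and the Poincaré lemma for divided powers supplies
an element of Brown's algebra with the same brackets. Transitivity identifies its realization with
`X`. For other `N` the prolong is the intersection with `𝔳𝔢𝔠𝔱(N)` (`prolongAux_eq_inf`). Since the
realization sees `f` and `g` only through derivatives, this intersection is slightly larger than `ℒ
/ ℒ₋₃`. One commutator leads into `ℒ`, and a second one into the curls and the functions without
highest term (`derPart`), whose classes form `D₄`.

Simplicity rests on `derPart_le_of_theta_ne_zero`: brackets with the negative part reduce any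
noncentral element to a constant field, from which all of `derPart` is recovered. The same argument
applied to the span of brackets shows that `D₄` is perfect, so it survives in every derived algebra
of the prolong.

For `N = (1, 1, 1)` all functions are square-free and the linear map `psi` from matrices of size 8
is explicit. It respects brackets up to constants, is onto modulo the center, and only scalar
matrices become central. The second derived algebra of `𝔬_Π(8)` consists of the matrices with
alternating off-diagonal blocks and traceless diagonal block (`mem_oPi2_iff`).

For the prolong of the negative part, a derivation of degree 0 of the negative part is determined on
`𝔤₋₁`, which gives `𝔰𝔩(3) ⊕ 𝔤𝔩(2)` (`exists_rho_eq`). The squares of `ad w` for the basis fields `w`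
of `𝔤₋₁` are second derivatives in `p` and `q`; they vanish on `𝔤₀` and hence everywhere
(`lie_lie_prolongAux`), so no divided powers of `p`, `q` occur. Degree 1 embeds into `Hom(𝔤₋₂,
𝔤₋₁)`, of dimension 18, and explicit fields fill that space. Finally, an odd field composed with
itself is again a derivation (`act_act_of_odd`), which gives the squaring of the superalgebra. -/

theorem neg_eq_self_of_charTwo (K : Type*) {M : Type*} [Field K] [CharP K 2] [AddCommGroup M]
    [Module K M] (x : M) : -x = x := by
  rw [neg_eq_iff_add_eq_zero, ← two_smul K x, CharTwo.two_eq_zero, zero_smul]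

theorem add_self_of_charTwo (K : Type*) {M : Type*} [Field K] [CharP K 2] [AddCommGroup M]
    [Module K M] (x : M) : x + x = 0 := by
  rw [← two_smul K x, CharTwo.two_eq_zero, zero_smul]

theorem sub_eq_add_of_charTwo (K : Type*) {M : Type*} [Field K] [CharP K 2] [AddCommGroup M]
    [Module K M] (x y : M) : x - y = x + y := by
  rw [sub_eq_add_neg, neg_eq_self_of_charTwo K y]

namespace DP

variable {σ K : Type*} [Field K]

theorem mono_eq_smul (r : σ → ℕ) (a : K) : (mono r a : DP σ K) = a • mono r 1 := by
  rw [smul_mono, mul_one]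

theorem mem_of_mono {S : Submodule K (DP σ K)} {f : DP σ K}
    (h : ∀ r, coeff r f ≠ 0 → mono r 1 ∈ S) : f ∈ S := by
  have e : f = ∑ r ∈ Finsupp.support (M := K) f, mono r (coeff r f) :=
    (Finsupp.sum_single (M := K) f).symm
  rw [e]
  refine Submodule.sum_mem _ fun r hr => ?_
  rw [mono_eq_smul]
  exact S.smul_mem _ (h r (Finsupp.mem_support_iff.mp hr))

theorem finite_support (f : DP σ K) : {r | coeff r f ≠ 0}.Finite := by
  refine (Finsupp.support (M := K) f).finite_toSet.subset fun r hr => ?_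
  exact Finsupp.mem_support_iff.mpr hr

theorem exists_of_finite (c : (σ → ℕ) → K) (h : {r | c r ≠ 0}.Finite) :
    ∃ f : DP σ K, ∀ r, coeff r f = c r :=
  ⟨Finsupp.onFinset h.toFinset c fun _ hr => h.mem_toFinset.mpr hr, fun _ => rfl⟩

section

variable [Fintype σ]

theorem one_eq_mono : (1 : DP σ K) = mono 0 1 := rfl

instance [CharP K 2] : CharP (DP σ K) 2 := by
  classical
  refine CharTwo.of_one_ne_zero_of_two_eq_zero (fun h => ?_) ?_
  · have := congrArg (coeff (0 : σ → ℕ)) h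
    rw [one_eq_mono, coeff_mono, if_pos rfl, map_zero] at this
    exact one_ne_zero this
  · rw [← one_add_one_eq_two, add_self_of_charTwo K]

variable [DecidableEq σ]

theorem pd_one (i : σ) : pd i (1 : DP σ K) = 0 :=
  pd_mono_zero (r := (0 : σ → ℕ)) rfl 1

theorem coeff_eq_zero_of_pd {f : DP σ K} (h : ∀ i, pd i f = 0) {r : σ → ℕ} (hr : r ≠ 0) :
    coeff r f = 0 := by
  obtain ⟨i, hi⟩ := Function.ne_iff.mp hr
  obtain ⟨s, rfl⟩ := eq_add_single hi
  rw [← coeff_pd, h i, map_zero]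

theorem eq_mono_of_pd {f : DP σ K} (h : ∀ i, pd i f = 0) : f = mono 0 (coeff 0 f) := by
  classical
  refine ext fun r => ?_
  rw [coeff_mono]
  split_ifs with hr
  · rw [hr]
  · exact coeff_eq_zero_of_pd h (Ne.symm hr)

theorem eq_zero_of_pd {f : DP σ K} (h : ∀ i, pd i f = 0) (h0 : coeff 0 f = 0) : f = 0 := by
  classical
  refine ext fun r => ?_
  by_cases hr : r = 0
  · rw [hr, h0, map_zero]
  · rw [coeff_eq_zero_of_pd h hr, map_zero]

theorem coeff_zero_of_hom {w : σ → ℤ} {d : ℤ} {f : DP σ K} (hf : f ∈ hom K w d) (hd : d ≠ 0) :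
    coeff 0 f = 0 := by
  by_contra h
  exact hd (by simpa using (hf 0 h).symm)

/-- A nonconstant monomial survives in one of its partial derivatives, so homogeneity can be tested
there. Only the constant term escapes this test and must be assumed to vanish. -/
theorem hom_of_pd {w : σ → ℤ} {d : ℤ} {f : DP σ K} (h0 : coeff 0 f = 0)
    (h : ∀ i, pd i f ∈ hom K w (d - w i)) : f ∈ hom K w d := by
  intro r hr
  have hr0 : r ≠ 0 := fun e => hr (e ▸ h0)
  obtain ⟨i, hi⟩ := Function.ne_iff.mp hr0
  obtain ⟨s, rfl⟩ := eq_add_single hi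
  have := h i s (by rwa [coeff_pd])
  simp [mul_add, Finset.sum_add_distrib, Pi.single_apply, this]

/-- The Poincaré lemma for divided powers. -/
theorem exists_pd_eq (f : σ → DP σ K) (h : ∀ i j, pd i (f j) = pd j (f i)) :
    ∃ F : DP σ K, coeff 0 F = 0 ∧ ∀ i, pd i F = f i := by
  classical
  -- The coefficient of the primitive at `r` is read off from some `f i` with `r i ≠ 0`; closedness
  -- makes the choice immaterial, which is the content of `hc`. Since `∂ᵢ` only shifts divided
  -- monomials, no denominators occur.
  let c : (σ → ℕ) → K := fun r =>
    if hr : ∃ i, r i ≠ 0 then coeff (r - Pi.single hr.choose 1) (f hr.choose) else 0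
  have hc : ∀ s i, c (s + Pi.single i 1) = coeff s (f i) := by
    intro s i
    have hr : ∃ j, (s + Pi.single i 1 : σ → ℕ) j ≠ 0 := ⟨i, by simp⟩
    simp only [c]
    rw [dif_pos hr]
    have hj := hr.choose_spec
    generalize hr.choose = j at hj ⊢
    by_cases hij : j = i
    · rw [hij]; simp
    · have hsj : s j ≠ 0 := by simpa [hij] using hj
      obtain ⟨t, rfl⟩ := eq_add_single hsj
      have e : t + Pi.single j 1 + Pi.single i 1 - Pi.single j 1 = t + Pi.single i 1 := by
        rw [add_right_comm]; simp
      rw [e, ← coeff_pd, ← coeff_pd, h]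
  have hfin : {r | c r ≠ 0}.Finite := by
    refine (Set.finite_iUnion fun i => (finite_support (f i)).image
      fun s => s + Pi.single i 1).subset fun r hr => ?_
    by_cases hr' : ∃ i, r i ≠ 0
    · obtain ⟨i, hi⟩ := hr'
      obtain ⟨s, rfl⟩ := eq_add_single hi
      rw [Set.mem_ofPred_eq, hc] at hr
      exact Set.mem_iUnion.mpr ⟨i, s, hr, rfl⟩
    · exact absurd (by simp only [c, dif_neg hr']) hr
  obtain ⟨F, hF⟩ := exists_of_finite c hfin
  refine ⟨F, ?_, fun i => ext fun s => ?_⟩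
  · rw [hF]; simp [c]
  · rw [coeff_pd, hF, hc]

/-- Squaring is additive in characteristic 2, and the square of a nonconstant divided monomial
carries a central binomial coefficient, which is even. -/
theorem mul_self [CharP K 2] (f : DP σ K) (h : coeff 0 f = 0) : f * f = 0 := by
  classical
  have hm : ∀ r : σ → ℕ, r ≠ 0 → ∀ a : K, (mono r a * mono r a : DP σ K) = 0 := by
    intro r hr a
    rw [mono_mul_mono]
    obtain ⟨i, hi⟩ := Function.ne_iff.mp hr
    have h2 : 2 ∣ binom r r := by
      refine Dvd.dvd.trans ?_ (Finset.dvd_prod_of_mem _ (Finset.mem_univ i))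
      have := Nat.two_dvd_centralBinom_of_one_le (Nat.one_le_iff_ne_zero.mpr hi)
      rwa [Nat.centralBinom, two_mul] at this
    have : ((binom r r : ℕ) : K) = 0 := (CharP.cast_eq_zero_iff K 2 _).mpr h2
    rw [this, zero_mul, mono_zero]
  have e : f = ∑ r ∈ Finsupp.support (M := K) f, mono r (coeff r f) :=
    (Finsupp.sum_single (M := K) f).symm
  rw [e, ← sq, CharTwo.sum_sq]
  refine Finset.sum_eq_zero fun r hr => ?_
  rw [sq, hm]
  rintro rfl
  exact Finsupp.mem_support_iff.mp hr h

end

end DP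

/-! ### Functions of `z` among the functions of `z`, `p`, `q`. -/

section Embedding

variable {K : Type*} [Field K]

theorem sumElim_injective :
    Function.Injective (fun r : Fin 3 → ℕ => (Sum.elim r 0 : Idx → ℕ)) := fun _ _ h =>
  funext fun i => congrFun h (.inl i)

variable (K) in
/-- The embedding of functions of `z` into functions of `z`, `p`, `q`. -/
noncomputable def zEmb : DP (Fin 3) K →ₗ[K] DP Idx K :=
  Finsupp.lmapDomain K K fun r : Fin 3 → ℕ => (Sum.elim r 0 : Idx → ℕ)

theorem zEmb_mono (r : Fin 3 → ℕ) (a : K) :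
    zEmb K (DP.mono r a) = DP.mono (Sum.elim r 0) a :=
  Finsupp.mapDomain_single (M := K)

theorem coeff_zEmb (r : Fin 3 → ℕ) (f : DP (Fin 3) K) :
    DP.coeff (Sum.elim r 0 : Idx → ℕ) (zEmb K f) = DP.coeff r f :=
  Finsupp.mapDomain_apply (M := K) sumElim_injective _ _

theorem coeff_zEmb_ne_zero {t : Idx → ℕ} {f : DP (Fin 3) K} (h : DP.coeff t (zEmb K f) ≠ 0) :
    ∃ r : Fin 3 → ℕ, t = Sum.elim r 0 ∧ DP.coeff r f ≠ 0 := by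
  by_cases ht : t ∈ Set.range (fun r : Fin 3 → ℕ => (Sum.elim r 0 : Idx → ℕ))
  · obtain ⟨r, rfl⟩ := ht
    exact ⟨r, rfl, by rwa [coeff_zEmb] at h⟩
  · exact absurd (Finsupp.mapDomain_of_notMem_range (M := K) _ _ ht) h

theorem zEmb_one : zEmb K 1 = 1 := by
  rw [DP.one_eq_mono, zEmb_mono, DP.one_eq_mono]
  congr 1
  funext i; rcases i with i | i <;> rfl

@[simp] theorem pd_inl_zEmb (i : Fin 3) (f : DP (Fin 3) K) :
    DP.pd (.inl i) (zEmb K f) = zEmb K (DP.pd i f) := by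
  induction f using DP.induction with
  | h0 => simp
  | ha f g hf hg => simp only [map_add, hf, hg]
  | hm r a =>
    rw [zEmb_mono]
    by_cases hr : r i = 0
    · rw [DP.pd_mono_zero (by exact hr), DP.pd_mono_zero hr, map_zero]
    · obtain ⟨s, rfl⟩ := DP.eq_add_single hr
      have e : (Sum.elim (s + Pi.single i 1) 0 : Idx → ℕ) =
          Sum.elim s 0 + Pi.single (.inl i) 1 := by
        funext j
        rcases j with j | j <;> simp [Pi.single_apply]
      rw [e, DP.pd_mono_add, DP.pd_mono_add, zEmb_mono]

@[simp] theorem pd_inr_zEmb (i : Fin 3 ⊕ Fin 3) (f : DP (Fin 3) K) :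
    DP.pd (.inr i) (zEmb K f) = 0 := by
  induction f using DP.induction with
  | h0 => simp
  | ha f g hf hg => simp only [map_add, hf, hg, add_zero]
  | hm r a => rw [zEmb_mono, DP.pd_mono_zero (by rfl)]

theorem zEmb_shear {N : Fin 3 → WithTop ℕ+} {f : DP (Fin 3) K} (hf : f ∈ DP.shear K N) :
    zEmb K f ∈ DP.shear K (withOnes N) := by
  intro t ht i n hn
  obtain ⟨r, rfl, hr⟩ := coeff_zEmb_ne_zero ht
  rcases i with i | i
  · exact hf r hr i n hn
  · exact Nat.two_pow_pos _

theorem zEmb_hom {d : ℤ} {f : DP (Fin 3) K} (hf : f ∈ DP.hom K (fun _ => 2) d) :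
    zEmb K f ∈ DP.hom K wt d := by
  intro t ht
  obtain ⟨r, rfl, hr⟩ := coeff_zEmb_ne_zero ht
  rw [← hf r hr, Fintype.sum_sum_type]
  simp [wt]

end Embedding

/-! ## Brackets with the negative part -/

section Negative

variable {K : Type*} [Field K]

theorem act_idx (X : VF Idx K) (f : DP Idx K) :
    X.act f = ∑ i, X (.inl i) * DP.pd (.inl i) f +
      (∑ i, X (.inr (.inl i)) * DP.pd (.inr (.inl i)) f +
        ∑ i, X (.inr (.inr i)) * DP.pd (.inr (.inr i)) f) := by
  rw [VF.act_apply, Fintype.sum_sum_type, Fintype.sum_sum_type]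

theorem lie_wz_apply (v : Fin 3 → K) (X : VF Idx K) (j : Idx) :
    ⁅wz K v, X⁆ j = ∑ i, v i • DP.pd (.inl i) (X j) := by
  have h : X.act (wz K v j) = 0 := by
    rcases j with j | j | j <;> simp [VF.act_apply, wz_def, DP.pd_const]
  rw [VF.lie_apply, h, sub_zero, wz_def, act_mkVF]
  simp [DP.const_mul]

theorem lie_wp_apply (v : Fin 3 → K) (X : VF Idx K) (j : Idx) :
    ⁅wp K v, X⁆ j = ∑ i, v i • DP.pd (.inr (.inl i)) (X j) := by
  have h : X.act (wp K v j) = 0 := by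
    rcases j with j | j | j <;> simp [VF.act_apply, wp_def, DP.pd_const]
  rw [VF.lie_apply, h, sub_zero, wp_def, act_mkVF]
  simp [DP.const_mul]

/-- The action of the field `wq v` on functions. -/
theorem act_wq (v : Fin 3 → K) (f : DP Idx K) :
    (wq K v).act f = ∑ i, v i • DP.pd (.inr (.inr i)) f +
      ∑ i, crossProduct (fun j => DP.var K (.inr (.inl j))) (fun j => DP.const K (v j)) i *
        DP.pd (.inl i) f := by
  rw [wq_def, act_mkVF]
  simp [DP.const_mul, add_comm]

theorem lie_wq_apply_inr (v : Fin 3 → K) (X : VF Idx K) (j : Fin 3 ⊕ Fin 3) :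
    ⁅wq K v, X⁆ (.inr j) = (wq K v).act (X (.inr j)) := by
  have h : X.act (wq K v (.inr j)) = 0 := by
    rcases j with j | j <;> simp [VF.act_apply, wq_def, DP.pd_const]
  rw [VF.lie_apply, h, sub_zero]

/-- The extra term appears because `X` differentiates the linear coefficients `p × v`, feeding its
`p`-components into the `z`-components. -/
theorem lie_wq_apply_inl (v : Fin 3 → K) (X : VF Idx K) (j : Fin 3) :
    ⁅wq K v, X⁆ (.inl j) = (wq K v).act (X (.inl j)) -
      crossProduct (fun j => X (.inr (.inl j))) (fun j => DP.const K (v j)) j := by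
  have h : X.act (wq K v (.inl j)) =
      crossProduct (fun j => X (.inr (.inl j))) (fun j => DP.const K (v j)) j := by
    rw [act_idx]
    fin_cases j <;>
      simp [wq_def, cross_apply, DP.pd_mul, DP.pd_const, DP.pd_var, Fin.sum_univ_three] <;> ring
  rw [VF.lie_apply, h]

theorem lie_wz_single (i : Fin 3) (X : VF Idx K) (j : Idx) :
    ⁅wz K (Pi.single i 1), X⁆ j = DP.pd (.inl i) (X j) := by
  rw [lie_wz_apply, Finset.sum_eq_single i] <;> simp +contextual

theorem lie_wp_single (i : Fin 3) (X : VF Idx K) (j : Idx) :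
    ⁅wp K (Pi.single i 1), X⁆ j = DP.pd (.inr (.inl i)) (X j) := by
  rw [lie_wp_apply, Finset.sum_eq_single i] <;> simp +contextual

theorem gm2_le_of_single {S : Submodule K (VF Idx K)} (h : ∀ i, wz K (Pi.single i 1) ∈ S) :
    gm2 K ≤ S := by
  rintro _ ⟨v, rfl⟩
  rw [pi_eq_sum_univ' v, map_sum]
  exact S.sum_mem fun i _ => by
    rw [map_smul]
    exact S.smul_mem _ (by convert h i using 2)

theorem gm1_le_of_single {S : Submodule K (VF Idx K)} (hp : ∀ i, wp K (Pi.single i 1) ∈ S)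
    (hq : ∀ i, wq K (Pi.single i 1) ∈ S) : gm1 K ≤ S := by
  refine sup_le ?_ ?_
  · rintro _ ⟨v, rfl⟩
    rw [pi_eq_sum_univ' v, map_sum]
    exact S.sum_mem fun i _ => by
      rw [map_smul]
      exact S.smul_mem _ (by convert hp i using 2)
  · rintro _ ⟨v, rfl⟩
    rw [pi_eq_sum_univ' v, map_sum]
    exact S.sum_mem fun i _ => by
      rw [map_smul]
      exact S.smul_mem _ (by convert hq i using 2)

variable [CharP K 2]

theorem forall_gm2_iff {A : Submodule K (VF Idx K)} {X : VF Idx K} :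
    (∀ Y ∈ gm2 K, ⁅X, Y⁆ ∈ A) ↔ ∀ i, ⁅wz K (Pi.single i 1), X⁆ ∈ A := by
  refine ⟨fun h i => lie_mem_comm K A (h _ ⟨_, rfl⟩), fun h Y hY => ?_⟩
  exact gm2_le_of_single (S := A.comap (LieAlgebra.ad K (VF Idx K) X))
    (fun i => lie_mem_comm K A (h i)) hY

theorem forall_gm1_iff {A : Submodule K (VF Idx K)} {X : VF Idx K} :
    (∀ Y ∈ gm1 K, ⁅X, Y⁆ ∈ A) ↔
      (∀ i, ⁅wp K (Pi.single i 1), X⁆ ∈ A) ∧ ∀ i, ⁅wq K (Pi.single i 1), X⁆ ∈ A := by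
  refine ⟨fun h => ⟨fun i => lie_mem_comm K A (h _ (Submodule.mem_sup_left ⟨_, rfl⟩)),
    fun i => lie_mem_comm K A (h _ (Submodule.mem_sup_right ⟨_, rfl⟩))⟩, fun h Y hY => ?_⟩
  exact gm1_le_of_single (S := A.comap (LieAlgebra.ad K (VF Idx K) X))
    (fun i => lie_mem_comm K A (h.1 i)) (fun i => lie_mem_comm K A (h.2 i)) hY

/-- A vector field that commutes with the negative part and vanishes at the origin is zero. -/
theorem eq_zero_of_lie_negative {X : VF Idx K} (hz : ∀ i, ⁅wz K (Pi.single i 1), X⁆ = 0)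
    (hp : ∀ i, ⁅wp K (Pi.single i 1), X⁆ = 0) (hq : ∀ i, ⁅wq K (Pi.single i 1), X⁆ = 0)
    (h0 : ∀ j, DP.coeff 0 (X j) = 0) : X = 0 := by
  have ez : ∀ i j, DP.pd (.inl i) (X j) = 0 := fun i j => by rw [← lie_wz_single, hz]; rfl
  have ep : ∀ i j, DP.pd (.inr (.inl i)) (X j) = 0 := fun i j => by
    rw [← lie_wp_single, hp]; rfl
  have aq : ∀ i j, (wq K (Pi.single i 1)).act (X j) = DP.pd (.inr (.inr i)) (X j) := by
    intro i j
    rw [act_wq, Finset.sum_eq_single i]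
    · simp [ez]
    · simp +contextual
    · simp
  -- With the `z`-derivatives gone, `wq` acts on functions as a derivative in `q`. The `p`- and
  -- `q`-components carry no correction term and are settled before the `z`-components, whose
  -- correction involves the `p`-components.
  have e1 : ∀ j, X (.inr j) = 0 := by
    intro j
    refine DP.eq_zero_of_pd (fun i => ?_) (h0 _)
    rcases i with i | i | i
    · exact ez i _
    · exact ep i _
    · rw [← aq, ← lie_wq_apply_inr, hq]; rfl
  refine VF.ext fun j => ?_
  rcases j with j | j
  · refine DP.eq_zero_of_pd (fun i => ?_) (h0 _)
    rcases i with i | i | i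
    · exact ez i _
    · exact ep i _
    · have h := congrFun (hq i) (.inl j)
      rw [lie_wq_apply_inl, aq] at h
      have h' : crossProduct (fun j => X (.inr (.inl j)))
          (fun j => DP.const K ((Pi.single i 1 : Fin 3 → K) j)) j = 0 := by
        fin_cases j <;> simp [cross_apply, e1]
      rwa [h', sub_zero] at h
  · exact e1 j

theorem coeff_zero_of_hom_idx {X : VF Idx K} {k : ℤ} (hX : X ∈ VF.hom K wt k) (hk : 0 ≤ k)
    (j : Idx) : DP.coeff 0 (X j) = 0 := by
  refine DP.coeff_zero_of_hom (hX j) ?_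
  rcases j with j | j <;> simp [wt] <;> omega

theorem eq_zero_of_lie_negative_of_hom {X : VF Idx K} {k : ℤ} (hX : X ∈ VF.hom K wt k)
    (hk : 0 ≤ k) (hz : ∀ i, ⁅wz K (Pi.single i 1), X⁆ = 0)
    (hp : ∀ i, ⁅wp K (Pi.single i 1), X⁆ = 0) (hq : ∀ i, ⁅wq K (Pi.single i 1), X⁆ = 0) :
    X = 0 :=
  eq_zero_of_lie_negative hz hp hq (coeff_zero_of_hom_idx hX hk)

end Negative

/-! ## Brown's algebra as an algebra of vector fields in nine indeterminates -/

theorem DP.pd_var_apply {σ K : Type*} [Field K] [Fintype σ] [DecidableEq σ] (i j : σ) :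
    DP.pd i (DP.var K j) = if i = j then 1 else 0 := by
  by_cases h : i = j
  · subst h
    rw [if_pos rfl]
    have := DP.pd_mono_add (K := K) i 0 1
    rwa [zero_add] at this
  · rw [if_neg h]
    exact DP.pd_mono_zero (by simp [h]) 1

theorem DP.var_mul_self {σ K : Type*} [Field K] [CharP K 2] [Fintype σ] [DecidableEq σ] (i : σ) :
    DP.var K i * DP.var K i = 0 := by
  refine DP.mul_self _ ?_
  classical
  rw [DP.var, DP.coeff_mono, if_neg]
  intro h
  have := congrFun h i
  simp at this

namespace BrownSpace

variable {K : Type*} [Field K]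

/-- The element of Brown's algebra with given components. -/
def of (X : svect K) (f g : DP (Fin 3) K) : BrownSpace K := (X, f, g)

@[simp] theorem vf_of (X : svect K) (f g : DP (Fin 3) K) : (of X f g).vf = X.1 := rfl
@[simp] theorem fst_of (X : svect K) (f g : DP (Fin 3) K) : (of X f g).fst = f := rfl
@[simp] theorem snd_of (X : svect K) (f g : DP (Fin 3) K) : (of X f g).snd = g := rfl

variable (K) in
/-- The constant field `∂ₖ`. -/
noncomputable def dz (k : Fin 3) : BrownSpace K :=
  of ⟨(Pi.single k 1 : Fin 3 → DP (Fin 3) K), by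
    change ∑ i, DP.pd i ((Pi.single k 1 : Fin 3 → DP (Fin 3) K) i) = 0
    refine Finset.sum_eq_zero fun i _ => ?_
    rw [Pi.single_apply]
    split_ifs
    · exact DP.pd_one i
    · exact map_zero _⟩ 0 0

variable (K) in
/-- The indeterminate `uₖ` in the first copy of the functions. -/
noncomputable def uFst (k : Fin 3) : BrownSpace K := of 0 (DP.var K k) 0

variable (K) in
/-- The indeterminate `uₖ` in the second copy of the functions. -/
noncomputable def uSnd (k : Fin 3) : BrownSpace K := of 0 0 (DP.var K k)

theorem vf_dz_apply (k i : Fin 3) : (dz K k).vf i = if i = k then 1 else 0 := by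
  change (Pi.single k 1 : Fin 3 → DP (Fin 3) K) i = _
  rw [Pi.single_apply]
@[simp] theorem fst_dz (k : Fin 3) : (dz K k).fst = 0 := rfl
@[simp] theorem snd_dz (k : Fin 3) : (dz K k).snd = 0 := rfl
@[simp] theorem vf_uFst (k : Fin 3) : (uFst K k).vf = 0 := rfl
@[simp] theorem fst_uFst (k : Fin 3) : (uFst K k).fst = DP.var K k := rfl
@[simp] theorem snd_uFst (k : Fin 3) : (uFst K k).snd = 0 := rfl
@[simp] theorem vf_uSnd (k : Fin 3) : (uSnd K k).vf = 0 := rfl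
@[simp] theorem fst_uSnd (k : Fin 3) : (uSnd K k).fst = 0 := rfl
@[simp] theorem snd_uSnd (k : Fin 3) : (uSnd K k).snd = DP.var K k := rfl

theorem act_dz (k : Fin 3) (f : DP (Fin 3) K) : (dz K k).vf.act f = DP.pd k f := by
  simp [VF.act_apply, vf_dz_apply]

theorem act_zero_left (f : DP (Fin 3) K) : (0 : VF (Fin 3) K).act f = 0 := by
  simp [VF.act_apply]

theorem act_dz_right (X : VF (Fin 3) K) (k i : Fin 3) : X.act ((dz K k).vf i) = 0 := by
  rw [vf_dz_apply]
  split_ifs <;> simp [VF.act_apply, DP.pd_one]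

theorem act_var (X : VF (Fin 3) K) (k : Fin 3) : X.act (DP.var K k) = X k := by
  rw [VF.act_apply, Finset.sum_eq_single k] <;> simp +contextual [DP.pd_var_apply]

theorem gradCross_zero_left (f : DP (Fin 3) K) : (gradCross 0 f).1 = 0 := by
  refine VF.ext fun i => ?_
  fin_cases i <;> simp [gradCross_zero, gradCross_one, gradCross_two]

theorem gradCross_zero_right (f : DP (Fin 3) K) : (gradCross f 0).1 = 0 := by
  refine VF.ext fun i => ?_
  fin_cases i <;> simp [gradCross_zero, gradCross_one, gradCross_two]

theorem vf_dz_lie (k : Fin 3) (x : BrownSpace K) (i : Fin 3) :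
    ⁅dz K k, x⁆.vf i = DP.pd k (x.vf i) := by
  rw [vf_lie]
  simp [VF.lie_apply, act_dz, act_dz_right, gradCross_zero_left, gradCross_zero_right]

theorem fst_dz_lie (k : Fin 3) (x : BrownSpace K) : ⁅dz K k, x⁆.fst = DP.pd k x.fst := by
  simp [fst_lie, act_dz]

theorem snd_dz_lie (k : Fin 3) (x : BrownSpace K) : ⁅dz K k, x⁆.snd = DP.pd k x.snd := by
  simp [snd_lie, act_dz]

theorem vf_uFst_lie (k : Fin 3) (x : BrownSpace K) :
    ⁅uFst K k, x⁆.vf = (gradCross (DP.var K k) x.snd).1 := by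
  rw [vf_lie]
  simp [gradCross_zero_left, gradCross_zero_right]

theorem fst_uFst_lie (k : Fin 3) (x : BrownSpace K) : ⁅uFst K k, x⁆.fst = -x.vf k := by
  simp [fst_lie, act_zero_left, act_var]

theorem snd_uFst_lie (k : Fin 3) (x : BrownSpace K) : ⁅uFst K k, x⁆.snd = 0 := by
  simp [snd_lie, act_zero_left]

theorem vf_uSnd_lie (k : Fin 3) (x : BrownSpace K) :
    ⁅uSnd K k, x⁆.vf = -(gradCross x.fst (DP.var K k)).1 := by
  rw [vf_lie]
  simp [gradCross_zero_left, gradCross_zero_right]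

theorem fst_uSnd_lie (k : Fin 3) (x : BrownSpace K) : ⁅uSnd K k, x⁆.fst = 0 := by
  simp [fst_lie, act_zero_left]

theorem snd_uSnd_lie (k : Fin 3) (x : BrownSpace K) : ⁅uSnd K k, x⁆.snd = -x.vf k := by
  simp [snd_lie, act_zero_left, act_var]

end BrownSpace

section Theta

variable {K : Type*} [Field K]

variable (K) in
/-- The indeterminate `pᵢ`. -/
noncomputable abbrev pVar (i : Fin 3) : DP Idx K := DP.var K (.inr (.inl i))

variable (K) in
/-- The indeterminate `qᵢ`. -/
noncomputable abbrev qVar (i : Fin 3) : DP Idx K := DP.var K (.inr (.inr i))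

/-- The vector `(v₁ v₂, v₂ v₀, v₀ v₁)`. -/
noncomputable def hat (v : Fin 3 → DP Idx K) : Fin 3 → DP Idx K := ![v 1 * v 2, v 2 * v 0, v 0 * v 1]

namespace BrownSpace

/-- The `z`-components of the vector field that realizes an element of Brown's algebra. -/
noncomputable def zPart (x : BrownSpace K) : Fin 3 → DP Idx K := fun i =>
  zEmb K (x.vf i) + crossProduct (pVar K) (fun j => zEmb K (DP.pd j x.snd)) i

/-- The potential of the `p`-components. -/
noncomputable def pPot (x : BrownSpace K) : DP Idx K :=
  ∑ i, pVar K i * zEmb K (x.vf i) + zEmb K x.fst + ∑ i, hat (pVar K) i * zEmb K (DP.pd i x.snd)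

/-- The potential of the `q`-components. -/
noncomputable def qPot (x : BrownSpace K) : DP Idx K :=
  zEmb K x.snd + ∑ i, qVar K i * x.zPart i + ∑ i, hat (qVar K) i * DP.pd (.inl i) x.pPot

theorem zPart_zero (x : BrownSpace K) : x.zPart 0 = zEmb K (x.vf 0) +
    (pVar K 1 * zEmb K (DP.pd 2 x.snd) - pVar K 2 * zEmb K (DP.pd 1 x.snd)) := by
  simp [zPart, cross_apply]
theorem zPart_one (x : BrownSpace K) : x.zPart 1 = zEmb K (x.vf 1) +
    (pVar K 2 * zEmb K (DP.pd 0 x.snd) - pVar K 0 * zEmb K (DP.pd 2 x.snd)) := by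
  simp [zPart, cross_apply]
theorem zPart_two (x : BrownSpace K) : x.zPart 2 = zEmb K (x.vf 2) +
    (pVar K 0 * zEmb K (DP.pd 1 x.snd) - pVar K 1 * zEmb K (DP.pd 0 x.snd)) := by
  simp [zPart, cross_apply]

theorem zPart_add (x y : BrownSpace K) (i : Fin 3) : (x + y).zPart i = x.zPart i + y.zPart i := by
  fin_cases i <;> simp [zPart_zero, zPart_one, zPart_two] <;> ring

theorem zPart_smul (c : K) (x : BrownSpace K) (i : Fin 3) : (c • x).zPart i = c • x.zPart i := by
  fin_cases i <;> simp [zPart_zero, zPart_one, zPart_two, DP.mul_smul, smul_sub]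

theorem pPot_add (x y : BrownSpace K) : (x + y).pPot = x.pPot + y.pPot := by
  simp [pPot, mul_add, Finset.sum_add_distrib]; ring

theorem pPot_smul (c : K) (x : BrownSpace K) : (c • x).pPot = c • x.pPot := by
  simp [pPot, DP.mul_smul, Finset.smul_sum]

theorem qPot_add (x y : BrownSpace K) : (x + y).qPot = x.qPot + y.qPot := by
  simp [qPot, mul_add, Finset.sum_add_distrib, zPart_add, pPot_add]; ring

theorem qPot_smul (c : K) (x : BrownSpace K) : (c • x).qPot = c • x.qPot := by
  simp [qPot, DP.mul_smul, Finset.smul_sum, zPart_smul, pPot_smul]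

end BrownSpace

open BrownSpace

variable (K) in
/-- The vector field in nine indeterminates that realizes an element of Brown's algebra. -/
noncomputable def thetaLin : BrownSpace K →ₗ[K] VF Idx K where
  toFun x := mkVF x.zPart (fun i => DP.pd (.inl i) x.pPot) (fun i => DP.pd (.inl i) x.qPot)
  map_add' x y := VF.ext fun i => by
    rcases i with i | i | i <;> simp [zPart_add, pPot_add, qPot_add]
  map_smul' c x := VF.ext fun i => by
    rcases i with i | i | i <;> simp [zPart_smul, pPot_smul, qPot_smul]

theorem thetaLin_inl (x : BrownSpace K) (i : Fin 3) : thetaLin K x (.inl i) = x.zPart i := rfl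
theorem thetaLin_p (x : BrownSpace K) (i : Fin 3) :
    thetaLin K x (.inr (.inl i)) = DP.pd (.inl i) x.pPot := rfl
theorem thetaLin_q (x : BrownSpace K) (i : Fin 3) :
    thetaLin K x (.inr (.inr i)) = DP.pd (.inl i) x.qPot := rfl

theorem zPart_dz_lie (k i : Fin 3) (x : BrownSpace K) :
    zPart ⁅dz K k, x⁆ i = DP.pd (.inl k) (x.zPart i) := by
  fin_cases i <;> simp [zPart_zero, zPart_one, zPart_two, vf_dz_lie, snd_dz_lie, DP.pd_mul,
    DP.pd_var, DP.pd_comm k]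

theorem pPot_dz_lie (k : Fin 3) (x : BrownSpace K) :
    pPot ⁅dz K k, x⁆ = DP.pd (.inl k) x.pPot := by
  simp [pPot, vf_dz_lie, snd_dz_lie, fst_dz_lie, DP.pd_mul, DP.pd_var, DP.pd_comm k,
    Fin.sum_univ_three, hat]

theorem qPot_dz_lie (k : Fin 3) (x : BrownSpace K) :
    qPot ⁅dz K k, x⁆ = DP.pd (.inl k) x.qPot := by
  simp [qPot, snd_dz_lie, DP.pd_mul, DP.pd_var, zPart_dz_lie, pPot_dz_lie,
    DP.pd_comm (.inl k : Idx) (.inl _), Fin.sum_univ_three, hat]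

/-- `∂ₖ` differentiates all three components of an element, and `p`, `q` do not depend on `z`; hence
differentiation passes through the formulas for `zPart`, `pPot` and `qPot`. -/
theorem thetaLin_dz_lie (k : Fin 3) (x : BrownSpace K) :
    thetaLin K ⁅dz K k, x⁆ = ⁅wz K (Pi.single k 1), thetaLin K x⁆ := by
  refine VF.ext fun j => ?_
  rw [lie_wz_single]
  rcases j with j | j | j
  · exact zPart_dz_lie k j x
  · rw [thetaLin_p, thetaLin_p, pPot_dz_lie, DP.pd_comm]
  · rw [thetaLin_q, thetaLin_q, qPot_dz_lie, DP.pd_comm]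

variable [CharP K 2]

/-- Bracketing with `uₖ` sends `g` to a field and `D` to a function. This is the pattern of the
expansions of `zPart` and `pPot` in powers of `p`, whose coefficients are `D`, `∇g` and `f`, `D`,
`∇g`, respectively. -/
theorem zPart_uFst_lie (k i : Fin 3) (x : BrownSpace K) :
    zPart ⁅uFst K k, x⁆ i = DP.pd (.inr (.inl k)) (x.zPart i) := by
  fin_cases k <;> fin_cases i <;>
    simp [zPart_zero, zPart_one, zPart_two, vf_uFst_lie, snd_uFst_lie, DP.pd_mul,
    DP.pd_var, gradCross_zero, gradCross_one, gradCross_two, DP.pd_var_apply]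

theorem pPot_uFst_lie (k : Fin 3) (x : BrownSpace K) :
    pPot ⁅uFst K k, x⁆ = DP.pd (.inr (.inl k)) x.pPot := by
  fin_cases k <;>
    simp [pPot, vf_uFst_lie, fst_uFst_lie, snd_uFst_lie, DP.pd_mul, CharTwo.sub_eq_add,
      DP.pd_var, gradCross_zero, gradCross_one, gradCross_two, DP.pd_var_apply, hat,
      Fin.sum_univ_three, CharTwo.neg_eq] <;> ring

theorem qPot_uFst_lie (k : Fin 3) (x : BrownSpace K) :
    qPot ⁅uFst K k, x⁆ = DP.pd (.inr (.inl k)) x.qPot := by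
  simp [qPot, snd_uFst_lie, DP.pd_mul, DP.pd_var, zPart_uFst_lie, pPot_uFst_lie,
    DP.pd_comm (.inr (.inl k) : Idx) (.inl _), Fin.sum_univ_three, hat]

theorem thetaLin_uFst_lie (k : Fin 3) (x : BrownSpace K) :
    thetaLin K ⁅uFst K k, x⁆ = ⁅wp K (Pi.single k 1), thetaLin K x⁆ := by
  refine VF.ext fun j => ?_
  rw [lie_wp_single]
  rcases j with j | j | j
  · exact zPart_uFst_lie k j x
  · rw [thetaLin_p, thetaLin_p, pPot_uFst_lie, DP.pd_comm]
  · rw [thetaLin_q, thetaLin_q, qPot_uFst_lie, DP.pd_comm]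

end Theta

/-! ### Compatibility of the realization with the fields `wq`. -/

section ThetaQ

open BrownSpace

variable {K : Type*} [Field K] [CharP K 2]

theorem const_one : DP.const (σ := Idx) K 1 = 1 := rfl

theorem act_wq_zero (f : DP Idx K) :
    (wq K (Pi.single 0 1)).act f = DP.pd (.inr (.inr 0)) f +
      (pVar K 2 * DP.pd (.inl 1) f + pVar K 1 * DP.pd (.inl 2) f) := by
  rw [act_wq]
  simp [Fin.sum_univ_three, cross_apply, const_one, CharTwo.neg_eq]

theorem act_wq_one (f : DP Idx K) :
    (wq K (Pi.single 1 1)).act f = DP.pd (.inr (.inr 1)) f +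
      (pVar K 2 * DP.pd (.inl 0) f + pVar K 0 * DP.pd (.inl 2) f) := by
  rw [act_wq]
  simp [Fin.sum_univ_three, cross_apply, const_one, CharTwo.neg_eq]

theorem act_wq_two (f : DP Idx K) :
    (wq K (Pi.single 2 1)).act f = DP.pd (.inr (.inr 2)) f +
      (pVar K 1 * DP.pd (.inl 0) f + pVar K 0 * DP.pd (.inl 1) f) := by
  rw [act_wq]
  simp [Fin.sum_univ_three, cross_apply, const_one, CharTwo.neg_eq]

theorem pd_two_vf (x : BrownSpace K) :
    DP.pd 2 (x.vf 2) = DP.pd 0 (x.vf 0) + DP.pd 1 (x.vf 1) := by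
  have := div_vf x
  rw [← CharTwo.add_eq_zero, ← this]; ring

theorem forall_fin_three {P : Fin 3 → Prop} (h0 : P 0) (h1 : P 1) (h2 : P 2) :
    ∀ i, P i := by
  intro i
  fin_cases i
  exacts [h0, h1, h2]

theorem pVar_sq (i : Fin 3) : pVar K i * pVar K i = 0 := DP.var_mul_self _

/-- The correction term in brackets with `wq` couples `zPart` to the gradient of `pPot`. The terms
quadratic in `p` match because `pᵢ² = 0` and `2 = 0`; the vanishing divergence enters through
`pd_two_vf`. -/
theorem zPart_uSnd_lie (k i : Fin 3) (x : BrownSpace K) :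
    zPart ⁅uSnd K k, x⁆ i = (wq K (Pi.single k 1)).act (x.zPart i) -
      crossProduct (fun j => DP.pd (.inl j) x.pPot)
        (fun j => DP.const K ((Pi.single k 1 : Fin 3 → K) j)) i := by
  have h0 := pVar_sq (K := K) 0
  have h1 := pVar_sq (K := K) 1
  have h2 := pVar_sq (K := K) 2
  have ht : (2 : DP Idx K) = 0 := CharTwo.two_eq_zero
  revert k i
  refine forall_fin_three ?_ ?_ ?_ <;> refine forall_fin_three ?_ ?_ ?_
  all_goals
    simp only [act_wq_zero, act_wq_one, act_wq_two]
    simp [zPart_zero, zPart_one, zPart_two, vf_uSnd_lie, snd_uSnd_lie, DP.pd_mul,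
      CharTwo.sub_eq_add, CharTwo.neg_eq, DP.pd_var, gradCross_zero, gradCross_one, gradCross_two,
      DP.pd_var_apply, pPot, hat, Fin.sum_univ_three, cross_apply, const_one, pd_two_vf,
      DP.pd_comm 1 0 x.snd, DP.pd_comm 2 0 x.snd, DP.pd_comm 2 1 x.snd]
    try grind

theorem pPot_uSnd_lie (k : Fin 3) (x : BrownSpace K) :
    pPot ⁅uSnd K k, x⁆ = (wq K (Pi.single k 1)).act x.pPot := by
  have h0 := pVar_sq (K := K) 0
  have h1 := pVar_sq (K := K) 1
  have h2 := pVar_sq (K := K) 2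
  have ht : (2 : DP Idx K) = 0 := CharTwo.two_eq_zero
  revert k
  refine forall_fin_three ?_ ?_ ?_
  all_goals
    simp only [act_wq_zero, act_wq_one, act_wq_two]
    simp [pPot, vf_uSnd_lie, snd_uSnd_lie, fst_uSnd_lie, DP.pd_mul, CharTwo.sub_eq_add,
      CharTwo.neg_eq, DP.pd_var, gradCross_zero, gradCross_one, gradCross_two, DP.pd_var_apply,
      pd_two_vf, hat, Fin.sum_univ_three, DP.pd_comm 1 0 x.snd, DP.pd_comm 2 0 x.snd,
      DP.pd_comm 2 1 x.snd]
    grind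

theorem pd_act_wq (k i : Fin 3) (f : DP Idx K) :
    DP.pd (.inl i) ((wq K (Pi.single k 1)).act f) =
      (wq K (Pi.single k 1)).act (DP.pd (.inl i) f) := by
  revert k
  refine forall_fin_three ?_ ?_ ?_
  all_goals
    simp only [act_wq_zero, act_wq_one, act_wq_two]
    simp [DP.pd_mul, DP.pd_var, DP.pd_comm (.inl i) _ f]

theorem act_wq_qVar (k i : Fin 3) :
    (wq K (Pi.single k 1)).act (qVar K i) = if k = i then 1 else 0 := by
  revert k i
  refine forall_fin_three ?_ ?_ ?_ <;> refine forall_fin_three ?_ ?_ ?_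
  all_goals
    simp only [act_wq_zero, act_wq_one, act_wq_two]
    simp [DP.pd_var]

theorem qPot_uSnd_lie (k : Fin 3) (x : BrownSpace K) :
    qPot ⁅uSnd K k, x⁆ = (wq K (Pi.single k 1)).act x.qPot := by
  have ht : (2 : DP Idx K) = 0 := CharTwo.two_eq_zero
  -- The action of `wq` on `g` and the part of `zPart` linear in `p` are, up to sign, the same
  -- component of `p × ∇g`, so they cancel. The rest of the computation uses only the Leibniz rule
  -- and the action of `wq` on `q`.
  have hg : (wq K (Pi.single k 1)).act (zEmb K x.snd) + x.zPart k = zEmb K (x.vf k) := by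
    revert k
    refine forall_fin_three ?_ ?_ ?_
    all_goals
      simp only [act_wq_zero, act_wq_one, act_wq_two]
      simp [zPart_zero, zPart_one, zPart_two, CharTwo.sub_eq_add]
      grind
  simp only [qPot, snd_uSnd_lie, zPart_uSnd_lie, pPot_uSnd_lie, pd_act_wq, map_add, map_sum,
    VF.act_mul, act_wq_qVar, map_neg, ← hg]
  clear hg
  generalize (wq K (Pi.single k 1)).act (zEmb K x.snd) = A
  revert k
  refine forall_fin_three ?_ ?_ ?_
  all_goals
    simp [hat, VF.act_mul, act_wq_qVar, Fin.sum_univ_three, cross_apply, const_one,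
      CharTwo.sub_eq_add, CharTwo.neg_eq]
    grind

theorem thetaLin_uSnd_lie (k : Fin 3) (x : BrownSpace K) :
    thetaLin K ⁅uSnd K k, x⁆ = ⁅wq K (Pi.single k 1), thetaLin K x⁆ := by
  refine VF.ext fun j => ?_
  rcases j with j | j | j
  · rw [lie_wq_apply_inl]
    exact zPart_uSnd_lie k j x
  · rw [lie_wq_apply_inr, thetaLin_p, thetaLin_p, pPot_uSnd_lie, pd_act_wq]
  · rw [lie_wq_apply_inr, thetaLin_q, thetaLin_q, qPot_uSnd_lie, pd_act_wq]

end ThetaQ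

/-! ### The homomorphism property -/

theorem DP.coeff_zero_mul {σ K : Type*} [Field K] [Fintype σ] (f g : DP σ K) :
    DP.coeff 0 (f * g) = DP.coeff 0 f * DP.coeff 0 g := by
  classical
  induction f using DP.induction with
  | h0 => simp
  | ha f₁ f₂ h₁ h₂ => rw [add_mul, map_add, h₁, h₂, map_add, add_mul]
  | hm r a =>
    induction g using DP.induction with
    | h0 => simp
    | ha f₁ f₂ h₁ h₂ => rw [mul_add, map_add, h₁, h₂, map_add, mul_add]
    | hm s b =>
      rw [DP.mono_mul_mono, DP.coeff_mono, DP.coeff_mono, DP.coeff_mono]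
      by_cases hr : r = 0
      · by_cases hs : s = 0
        · subst hr; subst hs; simp [DP.binom]
        · subst hr; simp [hs]
      · have : r + s ≠ 0 := fun h => hr <| funext fun i => by
          have := congrFun h i
          simp only [Pi.add_apply, Pi.zero_apply] at this ⊢
          omega
        simp [hr, this]

theorem coeff_zero_lie {K : Type*} [Field K] {X Y : VF Idx K} (hX : ∀ j, DP.coeff 0 (X j) = 0)
    (hY : ∀ j, DP.coeff 0 (Y j) = 0) (j : Idx) : DP.coeff 0 (⁅X, Y⁆ j) = 0 := by
  rw [VF.lie_apply, map_sub, VF.act_apply, VF.act_apply, map_sum, map_sum]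
  simp only [DP.coeff_zero_mul, hX, hY, zero_mul, Finset.sum_const_zero, sub_zero]

theorem DP.coeff_zero_var {σ K : Type*} [Field K] [DecidableEq σ] (i : σ) :
    DP.coeff 0 (DP.var K i) = 0 := by
  classical
  rw [DP.var, DP.coeff_mono, if_neg]
  intro h
  have := congrFun h i
  simp at this

theorem coeff_zero_zEmb {K : Type*} [Field K] (f : DP (Fin 3) K) :
    DP.coeff 0 (zEmb K f) = DP.coeff 0 f := by
  rw [← coeff_zEmb]
  congr 2
  funext i; rcases i with i | i <;> rfl

section Hom

open BrownSpace

variable {K : Type*} [Field K]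

namespace BrownSpace

@[simp] theorem vf_sub (x y : BrownSpace K) : (x - y).vf = x.vf - y.vf := rfl
@[simp] theorem fst_sub (x y : BrownSpace K) : (x - y).fst = x.fst - y.fst := rfl
@[simp] theorem snd_sub (x y : BrownSpace K) : (x - y).snd = x.snd - y.snd := rfl
@[simp] theorem vf_neg (x : BrownSpace K) : (-x).vf = -x.vf := rfl
@[simp] theorem fst_neg (x : BrownSpace K) : (-x).fst = -x.fst := rfl
@[simp] theorem snd_neg (x : BrownSpace K) : (-x).snd = -x.snd := rfl

/-- The vanishing at the origin of the vector field that realizes an element of Brown's algebra. -/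
def VanishesAtZero (x : BrownSpace K) : Prop :=
  ∀ i, DP.coeff 0 (x.vf i) = 0 ∧ DP.coeff 0 (DP.pd i x.fst) = 0 ∧ DP.coeff 0 (DP.pd i x.snd) = 0

/-- A bound for the degrees of the coefficients. -/
def DegLE (m : ℕ) (x : BrownSpace K) : Prop :=
  (∀ i r, DP.coeff r (x.vf i) ≠ 0 → 2 * ∑ j, r j + 1 ≤ m) ∧
  (∀ r, r ≠ 0 → DP.coeff r x.fst ≠ 0 → 2 * ∑ j, r j ≤ m) ∧
  (∀ r, r ≠ 0 → DP.coeff r x.snd ≠ 0 → 2 * ∑ j, r j ≤ m)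

theorem sum_add_single (r : Fin 3 → ℕ) (k : Fin 3) :
    ∑ j, (r + Pi.single k 1 : Fin 3 → ℕ) j = ∑ j, r j + 1 := by
  simp [Finset.sum_add_distrib]

theorem add_single_ne_zero (r : Fin 3 → ℕ) (k : Fin 3) : r + Pi.single k 1 ≠ 0 := fun h => by
  have := congrFun h k
  simp at this

theorem exists_degLE (x : BrownSpace K) : ∃ m, x.DegLE m := by
  have h : ∀ f : DP (Fin 3) K, ∃ m, ∀ r, DP.coeff r f ≠ 0 → 2 * ∑ j, r j + 1 ≤ m := fun f => by
    obtain ⟨m, hm⟩ := ((DP.finite_support f).image fun r => 2 * ∑ j, r j + 1).bddAbove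
    exact ⟨m, fun r hr => hm ⟨r, hr, rfl⟩⟩
  choose M hM using fun i => h (x.vf i)
  obtain ⟨a, ha⟩ := h x.fst
  obtain ⟨b, hb⟩ := h x.snd
  refine ⟨∑ i, M i + a + b, fun i r hr => ?_, fun r _ hr => ?_, fun r _ hr => ?_⟩
  · have := hM i r hr
    have := Finset.single_le_sum (f := M) (fun _ _ => Nat.zero_le _) (Finset.mem_univ i)
    omega
  · have := ha r hr; omega
  · have := hb r hr; omega

/-- The weights `2|r| + 1` for fields and `2|r|` for functions are tuned so that each generator of
the negative part lowers the bound: the two kinds of `uₖ` turn fields into functions of the same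
polynomial degree and functions into fields of degree one less. Constant functions are ignored,
being central. -/
theorem DegLE.dz_lie {m : ℕ} {x : BrownSpace K} (h : x.DegLE (m + 1)) (k : Fin 3) :
    ⁅dz K k, x⁆.DegLE m := by
  refine ⟨fun i r hr => ?_, fun r _ hr => ?_, fun r _ hr => ?_⟩
  · rw [vf_dz_lie, DP.coeff_pd] at hr
    have := h.1 i _ hr
    rw [sum_add_single] at this
    omega
  · rw [fst_dz_lie, DP.coeff_pd] at hr
    have := h.2.1 _ (add_single_ne_zero r k) hr
    rw [sum_add_single] at this
    omega
  · rw [snd_dz_lie, DP.coeff_pd] at hr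
    have := h.2.2 _ (add_single_ne_zero r k) hr
    rw [sum_add_single] at this
    omega

theorem coeff_gradCross_var {k i : Fin 3} {f : DP (Fin 3) K} {r : Fin 3 → ℕ}
    (h : DP.coeff r ((gradCross (DP.var K k) f).1 i) ≠ 0) : ∃ j, DP.coeff r (DP.pd j f) ≠ 0 := by
  by_contra hc
  push Not at hc
  apply h
  fin_cases k <;> fin_cases i <;>
    simp [gradCross_zero, gradCross_one, gradCross_two, DP.pd_var_apply, hc]

theorem gradCross_swap (f g : DP (Fin 3) K) : (gradCross f g).1 = -(gradCross g f).1 := by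
  refine VF.ext fun i => ?_
  fin_cases i <;> simp [gradCross_zero, gradCross_one, gradCross_two] <;> ring

variable [CharP K 2]

theorem DegLE.uFst_lie {m : ℕ} {x : BrownSpace K} (h : x.DegLE (m + 1)) (k : Fin 3) :
    ⁅uFst K k, x⁆.DegLE m := by
  refine ⟨fun i r hr => ?_, fun r _ hr => ?_, fun r _ hr => ?_⟩
  · rw [vf_uFst_lie] at hr
    obtain ⟨j, hj⟩ := coeff_gradCross_var hr
    rw [DP.coeff_pd] at hj
    have := h.2.2 _ (add_single_ne_zero r j) hj
    rw [sum_add_single] at this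
    omega
  · rw [fst_uFst_lie, map_neg] at hr
    have := h.1 k r (neg_ne_zero.mp hr)
    omega
  · rw [snd_uFst_lie, map_zero] at hr
    exact absurd rfl hr

theorem DegLE.uSnd_lie {m : ℕ} {x : BrownSpace K} (h : x.DegLE (m + 1)) (k : Fin 3) :
    ⁅uSnd K k, x⁆.DegLE m := by
  refine ⟨fun i r hr => ?_, fun r _ hr => ?_, fun r _ hr => ?_⟩
  · rw [vf_uSnd_lie, gradCross_swap, neg_neg] at hr
    obtain ⟨j, hj⟩ := coeff_gradCross_var hr
    rw [DP.coeff_pd] at hj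
    have := h.2.1 _ (add_single_ne_zero r j) hj
    rw [sum_add_single] at this
    omega
  · rw [fst_uSnd_lie, map_zero] at hr
    exact absurd rfl hr
  · rw [snd_uSnd_lie, map_neg] at hr
    have := h.1 k r (neg_ne_zero.mp hr)
    omega

/-- The elements on which the two brackets agree. -/
def compat (x : BrownSpace K) : Submodule K (BrownSpace K) where
  carrier := {y | ⁅thetaLin K x, thetaLin K y⁆ = thetaLin K ⁅x, y⁆}
  zero_mem' := by simp
  add_mem' := fun {y z} hy hz => by
    change _ = _ at hy hz ⊢
    rw [map_add, lie_add, hy, hz, lie_add, map_add]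
  smul_mem' := fun c y hy => by
    change _ = _ at hy ⊢
    rw [map_smul, lie_smul, hy, lie_smul, map_smul]

theorem mem_compat {x y : BrownSpace K} :
    y ∈ compat x ↔ ⁅thetaLin K x, thetaLin K y⁆ = thetaLin K ⁅x, y⁆ := Iff.rfl

theorem mem_compat_comm {x y : BrownSpace K} (h : y ∈ compat x) : x ∈ compat y := by
  rw [mem_compat] at h ⊢
  rw [← lie_skew, h, ← map_neg, lie_skew]

theorem thetaLin_dz (k : Fin 3) : thetaLin K (dz K k) = wz K (Pi.single k 1) := by
  refine VF.ext fun j => ?_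
  rcases j with j | j | j
  · rw [thetaLin_inl, zPart, vf_dz_apply, wz_def, mkVF_inl, Pi.single_apply]
    have : crossProduct (pVar K) (fun j => zEmb K (DP.pd j (dz K k).snd)) j = 0 := by
      fin_cases j <;> simp [cross_apply]
    rw [this, add_zero]
    split_ifs
    · rw [zEmb_one, const_one]
    · rw [map_zero, map_zero]
  · have : ∀ i, DP.pd (.inl j) (zEmb K ((dz K k).vf i)) = 0 := fun i => by
      rw [vf_dz_apply]; split_ifs <;> simp [DP.pd_one]
    rw [thetaLin_p]
    simp [pPot, wz_def, DP.pd_mul, this, DP.pd_var]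
  · have : ∀ i, DP.pd (.inl j) ((dz K k).zPart i) = 0 := fun i => by
      revert i
      refine forall_fin_three ?_ ?_ ?_ <;>
      · simp only [zPart_zero, zPart_one, zPart_two, vf_dz_apply]
        split_ifs <;> simp [DP.pd_one]
    have h2 : ∀ i, DP.pd (.inl j) (zEmb K ((dz K k).vf i)) = 0 := fun i => by
      rw [vf_dz_apply]; split_ifs <;> simp [DP.pd_one]
    have h3 : DP.pd (.inl j) ((dz K k).pPot) = 0 := by
      simp [pPot, DP.pd_mul, h2, DP.pd_var]
    rw [thetaLin_q]
    simp [qPot, wz_def, DP.pd_mul, this, DP.pd_var, hat, Fin.sum_univ_three, h3,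
      DP.pd_comm (.inl j : Idx) (.inl _)]

theorem thetaLin_uFst (k : Fin 3) : thetaLin K (uFst K k) = wp K (Pi.single k 1) := by
  have hp : ∀ i j, DP.pd (.inl i) (DP.pd (.inl j) ((uFst K k).pPot)) = 0 := by
    intro i j
    simp only [pPot, vf_uFst, fst_uFst, snd_uFst]
    simp [DP.pd_var_apply]
    split_ifs <;> simp [DP.pd_one]
  refine VF.ext fun j => ?_
  rcases j with j | j | j
  · revert j
    refine forall_fin_three ?_ ?_ ?_ <;>
      simp [thetaLin_inl, zPart_zero, zPart_one, zPart_two, wp_def]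
  · rw [thetaLin_p]
    simp only [pPot, vf_uFst, fst_uFst, snd_uFst]
    simp [wp_def, DP.pd_var_apply, Pi.single_apply]
    split_ifs <;> simp [zEmb_one, const_one]
  · have : ∀ i, (uFst K k).zPart i = 0 := by
      refine forall_fin_three ?_ ?_ ?_ <;> simp [zPart_zero, zPart_one, zPart_two]
    rw [thetaLin_q]
    simp [qPot, this, wp_def, DP.pd_mul, hp, hat, Fin.sum_univ_three, DP.pd_var]

theorem thetaLin_uSnd (k : Fin 3) : thetaLin K (uSnd K k) = wq K (Pi.single k 1) := by
  have hz : ∀ i j, DP.pd (.inl i) ((uSnd K k).zPart j) = 0 := by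
    intro i
    refine forall_fin_three ?_ ?_ ?_ <;>
    · simp only [zPart_zero, zPart_one, zPart_two, vf_uSnd, snd_uSnd, DP.pd_var_apply]
      simp [DP.pd_mul, DP.pd_var]
      split_ifs <;> simp [DP.pd_one]
  have hp : ∀ i, DP.pd (.inl i) ((uSnd K k).pPot) = 0 := by
    intro i
    simp only [pPot, vf_uSnd, fst_uSnd, snd_uSnd, DP.pd_var_apply]
    simp [DP.pd_mul, DP.pd_var, hat, Fin.sum_univ_three]
    split_ifs <;> simp [DP.pd_one]
  refine VF.ext fun j => ?_
  rcases j with j | j | j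
  · revert j k
    refine forall_fin_three ?_ ?_ ?_ <;> intro _ _ <;> refine forall_fin_three ?_ ?_ ?_ <;>
      simp [thetaLin_inl, zPart_zero, zPart_one, zPart_two, wq_def, cross_apply, DP.pd_var_apply,
        zEmb_one, const_one]
  · rw [thetaLin_p, hp]
    simp [wq_def]
  · rw [thetaLin_q]
    simp [qPot, wq_def, DP.pd_mul, hp, hz, hat, Fin.sum_univ_three, DP.pd_var, DP.pd_var_apply,
      DP.pd_comm (.inl j : Idx) (.inl _), Pi.single_apply]
    split_ifs <;> simp [zEmb_one, const_one]

theorem compat_dz (k : Fin 3) (x : BrownSpace K) : x ∈ compat (dz K k) := by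
  rw [mem_compat, thetaLin_dz, thetaLin_dz_lie]

theorem compat_uFst (k : Fin 3) (x : BrownSpace K) : x ∈ compat (uFst K k) := by
  rw [mem_compat, thetaLin_uFst, thetaLin_uFst_lie]

theorem compat_uSnd (k : Fin 3) (x : BrownSpace K) : x ∈ compat (uSnd K k) := by
  rw [mem_compat, thetaLin_uSnd, thetaLin_uSnd_lie]

/-- The linear combination of the generators of the negative part with the same value at the
origin. -/
noncomputable def negPart (x : BrownSpace K) : BrownSpace K :=
  ∑ i, (DP.coeff 0 (x.vf i) • dz K i + DP.coeff 0 (DP.pd i x.fst) • uFst K i +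
    DP.coeff 0 (DP.pd i x.snd) • uSnd K i)

theorem negPart_mem {x : BrownSpace K} {S : Submodule K (BrownSpace K)} (hz : ∀ i, dz K i ∈ S)
    (hf : ∀ i, uFst K i ∈ S) (hs : ∀ i, uSnd K i ∈ S) : x.negPart ∈ S :=
  S.sum_mem fun i _ => S.add_mem (S.add_mem (S.smul_mem _ (hz i)) (S.smul_mem _ (hf i)))
    (S.smul_mem _ (hs i))

theorem coeff_zero_one {σ : Type*} [Fintype σ] : DP.coeff 0 (1 : DP σ K) = 1 := by
  classical
  rw [DP.one_eq_mono, DP.coeff_mono, if_pos rfl]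

theorem vanishesAtZero_sub_negPart (x : BrownSpace K) : (x - x.negPart).VanishesAtZero := by
  refine fun i => ⟨?_, ?_, ?_⟩
  all_goals
    rw [negPart, Fin.sum_univ_three]
    revert i
    refine forall_fin_three ?_ ?_ ?_ <;>
      simp [vf_dz_apply, DP.pd_var_apply, coeff_zero_one]

theorem thetaLin_vanishes {x : BrownSpace K} (hx : x.VanishesAtZero) (j : Idx) :
    DP.coeff 0 (thetaLin K x j) = 0 := by
  have hv : ∀ i, DP.coeff (0 : Idx → ℕ) (pVar K i) = 0 := fun i => DP.coeff_zero_var _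
  have hv' : ∀ i, DP.coeff (0 : Idx → ℕ) (qVar K i) = 0 := fun i => DP.coeff_zero_var _
  rcases j with j | j | j
  · revert j
    refine forall_fin_three ?_ ?_ ?_ <;>
      simp [thetaLin_inl, zPart_zero, zPart_one, zPart_two, DP.coeff_zero_mul, coeff_zero_zEmb,
        (hx _).1, hv]
  · rw [thetaLin_p]
    simp [pPot, DP.pd_mul, DP.coeff_zero_mul, coeff_zero_zEmb, (hx _).2.1, hv, hat,
      Fin.sum_univ_three]
    simp [DP.pd_var]
  · rw [thetaLin_q]
    simp [qPot, DP.pd_mul, DP.coeff_zero_mul, coeff_zero_zEmb, (hx _).2.2, hv', hat,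
      Fin.sum_univ_three, DP.pd_var]

/-- After the Leibniz rule every summand contains an undifferentiated coefficient of `D` or a first
derivative of `f` or `g`, and these are zero at the origin. -/
theorem vanishesAtZero_lie {x y : BrownSpace K} (hx : x.VanishesAtZero) (hy : y.VanishesAtZero) :
    ⁅x, y⁆.VanishesAtZero := by
  refine fun i => ⟨?_, ?_, ?_⟩
  · rw [vf_lie]
    revert i
    refine forall_fin_three ?_ ?_ ?_ <;>
      simp [VF.lie_apply, VF.act_apply, DP.coeff_zero_mul, (hx _).1, (hy _).1, gradCross_zero,
        gradCross_one, gradCross_two, (hx _).2.1, (hx _).2.2, (hy _).2.1, (hy _).2.2]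
  · rw [fst_lie]
    simp [VF.act_apply, DP.coeff_zero_mul, DP.pd_mul, (hx _).1, (hy _).1, (hx _).2.1, (hy _).2.1]
  · rw [snd_lie]
    simp [VF.act_apply, DP.coeff_zero_mul, DP.pd_mul, (hx _).1, (hy _).1, (hx _).2.2, (hy _).2.2]

theorem DegLE.eq_zero {x : BrownSpace K} (hx : x.DegLE 0) :
    x.vf = 0 ∧ (∀ i, DP.pd i x.fst = 0) ∧ ∀ i, DP.pd i x.snd = 0 := by
  refine ⟨VF.ext fun i => DP.ext fun r => ?_, fun i => DP.ext fun r => ?_,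
    fun i => DP.ext fun r => ?_⟩
  · by_contra hc
    have := hx.1 i r hc
    omega
  · by_contra hc
    have := hx.2.1 (r + Pi.single i 1) (add_single_ne_zero r i) hc
    rw [sum_add_single] at this
    omega
  · by_contra hc
    have := hx.2.2 (r + Pi.single i 1) (add_single_ne_zero r i) hc
    rw [sum_add_single] at this
    omega

theorem thetaLin_eq_zero {x : BrownSpace K} (h : x.vf = 0) (hf : ∀ i, DP.pd i x.fst = 0)
    (hg : ∀ i, DP.pd i x.snd = 0) : thetaLin K x = 0 := by
  have hp : ∀ i, DP.pd (.inl i) x.pPot = 0 := fun i => by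
    simp [pPot, h, hf, hg]
  have hz : ∀ i, x.zPart i = 0 := by
    refine forall_fin_three ?_ ?_ ?_ <;> simp [zPart_zero, zPart_one, zPart_two, h, hg]
  refine VF.ext fun j => ?_
  rcases j with j | j | j
  · exact hz j
  · exact hp j
  · rw [thetaLin_q]
    simp [qPot, hp, hz, hg]

theorem lie_eq_zero_of_const {x : BrownSpace K} (h : x.vf = 0) (hf : ∀ i, DP.pd i x.fst = 0)
    (hg : ∀ i, DP.pd i x.snd = 0) (y : BrownSpace K) : ⁅x, y⁆ = 0 := by
  refine ext (fun i => ?_) ?_ ?_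
  · rw [vf_lie, h]
    revert i
    refine forall_fin_three ?_ ?_ ?_ <;>
      simp [gradCross_zero, gradCross_one, gradCross_two, hf, hg]
  · rw [fst_lie, h]
    simp [VF.act_apply, hf]
  · rw [snd_lie, h]
    simp [VF.act_apply, hg]

/-- Induction on the sum of the degree bounds. The defect `[θx, θy] - θ[x, y]` commutes with the
negative part by the Jacobi identity, and it vanishes at the origin once `x` and `y` are corrected
by elements of the negative part. By transitivity it is zero. -/
theorem compat_of_degLE (t : ℕ) : ∀ (a b : ℕ) (x y : BrownSpace K), a + b = t → x.DegLE a →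
    y.DegLE b → y ∈ compat x := by
  induction t with
  | zero =>
    intro a b x y hab hx hy
    obtain rfl : a = 0 := by omega
    obtain ⟨h1, h2, h3⟩ := hx.eq_zero
    rw [mem_compat, thetaLin_eq_zero h1 h2 h3, lie_eq_zero_of_const h1 h2 h3, zero_lie, map_zero]
  | succ t ih =>
    intro a b x y hab hx hy
    rcases a with _ | a
    · obtain ⟨h1, h2, h3⟩ := hx.eq_zero
      rw [mem_compat, thetaLin_eq_zero h1 h2 h3, lie_eq_zero_of_const h1 h2 h3, zero_lie, map_zero]
    rcases b with _ | b
    · obtain ⟨h1, h2, h3⟩ := hy.eq_zero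
      refine mem_compat_comm ?_
      rw [mem_compat, thetaLin_eq_zero h1 h2 h3, lie_eq_zero_of_const h1 h2 h3, zero_lie, map_zero]
    -- Here `w` stands for a generator of the negative part; it lowers either bound, so the
    -- induction hypothesis covers both `[w, x], y` and `x, [w, y]`.
    have key : ∀ w : BrownSpace K, (∀ z, z ∈ compat w) → ⁅w, x⁆.DegLE a → ⁅w, y⁆.DegLE b →
        ⁅thetaLin K w, ⁅thetaLin K x, thetaLin K y⁆ - thetaLin K ⁅x, y⁆⁆ = 0 := by
      intro w hw hwx hwy
      have e1 := ih a (b + 1) _ _ (by omega) hwx hy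
      have e2 := ih (a + 1) b _ _ (by omega) hx hwy
      rw [mem_compat] at e1 e2
      rw [lie_sub, leibniz_lie, mem_compat.mp (hw x), mem_compat.mp (hw y), mem_compat.mp (hw _),
        e1, e2, leibniz_lie w x y, map_add, sub_self]
    rw [mem_compat, ← sub_eq_zero]
    refine eq_zero_of_lie_negative (fun i => ?_) (fun i => ?_) (fun i => ?_) fun j => ?_
    · rw [← thetaLin_dz]
      exact key _ (compat_dz i) (hx.dz_lie i) (hy.dz_lie i)
    · rw [← thetaLin_uFst]
      exact key _ (compat_uFst i) (hx.uFst_lie i) (hy.uFst_lie i)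
    · rw [← thetaLin_uSnd]
      exact key _ (compat_uSnd i) (hx.uSnd_lie i) (hy.uSnd_lie i)
    · have hneg : ∀ x z : BrownSpace K, x.negPart ∈ compat z := fun x z =>
        negPart_mem (fun i => mem_compat_comm (compat_dz i z))
          (fun i => mem_compat_comm (compat_uFst i z)) (fun i => mem_compat_comm (compat_uSnd i z))
      -- Brackets with elements of the negative part are already compatible, so removing the values
      -- at the origin does not change the defect.
      have e : ⁅thetaLin K x, thetaLin K y⁆ - thetaLin K ⁅x, y⁆ =
          ⁅thetaLin K (x - x.negPart), thetaLin K (y - y.negPart)⁆ -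
            thetaLin K ⁅x - x.negPart, y - y.negPart⁆ := by
        have e1 := mem_compat.mp (hneg y (x - x.negPart))
        have e2 := mem_compat.mp (mem_compat_comm (hneg x y))
        rw [map_sub _ y, lie_sub (thetaLin K (x - x.negPart)), lie_sub (x - x.negPart), map_sub _ _
          ⁅x - x.negPart, y.negPart⁆, e1, sub_sub_sub_cancel_right, map_sub _ x, sub_lie, sub_lie,
          map_sub, e2, sub_sub_sub_cancel_right]
      rw [e, VF.sub_apply, map_sub, thetaLin_vanishes (vanishesAtZero_lie
        (vanishesAtZero_sub_negPart x) (vanishesAtZero_sub_negPart y)), sub_zero]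
      exact coeff_zero_lie (thetaLin_vanishes (vanishesAtZero_sub_negPart x))
        (thetaLin_vanishes (vanishesAtZero_sub_negPart y)) j

end BrownSpace

variable [CharP K 2]

variable (K) in
/-- The realization of Brown's algebra by vector fields in nine indeterminates. -/
noncomputable def theta : BrownSpace K →ₗ⁅K⁆ VF Idx K :=
  { thetaLin K with
    map_lie' := fun {x y} => by
      obtain ⟨a, ha⟩ := exists_degLE x
      obtain ⟨b, hb⟩ := exists_degLE y
      exact (mem_compat.mp (compat_of_degLE _ a b x y rfl ha hb)).symm }

end Hom

/-! ## Brown's algebra and the complete prolong -/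

section Image

open BrownSpace

variable {K : Type*} [Field K]

/-- Terms divisible by `p` or `q` are invisible at the exponents `Sum.elim r 0`. What remains of a
realized field there is `D`, `∇f` and `∇g`, and this controls the kernel of the realization, the
degrees and the shearing. -/
theorem coeff_var_mul {i : Fin 3 ⊕ Fin 3} {f : DP Idx K} (r : Fin 3 → ℕ) :
    DP.coeff (Sum.elim r 0 : Idx → ℕ) (DP.var K (.inr i) * f) = 0 := by
  classical
  by_contra h
  obtain ⟨s, t, hs, -, hst⟩ := DP.exists_coeff_mul h
  rw [DP.var, DP.coeff_mono] at hs
  have hs' : Pi.single (.inr i) 1 = s := by_contra fun e => hs (if_neg e)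
  have := congrFun hst (.inr i)
  rw [← hs'] at this
  simp at this

theorem coeff_thetaLin_inl (x : BrownSpace K) (r : Fin 3 → ℕ) (i : Fin 3) :
    DP.coeff (Sum.elim r 0 : Idx → ℕ) (thetaLin K x (.inl i)) = DP.coeff r (x.vf i) := by
  rw [thetaLin_inl]
  revert i
  refine forall_fin_three ?_ ?_ ?_ <;>
    simp [zPart_zero, zPart_one, zPart_two, coeff_var_mul, coeff_zEmb]

theorem coeff_thetaLin_p (x : BrownSpace K) (r : Fin 3 → ℕ) (i : Fin 3) :
    DP.coeff (Sum.elim r 0 : Idx → ℕ) (thetaLin K x (.inr (.inl i))) =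
      DP.coeff r (DP.pd i x.fst) := by
  rw [thetaLin_p]
  simp [pPot, DP.pd_mul, DP.pd_var, Fin.sum_univ_three, hat, coeff_var_mul, coeff_zEmb, mul_assoc]

theorem coeff_thetaLin_q (x : BrownSpace K) (r : Fin 3 → ℕ) (i : Fin 3) :
    DP.coeff (Sum.elim r 0 : Idx → ℕ) (thetaLin K x (.inr (.inr i))) =
      DP.coeff r (DP.pd i x.snd) := by
  rw [thetaLin_q]
  simp [qPot, DP.pd_mul, DP.pd_var, Fin.sum_univ_three, hat, coeff_var_mul, coeff_zEmb, mul_assoc]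

variable [CharP K 2]

theorem thetaLin_eq_zero_iff {x : BrownSpace K} : thetaLin K x = 0 ↔
    x.vf = 0 ∧ (∀ i, DP.pd i x.fst = 0) ∧ ∀ i, DP.pd i x.snd = 0 := by
  refine ⟨fun h => ⟨VF.ext fun i => DP.ext fun r => ?_, fun i => DP.ext fun r => ?_,
    fun i => DP.ext fun r => ?_⟩, fun h => thetaLin_eq_zero h.1 h.2.1 h.2.2⟩
  · rw [← coeff_thetaLin_inl, h]; rfl
  · rw [← coeff_thetaLin_p, h]; rfl
  · rw [← coeff_thetaLin_q, h]; rfl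

theorem thetaLin_eq_iff {x y : BrownSpace K} : thetaLin K x = thetaLin K y ↔
    x.vf = y.vf ∧ (∀ i, DP.pd i x.fst = DP.pd i y.fst) ∧ ∀ i, DP.pd i x.snd = DP.pd i y.snd := by
  rw [← sub_eq_zero, ← map_sub, thetaLin_eq_zero_iff]
  simp [sub_eq_zero]

variable (K) in
/-- The homogeneous components of Brown's algebra without restrictions on the divided powers. -/
def homPart (k : ℤ) : Submodule K (BrownSpace K) where
  carrier := {x | x.vf ∈ VF.hom K (fun _ => 2) k ∧ x.fst ∈ DP.hom K (fun _ => 2) (k + 3) ∧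
    x.snd ∈ DP.hom K (fun _ => 2) (k + 3)}
  zero_mem' := ⟨Submodule.zero_mem _, Submodule.zero_mem _, Submodule.zero_mem _⟩
  add_mem' := fun hx hy => ⟨Submodule.add_mem _ hx.1 hy.1, Submodule.add_mem _ hx.2.1 hy.2.1,
    Submodule.add_mem _ hx.2.2 hy.2.2⟩
  smul_mem' := fun c _ hx => ⟨Submodule.smul_mem _ c hx.1, Submodule.smul_mem _ c hx.2.1,
    Submodule.smul_mem _ c hx.2.2⟩

theorem gradCross_hom {d e : ℤ} {f g : DP (Fin 3) K} (hf : f ∈ DP.hom K (fun _ => 2) d)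
    (hg : g ∈ DP.hom K (fun _ => 2) e) :
    (gradCross f g).1 ∈ VF.hom K (fun _ => 2) (d + e - 6) := by
  have h : ∀ i j, DP.pd i f * DP.pd j g ∈ DP.hom K (fun _ => 2) (d + e - 6 + 2) := fun i j => by
    have := DP.hom_mul (DP.hom_pd i hf) (DP.hom_pd j hg)
    rwa [show d - 2 + (e - 2) = d + e - 6 + 2 by ring] at this
  refine forall_fin_three ?_ ?_ ?_
  · rw [gradCross_zero]; exact Submodule.sub_mem _ (h 1 2) (h 2 1)
  · rw [gradCross_one]; exact Submodule.sub_mem _ (h 2 0) (h 0 2)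
  · rw [gradCross_two]; exact Submodule.sub_mem _ (h 0 1) (h 1 0)

theorem var_hom_two (j : Fin 3) : DP.var K j ∈ DP.hom K (fun _ : Fin 3 => 2) 2 := by
  classical
  intro r hr
  rw [DP.var, DP.coeff_mono] at hr
  have h : (Pi.single j 1 : Fin 3 → ℕ) = r := by_contra fun e => hr (if_neg e)
  rw [← h]
  simp [Pi.single_apply]

theorem one_hom {σ : Type*} [Fintype σ] (w : σ → ℤ) : (1 : DP σ K) ∈ DP.hom K w 0 := by
  classical
  intro r hr
  rw [DP.one_eq_mono, DP.coeff_mono] at hr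
  have h : (0 : σ → ℕ) = r := by_contra fun e => hr (if_neg e)
  rw [← h]; simp

theorem eq_zero_of_hom_odd {d : ℤ} {f : DP (Fin 3) K} (hf : f ∈ DP.hom K (fun _ => 2) d)
    (hd : Odd d) : f = 0 := by
  refine DP.ext fun r => ?_
  by_contra hr
  have h := hf r hr
  rw [← Finset.mul_sum] at h
  obtain ⟨m, hm⟩ := hd
  omega

theorem eq_zero_of_hom_neg {d : ℤ} {f : DP (Fin 3) K} (hf : f ∈ DP.hom K (fun _ => 2) d)
    (hd : d < 0) : f = 0 := by
  refine DP.ext fun r => ?_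
  by_contra hr
  have h : ∑ i, (2 : ℤ) * (r i : ℤ) = d := hf r hr
  have : 0 ≤ ∑ i, (2 : ℤ) * (r i : ℤ) := Finset.sum_nonneg fun _ _ => by positivity
  omega

theorem eq_smul_one_of_hom {f : DP (Fin 3) K} (hf : f ∈ DP.hom K (fun _ => 2) 0) :
    f = DP.coeff 0 f • 1 := by
  rw [DP.one_eq_mono, DP.smul_mono, mul_one]
  exact DP.eq_mono_of_pd fun i => eq_zero_of_hom_neg (DP.hom_pd i hf) (by norm_num)

theorem eq_sum_var_of_hom {f : DP (Fin 3) K} (hf : f ∈ DP.hom K (fun _ => 2) 2) :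
    f = ∑ j, DP.coeff 0 (DP.pd j f) • DP.var K j := by
  rw [← sub_eq_zero]
  refine DP.eq_zero_of_pd (fun i => ?_) ?_
  · have h := eq_smul_one_of_hom (by simpa using DP.hom_pd i hf)
    have e : DP.pd i (∑ j, DP.coeff 0 (DP.pd j f) • DP.var K j) = DP.coeff 0 (DP.pd i f) • 1 := by
      rw [map_sum, Finset.sum_eq_single i] <;> simp +contextual [DP.pd_var_apply]
      intro j hj hji
      exact absurd hji.symm hj
    rw [map_sub, e, ← h, sub_self]
  · rw [map_sub, DP.coeff_zero_of_hom hf (by norm_num), map_sum]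
    simp [DP.coeff_zero_var]

theorem lie_homPart {k l : ℤ} {x y : BrownSpace K} (hx : x ∈ homPart K k) (hy : y ∈ homPart K l) :
    ⁅x, y⁆ ∈ homPart K (k + l) := by
  refine ⟨?_, ?_, ?_⟩
  · rw [vf_lie]
    have h1 := gradCross_hom hx.2.1 hy.2.2
    have h2 := gradCross_hom hy.2.1 hx.2.2
    rw [show k + 3 + (l + 3) - 6 = k + l by ring] at h1
    rw [show l + 3 + (k + 3) - 6 = k + l by ring] at h2
    exact Submodule.sub_mem _ (Submodule.add_mem _ (VF.lie_hom hx.1 hy.1) h1) h2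
  · rw [fst_lie]
    have h1 := VF.act_hom hx.1 hy.2.1
    have h2 := VF.act_hom hy.1 hx.2.1
    rw [show k + (l + 3) = k + l + 3 by ring] at h1
    rw [show l + (k + 3) = k + l + 3 by ring] at h2
    exact Submodule.sub_mem _ h1 h2
  · rw [snd_lie]
    have h1 := VF.act_hom hx.1 hy.2.2
    have h2 := VF.act_hom hy.1 hx.2.2
    rw [show k + (l + 3) = k + l + 3 by ring] at h1
    rw [show l + (k + 3) = k + l + 3 by ring] at h2
    exact Submodule.sub_mem _ h1 h2

theorem dz_mem_homPart (k : Fin 3) : dz K k ∈ homPart K (-2) := by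
  refine ⟨fun i => ?_, Submodule.zero_mem _, Submodule.zero_mem _⟩
  rw [vf_dz_apply]
  split_ifs
  · exact one_hom _
  · exact Submodule.zero_mem _

theorem uFst_mem_homPart (k : Fin 3) : uFst K k ∈ homPart K (-1) :=
  ⟨Submodule.zero_mem _, var_hom_two k, Submodule.zero_mem _⟩

theorem uSnd_mem_homPart (k : Fin 3) : uSnd K k ∈ homPart K (-1) :=
  ⟨Submodule.zero_mem _, Submodule.zero_mem _, var_hom_two k⟩

theorem hat_hom {v : Fin 3 → DP Idx K} (hv : ∀ i, v i ∈ DP.hom K wt 1) (i : Fin 3) :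
    hat v i ∈ DP.hom K wt 2 := by
  revert i
  refine forall_fin_three ?_ ?_ ?_ <;> exact DP.hom_mul (hv _) (hv _)

theorem zPart_hom {k : ℤ} {x : BrownSpace K} (hx : x ∈ homPart K k) (i : Fin 3) :
    x.zPart i ∈ DP.hom K wt (k + 2) := by
  refine Submodule.add_mem _ (zEmb_hom (hx.1 i)) (cross_mem _ (fun i j => ?_) i)
  have h1 : pVar K i ∈ DP.hom K wt 1 := var_hom K _
  have h2 := DP.hom_mul h1 (zEmb_hom (DP.hom_pd j hx.2.2))
  rwa [show 1 + (k + 3 - 2) = k + 2 by ring] at h2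

theorem pPot_hom {k : ℤ} {x : BrownSpace K} (hx : x ∈ homPart K k) :
    x.pPot ∈ DP.hom K wt (k + 3) := by
  have h1 : ∀ i, pVar K i ∈ DP.hom K wt 1 := fun i => var_hom K _
  refine Submodule.add_mem _ (Submodule.add_mem _ (Submodule.sum_mem _ fun i _ => ?_)
    (zEmb_hom hx.2.1)) (Submodule.sum_mem _ fun i _ => ?_)
  · have h2 := DP.hom_mul (h1 i) (zEmb_hom (hx.1 i))
    rwa [show 1 + (k + 2) = k + 3 by ring] at h2
  · have h2 := DP.hom_mul (hat_hom h1 i) (zEmb_hom (DP.hom_pd i hx.2.2))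
    rwa [show 2 + (k + 3 - 2) = k + 3 by ring] at h2

theorem qPot_hom {k : ℤ} {x : BrownSpace K} (hx : x ∈ homPart K k) :
    x.qPot ∈ DP.hom K wt (k + 3) := by
  have h1 : ∀ i, qVar K i ∈ DP.hom K wt 1 := fun i => var_hom K _
  refine Submodule.add_mem _ (Submodule.add_mem _ (zEmb_hom hx.2.2)
    (Submodule.sum_mem _ fun i _ => ?_)) (Submodule.sum_mem _ fun i _ => ?_)
  · have h2 := DP.hom_mul (h1 i) (zPart_hom hx i)
    rwa [show 1 + (k + 2) = k + 3 by ring] at h2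
  · have h2 := DP.hom_mul (hat_hom h1 i) (DP.hom_pd (.inl i) (pPot_hom hx))
    rwa [show wt (.inl i) = 2 from rfl, show 2 + (k + 3 - 2) = k + 3 by ring] at h2

theorem theta_hom {k : ℤ} {x : BrownSpace K} (hx : x ∈ homPart K k) :
    theta K x ∈ VF.hom K wt k := by
  refine mkVF_mem_hom (zPart_hom hx) (fun i => ?_) (fun i => ?_)
  · have := DP.hom_pd (.inl i) (pPot_hom hx)
    rwa [show wt (.inl i) = 2 from rfl, show k + 3 - 2 = k + 1 by ring] at this
  · have := DP.hom_pd (.inl i) (qPot_hom hx)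
    rwa [show wt (.inl i) = 2 from rfl, show k + 3 - 2 = k + 1 by ring] at this

theorem hom_of_coeff_zEmb {d : ℤ} {f : DP (Fin 3) K} {F : DP Idx K}
    (h : ∀ r, DP.coeff (Sum.elim r 0 : Idx → ℕ) F = DP.coeff r f) (hF : F ∈ DP.hom K wt d) :
    f ∈ DP.hom K (fun _ => 2) d := by
  intro r hr
  rw [← h] at hr
  rw [← hF _ hr, Fintype.sum_sum_type]
  simp [wt]

/-- An element with homogeneous image is homogeneous up to constants. -/
theorem exists_homPart_of_theta {k : ℤ} {x : BrownSpace K} (hx : theta K x ∈ VF.hom K wt k) :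
    ∃ a b : K, x - of 0 (DP.mono 0 a) (DP.mono 0 b) ∈ homPart K k := by
  -- The field determines only the gradients of the two functions, so homogeneity is obtained after
  -- subtracting their constant terms.
  have key : ∀ f : DP (Fin 3) K, (∀ i, DP.pd i f ∈ DP.hom K (fun _ => 2) (k + 1)) →
      f - DP.mono 0 (DP.coeff 0 f) ∈ DP.hom K (fun _ => 2) (k + 3) := by
    classical
    intro f hf
    refine DP.hom_of_pd ?_ fun i => ?_
    · rw [map_sub, DP.coeff_mono, if_pos rfl, sub_self]
    · rw [map_sub, DP.pd_mono_zero (by rfl), sub_zero, show k + 3 - 2 = k + 1 by ring]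
      exact hf i
  refine ⟨DP.coeff 0 x.fst, DP.coeff 0 x.snd, fun i => ?_, key _ fun i => ?_, key _ fun i => ?_⟩
  · have := hom_of_coeff_zEmb (fun r => coeff_thetaLin_inl x r i) (hx (.inl i))
    change x.vf i - (0 : VF (Fin 3) K) i ∈ _
    rw [VF.zero_apply, sub_zero]
    exact this
  · exact hom_of_coeff_zEmb (fun r => coeff_thetaLin_p x r i) (hx (.inr (.inl i)))
  · exact hom_of_coeff_zEmb (fun r => coeff_thetaLin_q x r i) (hx (.inr (.inr i)))

/-- The functions `f` and `g` enter the realization only through their derivatives, so they may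
themselves exceed `𝒪(N)`. This is the reason why the prolong for finite `N` can be larger than
Brown's algebra. -/
theorem theta_shear_iff {N : Fin 3 → WithTop ℕ+} {x : BrownSpace K} :
    theta K x ∈ VF.shear K (withOnes N) ↔ x.vf ∈ VF.shear K N ∧
      (∀ i, DP.pd i x.fst ∈ DP.shear K N) ∧ ∀ i, DP.pd i x.snd ∈ DP.shear K N := by
  constructor
  · intro h
    have key : ∀ {f : DP (Fin 3) K} {F : DP Idx K},
        (∀ r, DP.coeff (Sum.elim r 0 : Idx → ℕ) F = DP.coeff r f) →
        F ∈ DP.shear K (withOnes N) → f ∈ DP.shear K N := by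
      intro f F hf hF r hr i n hn
      exact hF _ (by rwa [hf]) (.inl i) n hn
    exact ⟨fun i => key (fun r => coeff_thetaLin_inl x r i) (h (.inl i)),
      fun i => key (fun r => coeff_thetaLin_p x r i) (h (.inr (.inl i))),
      fun i => key (fun r => coeff_thetaLin_q x r i) (h (.inr (.inr i)))⟩
  · rintro ⟨h1, h2, h3⟩
    have hp : ∀ i, pVar K i ∈ DP.shear K (withOnes N) := fun i => var_shear K _ _
    have hq : ∀ i, qVar K i ∈ DP.shear K (withOnes N) := fun i => var_shear K _ _
    have hhat : ∀ v : Fin 3 → DP Idx K, (∀ i, v i ∈ DP.shear K (withOnes N)) →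
        ∀ i, hat v i ∈ DP.shear K (withOnes N) := fun v hv => by
      refine forall_fin_three ?_ ?_ ?_ <;> exact DP.shear_mul (hv _) (hv _)
    have e1 : ∀ i, x.zPart i ∈ DP.shear K (withOnes N) := fun i =>
      Submodule.add_mem _ (zEmb_shear (h1 i))
        (cross_mem _ (fun i j => DP.shear_mul (hp i) (zEmb_shear (h3 j))) i)
    have e2 : ∀ i, DP.pd (.inl i) x.pPot ∈ DP.shear K (withOnes N) := fun i => by
      rw [pPot, map_add, map_add, map_sum, map_sum, pd_inl_zEmb]
      refine Submodule.add_mem _ (Submodule.add_mem _ (Submodule.sum_mem _ fun j _ => ?_)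
        (zEmb_shear (h2 i))) (Submodule.sum_mem _ fun j _ => ?_)
      · exact DP.shear_pd _ (DP.shear_mul (hp j) (zEmb_shear (h1 j)))
      · exact DP.shear_pd _ (DP.shear_mul (hhat _ hp j) (zEmb_shear (h3 j)))
    refine mkVF_mem_shear e1 e2 fun i => ?_
    rw [qPot, map_add, map_add, map_sum, map_sum, pd_inl_zEmb]
    refine Submodule.add_mem _ (Submodule.add_mem _ (zEmb_shear (h3 i))
      (Submodule.sum_mem _ fun j _ => ?_)) (Submodule.sum_mem _ fun j _ => ?_)
    · exact DP.shear_pd _ (DP.shear_mul (hq j) (e1 j))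
    · exact DP.shear_pd _ (DP.shear_mul (hhat _ hq j) (e2 j))

/-! ### The components of degree at most zero -/

theorem vf_eq_zero_of_odd {k : ℤ} {x : BrownSpace K} (hx : x ∈ homPart K k) (hk : Odd k) :
    x.vf = 0 := VF.ext fun i => eq_zero_of_hom_odd (hx.1 i) (hk.add_even even_two)

theorem fst_eq_zero_of_even {k : ℤ} {x : BrownSpace K} (hx : x ∈ homPart K k) (hk : Even k) :
    x.fst = 0 := eq_zero_of_hom_odd hx.2.1 (hk.add_odd (by decide))

theorem snd_eq_zero_of_even {k : ℤ} {x : BrownSpace K} (hx : x ∈ homPart K k) (hk : Even k) :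
    x.snd = 0 := eq_zero_of_hom_odd hx.2.2 (hk.add_odd (by decide))

theorem wz_eq_sum (v : Fin 3 → K) : wz K v = ∑ i, v i • wz K (Pi.single i 1) := by
  conv_lhs => rw [pi_eq_sum_univ' v, map_sum]
  refine Finset.sum_congr rfl fun i _ => ?_
  rw [map_smul]

theorem wp_eq_sum (v : Fin 3 → K) : wp K v = ∑ i, v i • wp K (Pi.single i 1) := by
  conv_lhs => rw [pi_eq_sum_univ' v, map_sum]
  refine Finset.sum_congr rfl fun i _ => ?_
  rw [map_smul]

theorem wq_eq_sum (v : Fin 3 → K) : wq K v = ∑ i, v i • wq K (Pi.single i 1) := by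
  conv_lhs => rw [pi_eq_sum_univ' v, map_sum]
  refine Finset.sum_congr rfl fun i _ => ?_
  rw [map_smul]

theorem map_theta_neg_two : (homPart K (-2)).map (theta K).toLinearMap = gm2 K := by
  refine le_antisymm ?_ (gm2_le_of_single fun i => ⟨dz K i, dz_mem_homPart i, thetaLin_dz i⟩)
  rintro _ ⟨x, hx, rfl⟩
  refine ⟨fun i => DP.coeff 0 (x.vf i), ?_⟩
  change _ = thetaLin K x
  rw [wz_eq_sum]
  simp only [← thetaLin_dz, ← map_smul, ← map_sum]
  refine congrArg _ (BrownSpace.ext (fun i => ?_) ?_ ?_)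
  · have h := eq_smul_one_of_hom (hx.1 i)
    rw [h, Fin.sum_univ_three]
    revert i
    refine forall_fin_three ?_ ?_ ?_ <;> intro _ <;> simp [vf_dz_apply, coeff_zero_one]
  · rw [fst_eq_zero_of_even hx (by decide), Fin.sum_univ_three]; simp
  · rw [snd_eq_zero_of_even hx (by decide), Fin.sum_univ_three]; simp

theorem map_theta_neg_one : (homPart K (-1)).map (theta K).toLinearMap = gm1 K := by
  refine le_antisymm ?_ (gm1_le_of_single (fun i => ⟨uFst K i, uFst_mem_homPart i, thetaLin_uFst i⟩)
    (fun i => ⟨uSnd K i, uSnd_mem_homPart i, thetaLin_uSnd i⟩))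
  rintro _ ⟨x, hx, rfl⟩
  refine Submodule.mem_sup.mpr ⟨_, ⟨fun i => DP.coeff 0 (DP.pd i x.fst), rfl⟩, _,
    ⟨fun i => DP.coeff 0 (DP.pd i x.snd), rfl⟩, ?_⟩
  change _ = thetaLin K x
  rw [wp_eq_sum, wq_eq_sum]
  simp only [← thetaLin_uFst, ← thetaLin_uSnd, ← map_smul, ← map_sum, ← map_add]
  refine congrArg _ (BrownSpace.ext (fun i => ?_) ?_ ?_)
  · rw [vf_eq_zero_of_odd hx (by decide)]
    simp [Fin.sum_univ_three]
  · conv_rhs => rw [eq_sum_var_of_hom hx.2.1]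
    simp [Fin.sum_univ_three]
  · conv_rhs => rw [eq_sum_var_of_hom hx.2.2]
    simp [Fin.sum_univ_three]

theorem thetaLin_linear {A : Matrix (Fin 3) (Fin 3) K} {x : BrownSpace K}
    (h : ∀ i, x.vf i = ∑ j, A j i • DP.var K j) (hf : x.fst = 0) (hg : x.snd = 0) :
    thetaLin K x = lin K A := by
  have hv : ∀ i, zEmb K (DP.var K i) = DP.var K (.inl i) := fun i => by
    rw [DP.var, zEmb_mono, DP.var]
    congr 1
    funext j; rcases j with j | j <;> simp [Pi.single_apply]
  have hz : ∀ i, x.zPart i = ∑ j, A j i • DP.var K (.inl j) := by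
    refine forall_fin_three ?_ ?_ ?_ <;>
      simp [zPart_zero, zPart_one, zPart_two, h, hg, hv]
  have hp : ∀ i, DP.pd (.inl i) x.pPot = -∑ j, A i j • pVar K j := fun i => by
    rw [neg_eq_self_of_charTwo K, pPot, hf, hg]
    simp [h, DP.pd_mul, DP.pd_var, hv, DP.mul_smul]
  have hq : ∀ i, DP.pd (.inl i) x.qPot = -∑ j, A i j • qVar K j := fun i => by
    -- For a linear field the potential of the `p`-components has degree one in `z`, so the terms
    -- quadratic in `q` disappear.
    have : ∀ i j, DP.pd (.inl i) (DP.pd (.inl j) x.pPot) = 0 := fun i j => by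
      rw [hp]; simp [DP.pd_var]
    rw [neg_eq_self_of_charTwo K, qPot, hg]
    simp only [hz, DP.pd_mul, map_add, map_sum, map_smul, this, hat, Fin.sum_univ_three, DP.pd_var,
      map_zero]
    revert i
    refine forall_fin_three ?_ ?_ ?_ <;> simp [DP.mul_smul, DP.pd_mul, DP.pd_var]
  refine VF.ext fun j => ?_
  rcases j with j | j | j
  · exact hz j
  · exact hp j
  · exact hq j

theorem map_theta_zero : (homPart K 0).map (theta K).toLinearMap = g0sl K := by
  refine le_antisymm ?_ ?_
  · rintro _ ⟨x, hx, rfl⟩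
    have hl : ∀ i, x.vf i = ∑ j, DP.coeff 0 (DP.pd j (x.vf i)) • DP.var K j := fun i =>
      eq_sum_var_of_hom (by simpa using hx.1 i)
    refine ⟨Matrix.of fun j i => DP.coeff 0 (DP.pd j (x.vf i)), ?_, ?_⟩
    · have := congrArg (DP.coeff 0) (div_vf x)
      rw [map_add, map_add, map_zero] at this
      simpa [Matrix.trace, Fin.sum_univ_three] using this
    · exact (thetaLin_linear hl (fst_eq_zero_of_even hx (by decide))
        (snd_eq_zero_of_even hx (by decide))).symm
  · rintro _ ⟨A, hA, rfl⟩
    have hd : ∑ i, DP.pd i (∑ j, A j i • DP.var K j : DP (Fin 3) K) = 0 := by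
      have hA' : A.trace = 0 := hA
      rw [Matrix.trace_fin_three] at hA'
      simp [Fin.sum_univ_three, DP.pd_var_apply]
      rw [← add_smul, ← add_smul, hA', zero_smul]
    refine ⟨of ⟨fun i => ∑ j, A j i • DP.var K j, hd⟩ 0 0, ⟨fun i => ?_, Submodule.zero_mem _,
      Submodule.zero_mem _⟩, thetaLin_linear (fun _ => rfl) rfl rfl⟩
    change (∑ j, A j i • DP.var K j : DP (Fin 3) K) ∈ DP.hom K _ (0 + 2)
    rw [zero_add]
    exact Submodule.sum_mem _ fun j _ => Submodule.smul_mem _ _ (var_hom_two j)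

end Image

/-! ### The complete prolong with `𝔤₀ = 𝔰𝔩(3)` -/

section Prolongation

open BrownSpace

variable {K : Type*} [Field K] [CharP K 2]

theorem theta_dz_lie (k : Fin 3) (x : BrownSpace K) :
    theta K ⁅dz K k, x⁆ = ⁅wz K (Pi.single k 1), theta K x⁆ := thetaLin_dz_lie k x
theorem theta_uFst_lie (k : Fin 3) (x : BrownSpace K) :
    theta K ⁅uFst K k, x⁆ = ⁅wp K (Pi.single k 1), theta K x⁆ := thetaLin_uFst_lie k x
theorem theta_uSnd_lie (k : Fin 3) (x : BrownSpace K) :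
    theta K ⁅uSnd K k, x⁆ = ⁅wq K (Pi.single k 1), theta K x⁆ := thetaLin_uSnd_lie k x

theorem theta_eq_iff {x y : BrownSpace K} : theta K x = theta K y ↔
    x.vf = y.vf ∧ (∀ i, DP.pd i x.fst = DP.pd i y.fst) ∧ ∀ i, DP.pd i x.snd = DP.pd i y.snd :=
  thetaLin_eq_iff

theorem theta_eq_zero_iff {x : BrownSpace K} : theta K x = 0 ↔
    x.vf = 0 ∧ (∀ i, DP.pd i x.fst = 0) ∧ ∀ i, DP.pd i x.snd = 0 := thetaLin_eq_zero_iff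

theorem mem_shear_top {σ : Type*} (X : VF σ K) [Fintype σ] [DecidableEq σ] :
    X ∈ VF.shear K (fun _ => ⊤) := fun _ _ _ _ _ hn => absurd hn (by simp)

theorem lie_wz_comm {w X : VF Idx K} {k : Fin 3} (h : ⁅wz K (Pi.single k 1), w⁆ = 0) :
    ⁅wz K (Pi.single k 1), ⁅w, X⁆⁆ = ⁅w, ⁅wz K (Pi.single k 1), X⁆⁆ := by
  rw [leibniz_lie, h, zero_lie, zero_add]

/-- A homogeneous element of nonnegative degree whose brackets with all `∂ₖ` vanish is zero. -/
theorem theta_eq_zero_of_dz {n : ℤ} (hn : 0 ≤ n) {x : BrownSpace K} (hx : x ∈ homPart K n)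
    (h : ∀ k, theta K ⁅dz K k, x⁆ = 0) : theta K x = 0 := by
  have h' := fun k => theta_eq_zero_iff.mp (h k)
  refine theta_eq_zero_iff.mpr ⟨VF.ext fun i => ?_, fun i => ?_, fun i => ?_⟩
  · refine DP.eq_zero_of_pd (fun k => ?_) (DP.coeff_zero_of_hom (hx.1 i) (by change n + 2 ≠ 0; omega))
    rw [← vf_dz_lie, (h' k).1]; rfl
  · refine DP.eq_zero_of_pd (fun k => ?_) (DP.coeff_zero_of_hom (DP.hom_pd i hx.2.1) (by omega))
    rw [DP.pd_comm, ← fst_dz_lie]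
    exact (h' k).2.1 i
  · refine DP.eq_zero_of_pd (fun k => ?_) (DP.coeff_zero_of_hom (DP.hom_pd i hx.2.2) (by omega))
    rw [DP.pd_comm, ← snd_dz_lie]
    exact (h' k).2.2 i

/-- Homogeneous elements of even degree with given brackets with all `∂ₖ`. -/
theorem exists_dz_lie_even {k : ℤ} (hk : 0 < k) (he : Even k) {y : Fin 3 → BrownSpace K}
    (hy : ∀ i, y i ∈ homPart K (k - 2))
    (h : ∀ i j, theta K ⁅dz K i, y j⁆ = theta K ⁅dz K j, y i⁆) :
    ∃ x ∈ homPart K k, ∀ i, theta K ⁅dz K i, x⁆ = theta K (y i) := by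
  have hpd : ∀ l i j, DP.pd i ((y j).vf l) = DP.pd j ((y i).vf l) := fun l i j => by
    rw [← vf_dz_lie, ← vf_dz_lie, (theta_eq_iff.mp (h i j)).1]
  choose D hD0 hD using fun l => DP.exists_pd_eq (fun i => (y i).vf l) (hpd l)
  have hDh : ∀ l, D l ∈ DP.hom K (fun _ => 2) (k + 2) := fun l => by
    refine DP.hom_of_pd (hD0 l) fun i => ?_
    rw [hD, show k + 2 - 2 = k - 2 + 2 by ring]
    exact (hy i).1 l
  -- The derivatives of the divergence are divergences of the `y i`, hence zero; a constant
  -- divergence is excluded by the positive degree.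
  have hdiv : ∑ l, DP.pd l (D l) = 0 := by
    refine DP.eq_zero_of_pd (fun i => ?_) ?_
    · rw [map_sum]
      refine Eq.trans (Finset.sum_congr rfl fun l _ => ?_) (y i).1.2
      rw [DP.pd_comm, hD]
      rfl
    · rw [map_sum]
      refine Finset.sum_eq_zero fun l _ => DP.coeff_zero_of_hom (DP.hom_pd l (hDh l)) ?_
      omega
  have he2 : Even (k - 2) := he.sub even_two
  refine ⟨of ⟨D, hdiv⟩ 0 0, ⟨hDh, Submodule.zero_mem _, Submodule.zero_mem _⟩, fun i => ?_⟩
  refine theta_eq_iff.mpr ⟨VF.ext fun l => ?_, fun l => ?_, fun l => ?_⟩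
  · rw [vf_dz_lie]
    exact hD l i
  · rw [fst_dz_lie, fst_eq_zero_of_even (hy i) he2]
    simp
  · rw [snd_dz_lie, snd_eq_zero_of_even (hy i) he2]
    simp

/-- The sum over `j` of the `j`-th components of `eᵢ × ∇gⱼ` is the `i`-th component of the curl of
`g`. -/
theorem curl_eq_zero {g : Fin 3 → DP (Fin 3) K}
    (h : ∀ i, ∑ j, (gradCross (DP.var K i) (g j)).1 j = 0) (i j : Fin 3) :
    DP.pd i (g j) = DP.pd j (g i) := by
  have h0 := h 0
  have h1 := h 1
  have h2 := h 2
  simp [Fin.sum_univ_three, gradCross_zero, gradCross_one, gradCross_two, DP.pd_var_apply,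
    CharTwo.neg_eq, CharTwo.add_eq_zero] at h0 h1 h2
  revert i j
  refine forall_fin_three ?_ ?_ ?_ <;> refine forall_fin_three ?_ ?_ ?_ <;> simp [h0, h1, h2]

/-- Homogeneous elements of odd degree with given brackets with all `∂ₖ`. -/
theorem exists_dz_lie_odd {k : ℤ} (ho : Odd k) {y a b : Fin 3 → BrownSpace K}
    (hy : ∀ i, y i ∈ homPart K (k - 2))
    (ha : ∀ i j, theta K ⁅dz K j, a i⁆ = theta K ⁅uFst K i, y j⁆)
    (hb : ∀ i j, theta K ⁅dz K j, b i⁆ = theta K ⁅uSnd K i, y j⁆) :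
    ∃ x ∈ homPart K k, ∀ i, theta K ⁅dz K i, x⁆ = theta K (y i) := by
  -- Commutation of the fields `∂ᵢ` is not enough here: in degree 1 the required symmetry is an
  -- identity between constants, which the realization does not see. It comes instead from the
  -- vanishing divergence of `a i`, whose derivatives are known by `ha`.
  have hg : ∀ i j, DP.pd i (y j).snd = DP.pd j (y i).snd := by
    refine curl_eq_zero fun i => ?_
    have e : ∀ j, (gradCross (DP.var K i) (y j).snd).1 j = DP.pd j ((a i).vf j) := fun j => by
      rw [← vf_uFst_lie, ← vf_dz_lie, (theta_eq_iff.mp (ha i j)).1]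
    simp only [e]
    exact (a i).1.2
  have hf : ∀ i j, DP.pd i (y j).fst = DP.pd j (y i).fst := by
    refine curl_eq_zero fun i => ?_
    have e : ∀ j, (gradCross (DP.var K i) (y j).fst).1 j = DP.pd j ((b i).vf j) := fun j => by
      rw [gradCross_swap, ← vf_uSnd_lie, ← vf_dz_lie, (theta_eq_iff.mp (hb i j)).1]
    simp only [e]
    exact (b i).1.2
  obtain ⟨f, hf0, hf⟩ := DP.exists_pd_eq _ hf
  obtain ⟨g, hg0, hg⟩ := DP.exists_pd_eq _ hg
  refine ⟨of 0 f g, ⟨Submodule.zero_mem _, DP.hom_of_pd hf0 fun i => ?_,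
    DP.hom_of_pd hg0 fun i => ?_⟩, fun i => ?_⟩
  · rw [fst_of, hf, show k + 3 - 2 = k - 2 + 3 by ring]
    exact (hy i).2.1
  · rw [snd_of, hg, show k + 3 - 2 = k - 2 + 3 by ring]
    exact (hy i).2.2
  · refine congrArg _ (BrownSpace.ext (fun l => ?_) ?_ ?_)
    · rw [vf_dz_lie, vf_eq_zero_of_odd (hy i) (ho.sub_even even_two)]
      simp
    · rw [fst_dz_lie]
      exact hf i
    · rw [snd_dz_lie]
      exact hg i

theorem dz_lie_mem {n : ℕ} {x : BrownSpace K} (hx : x ∈ homPart K (((n + 3 : ℕ) : ℤ) - 2))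
    (k : Fin 3) : ⁅dz K k, x⁆ ∈ homPart K (((n + 1 : ℕ) : ℤ) - 2) := by
  have := lie_homPart (dz_mem_homPart k) hx
  rwa [show -2 + (((n + 3 : ℕ) : ℤ) - 2) = ((n + 1 : ℕ) : ℤ) - 2 by push_cast; ring] at this

theorem uFst_lie_mem {n : ℕ} {x : BrownSpace K} (hx : x ∈ homPart K (((n + 3 : ℕ) : ℤ) - 2))
    (k : Fin 3) : ⁅uFst K k, x⁆ ∈ homPart K (((n + 2 : ℕ) : ℤ) - 2) := by
  have := lie_homPart (uFst_mem_homPart k) hx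
  rwa [show -1 + (((n + 3 : ℕ) : ℤ) - 2) = ((n + 2 : ℕ) : ℤ) - 2 by push_cast; ring] at this

theorem uSnd_lie_mem {n : ℕ} {x : BrownSpace K} (hx : x ∈ homPart K (((n + 3 : ℕ) : ℤ) - 2))
    (k : Fin 3) : ⁅uSnd K k, x⁆ ∈ homPart K (((n + 2 : ℕ) : ℤ) - 2) := by
  have := lie_homPart (uSnd_mem_homPart k) hx
  rwa [show -1 + (((n + 3 : ℕ) : ℤ) - 2) = ((n + 2 : ℕ) : ℤ) - 2 by push_cast; ring] at this

/-- The components of the complete prolong without restrictions on the divided powers. -/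
theorem map_theta_homPart (n : ℕ) : (homPart K ((n : ℤ) - 2)).map (theta K).toLinearMap =
    prolongAux (fun _ => ⊤) (g0sl K) n := by
  induction n using Nat.strong_induction_on with
  | _ n ih =>
    match n, ih with
    | 0, _ => exact map_theta_neg_two
    | 1, _ => exact map_theta_neg_one
    | 2, _ => exact map_theta_zero
    | n + 3, ih =>
      refine le_antisymm ?_ fun X hX => ?_
      · rintro _ ⟨x, hx, rfl⟩
        have e : (((n + 3 : ℕ) : ℤ) - 2) = (n : ℤ) + 1 := by push_cast; ring
        refine ⟨mem_shear_top _, e ▸ theta_hom hx, ?_, ?_⟩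
        · refine forall_gm1_iff.mpr ⟨fun i => ?_, fun i => ?_⟩
          · rw [← ih (n + 2) (by omega)]
            exact ⟨_, uFst_lie_mem hx i, theta_uFst_lie i x⟩
          · rw [← ih (n + 2) (by omega)]
            exact ⟨_, uSnd_lie_mem hx i, theta_uSnd_lie i x⟩
        · refine forall_gm2_iff.mpr fun i => ?_
          rw [← ih (n + 1) (by omega)]
          exact ⟨_, dz_lie_mem hx i, theta_dz_lie i x⟩
      · obtain ⟨-, hXh, h1, h2⟩ := hX
        rw [forall_gm1_iff, ← ih (n + 2) (by omega)] at h1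
        rw [forall_gm2_iff, ← ih (n + 1) (by omega)] at h2
        choose a ha ha' using h1.1
        choose b hb hb' using h1.2
        choose y hy hy' using h2
        change ∀ i, theta K (a i) = _ at ha'
        change ∀ i, theta K (b i) = _ at hb'
        change ∀ i, theta K (y i) = _ at hy'
        have hk : (((n + 3 : ℕ) : ℤ) - 2) = (n : ℤ) + 1 := by push_cast; ring
        have hy2 : ∀ i, y i ∈ homPart K ((((n + 3 : ℕ) : ℤ) - 2) - 2) := fun i => by
          have := hy i
          rwa [show ((n + 1 : ℕ) : ℤ) - 2 = (((n + 3 : ℕ) : ℤ) - 2) - 2 by push_cast; ring] at this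
        obtain ⟨x, hx, hxy⟩ : ∃ x ∈ homPart K (((n + 3 : ℕ) : ℤ) - 2),
            ∀ i, theta K ⁅dz K i, x⁆ = theta K (y i) := by
          rcases Int.even_or_odd (((n + 3 : ℕ) : ℤ) - 2) with he | ho
          · refine exists_dz_lie_even (by omega) he hy2 fun i j => ?_
            rw [theta_dz_lie, theta_dz_lie, hy', hy', lie_wz_comm (lie_wz_wz K _ _)]
          · refine exists_dz_lie_odd (a := a) (b := b) ho hy2 (fun i j => ?_) fun i j => ?_
            · rw [theta_dz_lie, theta_uFst_lie, ha', hy', lie_wz_comm (lie_wz_wp K _ _)]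
            · rw [theta_dz_lie, theta_uSnd_lie, hb', hy', lie_wz_comm (lie_wz_wq K _ _)]
        refine ⟨x, hx, ?_⟩
        change theta K x = X
        -- The element `x` was chosen by its brackets with `𝔤₋₂` alone. The brackets of `X - θx`
        -- with `𝔤₋₁` are realized elements of nonnegative degree that commute with `𝔤₋₂`, so they
        -- vanish too.
        have hz : ∀ i, ⁅wz K (Pi.single i 1), X - theta K x⁆ = 0 := fun i => by
          rw [lie_sub, ← hy', ← theta_dz_lie, hxy, sub_self]
        have hdeg : 0 ≤ ((n + 2 : ℕ) : ℤ) - 2 := by omega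
        symm
        rw [← sub_eq_zero]
        refine eq_zero_of_lie_negative_of_hom (k := n + 1) (Submodule.sub_mem _ hXh
          (hk ▸ theta_hom hx)) (by omega) hz (fun i => ?_) fun i => ?_
        · rw [lie_sub, ← ha', ← theta_uFst_lie, ← map_sub]
          refine theta_eq_zero_of_dz hdeg (Submodule.sub_mem _ (ha i) (uFst_lie_mem hx i)) fun j => ?_
          rw [theta_dz_lie, map_sub, ha', theta_uFst_lie, ← lie_sub,
            lie_wz_comm (lie_wz_wp K _ _), hz, lie_zero]
        · rw [lie_sub, ← hb', ← theta_uSnd_lie, ← map_sub]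
          refine theta_eq_zero_of_dz hdeg (Submodule.sub_mem _ (hb i) (uSnd_lie_mem hx i)) fun j => ?_
          rw [theta_dz_lie, map_sub, hb', theta_uSnd_lie, ← lie_sub,
            lie_wz_comm (lie_wz_wq K _ _), hz, lie_zero]

/-- The coefficients of the negative part lie in every `𝒪(N)`, so brackets with it preserve
`𝔳𝔢𝔠𝔱(N)`; the restriction on divided powers may therefore be imposed after prolonging. -/
theorem prolongStep_eq_inf {N : Idx → WithTop ℕ+} {k : ℤ} {A B A' B' : Submodule K (VF Idx K)}
    (hA : A = A' ⊓ VF.shear K N) (hB : B = B' ⊓ VF.shear K N) :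
    prolongStep N k A B = prolongStep (fun _ => ⊤) k A' B' ⊓ VF.shear K N := by
  subst hA hB
  ext X
  constructor
  · rintro ⟨h1, h2, h3, h4⟩
    exact ⟨⟨mem_shear_top _, h2, fun Y hY => (h3 Y hY).1, fun Y hY => (h4 Y hY).1⟩, h1⟩
  · rintro ⟨⟨-, h2, h3, h4⟩, h1⟩
    exact ⟨h1, h2, fun Y hY => ⟨h3 Y hY, VF.lie_shear h1 (gm1_le K N hY).1⟩,
      fun Y hY => ⟨h4 Y hY, VF.lie_shear h1 (gm2_le K N hY).1⟩⟩

theorem prolongAux_eq_inf {N : Idx → WithTop ℕ+} {g0 g0' : Submodule K (VF Idx K)}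
    (h0 : g0 = g0' ⊓ VF.shear K N) (n : ℕ) :
    prolongAux N g0 n = prolongAux (fun _ => ⊤) g0' n ⊓ VF.shear K N := by
  induction n using Nat.strong_induction_on with
  | _ n ih =>
    match n, ih with
    | 0, _ => exact (inf_eq_left.mpr fun X hX => (gm2_le K N hX).1).symm
    | 1, _ => exact (inf_eq_left.mpr fun X hX => (gm1_le K N hX).1).symm
    | 2, _ => exact h0
    | n + 3, ih => exact prolongStep_eq_inf (ih (n + 2) (by omega)) (ih (n + 1) (by omega))

theorem g0sl_eq_inf (N : Idx → WithTop ℕ+) : g0sl K = g0sl K ⊓ VF.shear K N :=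
  (inf_eq_left.mpr fun _ hX => ((isDegreeZero_g0sl K N).le hX).1).symm

/-- If the coefficients contain no divided powers of `p` and `q`, the shearing vector can be
restricted to `z`. -/
theorem shear_iff_withOnes {N : Idx → WithTop ℕ+} {X : VF Idx K}
    (hX : X ∈ VF.shear K (withOnes fun _ => ⊤)) :
    X ∈ VF.shear K N ↔ X ∈ VF.shear K (withOnes fun i => N (.inl i)) := by
  constructor
  · intro h j r hr i n hn
    rcases i with i | i
    · exact h j r hr (.inl i) n hn
    · exact hX j r hr (.inr i) n hn
  · intro h j r hr i n hn
    rcases i with i | i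
    · exact h j r hr (.inl i) n hn
    · exact lt_of_lt_of_le (hX j r hr (.inr i) 1 rfl) (Nat.pow_le_pow_right (by norm_num) n.pos)

/-- Here `g0''` is the unrestricted degree 0 component. Once its unrestricted prolong is free of
divided powers of `p` and `q`, the last six coordinates of `N` impose no condition. -/
theorem prolongAux_withOnes {N : Idx → WithTop ℕ+} {g0 g0' g0'' : Submodule K (VF Idx K)}
    (h0 : g0 = g0'' ⊓ VF.shear K N)
    (h0' : g0' = g0'' ⊓ VF.shear K (withOnes fun i => N (.inl i)))
    (h : ∀ n, prolongAux (fun _ => ⊤) g0'' n ≤ VF.shear K (withOnes fun _ => ⊤)) (n : ℕ) :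
    prolongAux N g0 n = prolongAux (withOnes fun i => N (.inl i)) g0' n := by
  rw [prolongAux_eq_inf h0, prolongAux_eq_inf h0']
  ext X
  exact and_congr_right fun hX => shear_iff_withOnes (h n hX)

/-- For unrestricted `N` the conditions in `theta_shear_iff` are empty, since `p` and `q` enter the
realization only through products of the indeterminates themselves. -/
theorem prolongAux_g0sl_le (n : ℕ) :
    prolongAux (fun _ => ⊤) (g0sl K) n ≤ VF.shear K (withOnes fun _ => ⊤) := by
  rw [← map_theta_homPart]
  rintro _ ⟨x, -, rfl⟩
  have h : ∀ f : DP (Fin 3) K, f ∈ DP.shear K (fun _ => ⊤) := fun f _ _ _ _ hn =>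
    absurd hn (by simp)
  exact theta_shear_iff.mpr ⟨fun _ => h _, fun _ => h _, fun _ => h _⟩

variable (K) in
theorem prolongAux_g0sl_withOnes (N : Idx → WithTop ℕ+) (n : ℕ) :
    prolongAux N (g0sl K) n = prolongAux (withOnes fun i => N (.inl i)) (g0sl K) n :=
  prolongAux_withOnes (g0sl_eq_inf _) (g0sl_eq_inf _) prolongAux_g0sl_le n

theorem mem_prolongAux_g0sl {N : Fin 3 → WithTop ℕ+} {n : ℕ} {X : VF Idx K} :
    X ∈ prolongAux (withOnes N) (g0sl K) n ↔ ∃ x ∈ homPart K ((n : ℤ) - 2), theta K x = X ∧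
      x.vf ∈ VF.shear K N ∧ (∀ i, DP.pd i x.fst ∈ DP.shear K N) ∧
        ∀ i, DP.pd i x.snd ∈ DP.shear K N := by
  rw [prolongAux_eq_inf (g0sl_eq_inf _), ← map_theta_homPart]
  constructor
  · rintro ⟨⟨x, hx, rfl⟩, h⟩
    exact ⟨x, hx, rfl, theta_shear_iff.mp h⟩
  · rintro ⟨x, hx, rfl, h⟩
    exact ⟨⟨x, hx, rfl⟩, theta_shear_iff.mpr h⟩

end Prolongation

/-! ## The derived algebra -/

namespace DP

variable {σ K : Type*} [Field K] [Fintype σ] [DecidableEq σ]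

theorem mono_mem_shear {N : σ → WithTop ℕ+} {r : σ → ℕ}
    (h : ∀ i, ∀ n : ℕ+, N i = n → r i < 2 ^ (n : ℕ)) (a : K) : mono r a ∈ shear K N := by
  classical
  intro s hs
  rw [coeff_mono] at hs
  have : r = s := by_contra fun e => hs (if_neg e)
  exact this ▸ h

/-- The multi-indices of the highest divided monomial. -/
def IsTop (N : σ → WithTop ℕ+) (r : σ → ℕ) : Prop :=
  ∀ i, ∃ n : ℕ+, N i = n ∧ r i + 1 = 2 ^ (n : ℕ)

variable (K) in
/-- The functions without highest term. -/
def noTop (N : σ → WithTop ℕ+) : Submodule K (DP σ K) where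
  carrier := {f | f ∈ shear K N ∧ ∀ r, IsTop N r → coeff r f = 0}
  zero_mem' := ⟨Submodule.zero_mem _, fun _ _ => map_zero _⟩
  add_mem' := fun hf hg => ⟨Submodule.add_mem _ hf.1 hg.1, fun r hr => by
    rw [map_add, hf.2 r hr, hg.2 r hr, add_zero]⟩
  smul_mem' := fun c _ hf => ⟨Submodule.smul_mem _ c hf.1, fun r hr => by
    rw [map_smul, hf.2 r hr, smul_zero]⟩

theorem mono_mem_noTop {N : σ → WithTop ℕ+} {r : σ → ℕ}
    (h : ∀ i, ∀ n : ℕ+, N i = n → r i < 2 ^ (n : ℕ)) (ht : ¬IsTop N r) (a : K) :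
    mono r a ∈ noTop K N := by
  classical
  refine ⟨mono_mem_shear h a, fun s hs => ?_⟩
  rw [coeff_mono, if_neg]
  rintro rfl
  exact ht hs

theorem not_isTop_of_zero {N : σ → WithTop ℕ+} {r : σ → ℕ} {i : σ} (h : r i = 0) :
    ¬IsTop N r := fun ht => by
  obtain ⟨n, -, hn⟩ := ht i
  rw [h] at hn
  have := Nat.one_lt_two_pow n.pos.ne'
  omega


/-- The highest monomial could only be the derivative of a monomial outside `𝒪(N)`. -/
theorem pd_mem_noTop {N : σ → WithTop ℕ+} {f : DP σ K} (i : σ) (hf : f ∈ shear K N) :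
    pd i f ∈ noTop K N := by
  refine ⟨shear_pd i hf, fun r hr => ?_⟩
  by_contra hc
  rw [coeff_pd] at hc
  obtain ⟨n, hn, hr⟩ := hr i
  have := hf _ hc i n hn
  simp at this
  omega

theorem mem_noTop_of_pd {N : σ → WithTop ℕ+} {f : DP σ K} {i : σ} (hf : f ∈ shear K N)
    (h : pd i f = 0) : f ∈ noTop K N := by
  refine ⟨hf, fun r hr => ?_⟩
  by_contra hc
  refine not_isTop_of_zero (i := i) (r := r) ?_ hr
  by_contra hi
  obtain ⟨s, rfl⟩ := eq_add_single hi
  rw [← coeff_pd, h, map_zero] at hc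
  exact hc rfl

/-- Below the highest monomial some exponent is not maximal. Hence such a monomial is a derivative
of a monomial of `𝒪(N)`. -/
theorem exists_raise {N : σ → WithTop ℕ+} {r : σ → ℕ}
    (h : ∀ i, ∀ n : ℕ+, N i = n → r i < 2 ^ (n : ℕ)) (ht : ¬IsTop N r) :
    ∃ k, ∀ i, ∀ n : ℕ+, N i = n → (r + Pi.single k 1 : σ → ℕ) i < 2 ^ (n : ℕ) := by
  unfold IsTop at ht
  push Not at ht
  obtain ⟨k, hk⟩ := ht
  refine ⟨k, fun i n hn => ?_⟩
  by_cases hik : i = k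
  · subst hik
    have h1 := h i n hn
    have h2 := hk n hn
    simp
    omega
  · simpa [hik] using h i n hn

theorem var_mul_mono (i : σ) (r : σ → ℕ) (a : K) :
    var K i * mono r a = mono (r + Pi.single i 1) ((r i + 1) * a) := by
  rw [var, mono_mul_mono, add_comm]
  congr 1
  have : binom (Pi.single i 1) r = r i + 1 := by
    unfold binom
    rw [Finset.prod_eq_single i]
    · simp [add_comm]
    · intro j _ hj
      simp [hj]
    · simp
  rw [this, one_mul]
  push_cast; rfl

theorem var_mem_shear (N : σ → WithTop ℕ+) (j : σ) : var K j ∈ shear K N := by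
  refine mono_mem_shear (fun i n _ => ?_) 1
  have h1 : (Pi.single j 1 : σ → ℕ) i ≤ 1 := by
    rw [Pi.single_apply]; split <;> omega
  exact lt_of_le_of_lt h1 (Nat.one_lt_two_pow n.pos.ne')

theorem one_mem_shear (N : σ → WithTop ℕ+) : (1 : DP σ K) ∈ shear K N :=
  mono_mem_shear (r := 0) (fun _ _ _ => Nat.two_pow_pos _) 1

end DP

section Derived

open BrownSpace

variable {K : Type*} [Field K]

namespace BrownSpace

/-- The curl of a field, `∑ i, ∇(Y i) × eᵢ`. -/
noncomputable def curl (Y : Fin 3 → DP (Fin 3) K) : svect K :=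
  ∑ i, gradCross (Y i) (DP.var K i)

theorem curl_coe (Y : Fin 3 → DP (Fin 3) K) :
    (curl Y).1 = (gradCross (Y 0) (DP.var K 0)).1 + (gradCross (Y 1) (DP.var K 1)).1 +
      (gradCross (Y 2) (DP.var K 2)).1 := by
  rw [curl, Fin.sum_univ_three]; rfl

theorem curl_zero (Y : Fin 3 → DP (Fin 3) K) :
    (curl Y).1 0 = DP.pd 1 (Y 2) - DP.pd 2 (Y 1) := by
  rw [curl_coe]
  simp [gradCross_zero, DP.pd_var_apply]; ring
theorem curl_one (Y : Fin 3 → DP (Fin 3) K) :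
    (curl Y).1 1 = DP.pd 2 (Y 0) - DP.pd 0 (Y 2) := by
  rw [curl_coe]
  simp [gradCross_one, DP.pd_var_apply]; ring
theorem curl_two (Y : Fin 3 → DP (Fin 3) K) :
    (curl Y).1 2 = DP.pd 0 (Y 1) - DP.pd 1 (Y 0) := by
  rw [curl_coe]
  simp [gradCross_two, DP.pd_var_apply]; ring

theorem curl_add (Y Z : Fin 3 → DP (Fin 3) K) : (curl (Y + Z)).1 = (curl Y).1 + (curl Z).1 := by
  refine VF.ext (forall_fin_three ?_ ?_ ?_) <;> simp [curl_zero, curl_one, curl_two] <;> ring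

theorem curl_smul (c : K) (Y : Fin 3 → DP (Fin 3) K) : (curl (c • Y)).1 = c • (curl Y).1 := by
  refine VF.ext (forall_fin_three ?_ ?_ ?_) <;> simp [curl_zero, curl_one, curl_two, smul_sub]

/-- The elements of Brown's algebra whose classes form the derived algebra: curls and functions
without highest term. -/
def derPart (K : Type*) [Field K] (N : Fin 3 → WithTop ℕ+) : Submodule K (BrownSpace K) where
  carrier := {x | (∃ Y : Fin 3 → DP (Fin 3) K, (∀ i, Y i ∈ DP.shear K N) ∧ x.vf = (curl Y).1) ∧
    x.fst ∈ DP.noTop K N ∧ x.snd ∈ DP.noTop K N}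
  zero_mem' := ⟨⟨0, fun _ => Submodule.zero_mem _, by
    refine VF.ext (forall_fin_three ?_ ?_ ?_) <;> simp [curl_zero, curl_one, curl_two]⟩,
    Submodule.zero_mem _, Submodule.zero_mem _⟩
  add_mem' := by
    rintro x y ⟨⟨Y, hY, hx⟩, h1, h2⟩ ⟨⟨Z, hZ, hy⟩, h3, h4⟩
    exact ⟨⟨Y + Z, fun i => Submodule.add_mem _ (hY i) (hZ i), by rw [vf_add, hx, hy, curl_add]⟩,
      Submodule.add_mem _ h1 h3, Submodule.add_mem _ h2 h4⟩
  smul_mem' := by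
    rintro c x ⟨⟨Y, hY, hx⟩, h1, h2⟩
    exact ⟨⟨c • Y, fun i => Submodule.smul_mem _ c (hY i), by rw [vf_smul, hx, curl_smul]⟩,
      Submodule.smul_mem _ c h1, Submodule.smul_mem _ c h2⟩

theorem gradCross_var_mem {N : Fin 3 → WithTop ℕ+} {g : DP (Fin 3) K} (hg : g ∈ DP.shear K N)
    (i : Fin 3) : of (gradCross g (DP.var K i)) 0 0 ∈ derPart K N := by
  refine ⟨⟨Pi.single i g, fun j => ?_, ?_⟩, Submodule.zero_mem _, Submodule.zero_mem _⟩
  · rw [Pi.single_apply]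
    split_ifs
    · exact hg
    · exact Submodule.zero_mem _
  · change (gradCross g (DP.var K i)).1 = _
    refine VF.ext ?_
    revert i
    refine forall_fin_three ?_ ?_ ?_ <;> refine forall_fin_three ?_ ?_ ?_ <;>
      simp [curl_zero, curl_one, curl_two, gradCross_zero, gradCross_one, gradCross_two,
        DP.pd_var_apply]

theorem of_fst_mem {N : Fin 3 → WithTop ℕ+} {f : DP (Fin 3) K} (hf : f ∈ DP.noTop K N) :
    of 0 f 0 ∈ derPart K N :=
  ⟨(derPart K N).zero_mem.1, hf, Submodule.zero_mem _⟩

theorem of_snd_mem {N : Fin 3 → WithTop ℕ+} {f : DP (Fin 3) K} (hf : f ∈ DP.noTop K N) :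
    of 0 0 f ∈ derPart K N :=
  ⟨(derPart K N).zero_mem.1, Submodule.zero_mem _, hf⟩

/-- A submodule contains the derived part if it contains its generators. -/
theorem derPart_le {N : Fin 3 → WithTop ℕ+} {S : Submodule K (BrownSpace K)}
    (h1 : ∀ g ∈ DP.shear K N, ∀ i, of (gradCross g (DP.var K i)) 0 0 ∈ S)
    (h2 : ∀ f ∈ DP.noTop K N, of 0 f 0 ∈ S) (h3 : ∀ f ∈ DP.noTop K N, of 0 0 f ∈ S) :
    derPart K N ≤ S := by
  rintro x ⟨⟨Y, hY, hx⟩, hf, hg⟩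
  have e : x = of (gradCross (Y 0) (DP.var K 0)) 0 0 + of (gradCross (Y 1) (DP.var K 1)) 0 0 +
      of (gradCross (Y 2) (DP.var K 2)) 0 0 + of 0 x.fst 0 + of 0 0 x.snd := by
    refine ext (fun i => ?_) ?_ ?_
    · rw [hx, curl_coe]; simp
    · simp
    · simp
  rw [e]
  exact S.add_mem (S.add_mem (S.add_mem (S.add_mem (h1 _ (hY 0) 0) (h1 _ (hY 1) 1))
    (h1 _ (hY 2) 2)) (h2 _ hf)) (h3 _ hg)

theorem lie_of_fst_of_snd [CharP K 2] (f g : DP (Fin 3) K) :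
    ⁅of 0 f 0, of 0 0 g⁆ = of (gradCross f g) 0 0 := by
  refine ext (fun i => ?_) ?_ ?_
  · simp [vf_lie, gradCross_zero_left]
  · simp [fst_lie, act_zero_left]
  · simp [snd_lie, act_zero_left]

theorem dz_lie_of_fst [CharP K 2] (k : Fin 3) (f : DP (Fin 3) K) :
    ⁅dz K k, of 0 f 0⁆ = of 0 (DP.pd k f) 0 := by
  refine ext (fun i => ?_) ?_ ?_
  · simp [vf_dz_lie]
  · simp [fst_dz_lie]
  · simp [snd_dz_lie]

theorem dz_lie_of_snd [CharP K 2] (k : Fin 3) (f : DP (Fin 3) K) :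
    ⁅dz K k, of 0 0 f⁆ = of 0 0 (DP.pd k f) := by
  refine ext (fun i => ?_) ?_ ?_
  · simp [vf_dz_lie]
  · simp [fst_dz_lie]
  · simp [snd_dz_lie]

variable [CharP K 2]

theorem derPart_le_brownL (N : Fin 3 → WithTop ℕ+) :
    derPart K N ≤ (brownL K N).toSubmodule := by
  refine derPart_le (fun g hg i => ⟨?_, Submodule.zero_mem _, Submodule.zero_mem _⟩)
    (fun f hf => ⟨Submodule.zero_mem _, hf.1, Submodule.zero_mem _⟩)
    (fun f hf => ⟨Submodule.zero_mem _, Submodule.zero_mem _, hf.1⟩)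
  exact gradCross_mem_shear K hg (DP.var_mem_shear N i)

theorem dz_mem_derPart (N : Fin 3 → WithTop ℕ+) (k : Fin 3) : dz K k ∈ derPart K N := by
  obtain ⟨i, j, hij⟩ : ∃ i j : Fin 3, dz K k = of (gradCross (DP.var K i) (DP.var K j)) 0 0 := by
    revert k
    refine forall_fin_three ⟨1, 2, ?_⟩ ⟨2, 0, ?_⟩ ⟨0, 1, ?_⟩
    all_goals
      refine ext (forall_fin_three ?_ ?_ ?_) rfl rfl <;>
        simp [vf_dz_apply, gradCross_zero, gradCross_one, gradCross_two, DP.pd_var_apply]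
  rw [hij]
  exact gradCross_var_mem (DP.var_mem_shear N i) j

theorem var_mem_noTop (N : Fin 3 → WithTop ℕ+) (k : Fin 3) : DP.var K k ∈ DP.noTop K N := by
  obtain ⟨i, hi⟩ : ∃ i, i ≠ k := exists_ne k
  exact DP.mem_noTop_of_pd (i := i) (DP.var_mem_shear N k) (by rw [DP.pd_var_apply, if_neg hi])

theorem uFst_mem_derPart (N : Fin 3 → WithTop ℕ+) (k : Fin 3) : uFst K k ∈ derPart K N :=
  of_fst_mem (var_mem_noTop N k)

theorem uSnd_mem_derPart (N : Fin 3 → WithTop ℕ+) (k : Fin 3) : uSnd K k ∈ derPart K N :=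
  of_snd_mem (var_mem_noTop N k)

/-- For a divergence-free `D` the Leibniz rule gives `D f = ∑ ∂ᵢ(Dᵢ f)`, and derivatives never
contain the highest monomial. -/
theorem act_mem_noTop {N : Fin 3 → WithTop ℕ+} {x : BrownSpace K} {f : DP (Fin 3) K}
    (hx : x.vf ∈ VF.shear K N) (hf : f ∈ DP.shear K N) : x.vf.act f ∈ DP.noTop K N := by
  have e : x.vf.act f = ∑ i, DP.pd i (x.vf i * f) := by
    simp only [DP.pd_mul, Finset.sum_add_distrib, ← Finset.sum_mul]
    have : ∑ i, DP.pd i (x.vf i) = 0 := x.1.2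
    rw [this, zero_mul, zero_add, VF.act_apply]
  rw [e]
  exact Submodule.sum_mem _ fun i _ => DP.pd_mem_noTop i (DP.shear_mul (hx i) hf)

/-- This is the product rule for the curl, the curl of a gradient being zero. -/
theorem gradCross_eq_curl (f g : DP (Fin 3) K) :
    (gradCross f g).1 = (curl fun i => f * DP.pd i g).1 := by
  refine VF.ext (forall_fin_three ?_ ?_ ?_) <;>
    simp [curl_zero, curl_one, curl_two, gradCross_zero, gradCross_one, gradCross_two, DP.pd_mul,
      DP.pd_comm 1 0 g, DP.pd_comm 2 0 g, DP.pd_comm 2 1 g]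

/-- The identity of vector calculus for the curl of `X × Y`, without its divergence terms; signs are
irrelevant in characteristic 2. -/
theorem lie_vf_eq_curl (x y : BrownSpace K) :
    ⁅x.vf, y.vf⁆ = (curl (crossProduct (fun i => x.vf i) (fun i => y.vf i))).1 := by
  have ht : (2 : DP (Fin 3) K) = 0 := CharTwo.two_eq_zero
  have hx := pd_two_vf x
  have hy := pd_two_vf y
  refine VF.ext (forall_fin_three ?_ ?_ ?_) <;>
  · simp [curl_zero, curl_one, curl_two, cross_apply, VF.lie_apply, VF.act_apply,
      Fin.sum_univ_three, DP.pd_mul, CharTwo.sub_eq_add]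
    grind

/-- The derived algebra consists of curls and functions without highest term. -/
theorem lie_mem_derPart {N : Fin 3 → WithTop ℕ+} {x y : BrownSpace K} (hx : x ∈ brownL K N)
    (hy : y ∈ brownL K N) : ⁅x, y⁆ ∈ derPart K N := by
  refine ⟨⟨(fun i => crossProduct (fun i => x.vf i) (fun i => y.vf i) i) +
    ((fun i => x.fst * DP.pd i y.snd) + (-1 : K) • fun i => y.fst * DP.pd i x.snd),
    fun i => ?_, ?_⟩, ?_, ?_⟩
  · refine Submodule.add_mem _ ?_ (Submodule.add_mem _ ?_ (Submodule.smul_mem _ _ ?_))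
    · have h : ∀ i j, x.vf i * y.vf j ∈ DP.shear K N := fun i j =>
        DP.shear_mul (hx.1 i) (hy.1 j)
      revert i
      refine forall_fin_three ?_ ?_ ?_ <;> simp only [cross_apply, Matrix.cons_val]
      · exact Submodule.sub_mem _ (h 1 2) (h 2 1)
      · exact Submodule.sub_mem _ (h 2 0) (h 0 2)
      · exact Submodule.sub_mem _ (h 0 1) (h 1 0)
    · exact DP.shear_mul hx.2.1 (DP.shear_pd i hy.2.2)
    · exact DP.shear_mul hy.2.1 (DP.shear_pd i hx.2.2)
  · rw [vf_lie, curl_add, curl_add, curl_smul, ← gradCross_eq_curl, ← gradCross_eq_curl,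
      lie_vf_eq_curl, neg_one_smul, add_sub_assoc, sub_eq_add_neg]
  · rw [fst_lie]
    exact Submodule.sub_mem _ (act_mem_noTop hx.1 hy.2.1) (act_mem_noTop hy.1 hx.2.1)
  · rw [snd_lie]
    exact Submodule.sub_mem _ (act_mem_noTop hx.1 hy.2.2) (act_mem_noTop hy.1 hx.2.2)

variable (K) in
/-- The first copy of the functions. -/
noncomputable def inFst : DP (Fin 3) K →ₗ[K] BrownSpace K where
  toFun f := of 0 f 0
  map_add' _ _ := ext (by simp) (by simp) (by simp)
  map_smul' _ _ := ext (by simp) (by simp) (by simp)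

variable (K) in
/-- The second copy of the functions. -/
noncomputable def inSnd : DP (Fin 3) K →ₗ[K] BrownSpace K where
  toFun f := of 0 0 f
  map_add' _ _ := ext (by simp) (by simp) (by simp)
  map_smul' _ _ := ext (by simp) (by simp) (by simp)

theorem exists_pd_of_noTop {N : Fin 3 → WithTop ℕ+} {r : Fin 3 → ℕ}
    (h : ∀ i, ∀ n : ℕ+, N i = n → r i < 2 ^ (n : ℕ)) (ht : ¬DP.IsTop N r) :
    ∃ k, ∃ f ∈ DP.shear K N, DP.pd k f = DP.mono r 1 := by
  obtain ⟨k, hk⟩ := DP.exists_raise h ht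
  exact ⟨k, _, DP.mono_mem_shear hk 1, DP.pd_mono_add k r 1⟩

/-- The elements of the derived part are linear combinations of brackets. -/
theorem derPart_le_of_lie {N : Fin 3 → WithTop ℕ+} {S : Submodule K (BrownSpace K)}
    (h : ∀ x ∈ brownL K N, ∀ y ∈ brownL K N, ⁅x, y⁆ ∈ S) : derPart K N ≤ S := by
  have hL : ∀ f ∈ DP.shear K N, of 0 f 0 ∈ brownL K N := fun f hf =>
    ⟨Submodule.zero_mem _, hf, Submodule.zero_mem _⟩
  have hL' : ∀ f ∈ DP.shear K N, of 0 0 f ∈ brownL K N := fun f hf =>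
    ⟨Submodule.zero_mem _, Submodule.zero_mem _, hf⟩
  refine derPart_le (fun g hg i => ?_) (fun f hf => ?_) (fun f hf => ?_)
  · rw [← lie_of_fst_of_snd]
    exact h _ (hL g hg) _ (hL' _ (DP.var_mem_shear N i))
  · refine DP.mem_of_mono (S := S.comap (inFst K)) fun r hr => ?_
    obtain ⟨k, g, hg, hgr⟩ := exists_pd_of_noTop (K := K) (hf.1 r hr) fun ht => hr (hf.2 r ht)
    change of 0 (DP.mono r 1) 0 ∈ S
    rw [← hgr, ← dz_lie_of_fst]
    exact h _ (derPart_le_brownL N (dz_mem_derPart N k)) _ (hL g hg)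
  · refine DP.mem_of_mono (S := S.comap (inSnd K)) fun r hr => ?_
    obtain ⟨k, g, hg, hgr⟩ := exists_pd_of_noTop (K := K) (hf.1 r hr) fun ht => hr (hf.2 r ht)
    change of 0 0 (DP.mono r 1) ∈ S
    rw [← hgr, ← dz_lie_of_snd]
    exact h _ (derPart_le_brownL N (dz_mem_derPart N k)) _ (hL' g hg)

end BrownSpace

end Derived

/-! ## Ideals of the derived algebra -/

namespace DP

variable {σ K : Type*} [Field K] [Fintype σ] [DecidableEq σ]

theorem binom_eq_one {r s : σ → ℕ} (h : ∀ i, r i = 0 ∨ s i = 0) : binom r s = 1 :=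
  Finset.prod_eq_one fun i _ => by rcases h i with e | e <;> simp [e]

theorem mono_mul_mono_of_disjoint {r s : σ → ℕ} (h : ∀ i, r i = 0 ∨ s i = 0) (a b : K) :
    (mono r a * mono s b : DP σ K) = mono (r + s) (a * b) := by
  rw [mono_mul_mono, binom_eq_one h, Nat.cast_one, one_mul]

/-- The exponents of the highest monomial have the form `2ⁿ - 1` with `n ≥ 1`, so they are odd. -/
theorem IsTop.cast_eq_one [CharP K 2] {N : σ → WithTop ℕ+} {r : σ → ℕ} (h : IsTop N r) (i : σ) :
    ((r i : ℕ) : K) = 1 := by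
  obtain ⟨n, -, hn⟩ := h i
  have e : ((r i : ℕ) : K) + 1 = 2 ^ (n : ℕ) := by exact_mod_cast congrArg (Nat.cast : ℕ → K) hn
  rw [CharTwo.two_eq_zero, zero_pow n.pos.ne'] at e
  rwa [← CharTwo.sub_eq_add, sub_eq_zero] at e

theorem IsTop.eq {N : σ → WithTop ℕ+} {r s : σ → ℕ} (hr : IsTop N r) (hs : IsTop N s) : r = s := by
  funext i
  obtain ⟨n, h, hn⟩ := hr i
  obtain ⟨m, h', hm⟩ := hs i
  have : m = n := by rw [h'] at h; exact WithTop.coe_injective h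
  subst this
  omega

theorem IsTop.lt {N : σ → WithTop ℕ+} {r : σ → ℕ} (hr : IsTop N r) (i : σ) (n : ℕ+)
    (hn : N i = n) : r i < 2 ^ (n : ℕ) := by
  obtain ⟨m, h, hm⟩ := hr i
  have : m = n := by rw [h] at hn; exact WithTop.coe_injective hn
  subst this
  omega

/-- Functions without highest term are generated from each other by the operators `∂ₖ` and
`uₗ ∂ₖ`, `l ≠ k`. -/
theorem noTop_le [CharP K 2] [Nontrivial σ] {N : σ → WithTop ℕ+} {T : Submodule K (DP σ K)}
    (h1 : ∀ f ∈ noTop K N, ∀ k, pd k f ∈ T)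
    (h2 : ∀ f ∈ noTop K N, ∀ k l, l ≠ k → var K l * pd k f ∈ T) : noTop K N ≤ T := by
  intro f hf
  refine mem_of_mono fun r hr => ?_
  have hs := hf.1 r hr
  have ht : ¬IsTop N r := fun ht => hr (hf.2 r ht)
  obtain ⟨k, hk⟩ := exists_raise hs ht
  -- If raising the exponent of `k` reaches the highest monomial, that monomial is not available.
  -- Then one unit is moved from `l` to `k` instead, and `uₗ ∂ₖ` moves it back with the factor `rₗ`,
  -- which is odd.
  by_cases htk : IsTop N (r + Pi.single k 1)
  · obtain ⟨l, hl⟩ := exists_ne k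
    have hrl : ((r l : ℕ) : K) = 1 := by simpa [hl] using htk.cast_eq_one (K := K) l
    have hl0 : r l ≠ 0 := fun e => by rw [e] at hrl; simp at hrl
    obtain ⟨s, rfl⟩ := eq_add_single hl0
    have hmem : mono (s + Pi.single k 1) 1 ∈ noTop K N := by
      refine mono_mem_noTop (fun i n hn => lt_of_le_of_lt ?_ (hk i n hn)) (fun h => ?_) 1
      · simp only [Pi.add_apply]; omega
      · have := congrFun (h.eq htk) l
        simp at this
    have e := h2 _ hmem k l hl
    rw [pd_mono_add, var_mul_mono, mul_one] at e
    simp only [Pi.add_apply, Pi.single_eq_same, Nat.cast_add, Nat.cast_one] at hrl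
    rwa [hrl] at e
  · have e := h1 _ (mono_mem_noTop hk htk 1) k
    rwa [pd_mono_add] at e

end DP

section Ideals

open BrownSpace

variable {K : Type*} [Field K] [CharP K 2] {N : Fin 3 → WithTop ℕ+}

namespace BrownSpace

/-- The map `g ↦ ∇g × eᵢ`. -/
noncomputable def inGradCross (i : Fin 3) : DP (Fin 3) K →ₗ[K] BrownSpace K where
  toFun g := of (gradCross g (DP.var K i)) 0 0
  map_add' f g := ext (fun j => by simp only [vf_of, vf_add, gradCross_add_left])
    (by simp) (by simp)
  map_smul' c g := ext
    (fun j => by simp only [vf_of, vf_smul, gradCross_smul_left, RingHom.id_apply]) (by simp) (by simp)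

theorem inGradCross_apply (i : Fin 3) (g : DP (Fin 3) K) :
    inGradCross i g = of (gradCross g (DP.var K i)) 0 0 := rfl

theorem inFst_apply (f : DP (Fin 3) K) : inFst K f = of 0 f 0 := rfl

theorem inSnd_apply (f : DP (Fin 3) K) : inSnd K f = of 0 0 f := rfl

/-- Up to sign, `uₗ ∂ₖ = ∇(uₗ uₘ) × ∇uₗ`, where `m` is the third index. The product `uₗ uₘ` is
square-free and does not contain `uₖ`, so it is admissible for every `N`. -/
theorem exists_linear (N : Fin 3 → WithTop ℕ+) (k l : Fin 3) (h : l ≠ k) :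
    ∃ g ∈ DP.noTop K N, ∃ i, ∀ j, (gradCross g (DP.var K i)).1 j =
      if j = k then DP.var K l else 0 := by
  obtain ⟨m, hm, hmk⟩ : ∃ m, m ≠ l ∧ m ≠ k := by decide +revert
  refine ⟨DP.var K l * DP.var K m, DP.mem_noTop_of_pd (i := k)
    (DP.shear_mul (DP.var_mem_shear N l) (DP.var_mem_shear N m)) ?_, l, ?_⟩
  · rw [DP.pd_mul, DP.pd_var_apply, DP.pd_var_apply, if_neg h.symm, if_neg hmk.symm]; simp
  · revert k l m
    refine forall_fin_three ?_ ?_ ?_ <;> refine forall_fin_three ?_ ?_ ?_ <;> intro h <;>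
      refine forall_fin_three ?_ ?_ ?_ <;> intro h1 h2 <;> first
      | exact absurd rfl h
      | exact absurd rfl h1
      | exact absurd rfl h2
      | refine forall_fin_three ?_ ?_ ?_ <;>
          simp [gradCross_zero, gradCross_one, gradCross_two, DP.pd_var_apply, DP.pd_mul,
            CharTwo.neg_eq]

theorem exists_pd_eq_var (N : Fin 3 → WithTop ℕ+) (k : Fin 3) :
    ∃ l, ∃ f ∈ DP.noTop K N, DP.pd l f = DP.var K k := by
  obtain ⟨l, m, h1, h2, h3⟩ : ∃ l m : Fin 3, l ≠ k ∧ m ≠ k ∧ l ≠ m := by decide +revert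
  refine ⟨l, DP.var K k * DP.var K l, DP.mem_noTop_of_pd (i := m)
    (DP.shear_mul (DP.var_mem_shear N k) (DP.var_mem_shear N l)) ?_, ?_⟩
  · simp [DP.pd_mul, DP.pd_var_apply, h2, h3.symm]
  · simp [DP.pd_mul, DP.pd_var_apply, h1]

/-- Fields obtained from the highest function are rewritten through functions without highest term.
Factor the highest monomial as `a b c`, with `b` the highest power of `uᵢ`; then `∇(a uᵢ) × ∇(b c)`
has the required value, because `uᵢ b = 0` and `uᵢ ∂ᵢ b = b`. -/
theorem exists_gradCross_top {τ : Fin 3 → ℕ} (h : DP.IsTop N τ) (i : Fin 3) :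
    ∃ f ∈ DP.noTop K N, ∃ g ∈ DP.noTop K N,
      (gradCross f g).1 = (gradCross (DP.mono τ 1) (DP.var K i)).1 := by
  obtain ⟨j, k, hji, hki, hjk⟩ : ∃ j k : Fin 3, j ≠ i ∧ k ≠ i ∧ j ≠ k := by decide +revert
  set a : DP (Fin 3) K := DP.mono (Pi.single j (τ j)) 1 with ha
  set b : DP (Fin 3) K := DP.mono (Pi.single i (τ i)) 1 with hb
  set c : DP (Fin 3) K := DP.mono (Pi.single k (τ k)) 1 with hc
  have hsingle : ∀ l, DP.mono (Pi.single l (τ l)) 1 ∈ DP.shear K N := fun l =>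
    DP.mono_mem_shear (fun m n hn => by
      by_cases e : m = l
      · subst e; simpa using h.lt m n hn
      · simp [e]) 1
  have hpd : ∀ l m, m ≠ l → DP.pd m (DP.mono (Pi.single l (τ l)) (1 : K)) = 0 := fun l m e =>
    DP.pd_mono_zero (by simp [e]) 1
  -- The product carries the coefficient `τ i + 1`, which is even.
  have hub : DP.var K i * b = 0 := by
    rw [hb, DP.var_mul_mono]
    simp [h.cast_eq_one (K := K) i, CharTwo.add_self_eq_zero, DP.mono_zero]
  have hub' : DP.var K i * DP.pd i b = b := by
    have := congrArg (DP.pd i) hub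
    rw [DP.pd_mul, DP.pd_var_apply, if_pos rfl, one_mul, map_zero] at this
    rw [← sub_eq_zero, CharTwo.sub_eq_add, add_comm]
    exact this
  have hτ : DP.mono τ 1 = a * b * c := by
    rw [ha, hb, hc, DP.mono_mul_mono_of_disjoint, DP.mono_mul_mono_of_disjoint]
    · rw [mul_one, mul_one]
      congr 1
      funext l
      have hl : l = i ∨ l = j ∨ l = k := by
        clear_value a b c
        clear ha hb hc h hsingle hpd hub hub' a b c
        decide +revert
      rcases hl with rfl | rfl | rfl
      · simp [hji.symm, hki.symm]
      · simp [hji, hjk]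
      · simp [hki, hjk.symm]
    · intro l
      by_cases e : l = k
      · subst e; left; simp [hki, hjk.symm]
      · right; simp [e]
    · intro l
      by_cases e : l = i
      · subst e; left; simp [hji.symm]
      · right; simp [e]
  refine ⟨a * DP.var K i, DP.mem_noTop_of_pd (i := k) (DP.shear_mul (hsingle j)
    (DP.var_mem_shear N i)) ?_, b * c, DP.mem_noTop_of_pd (i := j) (DP.shear_mul (hsingle i)
    (hsingle k)) ?_, ?_⟩
  · rw [DP.pd_mul, hpd j k hjk.symm, DP.pd_var_apply, if_neg hki]; simp
  · rw [DP.pd_mul, hpd i j hji, hpd k j hjk]; simp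
  · rw [hτ]
    have h1 := hpd j i hji.symm
    have h2 := hpd j k hjk.symm
    have h3 := hpd i j hji
    have h4 := hpd i k hki
    have h5 := hpd k i hki.symm
    have h6 := hpd k j hjk
    rw [← ha] at h1 h2
    rw [← hb] at h3 h4
    rw [← hc] at h5 h6
    clear_value a b c
    clear ha hb hc hsingle hpd hτ
    refine VF.ext ?_
    revert i j k
    refine forall_fin_three ?_ ?_ ?_ <;> refine forall_fin_three ?_ ?_ ?_ <;>
      refine forall_fin_three ?_ ?_ ?_ <;> intro e1 e2 e3 <;> first
      | exact absurd rfl e1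
      | exact absurd rfl e2
      | exact absurd rfl e3
      | intro u1 u2 v1 v2 v3 v4 v5 v6
        refine forall_fin_three ?_ ?_ ?_ <;>
          simp [gradCross_zero, gradCross_one, gradCross_two, DP.pd_var_apply, DP.pd_mul,
            v1, v2, v3, v4, v5, v6, CharTwo.neg_eq] <;> grind

variable {S : Submodule K (BrownSpace K)} (hS : ∀ x ∈ S, ∀ y ∈ derPart K N, ⁅y, x⁆ ∈ S)
include hS

/-- The barred `uₖ` are derivatives of square-free quadratic functions. Bracketed with functions
they give the fields `∇g × eᵢ` with `g` without highest term, among them `uₗ ∂ₖ`. Together with the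
`∂ₖ` these reach all functions without highest term, and the fields still missing are brackets of
two such functions. -/
theorem derPart_le_of_dz (hdz : ∀ k, dz K k ∈ S) : derPart K N ≤ S := by
  have hS' : ∀ x ∈ S, ∀ y ∈ derPart K N, ⁅x, y⁆ ∈ S := fun x hx y hy => by
    rw [← lie_skew]; exact S.neg_mem (hS x hx y hy)
  have huS : ∀ k, uSnd K k ∈ S := fun k => by
    obtain ⟨l, f, hf, e⟩ := exists_pd_eq_var (K := K) N k
    have := hS' _ (hdz l) _ (of_snd_mem hf)
    rwa [dz_lie_of_snd, e] at this
  have hgc : ∀ g ∈ DP.noTop K N, ∀ i, of (gradCross g (DP.var K i)) 0 0 ∈ S := fun g hg i => by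
    rw [← lie_of_fst_of_snd]
    exact hS _ (huS i) _ (of_fst_mem hg)
  have hact : ∀ k l, l ≠ k → ∃ X : svect K, of X 0 0 ∈ S ∧
      ∀ f, X.1.act f = DP.var K l * DP.pd k f := fun k l hl => by
    obtain ⟨g, hg, i, h⟩ := exists_linear (K := K) N k l hl
    refine ⟨_, hgc g hg i, fun f => ?_⟩
    simp only [VF.act_apply, h]
    simp
  have hfst : ∀ f ∈ DP.noTop K N, of 0 f 0 ∈ S := by
    refine DP.noTop_le (T := S.comap (inFst K)) (fun f hf k => ?_) (fun f hf k l hl => ?_)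
    · rw [Submodule.mem_comap, inFst_apply, ← dz_lie_of_fst]
      exact hS' _ (hdz k) _ (of_fst_mem hf)
    · obtain ⟨X, hX, hXf⟩ := hact k l hl
      have e : ⁅of X 0 0, of 0 f 0⁆ = of 0 (DP.var K l * DP.pd k f) 0 := by
        rw [← hXf]
        refine ext (fun i => ?_) ?_ ?_
        · simp [vf_lie, gradCross_zero_left, gradCross_zero_right]
        · simp [fst_lie, act_zero_left]
        · simp [snd_lie, act_zero_left]
      rw [Submodule.mem_comap, inFst_apply, ← e]
      exact hS' _ hX _ (of_fst_mem hf)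
  have hsnd : ∀ f ∈ DP.noTop K N, of 0 0 f ∈ S := by
    refine DP.noTop_le (T := S.comap (inSnd K)) (fun f hf k => ?_) (fun f hf k l hl => ?_)
    · rw [Submodule.mem_comap, inSnd_apply, ← dz_lie_of_snd]
      exact hS' _ (hdz k) _ (of_snd_mem hf)
    · obtain ⟨X, hX, hXf⟩ := hact k l hl
      have e : ⁅of X 0 0, of 0 0 f⁆ = of 0 0 (DP.var K l * DP.pd k f) := by
        rw [← hXf]
        refine ext (fun i => ?_) ?_ ?_
        · simp [vf_lie, gradCross_zero_left, gradCross_zero_right]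
        · simp [fst_lie, act_zero_left]
        · simp [snd_lie, act_zero_left]
      rw [Submodule.mem_comap, inSnd_apply, ← e]
      exact hS' _ hX _ (of_snd_mem hf)
  refine derPart_le (fun g hg i => ?_) hfst hsnd
  rw [← inGradCross_apply, ← Submodule.mem_comap]
  refine DP.mem_of_mono (S := S.comap (inGradCross i)) fun r hr => ?_
  rw [Submodule.mem_comap, inGradCross_apply]
  by_cases ht : DP.IsTop N r
  · obtain ⟨f, hf, g', hg', e⟩ := exists_gradCross_top (K := K) ht i
    have e' : of (gradCross (DP.mono r 1) (DP.var K i)) 0 0 = ⁅of 0 f 0, of 0 0 g'⁆ := by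
      rw [lie_of_fst_of_snd]
      exact ext (fun j => by simp only [vf_of, e]) (by simp only [fst_of]) (by simp only [snd_of])
    rw [e']
    exact hS _ (hsnd _ hg') _ (of_fst_mem hf)
  · exact hgc _ (DP.mono_mem_noTop (hg r hr) ht 1) i

/-- The bracket of `uᵢ ∂ₖ` with a constant field is, up to sign, the `i`-th component of that field
times `∂ₖ`. The constant functions play no role. -/
theorem dz_mem_of_const {x : BrownSpace K} (hx : x ∈ S) (h : ∀ i k, DP.pd k (x.vf i) = 0)
    (hf : ∀ i, DP.pd i x.fst = 0) (hg : ∀ i, DP.pd i x.snd = 0) {i k : Fin 3} (hik : i ≠ k)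
    (hi : DP.coeff 0 (x.vf i) ≠ 0) : dz K k ∈ S := by
  obtain ⟨g, hg', j, hj⟩ := exists_linear (K := K) N k i hik
  have hm := hS x hx _ (gradCross_var_mem hg'.1 j)
  have e : ⁅of (gradCross g (DP.var K j)) 0 0, x⁆ = (-DP.coeff 0 (x.vf i)) • dz K k := by
    refine ext (fun l => ?_) ?_ ?_
    · have e1 : x.vf.act (DP.var K i) = DP.mono 0 (DP.coeff 0 (x.vf i)) := by
        rw [act_var]; exact DP.eq_mono_of_pd (h i)
      have e2 : ∀ l, (gradCross g (DP.var K j)).1.act (x.vf l) = 0 := fun l => by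
        simp [VF.act_apply, h]
      rw [vf_lie]
      simp only [vf_of, fst_of, snd_of, gradCross_zero_left, gradCross_zero_right, VF.sub_apply,
        VF.add_apply, VF.lie_apply, hj, e2, vf_smul, VF.smul_apply, vf_dz_apply, VF.zero_apply]
      have e3 : (gradCross x.fst 0).1 l = 0 := by rw [gradCross_zero_right]; rfl
      split_ifs
      · rw [e1, DP.one_eq_mono, DP.smul_mono, neg_mul, mul_one]
        rw [DP.mono_eq_smul 0 (DP.coeff 0 _), DP.mono_eq_smul 0 (-_)]; simp
      · simp
    · simp [fst_lie, VF.act_apply, hf]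
    · simp [snd_lie, VF.act_apply, hg]
  rw [e] at hm
  exact (S.smul_mem_iff (neg_ne_zero.mpr hi)).mp hm

/-- Brackets with the generators of the negative part lower the degree bound. Descent ends at a
noncentral element whose brackets with all of them are central, and such an element is a nonzero
constant field up to constant functions. -/
theorem dz_mem_of_theta_ne_zero (m : ℕ) : ∀ {x : BrownSpace K}, x.DegLE m → x ∈ S →
    theta K x ≠ 0 → ∀ k, dz K k ∈ S := by
  induction m with
  | zero => exact fun hm _ h => absurd (theta_eq_zero_iff.mpr hm.eq_zero) h
  | succ m ih =>
    intro x hm hx h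
    by_cases h1 : ∃ k, theta K ⁅dz K k, x⁆ ≠ 0
    · obtain ⟨k, hk⟩ := h1
      exact ih (hm.dz_lie k) (hS _ hx _ (dz_mem_derPart N k)) hk
    by_cases h2 : ∃ k, theta K ⁅uFst K k, x⁆ ≠ 0
    · obtain ⟨k, hk⟩ := h2
      exact ih (hm.uFst_lie k) (hS _ hx _ (uFst_mem_derPart N k)) hk
    by_cases h3 : ∃ k, theta K ⁅uSnd K k, x⁆ ≠ 0
    · obtain ⟨k, hk⟩ := h3
      exact ih (hm.uSnd_lie k) (hS _ hx _ (uSnd_mem_derPart N k)) hk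
    push Not at h1 h2 h3
    have e1 : ∀ i k, DP.pd k (x.vf i) = 0 := fun i k => by
      rw [← vf_dz_lie, (theta_eq_zero_iff.mp (h1 k)).1]; rfl
    -- If `∇uₖ × ∇g` vanishes for every `k`, then so does `∇g`.
    have e2 : ∀ i, DP.pd i x.snd = 0 := by
      have := fun k => (theta_eq_zero_iff.mp (h2 k)).1
      simp only [vf_uFst_lie] at this
      have h12 := congrFun (this 1) 2
      have h01 := congrFun (this 0) 1
      have h02 := congrFun (this 0) 2
      refine forall_fin_three ?_ ?_ ?_
      · simpa [gradCross_two, DP.pd_var_apply] using h12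
      · simpa [gradCross_two, DP.pd_var_apply] using h02
      · simpa [gradCross_one, DP.pd_var_apply] using h01
    have e3 : ∀ i, DP.pd i x.fst = 0 := by
      have := fun k => (theta_eq_zero_iff.mp (h3 k)).1
      simp only [vf_uSnd_lie] at this
      have h12 := congrFun (this 1) 2
      have h01 := congrFun (this 0) 1
      have h02 := congrFun (this 0) 2
      refine forall_fin_three ?_ ?_ ?_
      · simpa [gradCross_two, DP.pd_var_apply] using h12
      · simpa [gradCross_two, DP.pd_var_apply] using h02
      · simpa [gradCross_one, DP.pd_var_apply] using h01
    obtain ⟨i, hi⟩ : ∃ i, DP.coeff 0 (x.vf i) ≠ 0 := by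
      by_contra hc
      push Not at hc
      exact h (theta_eq_zero_iff.mpr ⟨VF.ext fun i => DP.eq_zero_of_pd (e1 i) (hc i), e3, e2⟩)
    intro k
    -- The field `uᵢ ∂ᵢ` is not divergence-free, so `∂ᵢ` is reached in two steps, through `∂ⱼ` with
    -- another index `j`.
    by_cases hik : i = k
    · subst hik
      obtain ⟨j, hj⟩ := exists_ne i
      have := dz_mem_of_const hS hx e1 e3 e2 hj.symm hi
      refine dz_mem_of_const hS this (fun l k => ?_) (by simp) (by simp) hj ?_
      · rw [vf_dz_apply]; split_ifs <;> simp [DP.pd_one]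
      · rw [vf_dz_apply, if_pos rfl, coeff_zero_one]; exact one_ne_zero
    · exact dz_mem_of_const hS hx e1 e3 e2 hik hi

theorem derPart_le_of_theta_ne_zero {x : BrownSpace K} (hx : x ∈ S) (h : theta K x ≠ 0) :
    derPart K N ≤ S := by
  obtain ⟨m, hm⟩ := x.exists_degLE
  exact derPart_le_of_dz hS (dz_mem_of_theta_ne_zero hS m hm hx h)

end BrownSpace

end Ideals

/-! ## The simple algebras -/

section Quotient

open BrownSpace

variable {K : Type*} [Field K] [CharP K 2] {N : Fin 3 → WithTop ℕ+}

theorem mono_zero_mem_hom (c : K) : DP.mono (0 : Fin 3 → ℕ) c ∈ DP.hom K (fun _ => 2) 0 := by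
  rw [DP.mono_eq_smul, ← DP.one_eq_mono]
  exact Submodule.smul_mem _ _ (one_hom _)

theorem mem_brownLow_iff {x : brownL K N} : x ∈ brownLow K N ↔ theta K x.1 = 0 := by
  rw [theta_eq_zero_iff]
  refine ⟨fun h => ⟨vf_eq_zero_of_hom K h.1, pd_eq_zero_of_hom_zero K h.2.1,
    pd_eq_zero_of_hom_zero K h.2.2⟩, fun ⟨h1, h2, h3⟩ => ⟨?_, ?_, ?_⟩⟩
  · rw [h1]; exact Submodule.zero_mem _
  · rw [DP.eq_mono_of_pd h2]; exact mono_zero_mem_hom _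
  · rw [DP.eq_mono_of_pd h3]; exact mono_zero_mem_hom _

/-- Brackets with `∂ₖ` detect the gradients of the two functions, and a bracket with `uₖ` detects
the `k`-th component of the field. Only constant functions escape, and these act trivially. -/
theorem center_brownL : LieAlgebra.center K (brownL K N) = brownLow K N := by
  ext x
  rw [LieModule.mem_maxTrivSubmodule]
  refine ⟨fun h => ?_, fun h y => ?_⟩
  · have hd : ∀ y ∈ derPart K N, ⁅y, x.1⁆ = 0 := fun y hy =>
      congrArg Subtype.val (h ⟨y, derPart_le_brownL N hy⟩)
    rw [mem_brownLow_iff, theta_eq_zero_iff]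
    refine ⟨VF.ext fun k => ?_, fun k => ?_, fun k => ?_⟩
    · have := congrArg fst (hd _ (uFst_mem_derPart N k))
      rwa [fst_uFst_lie, fst_zero, neg_eq_zero] at this
    · have := congrArg fst (hd _ (dz_mem_derPart N k))
      rwa [fst_dz_lie] at this
    · have := congrArg snd (hd _ (dz_mem_derPart N k))
      rwa [snd_dz_lie] at this
  · obtain ⟨h1, h2, h3⟩ := theta_eq_zero_iff.mp (mem_brownLow_iff.mp h)
    rw [← lie_skew, neg_eq_zero]
    exact Subtype.ext (lie_eq_zero_of_const h1 h2 h3 y.1)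

variable (K N) in
/-- The realization by vector fields of the quotient of Brown's algebra by its center. -/
noncomputable def thetaQuot : (brownL K N ⧸ brownLow K N) →ₗ⁅K⁆ VF Idx K :=
  { (brownLow K N).toSubmodule.liftQ ((theta K).toLinearMap ∘ₗ (brownL K N).toSubmodule.subtype)
      fun _ hx => mem_brownLow_iff.mp hx with
    map_lie' := by
      intro x y
      induction x using Submodule.Quotient.induction_on
      induction y using Submodule.Quotient.induction_on
      exact (theta K).map_lie _ _ }

theorem thetaQuot_mk (x : brownL K N) :
    thetaQuot K N (LieSubmodule.Quotient.mk x) = theta K x.1 := rfl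

theorem thetaQuot_injective : Function.Injective (thetaQuot K N) := by
  refine (injective_iff_map_eq_zero _).mpr fun x h => ?_
  induction x using Submodule.Quotient.induction_on
  exact (Submodule.Quotient.mk_eq_zero _).mpr (mem_brownLow_iff.mpr h)

theorem mono_zero_mem_noTop (c : K) : DP.mono (0 : Fin 3 → ℕ) c ∈ DP.noTop K N :=
  DP.mono_mem_noTop (fun _ _ _ => Nat.two_pow_pos _) (DP.not_isTop_of_zero (i := 0) rfl) c

theorem mem_derPart_of_theta_eq_zero {x : BrownSpace K} (h : theta K x = 0) : x ∈ derPart K N := by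
  obtain ⟨h1, h2, h3⟩ := theta_eq_zero_iff.mp h
  refine ⟨?_, ?_, ?_⟩
  · rw [h1]; exact (derPart K N).zero_mem.1
  · rw [DP.eq_mono_of_pd h2]; exact mono_zero_mem_noTop _
  · rw [DP.eq_mono_of_pd h3]; exact mono_zero_mem_noTop _

/-- Brackets of elements of `ℒ` lie in `derPart` and span it. The constants belong to `derPart` as
well, so the criterion does not depend on the representative modulo `ℒ₋₃`. -/
theorem mk_mem_D4_iff {x : brownL K N} :
    LieSubmodule.Quotient.mk x ∈ D4 K N ↔ x.1 ∈ derPart K N := by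
  have key : (D4 K N).toSubmodule = Submodule.span K {⁅x, y⁆ | (x) (y)} :=
    LieAlgebra.coe_derivedSeries_one_eq K (brownL K N ⧸ brownLow K N)
  constructor
  · intro h
    have hle : (D4 K N).toSubmodule ≤ ((derPart K N).comap (brownL K N).toSubmodule.subtype).map
        (brownLow K N).toSubmodule.mkQ := by
      rw [key, Submodule.span_le]
      rintro _ ⟨y, z, rfl⟩
      induction y using Submodule.Quotient.induction_on with | _ y
      induction z using Submodule.Quotient.induction_on with | _ z
      exact ⟨⁅y, z⁆, lie_mem_derPart y.2 z.2, rfl⟩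
    obtain ⟨y, hy, e⟩ := hle h
    have e' : x.1 = y.1 + (x.1 - y.1) := by abel
    rw [e']
    refine Submodule.add_mem _ hy (mem_derPart_of_theta_eq_zero ?_)
    rw [map_sub, sub_eq_zero]
    exact (congrArg (thetaQuot K N) e).symm
  · intro h
    have hle : derPart K N ≤ ((D4 K N).toSubmodule.comap (brownLow K N).toSubmodule.mkQ).map
        (brownL K N).toSubmodule.subtype := by
      refine derPart_le_of_lie fun y hy z hz =>
        ⟨⁅(⟨y, hy⟩ : brownL K N), (⟨z, hz⟩ : brownL K N)⁆, ?_, rfl⟩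
      rw [SetLike.mem_coe, Submodule.mem_comap, key]
      exact Submodule.mem_span_of_mem ⟨(brownLow K N).toSubmodule.mkQ ⟨y, hy⟩, (brownLow K N).toSubmodule.mkQ ⟨z, hz⟩, rfl⟩
    obtain ⟨y, hy, e⟩ := hle h
    obtain rfl : y = x := Subtype.ext e
    exact hy

variable (K N) in
/-- The realization by vector fields of the simple algebra. -/
noncomputable def thetaD4 : D4 K N →ₗ⁅K⁆ VF Idx K := (thetaQuot K N).comp (D4 K N).incl

theorem thetaD4_apply (x : D4 K N) : thetaD4 K N x = thetaQuot K N x.1 := rfl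

theorem thetaD4_injective : Function.Injective (thetaD4 K N) := fun _ _ h =>
  Subtype.ext (thetaQuot_injective h)

variable (K N) in
/-- The element of the simple algebra represented by an element of Brown's algebra. -/
noncomputable def d4Mk : derPart K N →ₗ[K] D4 K N where
  toFun x := ⟨LieSubmodule.Quotient.mk ⟨x.1, derPart_le_brownL N x.2⟩, mk_mem_D4_iff.mpr x.2⟩
  map_add' _ _ := rfl
  map_smul' _ _ := rfl

theorem thetaD4_d4Mk (x : derPart K N) : thetaD4 K N (d4Mk K N x) = theta K x.1 := rfl

theorem d4Mk_surjective : Function.Surjective (d4Mk K N) := by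
  rintro ⟨x, hx⟩
  induction x using Submodule.Quotient.induction_on with | _ x
  exact ⟨⟨x.1, mk_mem_D4_iff.mp hx⟩, rfl⟩

theorem d4Mk_lie (x y : derPart K N) : ⁅d4Mk K N x, d4Mk K N y⁆ =
    d4Mk K N ⟨⁅x.1, y.1⁆, lie_mem_derPart (derPart_le_brownL N x.2) (derPart_le_brownL N y.2)⟩ := by
  apply thetaD4_injective
  rw [LieHom.map_lie]
  simp only [thetaD4_d4Mk, LieHom.map_lie]

theorem theta_dz (k : Fin 3) : theta K (dz K k) = wz K (Pi.single k 1) := thetaLin_dz k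
theorem theta_uFst (k : Fin 3) : theta K (uFst K k) = wp K (Pi.single k 1) := thetaLin_uFst k
theorem theta_uSnd (k : Fin 3) : theta K (uSnd K k) = wq K (Pi.single k 1) := thetaLin_uSnd k

theorem theta_dz_ne_zero (k : Fin 3) : theta K (dz K k) ≠ 0 := fun h => by
  have := congrFun (theta_eq_zero_iff.mp h).1 k
  rw [vf_dz_apply, if_pos rfl] at this
  have := congrArg (DP.coeff 0) this
  rw [coeff_zero_one] at this
  exact one_ne_zero this

theorem lie_uFst_uSnd : ⁅uFst K 0, uSnd K 1⁆ = dz K 2 := by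
  refine ext (forall_fin_three ?_ ?_ ?_) ?_ ?_ <;>
    simp [vf_uFst_lie, fst_uFst_lie, snd_uFst_lie, vf_dz_apply, gradCross_zero, gradCross_one,
      gradCross_two, DP.pd_var_apply]

/-- An ideal lifts to a subspace of `derPart` stable under brackets with `derPart`, and a nonzero
class lifts to an element with nonzero realization, so `derPart_le_of_theta_ne_zero` applies.
Noncommutativity is witnessed by `lie_uFst_uSnd`. -/
theorem isSimple_D4 : LieAlgebra.IsSimple K (D4 K N) where
  eq_bot_or_eq_top I := by
    rw [or_iff_not_imp_left]
    intro hI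
    obtain ⟨z, hz, hz0⟩ : ∃ z ∈ I, z ≠ 0 := by
      by_contra! hc
      exact hI ((LieSubmodule.eq_bot_iff _).mpr hc)
    obtain ⟨x, rfl⟩ := d4Mk_surjective z
    have hle : derPart K N ≤ (I.toSubmodule.comap (d4Mk K N)).map (derPart K N).subtype := by
      refine derPart_le_of_theta_ne_zero (x := x.1) ?_ ⟨x, hz, rfl⟩ fun h => hz0 ?_
      · rintro _ ⟨y, hy, rfl⟩ w hw
        refine ⟨⟨⁅w, y.1⁆, lie_mem_derPart (derPart_le_brownL N hw) (derPart_le_brownL N y.2)⟩,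
          ?_, rfl⟩
        have := I.lie_mem (x := d4Mk K N ⟨w, hw⟩) hy
        rwa [d4Mk_lie] at this
      · exact thetaD4_injective (h.trans (map_zero _).symm)
    rw [eq_top_iff]
    intro w _
    obtain ⟨y, rfl⟩ := d4Mk_surjective w
    obtain ⟨y', hy', e⟩ := hle y.2
    obtain rfl : y' = y := Subtype.ext e
    exact hy'
  non_abelian h := by
    have hne := theta_dz_ne_zero (K := K) 2
    have e := h.trivial (d4Mk K N ⟨_, uFst_mem_derPart N 0⟩) (d4Mk K N ⟨_, uSnd_mem_derPart N 1⟩)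
    rw [d4Mk_lie] at e
    have := congrArg (thetaD4 K N) e
    rw [thetaD4_d4Mk, map_zero] at this
    rw [← lie_uFst_uSnd] at hne
    exact hne this

theorem exists_pd_eq_of_pd_eq_zero {i k : Fin 3} (hik : k ≠ i) {f : DP (Fin 3) K}
    (h : DP.pd k f = 0) : ∃ F, DP.pd i F = f ∧ DP.pd k F = 0 := by
  obtain ⟨F, hF, e⟩ : f ∈ (LinearMap.ker (DP.pd (K := K) k)).map (DP.pd i) := by
    refine DP.mem_of_mono fun r hr => ⟨_, ?_, DP.pd_mono_add i r 1⟩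
    refine LinearMap.mem_ker.mpr (DP.pd_mono_zero ?_ 1)
    by_contra hk
    obtain ⟨s, rfl⟩ := DP.eq_add_single (i := k) (r := r) (by simpa [hik] using hk)
    rw [← DP.coeff_pd, h, map_zero] at hr
    exact hr rfl
  exact ⟨F, e, hF⟩

/-- Without restrictions no monomial is the highest one, and every divergence-free field is a curl
because each `∂ᵢ` is surjective. -/
theorem derPart_top : derPart K (fun _ => ⊤) = ⊤ := by
  rw [eq_top_iff]
  rintro x -
  have hsh : ∀ f : DP (Fin 3) K, f ∈ DP.shear K (fun _ => ⊤) := fun f _ _ _ _ hn =>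
    absurd hn (by simp)
  have hno : ∀ f : DP (Fin 3) K, f ∈ DP.noTop K (fun _ => ⊤) := fun f =>
    ⟨hsh f, fun r hr => by obtain ⟨n, hn, -⟩ := hr 0; exact absurd hn (by simp)⟩
  refine ⟨?_, hno _, hno _⟩
  have hint : ∀ (i : Fin 3) (f : DP (Fin 3) K), ∃ F, DP.pd i F = f := fun i f => by
    refine (LinearMap.range_eq_top (f := DP.pd (K := K) i)).mp ?_ f
    rw [eq_top_iff]
    exact fun g _ => DP.mem_of_mono fun r _ => ⟨_, DP.pd_mono_add i r 1⟩
  -- The field is sought as the curl of `(A + C', B, 0)`. Two components prescribe `∂₂A` and `∂₂B`;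
  -- the third is adjusted by a `C'` that does not depend on `u₂`, which is possible since the
  -- divergence vanishes.
  obtain ⟨A, hA⟩ := hint 2 (x.vf 1)
  obtain ⟨B, hB⟩ := hint 2 (x.vf 0)
  have hd := x.div_vf
  obtain ⟨C', hC', hC'2⟩ := exists_pd_eq_of_pd_eq_zero (i := 1) (k := 2) (by decide)
    (f := x.vf 2 + DP.pd 0 B + DP.pd 1 A) (by
      rw [map_add, map_add, DP.pd_comm 2 0, DP.pd_comm 2 1, hA, hB]
      linear_combination hd)
  refine ⟨![A + C', B, 0], fun _ => hsh _, VF.ext (forall_fin_three ?_ ?_ ?_)⟩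
  · simp [curl_zero, hB, CharTwo.neg_eq]
  · simp [curl_one, hA, hC'2]
  · simp [curl_two, hC', CharTwo.sub_eq_add]
    grind

theorem D4_top : D4 K (fun _ => ⊤) = ⊤ := by
  rw [eq_top_iff]
  intro x _
  induction x using Submodule.Quotient.induction_on with | _ x
  refine mk_mem_D4_iff.mpr ?_
  rw [derPart_top]
  trivial

/-- The grading is thus pulled back from vector fields along an injection, and the independence of
its components is inherited. Conversely, a class with homogeneous realization has a homogeneous
representative after subtracting constants. -/
theorem mem_D4Part_iff {k : ℤ} {x : D4 K N} :
    x ∈ D4Part K N k ↔ thetaD4 K N x ∈ VF.hom K wt k := by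
  constructor
  · rintro ⟨y, hy, e⟩
    rw [thetaD4_apply, ← show (brownLow K N).toSubmodule.mkQ y = x.1 from e]
    exact theta_hom (show y.1 ∈ homPart K k from hy)
  · intro h
    obtain ⟨y, rfl⟩ := d4Mk_surjective x
    obtain ⟨a, b, hab⟩ := exists_homPart_of_theta h
    have h0 : theta K (of 0 (DP.mono 0 a) (DP.mono 0 b)) = 0 :=
      theta_eq_zero_iff.mpr ⟨rfl, fun i => DP.pd_mono_zero (by rfl) a, fun i =>
        DP.pd_mono_zero (by rfl) b⟩
    have hmem := Submodule.sub_mem _ y.2 (mem_derPart_of_theta_eq_zero (N := N) h0)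
    refine ⟨⟨_, derPart_le_brownL N hmem⟩, hab, ?_⟩
    change LieSubmodule.Quotient.mk _ = (d4Mk K N y).1
    apply thetaQuot_injective
    rw [thetaQuot_mk, map_sub, h0, sub_zero]
    rfl

/-- The vector fields whose coefficients of degree `k` vanish. -/
def VF.offDegree {σ : Type*} [Fintype σ] (K : Type*) [Field K] (w : σ → ℤ) (k : ℤ) :
    Submodule K (VF σ K) where
  carrier := {X | ∀ j r, ∑ i, w i * r i = k + w j → DP.coeff r (X j) = 0}
  zero_mem' := fun _ _ _ => map_zero _
  add_mem' := fun hX hY j r h => by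
    change DP.coeff r (_ + _) = 0
    rw [map_add, hX j r h, hY j r h, add_zero]
  smul_mem' := fun c X hX j r h => by
    change DP.coeff r (c • _) = 0
    rw [map_smul, hX j r h, smul_zero]

theorem VF.iSupIndep_hom {σ : Type*} [Fintype σ] [DecidableEq σ] (w : σ → ℤ) :
    iSupIndep (VF.hom K w) := by
  intro k
  have hle : ⨆ (l) (_ : l ≠ k), VF.hom K w l ≤ VF.offDegree K w k := by
    refine iSup₂_le fun l hl X hX j r hr => ?_
    by_contra hc
    have := hX j r hc
    omega
  refine Disjoint.mono_right hle ?_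
  rw [Submodule.disjoint_def]
  intro X h1 h2
  refine VF.ext fun j => DP.ext fun r => ?_
  rw [VF.zero_apply, map_zero]
  by_contra hc
  exact hc (h2 j r (h1 j r hc))

/-- `derPart` is generated by elements built from single monomials, and these are homogeneous. -/
theorem iSup_D4Part : ⨆ k, D4Part K N k = ⊤ := by
  have hmem : ∀ k, ∀ x ∈ derPart K N, x ∈ homPart K k →
      x ∈ ((⨆ k, D4Part K N k).comap (d4Mk K N)).map (derPart K N).subtype := fun k x hx hk =>
    ⟨⟨x, hx⟩, Submodule.mem_iSup_of_mem k (mem_D4Part_iff.mpr (theta_hom hk)), rfl⟩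
  have hmono : ∀ r : Fin 3 → ℕ, DP.mono r 1 ∈ DP.hom K (fun _ => 2) (∑ i, 2 * (r i : ℤ)) :=
    fun r s hs => by
      classical
      rw [DP.coeff_mono] at hs
      have : r = s := by_contra fun e => hs (if_neg e)
      rw [this]
  have hle : derPart K N ≤
      ((⨆ k, D4Part K N k).comap (d4Mk K N)).map (derPart K N).subtype := by
    refine derPart_le (fun g hg i => ?_) (fun f hf => ?_) (fun f hf => ?_)
    · rw [← inGradCross_apply, ← Submodule.mem_comap]
      refine DP.mem_of_mono fun r hr => ?_
      rw [Submodule.mem_comap, inGradCross_apply]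
      refine hmem (∑ i, 2 * (r i : ℤ) + 2 - 6) _
        (gradCross_var_mem (DP.mono_mem_shear (hg r hr) 1) i)
        ⟨gradCross_hom (hmono r) (var_hom_two i), Submodule.zero_mem _, Submodule.zero_mem _⟩
    · rw [← inFst_apply, ← Submodule.mem_comap]
      refine DP.mem_of_mono fun r hr => ?_
      rw [Submodule.mem_comap, inFst_apply]
      refine hmem (∑ i, 2 * (r i : ℤ) - 3) _ (of_fst_mem (DP.mono_mem_noTop (hf.1 r hr)
        (fun h => hr (hf.2 r h)) 1)) ⟨Submodule.zero_mem _, ?_, Submodule.zero_mem _⟩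
      rw [sub_add_cancel]
      exact hmono r
    · rw [← inSnd_apply, ← Submodule.mem_comap]
      refine DP.mem_of_mono fun r hr => ?_
      rw [Submodule.mem_comap, inSnd_apply]
      refine hmem (∑ i, 2 * (r i : ℤ) - 3) _ (of_snd_mem (DP.mono_mem_noTop (hf.1 r hr)
        (fun h => hr (hf.2 r h)) 1)) ⟨Submodule.zero_mem _, Submodule.zero_mem _, ?_⟩
      rw [sub_add_cancel]
      exact hmono r
  rw [eq_top_iff]
  rintro z -
  obtain ⟨x, rfl⟩ := d4Mk_surjective z
  obtain ⟨y, hy, e⟩ := hle x.2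
  obtain rfl : y = x := Subtype.ext e
  exact hy

theorem isLieGrading_D4 : IsLieGrading K (D4Part K N) where
  isInternal := by
    refine DirectSum.isInternal_submodule_of_iSupIndep_of_iSup_eq_top ?_ iSup_D4Part
    have e : ∀ k, D4Part K N k = (VF.hom K wt k).comap (thetaD4 K N).toLinearMap := fun k =>
      Submodule.ext fun _ => mem_D4Part_iff
    intro k
    rw [Submodule.disjoint_def]
    intro x h1 h2
    have hle : ⨆ (l) (_ : l ≠ k), D4Part K N l ≤
        (⨆ (l) (_ : l ≠ k), VF.hom K wt l).comap (thetaD4 K N).toLinearMap := by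
      refine iSup₂_le fun l hl y hy => ?_
      exact Submodule.mem_iSup_of_mem l (Submodule.mem_iSup_of_mem hl (mem_D4Part_iff.mp hy))
    apply thetaD4_injective
    rw [map_zero]
    exact (Submodule.disjoint_def.mp (VF.iSupIndep_hom wt k)) _ (mem_D4Part_iff.mp h1) (hle h2)
  lie_mem hx hy := by
    rw [mem_D4Part_iff] at *
    rw [LieHom.map_lie]
    exact VF.lie_hom hx hy

/-- The derived part is spanned by brackets of its elements, up to the center. -/
theorem derPart_le_of_lie_derPart {S : Submodule K (BrownSpace K)}
    (h : ∀ x ∈ derPart K N, ∀ y ∈ derPart K N, ⁅x, y⁆ ∈ S) : derPart K N ≤ S := by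
  let T : Submodule K (BrownSpace K) := Submodule.span K
    {z | ∃ x ∈ derPart K N, ∃ y ∈ derPart K N, ⁅x, y⁆ = z}
  have hT : T ≤ derPart K N := by
    refine Submodule.span_le.mpr ?_
    rintro _ ⟨x, hx, y, hy, rfl⟩
    exact lie_mem_derPart (derPart_le_brownL N hx) (derPart_le_brownL N hy)
  have hTS : T ≤ S := by
    refine Submodule.span_le.mpr ?_
    rintro _ ⟨x, hx, y, hy, rfl⟩
    exact h x hx y hy
  -- The span `T` of brackets is stable under `derPart` and contains the noncentral element `dz K
  -- 2`, so the argument for ideals shows that it exhausts `derPart`.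
  refine le_trans (derPart_le_of_theta_ne_zero (S := T) (x := dz K 2) (fun x hx y hy =>
    Submodule.mem_span_of_mem ⟨y, hy, x, hT hx, rfl⟩) ?_ (theta_dz_ne_zero 2)) hTS
  rw [← lie_uFst_uSnd]
  exact Submodule.mem_span_of_mem ⟨_, uFst_mem_derPart N 0, _, uSnd_mem_derPart N 1, rfl⟩

end Quotient

/-! ## The complete prolong with `𝔤₀ = 𝔰𝔩(3)` -/

section SlProlong

open BrownSpace

variable {K : Type*} [Field K] [CharP K 2]

theorem vf_hom_eq_zero {k : ℤ} (hk : k < -2) {X : VF Idx K} (hX : X ∈ VF.hom K wt k) : X = 0 := by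
  refine VF.ext fun j => DP.ext fun r => ?_
  rw [VF.zero_apply, map_zero]
  by_contra hc
  have h := hX j r hc
  have h1 : 0 ≤ ∑ i, wt i * (r i : ℤ) := Finset.sum_nonneg fun i _ => by
    rcases i with i | i <;> simp [wt]
  have h2 : wt j ≤ 2 := by rcases j with j | j <;> simp [wt]
  omega

variable (K) in
/-- The elements of Brown's algebra that are realized by fields in `𝔳𝔢𝔠𝔱(9; N₁, N₂, N₃, 1, …, 1)`. -/
def extPart (N : Fin 3 → WithTop ℕ+) : Submodule K (BrownSpace K) where
  carrier := {x | x.vf ∈ VF.shear K N ∧ (∀ i, DP.pd i x.fst ∈ DP.shear K N) ∧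
    ∀ i, DP.pd i x.snd ∈ DP.shear K N}
  zero_mem' := ⟨Submodule.zero_mem _, fun i => by simp, fun i => by simp⟩
  add_mem' := fun hx hy => ⟨Submodule.add_mem _ hx.1 hy.1,
    fun i => by rw [fst_add, map_add]; exact Submodule.add_mem _ (hx.2.1 i) (hy.2.1 i),
    fun i => by rw [snd_add, map_add]; exact Submodule.add_mem _ (hx.2.2 i) (hy.2.2 i)⟩
  smul_mem' := fun c _ hx => ⟨Submodule.smul_mem _ c hx.1,
    fun i => by rw [fst_smul, map_smul]; exact Submodule.smul_mem _ c (hx.2.1 i),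
    fun i => by rw [snd_smul, map_smul]; exact Submodule.smul_mem _ c (hx.2.2 i)⟩

variable {N : Fin 3 → WithTop ℕ+}

theorem brownL_le_extPart : (brownL K N).toSubmodule ≤ extPart K N := fun _ hx =>
  ⟨hx.1, fun i => DP.shear_pd i hx.2.1, fun i => DP.shear_pd i hx.2.2⟩

theorem gradCross_mem_of_pd {f g : DP (Fin 3) K} (hf : ∀ i, DP.pd i f ∈ DP.shear K N)
    (hg : ∀ i, DP.pd i g ∈ DP.shear K N) : (gradCross f g).1 ∈ VF.shear K N := by
  have h : ∀ j k, DP.pd j f * DP.pd k g ∈ DP.shear K N := fun j k => DP.shear_mul (hf j) (hg k)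
  refine forall_fin_three ?_ ?_ ?_
  · exact gradCross_zero f g ▸ Submodule.sub_mem _ (h 1 2) (h 2 1)
  · exact gradCross_one f g ▸ Submodule.sub_mem _ (h 2 0) (h 0 2)
  · exact gradCross_two f g ▸ Submodule.sub_mem _ (h 0 1) (h 1 0)

/-- The bracket uses the functions only through their gradients. An excess such as the divided power
of `uᵢ` of exponent `2 ^ Nᵢ` therefore disappears after a single commutator. -/
theorem lie_extPart {x y : BrownSpace K} (hx : x ∈ extPart K N) (hy : y ∈ extPart K N) :
    ⁅x, y⁆ ∈ brownL K N := by
  have hact : ∀ {X : VF (Fin 3) K} {f : DP (Fin 3) K}, X ∈ VF.shear K N →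
      (∀ i, DP.pd i f ∈ DP.shear K N) → X.act f ∈ DP.shear K N := fun {X f} hX hf => by
    rw [VF.act_apply]
    exact Submodule.sum_mem _ fun i _ => DP.shear_mul (hX i) (hf i)
  refine ⟨?_, ?_, ?_⟩
  · rw [vf_lie]
    exact Submodule.sub_mem _ (Submodule.add_mem _ (VF.lie_shear hx.1 hy.1)
      (gradCross_mem_of_pd hx.2.1 hy.2.2)) (gradCross_mem_of_pd hy.2.1 hx.2.2)
  · rw [fst_lie]
    exact Submodule.sub_mem _ (hact hx.1 hy.2.1) (hact hy.1 hx.2.1)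
  · rw [snd_lie]
    exact Submodule.sub_mem _ (hact hx.1 hy.2.2) (hact hy.1 hx.2.2)

theorem brownProlong_le : (brownProlong K (withOnes N)).toSubmodule ≤
    (extPart K N).map (theta K).toLinearMap := by
  change ⨆ n, prolongAux (withOnes N) (g0sl K) n ≤ _
  refine iSup_le fun n X hX => ?_
  obtain ⟨x, -, rfl, h⟩ := mem_prolongAux_g0sl.mp hX
  exact ⟨x, h, rfl⟩

/-- The grading of the simple algebra is the grading of the prolong. -/
theorem mem_D4Part_iff_prolongAux {n : ℕ} {x : D4 K N} :
    x ∈ D4Part K N (n - 2) ↔ thetaD4 K N x ∈ prolongAux (withOnes N) (g0sl K) n := by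
  constructor
  · rintro ⟨y, hy, e⟩
    have e' : thetaD4 K N x = theta K y.1 := by
      rw [thetaD4_apply, ← show (brownLow K N).toSubmodule.mkQ y = x.1 from e]; rfl
    rw [e', mem_prolongAux_g0sl]
    exact ⟨y.1, hy, rfl, brownL_le_extPart y.2⟩
  · exact fun h => mem_D4Part_iff.mpr (prolongAux_le (isDegreeZero_g0sl K _) n h).2

theorem thetaD4_mem (x : D4 K N) : thetaD4 K N x ∈ brownProlong K (withOnes N) := by
  have hle : ⨆ k, D4Part K N k ≤
      (brownProlong K (withOnes N)).toSubmodule.comap (thetaD4 K N).toLinearMap := by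
    refine iSup_le fun k x hx => ?_
    by_cases hk : k < -2
    · have h0 := vf_hom_eq_zero hk (mem_D4Part_iff.mp hx)
      rw [Submodule.mem_comap, LieHom.coe_toLinearMap, h0]
      exact Submodule.zero_mem _
    · obtain ⟨n, rfl⟩ : ∃ n : ℕ, k = n - 2 := ⟨(k + 2).toNat, by omega⟩
      exact Submodule.mem_iSup_of_mem n (mem_D4Part_iff_prolongAux.mp hx)
  rw [iSup_D4Part] at hle
  exact hle trivial

theorem theta_mem_brownProlong {x : BrownSpace K} (hx : x ∈ derPart K N) :
    theta K x ∈ brownProlong K (withOnes N) := thetaD4_mem (d4Mk K N ⟨x, hx⟩)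

theorem derivedSeries_succ_toSubmodule {L : Type*} [LieRing L] [LieAlgebra K L] (k : ℕ) :
    (LieAlgebra.derivedSeries K L (k + 1)).toSubmodule = Submodule.span K
      {z | ∃ x ∈ LieAlgebra.derivedSeries K L k, ∃ y ∈ LieAlgebra.derivedSeries K L k,
        ⁅x, y⁆ = z} := by
  rw [LieAlgebra.derivedSeries_def, LieAlgebra.derivedSeriesOfIdeal_succ,
    LieSubmodule.lieIdeal_oper_eq_linear_span']

/-- As `derPart` is spanned by brackets of its own elements, its image survives in every derived
algebra of the prolong. -/
theorem theta_mem_derivedSeries (k : ℕ) : ∀ {x : BrownSpace K} (hx : x ∈ derPart K N),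
    (⟨theta K x, theta_mem_brownProlong hx⟩ : brownProlong K (withOnes N)) ∈
      LieAlgebra.derivedSeries K (brownProlong K (withOnes N)) k := by
  induction k with
  | zero => exact fun _ => LieSubmodule.mem_top _
  | succ k ih =>
    let f : derPart K N →ₗ[K] brownProlong K (withOnes N) :=
      { toFun := fun x => ⟨theta K x.1, theta_mem_brownProlong x.2⟩
        map_add' := fun x y => Subtype.ext (map_add (theta K) x.1 y.1)
        map_smul' := fun c x => Subtype.ext (map_smul (theta K) c x.1) }
    have hle : derPart K N ≤ ((LieAlgebra.derivedSeries K (brownProlong K (withOnes N))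
        (k + 1)).toSubmodule.comap f).map (derPart K N).subtype := by
      refine derPart_le_of_lie_derPart fun x hx y hy => ?_
      refine ⟨⟨⁅x, y⁆, lie_mem_derPart (derPart_le_brownL N hx) (derPart_le_brownL N hy)⟩, ?_, rfl⟩
      rw [SetLike.mem_coe, Submodule.mem_comap, derivedSeries_succ_toSubmodule]
      exact Submodule.mem_span_of_mem
        ⟨_, ih hx, _, ih hy, Subtype.ext ((theta K).map_lie x y).symm⟩
    intro x hx
    obtain ⟨y, hy, rfl⟩ := hle hx
    exact hy

/-- The first commutator brings the prolong back into `ℒ`; the next one, in `derivedSeries_two_le`,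
leaves only curls and functions without highest term. This accounts for the second derived algebra.
-/
theorem derivedSeries_one_le {X : brownProlong K (withOnes N)}
    (hX : X ∈ LieAlgebra.derivedSeries K (brownProlong K (withOnes N)) 1) :
    ∃ x ∈ brownL K N, theta K x = X.1 := by
  have hle : (LieAlgebra.derivedSeries K (brownProlong K (withOnes N)) 1).toSubmodule ≤
      ((brownL K N).toSubmodule.map (theta K).toLinearMap).comap
        (brownProlong K (withOnes N)).toSubmodule.subtype := by
    rw [derivedSeries_succ_toSubmodule, Submodule.span_le]
    rintro _ ⟨Y, -, Z, -, rfl⟩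
    obtain ⟨y, hy, ey⟩ := brownProlong_le Y.2
    obtain ⟨z, hz, ez⟩ := brownProlong_le Z.2
    refine ⟨⁅y, z⁆, lie_extPart hy hz, ?_⟩
    change theta K ⁅y, z⁆ = ⁅Y.1, Z.1⁆
    rw [LieHom.map_lie]
    exact congrArg₂ _ ey ez
  exact hle hX

theorem derivedSeries_two_le {X : brownProlong K (withOnes N)}
    (hX : X ∈ LieAlgebra.derivedSeries K (brownProlong K (withOnes N)) 2) :
    ∃ x ∈ derPart K N, theta K x = X.1 := by
  have hle : (LieAlgebra.derivedSeries K (brownProlong K (withOnes N)) 2).toSubmodule ≤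
      ((derPart K N).map (theta K).toLinearMap).comap
        (brownProlong K (withOnes N)).toSubmodule.subtype := by
    rw [derivedSeries_succ_toSubmodule, Submodule.span_le]
    rintro _ ⟨Y, hY, Z, hZ, rfl⟩
    obtain ⟨y, hy, ey⟩ := derivedSeries_one_le hY
    obtain ⟨z, hz, ez⟩ := derivedSeries_one_le hZ
    refine ⟨⁅y, z⁆, lie_mem_derPart hy hz, ?_⟩
    change theta K ⁅y, z⁆ = ⁅Y.1, Z.1⁆
    rw [LieHom.map_lie]
    exact congrArg₂ _ ey ez
  exact hle hX

/-- Brown's algebra is the second derived algebra of the prolong. -/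
theorem exists_equiv_derivedSeries (N : Fin 3 → WithTop ℕ+) :
    ∃ e : D4 K N ≃ₗ⁅K⁆ LieAlgebra.derivedSeries K (brownProlong K (withOnes N)) 2,
      ∀ x, ((e x).1 : VF Idx K) = thetaD4 K N x := by
  have hmem : ∀ x : D4 K N, (⟨thetaD4 K N x, thetaD4_mem x⟩ : brownProlong K (withOnes N)) ∈
      LieAlgebra.derivedSeries K (brownProlong K (withOnes N)) 2 := fun x => by
    obtain ⟨y, rfl⟩ := d4Mk_surjective x
    exact theta_mem_derivedSeries 2 y.2
  let f : D4 K N →ₗ⁅K⁆ LieAlgebra.derivedSeries K (brownProlong K (withOnes N)) 2 :=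
    { toFun := fun x => ⟨⟨thetaD4 K N x, thetaD4_mem x⟩, hmem x⟩
      map_add' := fun x y => Subtype.ext (Subtype.ext (map_add (thetaD4 K N) x y))
      map_smul' := fun c x => Subtype.ext (Subtype.ext (map_smul (thetaD4 K N) c x))
      map_lie' := fun {x y} => Subtype.ext (Subtype.ext ((thetaD4 K N).map_lie x y)) }
  refine ⟨LieEquiv.ofBijective f ⟨fun x y h => thetaD4_injective ?_, fun X => ?_⟩, fun x => rfl⟩
  · exact congrArg (fun z => (z.1 : VF Idx K)) h
  · obtain ⟨x, hx, e⟩ := derivedSeries_two_le X.2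
    exact ⟨d4Mk K N ⟨x, hx⟩, Subtype.ext (Subtype.ext e)⟩

variable (K) in
/-- Brown's algebra without restrictions is the prolong. -/
theorem exists_equiv_brownProlong : ∃ e : D4 K (fun _ => ⊤) ≃ₗ⁅K⁆ brownProlong K (fun _ => ⊤),
    ∀ (n : ℕ) x, x ∈ D4Part K (fun _ => ⊤) (n - 2) ↔
      (e x : VF Idx K) ∈ prolongAux (fun _ => ⊤) (g0sl K) n := by
  have hmem : ∀ X, X ∈ brownProlong K (fun _ => ⊤) ↔ X ∈ brownProlong K (withOnes fun _ => ⊤) := by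
    intro X
    change X ∈ ⨆ n, prolongAux (fun _ => ⊤) (g0sl K) n ↔
      X ∈ ⨆ n, prolongAux (withOnes fun _ => ⊤) (g0sl K) n
    simp only [prolongAux_g0sl_withOnes K (fun _ => ⊤)]
  let f : D4 K (fun _ => ⊤) →ₗ⁅K⁆ brownProlong K (fun _ => ⊤) :=
    { toFun := fun x => ⟨thetaD4 K _ x, (hmem _).mpr (thetaD4_mem x)⟩
      map_add' := fun x y => Subtype.ext (map_add (thetaD4 K _) x y)
      map_smul' := fun c x => Subtype.ext (map_smul (thetaD4 K _) c x)
      map_lie' := fun {x y} => Subtype.ext ((thetaD4 K _).map_lie x y) }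
  refine ⟨LieEquiv.ofBijective f ⟨fun x y h => thetaD4_injective (congrArg Subtype.val h),
    fun X => ?_⟩, fun n x => ?_⟩
  · obtain ⟨x, -, e⟩ := brownProlong_le ((hmem _).mp X.2)
    refine ⟨d4Mk K _ ⟨x, ?_⟩, Subtype.ext e⟩
    rw [derPart_top]
    trivial
  · rw [mem_D4Part_iff_prolongAux, prolongAux_g0sl_withOnes K (fun _ => ⊤)]
    rfl

/-- A traceless linear field is the curl of a field whose coefficients are products of two distinct
indeterminates. These lie in every `𝒪(N)`, so all of `𝔰𝔩(3)` is retained for every `N`. -/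
theorem mem_derPart_of_homPart_zero {x : BrownSpace K} (hx : x ∈ homPart K 0) :
    x ∈ derPart K N := by
  have hl := fun i => eq_sum_var_of_hom (hx.1 i)
  have ht := x.div_vf
  set c : Fin 3 → Fin 3 → K := fun i j => DP.coeff 0 (DP.pd j (x.vf i)) with hc
  have hl' : ∀ i, x.vf i = c i 0 • DP.var K 0 + c i 1 • DP.var K 1 + c i 2 • DP.var K 2 :=
    fun i => by rw [hl i, Fin.sum_univ_three]
  have htr : c 0 0 = c 1 1 + c 2 2 := by
    have := congrArg (DP.coeff 0) ht
    rw [map_add, map_add, map_zero] at this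
    change c 0 0 + c 1 1 + c 2 2 = 0 at this
    rw [add_assoc, ← CharTwo.sub_eq_add, sub_eq_zero] at this
    exact this
  clear_value c
  have hm : ∀ (a : K) i j, a • (DP.var K i * DP.var K j) ∈ DP.shear K N := fun a i j =>
    Submodule.smul_mem _ _ (DP.shear_mul (DP.var_mem_shear N i) (DP.var_mem_shear N j))
  -- The trace condition `htr` has eliminated `c 0 0`. The remaining two diagonal entries enter
  -- through the third and the second component of the potential.
  refine ⟨⟨![c 1 0 • (DP.var K 0 * DP.var K 2) + c 2 0 • (DP.var K 0 * DP.var K 1),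
    c 2 2 • (DP.var K 0 * DP.var K 2) + c 0 1 • (DP.var K 1 * DP.var K 2) +
      c 2 1 • (DP.var K 0 * DP.var K 1),
    c 1 1 • (DP.var K 0 * DP.var K 1) + c 0 2 • (DP.var K 1 * DP.var K 2) +
      c 1 2 • (DP.var K 0 * DP.var K 2)], ?_, ?_⟩, ?_, ?_⟩
  · refine forall_fin_three ?_ ?_ ?_
    · exact Submodule.add_mem _ (hm _ _ _) (hm _ _ _)
    · exact Submodule.add_mem _ (Submodule.add_mem _ (hm _ _ _) (hm _ _ _)) (hm _ _ _)
    · exact Submodule.add_mem _ (Submodule.add_mem _ (hm _ _ _) (hm _ _ _)) (hm _ _ _)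
  · refine VF.ext (forall_fin_three ?_ ?_ ?_) <;>
      simp [hl', curl_zero, curl_one, curl_two, DP.pd_mul, DP.pd_var_apply, CharTwo.sub_eq_add,
        htr, add_smul] <;> abel
  · rw [fst_eq_zero_of_even hx Even.zero]; exact Submodule.zero_mem _
  · rw [snd_eq_zero_of_even hx Even.zero]; exact Submodule.zero_mem _

/-- The simple algebra contains the non-positive part of the prolong. -/
theorem exists_thetaD4_eq {n : ℕ} (hn : n ≤ 2) {X : VF Idx K}
    (hX : X ∈ prolongAux (withOnes N) (g0sl K) n) : ∃ x, thetaD4 K N x = X := by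
  have h0 : ∀ x ∈ derPart K N, theta K x ∈ LinearMap.range (thetaD4 K N).toLinearMap :=
    fun x hx => ⟨d4Mk K N ⟨x, hx⟩, rfl⟩
  suffices X ∈ LinearMap.range (thetaD4 K N).toLinearMap from this
  match n, hn, hX with
  | 0, _, hX =>
    exact gm2_le_of_single (fun i => theta_dz (K := K) i ▸ h0 _ (dz_mem_derPart N i)) hX
  | 1, _, hX =>
    exact gm1_le_of_single (fun i => theta_uFst (K := K) i ▸ h0 _ (uFst_mem_derPart N i))
      (fun i => theta_uSnd (K := K) i ▸ h0 _ (uSnd_mem_derPart N i)) hX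
  | 2, _, hX =>
    have hX' : X ∈ g0sl K := hX
    rw [← map_theta_zero] at hX'
    obtain ⟨x, hx, rfl⟩ := hX'
    exact h0 x (mem_derPart_of_homPart_zero hx)

/-- The exponents of the quadratic monomials in three indeterminates. -/
def quadIdx : Finset (Fin 3 → ℕ) :=
  (Fintype.piFinset fun _ => Finset.range 3).filter fun r => ∑ i, r i = 2

theorem card_quadIdx : quadIdx.card = 6 := by decide +kernel

variable (K) in
/-- The quadratic functions of three indeterminates. -/
noncomputable def quad : (quadIdx → K) →ₗ[K] DP (Fin 3) K :=
  Fintype.linearCombination K fun r => DP.mono r.1 1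

theorem coeff_quad (a : quadIdx → K) (t : quadIdx) : DP.coeff t.1 (quad K a) = a t := by
  classical
  rw [quad, Fintype.linearCombination_apply, map_sum, Finset.sum_eq_single t]
  · rw [map_smul, DP.coeff_mono, if_pos rfl, smul_eq_mul, mul_one]
  · intro r _ hr
    rw [map_smul, DP.coeff_mono, if_neg fun e => hr (Subtype.ext e), smul_zero]
  · exact fun h => absurd (Finset.mem_univ t) h

theorem sum_of_mem_quadIdx {r : Fin 3 → ℕ} (h : r ∈ quadIdx) : ∑ i, r i = 2 :=
  (Finset.mem_filter.mp h).2

theorem mem_quadIdx {r : Fin 3 → ℕ} (h : ∑ i, r i = 2) : r ∈ quadIdx := by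
  refine Finset.mem_filter.mpr ⟨Fintype.mem_piFinset.mpr fun i => Finset.mem_range.mpr ?_, h⟩
  have := Finset.single_le_sum (f := r) (fun _ _ => Nat.zero_le _) (Finset.mem_univ i)
  omega

theorem quad_hom (a : quadIdx → K) : quad K a ∈ DP.hom K (fun _ => 2) 4 := by
  classical
  rw [quad, Fintype.linearCombination_apply]
  refine Submodule.sum_mem _ fun r _ => Submodule.smul_mem _ _ fun s hs => ?_
  rw [DP.coeff_mono] at hs
  have e : r.1 = s := by_contra fun e => hs (if_neg e)
  rw [← e, ← Finset.mul_sum]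
  have := sum_of_mem_quadIdx r.2
  exact_mod_cast congrArg (2 * ·) this

theorem exists_quad {f : DP (Fin 3) K} (hf : f ∈ DP.hom K (fun _ => 2) 4) :
    ∃ a, quad K a = f := by
  refine ⟨fun r => DP.coeff r.1 f, DP.ext fun t => ?_⟩
  by_cases ht : ∑ i, t i = 2
  · exact coeff_quad _ ⟨t, mem_quadIdx ht⟩
  · have h : ∀ g ∈ DP.hom K (fun _ => 2) 4, DP.coeff t g = 0 := fun g hg => by
      by_contra hc
      have := hg t hc
      rw [← Finset.mul_sum] at this
      apply ht
      have h2 : ((∑ i, t i : ℕ) : ℤ) = 2 := by push_cast; linarith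
      exact_mod_cast h2
    rw [h _ hf, h _ (quad_hom _)]

/-- In degree 1 there are no fields in `D`, and each copy of the functions contributes its six
quadratic monomials. The divided squares count for every `N`, as only their gradients must lie in
`𝒪(N)`. -/
theorem finrank_prolongAux_g0sl (N : Fin 3 → WithTop ℕ+) :
    Module.finrank K (prolongAux (withOnes N) (g0sl K) 3) = 12 := by
  let f : (quadIdx → K) × (quadIdx → K) →ₗ[K] VF Idx K :=
    (theta K).toLinearMap ∘ₗ (inFst K ∘ₗ quad K).coprod (inSnd K ∘ₗ quad K)
  have hf : ∀ a b, f (a, b) = theta K (of 0 (quad K a) (quad K b)) := fun a b => by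
    refine congrArg (theta K) (ext ?_ ?_ ?_) <;> simp [inFst_apply, inSnd_apply]
  have hrange : LinearMap.range f = prolongAux (withOnes N) (g0sl K) 3 := by
    ext X
    rw [mem_prolongAux_g0sl]
    constructor
    · rintro ⟨⟨a, b⟩, rfl⟩
      have hpd : ∀ a i, DP.pd i (quad K a) ∈ DP.shear K N := fun a i => by
        have := DP.hom_pd i (quad_hom a)
        rw [eq_sum_var_of_hom this]
        exact Submodule.sum_mem _ fun j _ => Submodule.smul_mem _ _ (DP.var_mem_shear N j)
      rw [hf]
      have e : (((3 : ℕ) : ℤ) - 2 + 3) = 4 := by norm_num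
      refine ⟨of 0 (quad K a) (quad K b), ⟨Submodule.zero_mem _, ?_, ?_⟩, rfl,
        Submodule.zero_mem _, hpd a, hpd b⟩
      · rw [e]; exact quad_hom a
      · rw [e]; exact quad_hom b
    · rintro ⟨x, hx, rfl, -⟩
      obtain ⟨a, ha⟩ := exists_quad hx.2.1
      obtain ⟨b, hb⟩ := exists_quad hx.2.2
      refine ⟨(a, b), ?_⟩
      rw [hf, ha, hb]
      congr 1
      exact ext (fun i => by rw [vf_eq_zero_of_odd hx (by decide)]; rfl) rfl rfl
  have hinj : Function.Injective f := by
    refine (injective_iff_map_eq_zero f).mpr ?_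
    rintro ⟨a, b⟩ h
    rw [hf, theta_eq_zero_iff] at h
    have h0 : ∀ r : quadIdx, r.1 ≠ 0 := fun r e => by
      have := sum_of_mem_quadIdx r.2
      rw [e] at this
      simp at this
    refine Prod.ext (funext fun r => ?_) (funext fun r => ?_)
    · exact (coeff_quad a r).symm.trans (DP.coeff_eq_zero_of_pd h.2.1 (h0 r))
    · exact (coeff_quad b r).symm.trans (DP.coeff_eq_zero_of_pd h.2.2 (h0 r))
  rw [← hrange, LinearMap.finrank_range_of_inj hinj, Module.finrank_prod, Module.finrank_fintype_fun_eq_card,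
    Fintype.card_coe, card_quadIdx]

end SlProlong

/-! ## The orthogonal algebra -/

section OrthogonalReal

open BrownSpace

variable {K : Type*} [Field K]

/-- Matrices of size 8 in block form. -/
abbrev Mat8 (K : Type*) : Type _ := Matrix (Fin 4 ⊕ Fin 4) (Fin 4 ⊕ Fin 4) K

/-- The alternating matrix with given entries. -/
def altM (v w : Fin 3 → K) : Matrix (Fin 4) (Fin 4) K :=
  !![0, v 2, v 1, w 0; v 2, 0, v 0, w 1; v 1, v 0, 0, w 2; w 0, w 1, w 2, 0]

variable [CharP K 2]

local notation "u₀" => DP.var K (0 : Fin 3)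
local notation "u₁" => DP.var K (1 : Fin 3)
local notation "u₂" => DP.var K (2 : Fin 3)

/-- The divergence-free field attached to a matrix. -/
noncomputable def psiVF (M : Mat8 K) : svect K :=
  ⟨(![M (.inr 1) (.inl 2) • 1 + (M (.inl 0) (.inl 0) + M (.inl 3) (.inl 3)) • u₀ +
        M (.inl 0) (.inl 1) • u₁ + M (.inl 0) (.inl 2) • u₂ + M (.inl 2) (.inr 0) • (u₀ * u₁) +
        M (.inl 0) (.inr 1) • (u₀ * u₂),
      M (.inr 2) (.inl 0) • 1 + M (.inl 1) (.inl 0) • u₀ +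
        (M (.inl 1) (.inl 1) + M (.inl 3) (.inl 3)) • u₁ + M (.inl 1) (.inl 2) • u₂ +
        M (.inl 1) (.inr 2) • (u₀ * u₁) + M (.inl 0) (.inr 1) • (u₁ * u₂),
      M (.inr 0) (.inl 1) • 1 + M (.inl 2) (.inl 0) • u₀ + M (.inl 2) (.inl 1) • u₁ +
        (M (.inl 0) (.inl 0) + M (.inl 1) (.inl 1)) • u₂ + M (.inl 1) (.inr 2) • (u₀ * u₂) +
        M (.inl 2) (.inr 0) • (u₁ * u₂)] : Fin 3 → DP (Fin 3) K), by
    change ∑ i, DP.pd i _ = 0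
    have h2 : (2 : DP (Fin 3) K) = 0 := CharTwo.two_eq_zero
    simp [Fin.sum_univ_three, DP.pd_mul, DP.pd_var_apply, DP.pd_one, add_smul]
    abel_nf
    simp [two_smul, CharTwo.add_self_eq_zero]⟩

theorem psiVF_zero (M : Mat8 K) : (psiVF M).1 0 = M (.inr 1) (.inl 2) • 1 + (M (.inl 0) (.inl 0) + M (.inl 3) (.inl 3)) • u₀ +
        M (.inl 0) (.inl 1) • u₁ + M (.inl 0) (.inl 2) • u₂ + M (.inl 2) (.inr 0) • (u₀ * u₁) +
        M (.inl 0) (.inr 1) • (u₀ * u₂) := rfl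
theorem psiVF_one (M : Mat8 K) : (psiVF M).1 1 = M (.inr 2) (.inl 0) • 1 + M (.inl 1) (.inl 0) • u₀ +
        (M (.inl 1) (.inl 1) + M (.inl 3) (.inl 3)) • u₁ + M (.inl 1) (.inl 2) • u₂ +
        M (.inl 1) (.inr 2) • (u₀ * u₁) + M (.inl 0) (.inr 1) • (u₁ * u₂) := rfl
theorem psiVF_two (M : Mat8 K) : (psiVF M).1 2 = M (.inr 0) (.inl 1) • 1 + M (.inl 2) (.inl 0) • u₀ + M (.inl 2) (.inl 1) • u₁ +
        (M (.inl 0) (.inl 0) + M (.inl 1) (.inl 1)) • u₂ + M (.inl 1) (.inr 2) • (u₀ * u₂) +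
        M (.inl 2) (.inr 0) • (u₁ * u₂) := rfl

variable (K) in
/-- The element of Brown's algebra attached to a matrix. -/
noncomputable def psi : Mat8 K →ₗ[K] BrownSpace K where
  toFun M := of (psiVF M)
    (M (.inl 3) (.inl 0) • u₀ + M (.inl 3) (.inl 1) • u₁ + M (.inl 3) (.inl 2) • u₂ +
      M (.inl 0) (.inr 3) • (u₁ * u₂) + M (.inl 1) (.inr 3) • (u₀ * u₂) +
      M (.inl 2) (.inr 3) • (u₀ * u₁))
    (M (.inr 0) (.inl 3) • u₀ + M (.inr 1) (.inl 3) • u₁ + M (.inr 2) (.inl 3) • u₂ +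
      M (.inl 0) (.inl 3) • (u₁ * u₂) + M (.inl 1) (.inl 3) • (u₀ * u₂) +
      M (.inl 2) (.inl 3) • (u₀ * u₁))
  map_add' M M' := by
    refine ext (forall_fin_three ?_ ?_ ?_) ?_ ?_ <;> simp [psiVF_zero, psiVF_one, psiVF_two, add_smul] <;> abel
  map_smul' c M := by
    refine ext (forall_fin_three ?_ ?_ ?_) ?_ ?_ <;> simp [psiVF_zero, psiVF_one, psiVF_two, mul_smul, add_smul, mul_add]

theorem vf_psi (M : Mat8 K) : (psi K M).vf = (psiVF M).1 := rfl
theorem fst_psi (M : Mat8 K) : (psi K M).fst =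
    M (.inl 3) (.inl 0) • u₀ + M (.inl 3) (.inl 1) • u₁ + M (.inl 3) (.inl 2) • u₂ +
      M (.inl 0) (.inr 3) • (u₁ * u₂) + M (.inl 1) (.inr 3) • (u₀ * u₂) +
      M (.inl 2) (.inr 3) • (u₀ * u₁) := rfl
theorem snd_psi (M : Mat8 K) : (psi K M).snd =
    M (.inr 0) (.inl 3) • u₀ + M (.inr 1) (.inl 3) • u₁ + M (.inr 2) (.inl 3) • u₂ +
      M (.inl 0) (.inl 3) • (u₁ * u₂) + M (.inl 1) (.inl 3) • (u₀ * u₂) +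
      M (.inl 2) (.inl 3) • (u₀ * u₁) := rfl

/-- The matrices in the second derived algebra. -/
def blockM (a : Matrix (Fin 4) (Fin 4) K) (β w γ t : Fin 3 → K) : Mat8 K :=
  Matrix.fromBlocks a (altM β w) (altM γ t) a.transpose

theorem DP.smul_eq_mul {σ K : Type*} [Field K] [Fintype σ] (c : K) (f : DP σ K) :
    c • f = (c • (1 : DP σ K)) * f := by rw [DP.smul_mul, one_mul]

-- Scalars are turned into elements of the ring of functions, so that the bracket formulas below
-- become identities in a commutative ring.
variable (K) in
noncomputable def DP.C : K →+* DP (Fin 3) K where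
  toFun c := c • 1
  map_one' := one_smul _ _
  map_mul' a b := by rw [DP.smul_mul, one_mul, SemigroupAction.mul_smul]
  map_zero' := zero_smul _ _
  map_add' a b := add_smul a b _

theorem DP.smul_eq_C (c : K) (f : DP (Fin 3) K) : c • f = DP.C K c * f := DP.smul_eq_mul c f

section Bracket

variable {a a' : Matrix (Fin 4) (Fin 4) K} (β w γ t β' w' γ' t' : Fin 3 → K)
    (ha : a 2 2 = a 0 0 + a 1 1 + a 3 3) (ha' : a' 2 2 = a' 0 0 + a' 1 1 + a' 3 3)
include ha ha'

/-- In `psi` the vectors `γ` and `β` give constant and quadratic fields, the upper 3 by 3 part of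
`a` with the trace condition gives the linear fields, and the last row and column of `a` together
with `w` and `t` give the linear and quadratic functions. Brackets are preserved up to constant
functions; recording the constant makes the identity exact and open to direct expansion. -/
theorem fst_lie_psi : ⁅psi K (blockM a β w γ t), psi K (blockM a' β' w' γ' t')⁆.fst =
    (psi K ⁅blockM a β w γ t, blockM a' β' w' γ' t'⁆).fst +
      (γ 0 * a' 3 0 + γ 1 * a' 3 1 + γ 2 * a' 3 2 + γ' 0 * a 3 0 + γ' 1 * a 3 1 + γ' 2 * a 3 2) •
        1 := by
  rw [fst_lie, VF.act_apply, VF.act_apply, Fin.sum_univ_three, Fin.sum_univ_three, fst_psi, fst_psi,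
    fst_psi, vf_psi, vf_psi, psiVF_zero, psiVF_one, psiVF_two, psiVF_zero, psiVF_one, psiVF_two]
  have h2 : (2 : DP (Fin 3) K) = 0 := CharTwo.two_eq_zero
  have h0 : u₀ * u₀ = 0 := DP.var_mul_self _
  have h1 : u₁ * u₁ = 0 := DP.var_mul_self _
  have h3 : u₂ * u₂ = 0 := DP.var_mul_self _
  simp only [Ring.lie_def, Matrix.sub_apply, Matrix.mul_apply, Fintype.sum_sum_type,
    Fin.sum_univ_four, blockM, Matrix.fromBlocks_apply₁₁, Matrix.fromBlocks_apply₁₂,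
    Matrix.fromBlocks_apply₂₁, Matrix.fromBlocks_apply₂₂, altM, Matrix.transpose_apply,
    CharTwo.sub_eq_add]
  simp [DP.pd_mul, DP.pd_var_apply, ha, ha']
  simp only [DP.smul_eq_C, map_add, map_mul, map_zero]
  generalize DP.C K = C
  grind

theorem snd_lie_psi : ⁅psi K (blockM a β w γ t), psi K (blockM a' β' w' γ' t')⁆.snd =
    (psi K ⁅blockM a β w γ t, blockM a' β' w' γ' t'⁆).snd +
      (γ 0 * t' 0 + γ 1 * t' 1 + γ 2 * t' 2 + γ' 0 * t 0 + γ' 1 * t 1 + γ' 2 * t 2) • 1 := by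
  rw [snd_lie, VF.act_apply, VF.act_apply, Fin.sum_univ_three, Fin.sum_univ_three, snd_psi, snd_psi,
    snd_psi, vf_psi, vf_psi, psiVF_zero, psiVF_one, psiVF_two, psiVF_zero, psiVF_one, psiVF_two]
  have h2 : (2 : DP (Fin 3) K) = 0 := CharTwo.two_eq_zero
  have h0 : u₀ * u₀ = 0 := DP.var_mul_self _
  have h1 : u₁ * u₁ = 0 := DP.var_mul_self _
  have h3 : u₂ * u₂ = 0 := DP.var_mul_self _
  simp only [Ring.lie_def, Matrix.sub_apply, Matrix.mul_apply, Fintype.sum_sum_type,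
    Fin.sum_univ_four, blockM, Matrix.fromBlocks_apply₁₁, Matrix.fromBlocks_apply₁₂,
    Matrix.fromBlocks_apply₂₁, Matrix.fromBlocks_apply₂₂, altM, Matrix.transpose_apply,
    CharTwo.sub_eq_add]
  simp [DP.pd_mul, DP.pd_var_apply, ha, ha']
  simp only [DP.smul_eq_C, map_add, map_mul, map_zero]
  generalize DP.C K = C
  grind

theorem vf_lie_psi : ⁅psi K (blockM a β w γ t), psi K (blockM a' β' w' γ' t')⁆.vf =
    (psi K ⁅blockM a β w γ t, blockM a' β' w' γ' t'⁆).vf := by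
  have h2 : (2 : DP (Fin 3) K) = 0 := CharTwo.two_eq_zero
  have h0 : u₀ * u₀ = 0 := DP.var_mul_self _
  have h1 : u₁ * u₁ = 0 := DP.var_mul_self _
  have h3 : u₂ * u₂ = 0 := DP.var_mul_self _
  refine VF.ext (forall_fin_three ?_ ?_ ?_)
  all_goals
    simp only [vf_lie, VF.sub_apply, VF.add_apply, VF.lie_apply, VF.act_apply, Fin.sum_univ_three,
      fst_psi, snd_psi, vf_psi, psiVF_zero, psiVF_one, psiVF_two, gradCross_zero, gradCross_one,
      gradCross_two]
    simp only [Ring.lie_def, Matrix.sub_apply, Matrix.mul_apply, Fintype.sum_sum_type,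
      Fin.sum_univ_four, blockM, Matrix.fromBlocks_apply₁₁, Matrix.fromBlocks_apply₁₂,
      Matrix.fromBlocks_apply₂₁, Matrix.fromBlocks_apply₂₂, altM, Matrix.transpose_apply,
      CharTwo.sub_eq_add]
    simp [DP.pd_mul, DP.pd_var_apply, DP.pd_one, ha, ha']
    simp only [DP.smul_eq_C, map_add, map_mul, map_zero]
    generalize DP.C K = C
    grind

end Bracket

end OrthogonalReal

/-! ### Root vectors and the second derived algebra of `𝔬_Π(8)`. -/

section OrthogonalStructure

open BrownSpace

variable {K : Type*} [Field K]

variable (K) in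
/-- The matrices in the second derived algebra of the orthogonal algebra. -/
def oPiDer : Submodule K (Mat8 K) where
  carrier := {M | (∀ i j, M (.inr i) (.inr j) = M (.inl j) (.inl i)) ∧
    ((∀ i j, M (.inl i) (.inr j) = M (.inl j) (.inr i)) ∧ ∀ i, M (.inl i) (.inr i) = 0) ∧
    ((∀ i j, M (.inr i) (.inl j) = M (.inr j) (.inl i)) ∧ ∀ i, M (.inr i) (.inl i) = 0) ∧
    ∑ i, M (.inl i) (.inl i) = 0}
  zero_mem' := by simp
  add_mem' := by
    rintro M M' ⟨h1, ⟨h2, h3⟩, ⟨h4, h5⟩, h6⟩ ⟨k1, ⟨k2, k3⟩, ⟨k4, k5⟩, k6⟩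
    refine ⟨fun i j => ?_, ⟨fun i j => ?_, fun i => ?_⟩, ⟨fun i j => ?_, fun i => ?_⟩, ?_⟩
    · rw [Matrix.add_apply, h1, k1, Matrix.add_apply]
    · rw [Matrix.add_apply, h2, k2, Matrix.add_apply]
    · rw [Matrix.add_apply, h3, k3, add_zero]
    · rw [Matrix.add_apply, h4, k4, Matrix.add_apply]
    · rw [Matrix.add_apply, h5, k5, add_zero]
    · simp only [Matrix.add_apply, Finset.sum_add_distrib, h6, k6, add_zero]
  smul_mem' := by
    rintro c M ⟨h1, ⟨h2, h3⟩, ⟨h4, h5⟩, h6⟩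
    refine ⟨fun i j => ?_, ⟨fun i j => ?_, fun i => ?_⟩, ⟨fun i j => ?_, fun i => ?_⟩, ?_⟩
    · rw [Matrix.smul_apply, h1, Matrix.smul_apply]
    · rw [Matrix.smul_apply, h2, Matrix.smul_apply]
    · rw [Matrix.smul_apply, h3, smul_zero]
    · rw [Matrix.smul_apply, h4, Matrix.smul_apply]
    · rw [Matrix.smul_apply, h5, smul_zero]
    · simp only [Matrix.smul_apply, ← Finset.smul_sum, h6, smul_zero]

/-- The block diagonal matrices in the orthogonal algebra. -/
def diagA : Matrix (Fin 4) (Fin 4) K →ₗ[K] Mat8 K where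
  toFun x := Matrix.fromBlocks x 0 0 x.transpose
  map_add' x y := by rw [Matrix.fromBlocks_add, Matrix.transpose_add, add_zero]
  map_smul' c x := by rw [RingHom.id_apply, Matrix.fromBlocks_smul, Matrix.transpose_smul, smul_zero]
/-- The upper triangular matrices in the orthogonal algebra. -/
def upperB : Matrix (Fin 4) (Fin 4) K →ₗ[K] Mat8 K where
  toFun y := Matrix.fromBlocks 0 y 0 0
  map_add' x y := by rw [Matrix.fromBlocks_add, add_zero]
  map_smul' c x := by rw [RingHom.id_apply, Matrix.fromBlocks_smul, smul_zero]
/-- The lower triangular matrices in the orthogonal algebra. -/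
def lowerC : Matrix (Fin 4) (Fin 4) K →ₗ[K] Mat8 K where
  toFun z := Matrix.fromBlocks 0 0 z 0
  map_add' x y := by rw [Matrix.fromBlocks_add, add_zero]
  map_smul' c x := by rw [RingHom.id_apply, Matrix.fromBlocks_smul, smul_zero]

theorem diagA_apply (x : Matrix (Fin 4) (Fin 4) K) :
    diagA x = Matrix.fromBlocks x 0 0 x.transpose := rfl
theorem upperB_apply (y : Matrix (Fin 4) (Fin 4) K) : upperB y = Matrix.fromBlocks 0 y 0 0 := rfl
theorem lowerC_apply (z : Matrix (Fin 4) (Fin 4) K) : lowerC z = Matrix.fromBlocks 0 0 z 0 := rfl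

variable (K) in
/-- Root vectors. -/
def rootA (i j : Fin 4) : Mat8 K := diagA (Matrix.single i j 1)
variable (K) in
/-- Root vectors. -/
def rootB (i j : Fin 4) : Mat8 K := upperB (Matrix.single i j 1 + Matrix.single j i 1)
variable (K) in
/-- Root vectors. -/
def rootC (i j : Fin 4) : Mat8 K := lowerC (Matrix.single i j 1 + Matrix.single j i 1)
variable (K) in
/-- Elements of the maximal torus. -/
def torusH (i : Fin 4) : Mat8 K := diagA (Matrix.single i i 1 + Matrix.single 3 3 1)

theorem rootB_comm (i j : Fin 4) : rootB K i j = rootB K j i := by rw [rootB, add_comm, rootB]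
theorem rootC_comm (i j : Fin 4) : rootC K i j = rootC K j i := by rw [rootC, add_comm, rootC]

theorem rootA_mem {i j : Fin 4} (h : i ≠ j) : rootA K i j ∈ oPiDer K := by
  refine ⟨fun k l => ?_, ⟨fun k l => ?_, fun k => ?_⟩, ⟨fun k l => ?_, fun k => ?_⟩, ?_⟩ <;>
    simp [rootA, diagA_apply]
  · simp only [Matrix.single_apply, and_comm]
  · refine Finset.sum_eq_zero fun k _ => ?_
    rw [Matrix.single_apply, if_neg]
    rintro ⟨rfl, e⟩
    exact h e.symm

theorem rootB_mem {i j : Fin 4} (h : i ≠ j) : rootB K i j ∈ oPiDer K := by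
  refine ⟨fun k l => ?_, ⟨fun k l => ?_, fun k => ?_⟩, ⟨fun k l => ?_, fun k => ?_⟩, ?_⟩ <;>
    simp [rootB, upperB_apply, Matrix.single_apply]
  · rw [add_comm]; simp only [and_comm]
  · rw [if_neg, if_neg, add_zero]
    · rintro ⟨rfl, e⟩; exact h e
    · rintro ⟨rfl, e⟩; exact h e.symm

theorem rootC_mem {i j : Fin 4} (h : i ≠ j) : rootC K i j ∈ oPiDer K := by
  refine ⟨fun k l => ?_, ⟨fun k l => ?_, fun k => ?_⟩, ⟨fun k l => ?_, fun k => ?_⟩, ?_⟩ <;>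
    simp [rootC, lowerC_apply, Matrix.single_apply]
  · rw [add_comm]; simp only [and_comm]
  · rw [if_neg, if_neg, add_zero]
    · rintro ⟨rfl, e⟩; exact h e
    · rintro ⟨rfl, e⟩; exact h e.symm

variable [CharP K 2]

theorem lie_diagA_diagA (x y : Matrix (Fin 4) (Fin 4) K) :
    ⁅diagA x, diagA y⁆ = diagA (x * y - y * x) := by
  rw [Ring.lie_def, diagA_apply, diagA_apply, Matrix.fromBlocks_multiply, Matrix.fromBlocks_multiply, diagA_apply,
    sub_eq_add_neg, Matrix.fromBlocks_neg, Matrix.fromBlocks_add]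
  congr 1
  · simp [sub_eq_add_neg]
  · simp
  · simp
  · rw [sub_eq_add_of_charTwo K, Matrix.transpose_add, Matrix.transpose_mul, Matrix.transpose_mul,
      neg_eq_self_of_charTwo K]
    simp [add_comm]

theorem lie_diagA_upperB (x y : Matrix (Fin 4) (Fin 4) K) :
    ⁅diagA x, upperB y⁆ = upperB (x * y - y * x.transpose) := by
  rw [Ring.lie_def, diagA_apply, upperB_apply, Matrix.fromBlocks_multiply, Matrix.fromBlocks_multiply, upperB_apply,
    sub_eq_add_neg, Matrix.fromBlocks_neg, Matrix.fromBlocks_add]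
  congr 1 <;> simp [sub_eq_add_neg]

theorem lie_diagA_lowerC (x z : Matrix (Fin 4) (Fin 4) K) :
    ⁅diagA x, lowerC z⁆ = lowerC (x.transpose * z - z * x) := by
  rw [Ring.lie_def, diagA_apply, lowerC_apply, Matrix.fromBlocks_multiply, Matrix.fromBlocks_multiply, lowerC_apply,
    sub_eq_add_neg, Matrix.fromBlocks_neg, Matrix.fromBlocks_add]
  congr 1 <;> simp [sub_eq_add_neg]

theorem lie_rootA_rootA {i j k : Fin 4} (h : k ≠ i) :
    ⁅rootA K i j, rootA K j k⁆ = rootA K i k := by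
  rw [rootA, rootA, lie_diagA_diagA, rootA, Matrix.single_mul_single_same,
    Matrix.single_mul_single_of_ne _ _ _ _ h, sub_zero, mul_one]

theorem lie_rootA_opposite (i : Fin 4) : ⁅rootA K i 3, rootA K 3 i⁆ = torusH K i := by
  rw [rootA, rootA, lie_diagA_diagA, torusH, Matrix.single_mul_single_same,
    Matrix.single_mul_single_same, mul_one, sub_eq_add_of_charTwo K]

theorem lie_rootA_rootB {i j k : Fin 4} (h : k ≠ j) :
    ⁅rootA K i k, rootB K k j⁆ = rootB K i j := by
  rw [rootA, rootB, lie_diagA_upperB, rootB, Matrix.transpose_single, mul_add, add_mul,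
    Matrix.single_mul_single_same, Matrix.single_mul_single_same,
    Matrix.single_mul_single_of_ne _ _ _ _ h, Matrix.single_mul_single_of_ne _ _ _ _ h.symm, mul_one,
    add_zero, zero_add, sub_eq_add_of_charTwo K]

theorem lie_rootA_rootC {i j k : Fin 4} (h : k ≠ j) :
    ⁅rootA K k i, rootC K k j⁆ = rootC K i j := by
  rw [rootA, rootC, lie_diagA_lowerC, rootC, Matrix.transpose_single, mul_add, add_mul,
    Matrix.single_mul_single_same, Matrix.single_mul_single_same,
    Matrix.single_mul_single_of_ne _ _ _ _ h, Matrix.single_mul_single_of_ne _ _ _ _ h.symm, mul_one,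
    add_zero, zero_add, sub_eq_add_of_charTwo K]

/-- A matrix in the second derived algebra is a combination of root vectors and elements of the
torus. -/
theorem mem_of_roots {T : Submodule K (Mat8 K)} {M : Mat8 K} (hM : M ∈ oPiDer K)
    (hA : ∀ i j, i ≠ j → M (.inl i) (.inl j) ≠ 0 → rootA K i j ∈ T)
    (hB : ∀ i j, i ≠ j → M (.inl i) (.inr j) ≠ 0 → rootB K i j ∈ T)
    (hC : ∀ i j, i ≠ j → M (.inr i) (.inl j) ≠ 0 → rootC K i j ∈ T)
    (hH : ∀ i, i ≠ 3 → M (.inl i) (.inl i) ≠ 0 → torusH K i ∈ T) : M ∈ T := by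
  obtain ⟨h1, ⟨h2, h3⟩, ⟨h4, h5⟩, h6⟩ := hM
  have hs : ∀ (c : K) (R : Mat8 K), (c ≠ 0 → R ∈ T) → c • R ∈ T := fun c R h => by
    by_cases hc : c = 0
    · rw [hc, zero_smul]; exact T.zero_mem
    · exact T.smul_mem c (h hc)
  have e : M = diagA M.toBlocks₁₁ + upperB M.toBlocks₁₂ + lowerC M.toBlocks₂₁ := by
    rw [diagA_apply, upperB_apply, lowerC_apply, Matrix.fromBlocks_add, Matrix.fromBlocks_add]
    conv_lhs => rw [← Matrix.fromBlocks_toBlocks M]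
    simp only [add_zero, zero_add]
    congr 1
    exact Matrix.ext fun i j => h1 i j
  -- The vanishing trace determines the last diagonal entry, so the diagonal is a combination of the
  -- torus elements. The summand with `i = j = 3` is zero in characteristic 2.
  have eA : M.toBlocks₁₁ = ∑ i, ∑ j, M (.inl i) (.inl j) •
      (if i = j then Matrix.single i i 1 + Matrix.single 3 3 1 else Matrix.single i j 1) := by
    have h33 : M (.inl 3) (.inl 3) =
        M (.inl 0) (.inl 0) + M (.inl 1) (.inl 1) + M (.inl 2) (.inl 2) := by
      rw [Fin.sum_univ_four, ← CharTwo.sub_eq_add, sub_eq_zero] at h6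
      exact h6.symm
    ext i j
    fin_cases i <;> fin_cases j <;>
      simp [Fin.sum_univ_four, Matrix.toBlocks₁₁, h33, CharTwo.add_self_eq_zero]
  have eAlt : ∀ y : Matrix (Fin 4) (Fin 4) K, (∀ i j, y i j = y j i) → (∀ i, y i i = 0) →
      y = ∑ i, ∑ j, (if i < j then y i j else 0) •
        (Matrix.single i j 1 + Matrix.single j i 1) := fun y hy hy0 => by
    ext i j
    fin_cases i <;> fin_cases j <;> simp [Fin.sum_univ_four, hy0] <;> exact hy _ _
  rw [e]
  refine T.add_mem (T.add_mem ?_ ?_) ?_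
  · rw [eA, map_sum]
    refine T.sum_mem fun i _ => ?_
    rw [map_sum]
    refine T.sum_mem fun j _ => ?_
    rw [map_smul]
    refine hs _ _ fun hij => ?_
    split_ifs with hc
    · by_cases h3 : i = 3
      · rw [h3, add_self_of_charTwo K, map_zero]; exact T.zero_mem
      · subst hc; exact hH i h3 hij
    · exact hA i j hc hij
  · rw [eAlt M.toBlocks₁₂ h2 h3, map_sum]
    refine T.sum_mem fun i _ => ?_
    rw [map_sum]
    refine T.sum_mem fun j _ => ?_
    rw [map_smul]
    refine hs _ _ fun hij => ?_
    split_ifs at hij with hc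
    · exact hB i j hc.ne hij
    · exact absurd rfl hij
  · rw [eAlt M.toBlocks₂₁ h4 h5, map_sum]
    refine T.sum_mem fun i _ => ?_
    rw [map_sum]
    refine T.sum_mem fun j _ => ?_
    rw [map_smul]
    refine hs _ _ fun hij => ?_
    split_ifs at hij with hc
    · exact hC i j hc.ne hij
    · exact absurd rfl hij

theorem mem_oPi_iff {M : Mat8 K} : M ∈ oPi K ↔
    (∀ i j, M (.inr i) (.inr j) = M (.inl j) (.inl i)) ∧
      (∀ i j, M (.inl i) (.inr j) = M (.inl j) (.inr i)) ∧
      ∀ i j, M (.inr i) (.inl j) = M (.inr j) (.inl i) := by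
  rw [oPi, mem_skewAdjointMatricesLieSubalgebra, mem_skewAdjointMatricesSubmodule,
    Matrix.IsSkewAdjoint, Matrix.IsAdjointPair, neg_eq_self_of_charTwo K]
  conv_lhs => rw [← Matrix.fromBlocks_toBlocks M]
  rw [Matrix.fromBlocks_transpose, Matrix.fromBlocks_multiply, Matrix.fromBlocks_multiply]
  simp only [Matrix.mul_zero, Matrix.mul_one, Matrix.zero_mul, Matrix.one_mul, zero_add, add_zero,
    Matrix.fromBlocks_inj]
  constructor
  · rintro ⟨h1, h2, -, h4⟩
    exact ⟨fun i j => (congrFun (congrFun h2 i) j).symm, fun i j => (congrFun (congrFun h4 i) j).symm,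
      fun i j => (congrFun (congrFun h1 i) j).symm⟩
  · rintro ⟨h1, h2, h3⟩
    exact ⟨Matrix.ext fun i j => (h3 i j).symm, Matrix.ext fun i j => (h1 i j).symm,
      Matrix.ext fun i j => h1 j i, Matrix.ext fun i j => (h2 i j).symm⟩

theorem oPiDer_le_oPi {M : Mat8 K} (h : M ∈ oPiDer K) : M ∈ oPi K :=
  mem_oPi_iff.mpr ⟨h.1, h.2.1.1, h.2.2.1.1⟩

/-- By the symmetry of the blocks the two products have equal diagonals in the off-diagonal blocks
and cancel there. One commutator thus turns symmetric blocks into alternating ones. -/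
theorem lie_diag_eq_zero {M M' : Mat8 K} (hM : M ∈ oPi K) (hM' : M' ∈ oPi K) :
    (∀ i, ⁅M, M'⁆ (.inl i) (.inr i) = 0) ∧ ∀ i, ⁅M, M'⁆ (.inr i) (.inl i) = 0 := by
  obtain ⟨h1, h2, h3⟩ := mem_oPi_iff.mp hM
  obtain ⟨k1, k2, k3⟩ := mem_oPi_iff.mp hM'
  constructor
  · intro i
    simp only [Ring.lie_def, Matrix.sub_apply, Matrix.mul_apply, Fintype.sum_sum_type, h1, k1]
    rw [sub_eq_zero, add_comm]
    refine congrArg₂ _ ?_ ?_ <;> refine Finset.sum_congr rfl fun j _ => ?_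
    · rw [h2, mul_comm]
    · rw [k2, mul_comm]
  · intro i
    simp only [Ring.lie_def, Matrix.sub_apply, Matrix.mul_apply, Fintype.sum_sum_type, h1, k1]
    rw [sub_eq_zero, add_comm]
    refine congrArg₂ _ ?_ ?_ <;> refine Finset.sum_congr rfl fun j _ => ?_
    · rw [k3, mul_comm]
    · rw [h3, mul_comm]

/-- The trace of an alternating matrix times a symmetric one counts each pair of indices twice, so
it vanishes. The upper right blocks must already be alternating, and this is why the trace is lost
one commutator later than the diagonals. -/
theorem lie_trace_eq_zero {M M' : Mat8 K} (hM : M ∈ oPi K) (hM' : M' ∈ oPi K)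
    (h : ∀ i, M (.inl i) (.inr i) = 0) (h' : ∀ i, M' (.inl i) (.inr i) = 0) :
    ∑ i, ⁅M, M'⁆ (.inl i) (.inl i) = 0 := by
  obtain ⟨-, h2, h3⟩ := mem_oPi_iff.mp hM
  obtain ⟨-, k2, k3⟩ := mem_oPi_iff.mp hM'
  have e : ∀ b c : Fin 4 → Fin 4 → K, (∀ i j, b i j = b j i) → (∀ i, b i i = 0) →
      (∀ i j, c i j = c j i) → ∑ i, ∑ j, b i j * c j i = 0 := fun b c hb hb0 hc => by
    have ht : (2 : K) = 0 := CharTwo.two_eq_zero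
    simp only [Fin.sum_univ_four, hb0]
    rw [hb 1 0, hb 2 0, hb 2 1, hb 3 0, hb 3 1, hb 3 2, hc 1 0, hc 2 0, hc 2 1, hc 3 0, hc 3 1,
      hc 3 2]
    linear_combination (b 0 1 * c 0 1 + b 0 2 * c 0 2 + b 0 3 * c 0 3 + b 1 2 * c 1 2 +
      b 1 3 * c 1 3 + b 2 3 * c 2 3) * ht
  simp only [Ring.lie_def, Matrix.sub_apply, Matrix.mul_apply, Fintype.sum_sum_type,
    Finset.sum_sub_distrib, Finset.sum_add_distrib]
  rw [e _ _ h2 h k3, e _ _ k2 h' h3, add_zero, add_zero, sub_eq_zero, Finset.sum_comm]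
  exact Finset.sum_congr rfl fun i _ => Finset.sum_congr rfl fun j _ => mul_comm _ _

theorem lie_mem_oPiDer {M M' : Mat8 K} (hM : M ∈ oPiDer K) (hM' : M' ∈ oPiDer K) :
    ⁅M, M'⁆ ∈ oPiDer K := by
  have h := (oPi K).lie_mem (oPiDer_le_oPi hM) (oPiDer_le_oPi hM')
  obtain ⟨h1, h2, h3⟩ := mem_oPi_iff.mp h
  obtain ⟨h4, h5⟩ := lie_diag_eq_zero (oPiDer_le_oPi hM) (oPiDer_le_oPi hM')
  exact ⟨h1, ⟨h2, h4⟩, ⟨h3, h5⟩, lie_trace_eq_zero (oPiDer_le_oPi hM) (oPiDer_le_oPi hM')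
    hM.2.1.2 hM'.2.1.2⟩

/-- The algebra is spanned by brackets. -/
theorem oPiDer_le_of_lie {T : Submodule K (Mat8 K)}
    (h : ∀ M ∈ oPiDer K, ∀ M' ∈ oPiDer K, ⁅M, M'⁆ ∈ T) : oPiDer K ≤ T := by
  have hthird : ∀ i j : Fin 4, ∃ k, k ≠ i ∧ k ≠ j := by decide
  intro M hM
  refine mem_of_roots hM (fun i j hij _ => ?_) (fun i j hij _ => ?_) (fun i j hij _ => ?_)
    (fun i hi _ => ?_)
  · obtain ⟨k, hki, hkj⟩ := hthird i j
    rw [← lie_rootA_rootA (j := k) hij.symm]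
    exact h _ (rootA_mem hki.symm) _ (rootA_mem hkj)
  · obtain ⟨k, hki, hkj⟩ := hthird i j
    rw [← lie_rootA_rootB hkj]
    exact h _ (rootA_mem hki.symm) _ (rootB_mem hkj)
  · obtain ⟨k, hki, hkj⟩ := hthird i j
    rw [← lie_rootA_rootC hkj]
    exact h _ (rootA_mem hki) _ (rootC_mem hkj)
  · rw [← lie_rootA_opposite]
    exact h _ (rootA_mem hi) _ (rootA_mem hi.symm)

theorem mem_derivedSeries_of_mem_oPiDer (k : ℕ) : ∀ {M : Mat8 K} (hM : M ∈ oPiDer K),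
    (⟨M, oPiDer_le_oPi hM⟩ : oPi K) ∈ LieAlgebra.derivedSeries K (oPi K) k := by
  induction k with
  | zero => exact fun _ => LieSubmodule.mem_top _
  | succ k ih =>
    have hle : oPiDer K ≤ (LieAlgebra.derivedSeries K (oPi K) (k + 1)).toSubmodule.map
        (oPi K).toSubmodule.subtype := by
      refine oPiDer_le_of_lie fun M hM M' hM' => ?_
      refine ⟨⟨⁅M, M'⁆, (oPi K).lie_mem (oPiDer_le_oPi hM) (oPiDer_le_oPi hM')⟩, ?_, rfl⟩
      rw [derivedSeries_succ_toSubmodule]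
      exact Submodule.mem_span_of_mem ⟨_, ih hM, _, ih hM', rfl⟩
    intro M hM
    obtain ⟨M', hM', rfl⟩ := hle hM
    exact hM'

/-- First commutators lose the diagonals of the off-diagonal blocks, and second ones also the trace
of the diagonal block. Nothing more is lost, since the root vectors and the torus elements of
`oPiDer` are brackets of root vectors. -/
theorem mem_oPi2_iff {M : oPi K} : M ∈ oPi2 K ↔ M.1 ∈ oPiDer K := by
  refine ⟨fun h => ?_, fun h => mem_derivedSeries_of_mem_oPiDer 2 h⟩
  have h1 : ∀ X ∈ LieAlgebra.derivedSeries K (oPi K) 1,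
      (∀ i, X.1 (.inl i) (.inr i) = 0) ∧ ∀ i, X.1 (.inr i) (.inl i) = 0 := by
    intro X hX
    rw [← LieSubmodule.mem_toSubmodule, derivedSeries_succ_toSubmodule] at hX
    induction hX using Submodule.span_induction with
    | mem X hX =>
      obtain ⟨Y, -, Z, -, rfl⟩ := hX
      exact lie_diag_eq_zero Y.2 Z.2
    | zero => exact ⟨fun _ => rfl, fun _ => rfl⟩
    | add X Y _ _ hX hY =>
      refine ⟨fun i => ?_, fun i => ?_⟩
      · change X.1 _ _ + Y.1 _ _ = 0
        rw [hX.1, hY.1, add_zero]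
      · change X.1 _ _ + Y.1 _ _ = 0
        rw [hX.2, hY.2, add_zero]
    | smul c X _ hX =>
      refine ⟨fun i => ?_, fun i => ?_⟩
      · change c • X.1 _ _ = 0
        rw [hX.1, smul_zero]
      · change c • X.1 _ _ = 0
        rw [hX.2, smul_zero]
  rw [← LieSubmodule.mem_toSubmodule, derivedSeries_succ_toSubmodule] at h
  induction h using Submodule.span_induction with
  | mem X hX =>
    obtain ⟨Y, hY, Z, hZ, rfl⟩ := hX
    obtain ⟨e1, e2, e3⟩ := mem_oPi_iff.mp ⁅Y, Z⁆.2
    obtain ⟨d1, d2⟩ := lie_diag_eq_zero Y.2 Z.2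
    exact ⟨e1, ⟨e2, d1⟩, ⟨e3, d2⟩, lie_trace_eq_zero Y.2 Z.2 (h1 Y hY).1 (h1 Z hZ).1⟩
  | zero => exact Submodule.zero_mem _
  | add X Y _ _ hX hY => exact Submodule.add_mem _ hX hY
  | smul c X _ hX => exact Submodule.smul_mem _ c hX

end OrthogonalStructure

/-! ### The grading `(0011)` in terms of Chevalley generators and of matrix entries. -/

section OrthogonalIso

open BrownSpace

variable {K : Type*} [Field K]

/-- The degrees of the rows of matrices of size 8. -/
def rowDeg : Fin 4 ⊕ Fin 4 → ℤ := Sum.elim ![1, 1, 1, 0] (-![1, 1, 1, 0])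

variable (K) in
/-- The matrices of degree `k`. -/
def wtMat (k : ℤ) : Submodule K (Mat8 K) where
  carrier := {M | ∀ i j, M i j ≠ 0 → rowDeg i - rowDeg j = k}
  zero_mem' := fun _ _ h => absurd rfl h
  add_mem' := by
    intro M M' hM hM' i j h
    by_cases h' : M i j = 0
    · exact hM' i j (by simpa [h'] using h)
    · exact hM i j h'
  smul_mem' := by
    intro c M hM i j h
    exact hM i j (fun e => h (by simp [e]))

theorem mul_mem_wtMat {k l : ℤ} {M M' : Mat8 K} (hM : M ∈ wtMat K k) (hM' : M' ∈ wtMat K l) :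
    M * M' ∈ wtMat K (k + l) := by
  intro i j h
  rw [Matrix.mul_apply] at h
  obtain ⟨m, -, hm⟩ := Finset.exists_ne_zero_of_sum_ne_zero h
  have h1 := hM i m (left_ne_zero_of_mul hm)
  have h2 := hM' m j (right_ne_zero_of_mul hm)
  omega

theorem lie_mem_wtMat {k l : ℤ} {M M' : Mat8 K} (hM : M ∈ wtMat K k) (hM' : M' ∈ wtMat K l) :
    ⁅M, M'⁆ ∈ wtMat K (k + l) := by
  rw [Ring.lie_def]
  refine Submodule.sub_mem _ (mul_mem_wtMat hM hM') ?_
  rw [add_comm]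
  exact mul_mem_wtMat hM' hM

theorem transpose_mem_wtMat {k : ℤ} {M : Mat8 K} (hM : M ∈ wtMat K k) : M.transpose ∈ wtMat K (-k) :=
  fun i j h => by have := hM j i h; omega

theorem single_mem_wtMat (i j : Fin 4 ⊕ Fin 4) (c : K) :
    Matrix.single i j c ∈ wtMat K (rowDeg i - rowDeg j) := by
  intro k l h
  rw [Matrix.single_apply] at h
  split_ifs at h with e
  · rw [e.1, e.2]
  · exact absurd rfl h

theorem chevalley_mem_wtMat (i : Fin 4) : chevalley K i ∈ wtMat K ((![0, 0, 1, 1] : Fin 4 → ℤ) i) := by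
  fin_cases i
  · exact Submodule.add_mem _ (single_mem_wtMat _ _ _) (single_mem_wtMat _ _ _)
  · exact Submodule.add_mem _ (single_mem_wtMat _ _ _) (single_mem_wtMat _ _ _)
  · exact Submodule.add_mem _ (single_mem_wtMat _ _ _) (single_mem_wtMat _ _ _)
  · exact Submodule.add_mem _ (single_mem_wtMat _ _ _) (single_mem_wtMat _ _ _)

theorem diagA_single (i j : Fin 4) (c : K) : diagA (Matrix.single i j c) =
    Matrix.single (.inl i) (.inl j) c + Matrix.single (.inr j) (.inr i) c := by
  ext a b
  rcases a with a | a <;> rcases b with b | b <;> simp [diagA_apply, Matrix.single_apply, and_comm]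

theorem upperB_single (i j : Fin 4) (c : K) : upperB (Matrix.single i j c) =
    Matrix.single (.inl i) (.inr j) c := by
  ext a b
  rcases a with a | a <;> rcases b with b | b <;> simp [upperB_apply, Matrix.single_apply]

theorem lowerC_single (i j : Fin 4) (c : K) : lowerC (Matrix.single i j c) =
    Matrix.single (.inr i) (.inl j) c := by
  ext a b
  rcases a with a | a <;> rcases b with b | b <;> simp [lowerC_apply, Matrix.single_apply]

theorem chevalley_zero : chevalley K 0 = rootA K 0 1 := (diagA_single _ _ _).symm
theorem chevalley_one : chevalley K 1 = rootA K 1 2 := (diagA_single _ _ _).symm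
theorem chevalley_two : chevalley K 2 = rootA K 2 3 := (diagA_single _ _ _).symm
theorem chevalley_three : chevalley K 3 = rootB K 2 3 := by
  rw [rootB, map_add, upperB_single, upperB_single]; rfl
theorem transpose_rootA (i j : Fin 4) : (rootA K i j).transpose = rootA K j i := by
  rw [rootA, diagA_single, rootA, diagA_single, Matrix.transpose_add, Matrix.transpose_single,
    Matrix.transpose_single]
theorem transpose_rootB (i j : Fin 4) : (rootB K i j).transpose = rootC K i j := by
  rw [rootB, map_add, upperB_single, upperB_single, rootC, map_add, lowerC_single, lowerC_single,
    Matrix.transpose_add, Matrix.transpose_single, Matrix.transpose_single, add_comm]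

variable (K) in
/-- The span of the elements of degree `k` generated by Chevalley generators. -/
def chevalleyPart (k : ℤ) : Submodule K (Mat8 K) where
  carrier := {M | ChevalleyHom K ![0, 0, 1, 1] k M}
  zero_mem' := .zero k
  add_mem' := .add
  smul_mem' c _ := .smul c

variable [CharP K 2]

theorem mem_of_chevalley {k : ℤ} {M : Mat8 K} (h : ChevalleyHom K ![0, 0, 1, 1] k M) :
    M ∈ wtMat K k ∧ M ∈ oPiDer K := by
  induction h with
  | pos i =>
    refine ⟨chevalley_mem_wtMat i, ?_⟩
    fin_cases i
    · exact chevalley_zero (K := K) ▸ rootA_mem (by decide)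
    · exact chevalley_one (K := K) ▸ rootA_mem (by decide)
    · exact chevalley_two (K := K) ▸ rootA_mem (by decide)
    · exact chevalley_three (K := K) ▸ rootB_mem (by decide)
  | neg i =>
    refine ⟨transpose_mem_wtMat (chevalley_mem_wtMat i), ?_⟩
    fin_cases i
    · exact chevalley_zero (K := K) ▸ transpose_rootA (K := K) _ _ ▸ rootA_mem (by decide)
    · exact chevalley_one (K := K) ▸ transpose_rootA (K := K) _ _ ▸ rootA_mem (by decide)
    · exact chevalley_two (K := K) ▸ transpose_rootA (K := K) _ _ ▸ rootA_mem (by decide)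
    · exact chevalley_three (K := K) ▸ transpose_rootB (K := K) _ _ ▸ rootC_mem (by decide)
  | zero k => exact ⟨Submodule.zero_mem _, Submodule.zero_mem _⟩
  | add _ _ h1 h2 => exact ⟨Submodule.add_mem _ h1.1 h2.1, Submodule.add_mem _ h1.2 h2.2⟩
  | smul c _ h => exact ⟨Submodule.smul_mem _ c h.1, Submodule.smul_mem _ c h.2⟩
  | lie _ _ h1 h2 => exact ⟨lie_mem_wtMat h1.1 h2.1, lie_mem_oPiDer h1.2 h2.2⟩

/-- Root vectors for neighboring indices are the first three generators and their transposes; the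
others arise by composing them, and the degrees add up along the way. -/
theorem chevalley_rootA {i j : Fin 4} (h : i ≠ j) :
    rootA K i j ∈ chevalleyPart K ((![1, 1, 1, 0] : Fin 4 → ℤ) i - (![1, 1, 1, 0] : Fin 4 → ℤ) j) := by
  have step : ∀ (k l : ℤ) (i j m : Fin 4), m ≠ i → rootA K i j ∈ chevalleyPart K k →
      rootA K j m ∈ chevalleyPart K l → rootA K i m ∈ chevalleyPart K (k + l) :=
    fun k l i j m h h1 h2 => by
      rw [← lie_rootA_rootA h]
      exact ChevalleyHom.lie h1 h2
  have h01 : rootA K 0 1 ∈ chevalleyPart K 0 := chevalley_zero (K := K) ▸ .pos 0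
  have h12 : rootA K 1 2 ∈ chevalleyPart K 0 := chevalley_one (K := K) ▸ .pos 1
  have h23 : rootA K 2 3 ∈ chevalleyPart K 1 := chevalley_two (K := K) ▸ .pos 2
  have h10 : rootA K 1 0 ∈ chevalleyPart K 0 := by
    rw [← transpose_rootA, ← chevalley_zero]; exact .neg 0
  have h21 : rootA K 2 1 ∈ chevalleyPart K 0 := by
    rw [← transpose_rootA, ← chevalley_one]; exact .neg 1
  have h32 : rootA K 3 2 ∈ chevalleyPart K (-1) := by
    rw [← transpose_rootA, ← chevalley_two]; exact .neg 2
  have h02 := step _ _ _ _ _ (by decide) h01 h12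
  have h13 := step _ _ _ _ _ (by decide) h12 h23
  have h03 := step _ _ _ _ _ (by decide) h01 h13
  have h20 := step _ _ _ _ _ (by decide) h21 h10
  have h31 := step _ _ _ _ _ (by decide) h32 h21
  have h30 := step _ _ _ _ _ (by decide) h31 h10
  fin_cases i <;> fin_cases j <;> first | exact absurd rfl h | assumption

theorem chevalley_rootB {i j : Fin 4} (h : i ≠ j) :
    rootB K i j ∈ chevalleyPart K ((![1, 1, 1, 0] : Fin 4 → ℤ) i + (![1, 1, 1, 0] : Fin 4 → ℤ) j) := by
  have step : ∀ (l : ℤ) (i j m : Fin 4), j ≠ m → i ≠ j → rootB K j m ∈ chevalleyPart K l →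
      rootB K i m ∈ chevalleyPart K
        ((![1, 1, 1, 0] : Fin 4 → ℤ) i - (![1, 1, 1, 0] : Fin 4 → ℤ) j + l) :=
    fun l i j m h h' h2 => by
      rw [← lie_rootA_rootB h]
      exact ChevalleyHom.lie (chevalley_rootA h') h2
  have h23 : rootB K 2 3 ∈ chevalleyPart K 1 := chevalley_three (K := K) ▸ .pos 3
  have h32 : rootB K 3 2 ∈ chevalleyPart K 1 := rootB_comm (K := K) 2 3 ▸ h23
  have h13 := step _ 1 _ _ (by decide) (by decide) h23
  have h03 := step _ 0 _ _ (by decide) (by decide) h23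
  have h12 := step _ 1 _ _ (by decide) (by decide) h32
  have h02 := step _ 0 _ _ (by decide) (by decide) h32
  have h31 := h13
  rw [rootB_comm] at h31
  have h30 := h03
  rw [rootB_comm] at h30
  have h21 := h12
  rw [rootB_comm] at h21
  have h20 := h02
  rw [rootB_comm] at h20
  have h01 := step _ 0 _ _ (by decide) (by decide) h21
  have h10 := h01
  rw [rootB_comm] at h10
  fin_cases i <;> fin_cases j <;> first | exact absurd rfl h | assumption

theorem chevalley_rootC {i j : Fin 4} (h : i ≠ j) :
    rootC K i j ∈ chevalleyPart K
      (-(![1, 1, 1, 0] : Fin 4 → ℤ) i - (![1, 1, 1, 0] : Fin 4 → ℤ) j) := by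
  have step : ∀ (l : ℤ) (i j m : Fin 4), j ≠ m → j ≠ i → rootC K j m ∈ chevalleyPart K l →
      rootC K i m ∈ chevalleyPart K
        ((![1, 1, 1, 0] : Fin 4 → ℤ) j - (![1, 1, 1, 0] : Fin 4 → ℤ) i + l) :=
    fun l i j m h h' h2 => by
      rw [← lie_rootA_rootC h]
      exact ChevalleyHom.lie (chevalley_rootA h') h2
  have h23 : rootC K 2 3 ∈ chevalleyPart K (-1) := by
    rw [← transpose_rootB, ← chevalley_three]; exact .neg 3
  have h32 : rootC K 3 2 ∈ chevalleyPart K (-1) := rootC_comm (K := K) 2 3 ▸ h23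
  have h13 := step _ 1 _ _ (by decide) (by decide) h23
  have h03 := step _ 0 _ _ (by decide) (by decide) h23
  have h12 := step _ 1 _ _ (by decide) (by decide) h32
  have h02 := step _ 0 _ _ (by decide) (by decide) h32
  have h31 := h13
  rw [rootC_comm] at h31
  have h30 := h03
  rw [rootC_comm] at h30
  have h21 := h12
  rw [rootC_comm] at h21
  have h20 := h02
  rw [rootC_comm] at h20
  have h01 := step _ 0 _ _ (by decide) (by decide) h21
  have h10 := h01
  rw [rootC_comm] at h10
  fin_cases i <;> fin_cases j <;> first | exact absurd rfl h | assumption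

/-- A matrix homogeneous with respect to `rowDeg` involves only root vectors of its own degree and,
in degree 0, torus elements, which are brackets of opposite root vectors. -/
theorem chevalley_of_mem {k : ℤ} {M : Mat8 K} (hM : M ∈ oPiDer K) (hk : M ∈ wtMat K k) :
    ChevalleyHom K ![0, 0, 1, 1] k M := by
  refine mem_of_roots (T := chevalleyPart K k) hM (fun i j hij h => ?_) (fun i j hij h => ?_)
    (fun i j hij h => ?_) (fun i hi h => ?_)
  · rw [← hk _ _ h]; exact chevalley_rootA hij
  · rw [← hk _ _ h, show rowDeg (.inr j) = -(![1, 1, 1, 0] : Fin 4 → ℤ) j from rfl, sub_neg_eq_add]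
    exact chevalley_rootB hij
  · rw [← hk _ _ h]; exact chevalley_rootC hij
  · have e := hk _ _ h
    rw [sub_self] at e
    rw [← e, ← lie_rootA_opposite]
    have := ChevalleyHom.lie (chevalley_rootA hi) (chevalley_rootA (K := K) hi.symm)
    rwa [sub_add_sub_cancel, sub_self] at this

/-- The component of degree `k` of a matrix. -/
def wtProj (k : ℤ) (M : Mat8 K) : Mat8 K := fun i j => if rowDeg i - rowDeg j = k then M i j else 0

theorem wtProj_mem (k : ℤ) (M : Mat8 K) : wtProj k M ∈ wtMat K k := fun i j h => by
  by_contra hc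
  exact h (if_neg hc)

theorem wtProj_mem_oPiDer (k : ℤ) {M : Mat8 K} (hM : M ∈ oPiDer K) : wtProj k M ∈ oPiDer K := by
  obtain ⟨h1, ⟨h2, h3⟩, ⟨h4, h5⟩, h6⟩ := hM
  have hr : ∀ i, rowDeg (.inr i) = -rowDeg (.inl i) := fun i => rfl
  refine ⟨fun i j => ?_, ⟨fun i j => ?_, fun i => ?_⟩, ⟨fun i j => ?_, fun i => ?_⟩, ?_⟩
  · simp only [wtProj, h1 i j, hr]
    refine if_congr ?_ rfl rfl
    constructor <;> intro h <;> omega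
  · simp only [wtProj, h2 i j, hr]
    refine if_congr ?_ rfl rfl
    constructor <;> intro h <;> omega
  · simp [wtProj, h3]
  · simp only [wtProj, h4 i j, hr]
    refine if_congr ?_ rfl rfl
    constructor <;> intro h <;> omega
  · simp [wtProj, h5]
  · simp only [wtProj, sub_self]
    split_ifs
    · exact h6
    · exact Finset.sum_const_zero

theorem sum_wtProj (M : Mat8 K) : ∑ k ∈ Finset.Icc (-2 : ℤ) 2, wtProj k M = M := by
  have hb : ∀ i j, rowDeg i - rowDeg j ∈ Finset.Icc (-2 : ℤ) 2 := by decide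
  ext i j
  rw [Matrix.sum_apply]
  simp only [wtProj]
  rw [Finset.sum_ite_eq, if_pos (hb i j)]

end OrthogonalIso

/-! ### The isomorphism for `N = (1, 1, 1)`. -/

section OrthogonalIsomorphism

open BrownSpace

variable {K : Type*} [Field K]

local notation "u₀" => DP.var K (0 : Fin 3)
local notation "u₁" => DP.var K (1 : Fin 3)
local notation "u₂" => DP.var K (2 : Fin 3)

/-- The vector `(1, 1, 1)`. -/
abbrev allOnes : Fin 3 → WithTop ℕ+ := fun _ => ((1 : ℕ+) : WithTop ℕ+)

theorem blockM_inl_inl (a : Matrix (Fin 4) (Fin 4) K) (β w γ t : Fin 3 → K) (i j : Fin 4) :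
    blockM a β w γ t (.inl i) (.inl j) = a i j := rfl
theorem blockM_inl_inr (a : Matrix (Fin 4) (Fin 4) K) (β w γ t : Fin 3 → K) (i j : Fin 4) :
    blockM a β w γ t (.inl i) (.inr j) = altM β w i j := rfl
theorem blockM_inr_inl (a : Matrix (Fin 4) (Fin 4) K) (β w γ t : Fin 3 → K) (i j : Fin 4) :
    blockM a β w γ t (.inr i) (.inl j) = altM γ t i j := rfl
theorem blockM_inr_inr (a : Matrix (Fin 4) (Fin 4) K) (β w γ t : Fin 3 → K) (i j : Fin 4) :
    blockM a β w γ t (.inr i) (.inr j) = a j i := rfl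

theorem altM_comm (v w : Fin 3 → K) (i j : Fin 4) : altM v w i j = altM v w j i := by
  fin_cases i <;> fin_cases j <;> rfl

theorem altM_self (v w : Fin 3 → K) (i : Fin 4) : altM v w i i = 0 := by
  fin_cases i <;> rfl

theorem eq_altM {b : Fin 4 → Fin 4 → K} (h : ∀ i j, b i j = b j i) (h' : ∀ i, b i i = 0)
    (i j : Fin 4) : b i j = altM ![b 1 2, b 0 2, b 0 1] (fun i => b (Fin.castSucc i) 3) i j := by
  fin_cases i <;> fin_cases j <;> first | exact h' _ | rfl | exact h _ _

theorem blockM_mem [CharP K 2] {a : Matrix (Fin 4) (Fin 4) K} (β w γ t : Fin 3 → K)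
    (h : a 2 2 = a 0 0 + a 1 1 + a 3 3) : blockM a β w γ t ∈ oPiDer K := by
  refine ⟨fun _ _ => rfl, ⟨altM_comm _ _, altM_self _ _⟩, ⟨altM_comm _ _, altM_self _ _⟩, ?_⟩
  change ∑ i, a i i = 0
  rw [Fin.sum_univ_four, h]
  have := CharTwo.two_eq_zero (R := K)
  linear_combination (a 0 0 + a 1 1 + a 3 3) * this

theorem exists_blockM [CharP K 2] {M : Mat8 K} (hM : M ∈ oPiDer K) :
    ∃ a β w γ t, a 2 2 = a 0 0 + a 1 1 + a 3 3 ∧ M = blockM a β w γ t := by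
  obtain ⟨h1, ⟨h2, h3⟩, ⟨h4, h5⟩, h6⟩ := hM
  have hb := eq_altM (b := fun i j => M (.inl i) (.inr j)) h2 h3
  have hc := eq_altM (b := fun i j => M (.inr i) (.inl j)) h4 h5
  refine ⟨fun i j => M (.inl i) (.inl j), ![M (.inl 1) (.inr 2), M (.inl 0) (.inr 2),
    M (.inl 0) (.inr 1)], fun i => M (.inl i.castSucc) (.inr 3), ![M (.inr 1) (.inl 2),
    M (.inr 0) (.inl 2), M (.inr 0) (.inl 1)], fun i => M (.inr i.castSucc) (.inl 3), ?_,
    Matrix.ext fun i j => ?_⟩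
  · rw [Fin.sum_univ_four] at h6
    have := CharTwo.two_eq_zero (R := K)
    linear_combination h6 - (M (.inl 0) (.inl 0) + M (.inl 1) (.inl 1) + M (.inl 3) (.inl 3)) * this
  · rcases i with i | i <;> rcases j with j | j
    · rfl
    · exact hb i j
    · exact hc i j
    · exact h1 i j

section Homogeneous

variable [CharP K 2]

theorem mul_hom_two (i j : Fin 3) :
    DP.var K i * DP.var K j ∈ DP.hom K (fun _ : Fin 3 => 2) 4 :=
  DP.hom_mul (var_hom_two i) (var_hom_two j)

theorem smul_mem_of_ne {V : Type*} [AddCommGroup V] [Module K V] {S : Submodule K V} {c : K} {x : V}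
    (h : c ≠ 0 → x ∈ S) : c • x ∈ S := by
  by_cases hc : c = 0
  · rw [hc, zero_smul]; exact S.zero_mem
  · exact S.smul_mem c (h hc)

theorem psi_hom {k : ℤ} {M : Mat8 K} (hM : M ∈ wtMat K k) : psi K M ∈ homPart K k := by
  have hc : ∀ (i j : Fin 4 ⊕ Fin 4) (l d : ℤ) (f : DP (Fin 3) K), f ∈ DP.hom K (fun _ => 2) d →
      d = rowDeg i - rowDeg j + l → M i j • f ∈ DP.hom K (fun _ => 2) (k + l) :=
    fun i j l d f hf hd => smul_mem_of_ne fun h => by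
      rw [← hM i j h, ← hd]; exact hf
  have h1 := one_hom (K := K) (fun _ : Fin 3 => 2)
  have hv := var_hom_two (K := K)
  have hm := mul_hom_two (K := K)
  refine ⟨forall_fin_three ?_ ?_ ?_, ?_, ?_⟩
  · rw [vf_psi, psiVF_zero, add_smul]
    exact Submodule.add_mem _ (Submodule.add_mem _ (Submodule.add_mem _ (Submodule.add_mem _
      (Submodule.add_mem _ (hc _ _ _ _ _ h1 (by decide)) (Submodule.add_mem _
      (hc _ _ _ _ _ (hv 0) (by decide)) (hc _ _ _ _ _ (hv 0) (by decide))))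
      (hc _ _ _ _ _ (hv 1) (by decide))) (hc _ _ _ _ _ (hv 2) (by decide)))
      (hc _ _ _ _ _ (hm 0 1) (by decide))) (hc _ _ _ _ _ (hm 0 2) (by decide))
  · rw [vf_psi, psiVF_one, add_smul]
    exact Submodule.add_mem _ (Submodule.add_mem _ (Submodule.add_mem _ (Submodule.add_mem _
      (Submodule.add_mem _ (hc _ _ _ _ _ h1 (by decide)) (hc _ _ _ _ _ (hv 0) (by decide)))
      (Submodule.add_mem _ (hc _ _ _ _ _ (hv 1) (by decide)) (hc _ _ _ _ _ (hv 1) (by decide))))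
      (hc _ _ _ _ _ (hv 2) (by decide))) (hc _ _ _ _ _ (hm 0 1) (by decide)))
      (hc _ _ _ _ _ (hm 1 2) (by decide))
  · rw [vf_psi, psiVF_two, add_smul]
    exact Submodule.add_mem _ (Submodule.add_mem _ (Submodule.add_mem _ (Submodule.add_mem _
      (Submodule.add_mem _ (hc _ _ _ _ _ h1 (by decide)) (hc _ _ _ _ _ (hv 0) (by decide)))
      (hc _ _ _ _ _ (hv 1) (by decide)))
      (Submodule.add_mem _ (hc _ _ _ _ _ (hv 2) (by decide)) (hc _ _ _ _ _ (hv 2) (by decide))))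
      (hc _ _ _ _ _ (hm 0 2) (by decide))) (hc _ _ _ _ _ (hm 1 2) (by decide))
  · rw [fst_psi]
    exact Submodule.add_mem _ (Submodule.add_mem _ (Submodule.add_mem _ (Submodule.add_mem _
      (Submodule.add_mem _ (hc _ _ _ _ _ (hv 0) (by decide)) (hc _ _ _ _ _ (hv 1) (by decide)))
      (hc _ _ _ _ _ (hv 2) (by decide))) (hc _ _ _ _ _ (hm 1 2) (by decide)))
      (hc _ _ _ _ _ (hm 0 2) (by decide))) (hc _ _ _ _ _ (hm 0 1) (by decide))
  · rw [snd_psi]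
    exact Submodule.add_mem _ (Submodule.add_mem _ (Submodule.add_mem _ (Submodule.add_mem _
      (Submodule.add_mem _ (hc _ _ _ _ _ (hv 0) (by decide)) (hc _ _ _ _ _ (hv 1) (by decide)))
      (hc _ _ _ _ _ (hv 2) (by decide))) (hc _ _ _ _ _ (hm 1 2) (by decide)))
      (hc _ _ _ _ _ (hm 0 2) (by decide))) (hc _ _ _ _ _ (hm 0 1) (by decide))

end Homogeneous

section SquareFree

variable [CharP K 2]

theorem DP.var_mul_var {i j : Fin 3} (h : i ≠ j) :
    DP.var K i * DP.var K j = DP.mono (Pi.single i 1 + Pi.single j 1) 1 := by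
  rw [DP.var, DP.var, DP.mono_mul_mono_of_disjoint, mul_one]
  intro k
  by_cases hk : k = i
  · subst hk; right; simp [h]
  · left; simp [hk]

/-- The square-free monomials except the highest one. -/
theorem mono_mem_squareFree {S : Submodule K (DP (Fin 3) K)} (h1 : 1 ∈ S)
    (hv : ∀ i, DP.var K i ∈ S) (hm : ∀ i j, i < j → DP.var K i * DP.var K j ∈ S) {r : Fin 3 → ℕ}
    (hr : ∀ i, r i < 2) (ht : r ≠ 1) : DP.mono r 1 ∈ S := by
  have e : ∀ s, r = s → DP.mono s (1 : K) ∈ S → DP.mono r 1 ∈ S := fun s h h' => h ▸ h'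
  have hr' : r = ![r 0, r 1, r 2] := by funext i; fin_cases i <;> rfl
  have h0 := hr 0
  have h1' := hr 1
  have h2 := hr 2
  have hm' : ∀ i j, i < j → DP.mono (Pi.single i 1 + Pi.single j 1) 1 ∈ S := fun i j h => by
    rw [← DP.var_mul_var h.ne]; exact hm i j h
  generalize ha : r 0 = a at *
  generalize hb : r 1 = b at *
  generalize hc : r 2 = c at *
  clear ha hb hc hr
  interval_cases a <;> interval_cases b <;> interval_cases c
  · exact e 0 (hr'.trans (by decide)) h1
  · exact e _ (hr'.trans (by decide)) (hv 2)
  · exact e _ (hr'.trans (by decide)) (hv 1)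
  · exact e _ (hr'.trans (by decide)) (hm' 1 2 (by decide))
  · exact e _ (hr'.trans (by decide)) (hv 0)
  · exact e _ (hr'.trans (by decide)) (hm' 0 2 (by decide))
  · exact e _ (hr'.trans (by decide)) (hm' 0 1 (by decide))
  · exact absurd (hr'.trans (by decide)) ht

theorem exists_squareFree_of_noTop {f : DP (Fin 3) K} (hf : f ∈ DP.noTop K allOnes) :
    ∃ c : Fin 7 → K, f = c 0 • 1 + c 1 • u₀ + c 2 • u₁ + c 3 • u₂ + c 4 • (u₀ * u₁) +
      c 5 • (u₀ * u₂) + c 6 • (u₁ * u₂) := by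
  have h : f ∈ Submodule.span K (Set.range
      (![1, u₀, u₁, u₂, u₀ * u₁, u₀ * u₂, u₁ * u₂] : Fin 7 → DP (Fin 3) K)) := by
    refine DP.mem_of_mono fun r hr => mono_mem_squareFree ?_ (fun i => ?_) ?_
      (fun i => hf.1 r hr i 1 rfl) ?_
    · exact Submodule.mem_span_of_mem ⟨0, rfl⟩
    · fin_cases i
      · exact Submodule.mem_span_of_mem ⟨1, rfl⟩
      · exact Submodule.mem_span_of_mem ⟨2, rfl⟩
      · exact Submodule.mem_span_of_mem ⟨3, rfl⟩
    · intro i j hij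
      obtain ⟨rfl, rfl⟩ | ⟨rfl, rfl⟩ | ⟨rfl, rfl⟩ :
          (i = 0 ∧ j = 1) ∨ (i = 0 ∧ j = 2) ∨ (i = 1 ∧ j = 2) := by omega
      · exact Submodule.mem_span_of_mem ⟨4, rfl⟩
      · exact Submodule.mem_span_of_mem ⟨5, rfl⟩
      · exact Submodule.mem_span_of_mem ⟨6, rfl⟩
    · rintro rfl
      exact hr (hf.2 _ fun i => ⟨1, rfl, rfl⟩)
  obtain ⟨c, hc⟩ := (Submodule.mem_span_range_iff_exists_fun K).mp h
  refine ⟨c, ?_⟩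
  rw [← hc, Fin.sum_univ_seven]
  rfl

theorem exists_squareFree {f : DP (Fin 3) K} (hf : f ∈ DP.shear K allOnes) :
    ∃ c : Fin 8 → K, f = c 0 • 1 + c 1 • u₀ + c 2 • u₁ + c 3 • u₂ + c 4 • (u₀ * u₁) +
      c 5 • (u₀ * u₂) + c 6 • (u₁ * u₂) + c 7 • DP.mono 1 1 := by
  have h : f ∈ Submodule.span K (Set.range
      (![1, u₀, u₁, u₂, u₀ * u₁, u₀ * u₂, u₁ * u₂, DP.mono 1 1] : Fin 8 → DP (Fin 3) K)) := by
    refine DP.mem_of_mono fun r hr => ?_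
    by_cases ht : r = 1
    · subst ht
      exact Submodule.mem_span_of_mem ⟨7, rfl⟩
    refine mono_mem_squareFree ?_ (fun i => ?_) ?_
      (fun i => hf r hr i 1 rfl) ht
    · exact Submodule.mem_span_of_mem ⟨0, rfl⟩
    · fin_cases i
      · exact Submodule.mem_span_of_mem ⟨1, rfl⟩
      · exact Submodule.mem_span_of_mem ⟨2, rfl⟩
      · exact Submodule.mem_span_of_mem ⟨3, rfl⟩
    · intro i j hij
      obtain ⟨rfl, rfl⟩ | ⟨rfl, rfl⟩ | ⟨rfl, rfl⟩ :
          (i = 0 ∧ j = 1) ∨ (i = 0 ∧ j = 2) ∨ (i = 1 ∧ j = 2) := by omega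
      · exact Submodule.mem_span_of_mem ⟨4, rfl⟩
      · exact Submodule.mem_span_of_mem ⟨5, rfl⟩
      · exact Submodule.mem_span_of_mem ⟨6, rfl⟩
  obtain ⟨c, hc⟩ := (Submodule.mem_span_range_iff_exists_fun K).mp h
  refine ⟨c, ?_⟩
  rw [← hc, Fin.sum_univ_eight]
  rfl

theorem DP.mono_one_eq : (DP.mono 1 1 : DP (Fin 3) K) = u₀ * u₁ * u₂ := by
  rw [DP.var_mul_var (by decide), DP.var, DP.mono_mul_mono_of_disjoint, mul_one]
  · congr 1
    decide
  · decide

theorem DP.coeff_var (i : Fin 3) : DP.coeff 0 (DP.var K i) = 0 := by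
  classical
  rw [DP.var, DP.coeff_mono, if_neg]
  exact fun e => by simpa using congrFun e i

theorem DP.coeff_var_mul (i j : Fin 3) : DP.coeff 0 (DP.var K i * DP.var K j) = 0 := by
  by_contra hc
  obtain h := mul_hom_two i j 0 hc
  simp at h

/-- Evaluating the function, its first derivatives and its mixed second derivatives at the origin
isolates the coefficients one by one. -/
theorem squareFree_eq_zero {c : Fin 7 → K} (h : c 0 • (1 : DP (Fin 3) K) + c 1 • u₀ + c 2 • u₁ +
    c 3 • u₂ + c 4 • (u₀ * u₁) + c 5 • (u₀ * u₂) + c 6 • (u₁ * u₂) = 0) : ∀ i, c i = 0 := by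
  have e : ∀ T : DP (Fin 3) K →ₗ[K] K, c 0 * T 1 + c 1 * T u₀ + c 2 * T u₁ +
      c 3 * T u₂ + c 4 * T (u₀ * u₁) + c 5 * T (u₀ * u₂) + c 6 * T (u₁ * u₂) = 0 := fun T => by
    simpa using congrArg T h
  have h0 := e (DP.coeff 0)
  have h1 := fun i => e (DP.coeff 0 ∘ₗ DP.pd i)
  have h2 := fun i j => e (DP.coeff 0 ∘ₗ DP.pd i ∘ₗ DP.pd j)
  simp [DP.coeff_var, DP.coeff_var_mul, coeff_zero_one] at h0
  have h10 := h1 0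
  have h11 := h1 1
  have h12 := h1 2
  have h201 := h2 0 1
  have h202 := h2 0 2
  have h212 := h2 1 2
  simp [DP.pd_mul, DP.pd_one, DP.pd_var_apply, DP.coeff_var, coeff_zero_one] at h10 h11 h12 h201 h202 h212
  intro i
  fin_cases i
  exacts [h0, h10, h11, h12, h201, h202, h212]

end SquareFree

variable [CharP K 2]

theorem theta_lie_psi {M M' : Mat8 K} (hM : M ∈ oPiDer K) (hM' : M' ∈ oPiDer K) :
    theta K ⁅psi K M, psi K M'⁆ = theta K (psi K ⁅M, M'⁆) := by
  obtain ⟨a, β, w, γ, t, ha, rfl⟩ := exists_blockM hM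
  obtain ⟨a', β', w', γ', t', ha', rfl⟩ := exists_blockM hM'
  refine theta_eq_iff.mpr ⟨vf_lie_psi _ _ _ _ _ _ _ _ ha ha', fun i => ?_, fun i => ?_⟩
  · rw [fst_lie_psi _ _ _ _ _ _ _ _ ha ha', map_add, map_smul, DP.pd_one, smul_zero, add_zero]
  · rw [snd_lie_psi _ _ _ _ _ _ _ _ ha ha', map_add, map_smul, DP.pd_one, smul_zero, add_zero]

theorem psi_mem_brownL (N : Fin 3 → WithTop ℕ+) (M : Mat8 K) : psi K M ∈ brownL K N := by
  have h1 : ∀ c : K, c • 1 ∈ DP.shear K N := fun c => Submodule.smul_mem _ c (DP.one_mem_shear N)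
  have hv : ∀ (c : K) i, c • DP.var K i ∈ DP.shear K N := fun c i =>
    Submodule.smul_mem _ c (DP.var_mem_shear N i)
  have hm : ∀ (c : K) i j, c • (DP.var K i * DP.var K j) ∈ DP.shear K N := fun c i j =>
    Submodule.smul_mem _ c (DP.shear_mul (DP.var_mem_shear N i) (DP.var_mem_shear N j))
  refine ⟨forall_fin_three ?_ ?_ ?_, ?_, ?_⟩
  · rw [vf_psi, psiVF_zero]
    exact Submodule.add_mem _ (Submodule.add_mem _ (Submodule.add_mem _ (Submodule.add_mem _
      (Submodule.add_mem _ (h1 _) (hv _ _)) (hv _ _)) (hv _ _)) (hm _ _ _)) (hm _ _ _)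
  · rw [vf_psi, psiVF_one]
    exact Submodule.add_mem _ (Submodule.add_mem _ (Submodule.add_mem _ (Submodule.add_mem _
      (Submodule.add_mem _ (h1 _) (hv _ _)) (hv _ _)) (hv _ _)) (hm _ _ _)) (hm _ _ _)
  · rw [vf_psi, psiVF_two]
    exact Submodule.add_mem _ (Submodule.add_mem _ (Submodule.add_mem _ (Submodule.add_mem _
      (Submodule.add_mem _ (h1 _) (hv _ _)) (hv _ _)) (hv _ _)) (hm _ _ _)) (hm _ _ _)
  · rw [fst_psi]
    exact Submodule.add_mem _ (Submodule.add_mem _ (Submodule.add_mem _ (Submodule.add_mem _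
      (Submodule.add_mem _ (hv _ _) (hv _ _)) (hv _ _)) (hm _ _ _)) (hm _ _ _)) (hm _ _ _)
  · rw [snd_psi]
    exact Submodule.add_mem _ (Submodule.add_mem _ (Submodule.add_mem _ (Submodule.add_mem _
      (Submodule.add_mem _ (hv _ _) (hv _ _)) (hv _ _)) (hm _ _ _)) (hm _ _ _)) (hm _ _ _)

/-- `oPiDer` is spanned by brackets, `psi` respects brackets up to constants, and constants belong
to `derPart`. -/
theorem psi_mem_derPart (N : Fin 3 → WithTop ℕ+) {M : Mat8 K} (hM : M ∈ oPiDer K) :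
    psi K M ∈ derPart K N := by
  refine oPiDer_le_of_lie (T := (derPart K N).comap (psi K)) (fun M hM M' hM' => ?_) hM
  have h := lie_mem_derPart (psi_mem_brownL N M) (psi_mem_brownL N M')
  have e : psi K ⁅M, M'⁆ = ⁅psi K M, psi K M'⁆ + (psi K ⁅M, M'⁆ - ⁅psi K M, psi K M'⁆) := by abel
  rw [Submodule.mem_comap, e]
  refine Submodule.add_mem _ h (mem_derPart_of_theta_eq_zero ?_)
  rw [map_sub, theta_lie_psi hM hM', sub_self]

theorem exists_psi {x : BrownSpace K} (hx : x ∈ derPart K allOnes) :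
    ∃ M ∈ oPiDer K, theta K (psi K M) = theta K x := by
  obtain ⟨⟨Y, hY, hv⟩, hf, hg⟩ := hx
  obtain ⟨y0, h0⟩ := exists_squareFree (hY 0)
  obtain ⟨y1, h1⟩ := exists_squareFree (hY 1)
  obtain ⟨y2, h2⟩ := exists_squareFree (hY 2)
  obtain ⟨f, hf⟩ := exists_squareFree_of_noTop hf
  obtain ⟨g, hg⟩ := exists_squareFree_of_noTop hg
  -- The entries come from comparing coefficients of the curl of `Y` and of `f`, `g` with the
  -- formulas for `psi`. The matrix is determined only up to a scalar matrix, and the last diagonal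
  -- entry of `a` is normalized to zero; the constant terms `f 0` and `g 0` are lost in the
  -- quotient.
  refine ⟨blockM !![y2 4 + y1 5, y1 6, y2 6, g 6; y0 5, y0 6 + y2 4, y2 5, g 5;
    y0 4, y1 4, y1 5 + y0 6, g 4; f 1, f 2, f 3, 0] ![y0 7, y1 7, y2 7] ![f 6, f 5, f 4]
    ![y2 2 + y1 3, y0 3 + y2 1, y1 1 + y0 2] ![g 1, g 2, g 3], blockM_mem _ _ _ _ ?_,
    theta_eq_iff.mpr ⟨?_, fun i => ?_, fun i => ?_⟩⟩
  · have := CharTwo.two_eq_zero (R := K)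
    simp
    grind
  · have e2 : (2 : DP (Fin 3) K) = 0 := CharTwo.two_eq_zero
    have e3 : (2 : K) = 0 := CharTwo.two_eq_zero
    rw [hv, vf_psi]
    refine VF.ext (forall_fin_three ?_ ?_ ?_)
    all_goals
      simp only [curl_zero, curl_one, curl_two, h0, h1, h2, psiVF_zero, psiVF_one, psiVF_two,
        blockM_inl_inl, blockM_inl_inr, blockM_inr_inl, DP.mono_one_eq, altM, CharTwo.sub_eq_add]
      simp [DP.pd_mul, DP.pd_var_apply, DP.pd_one]
      simp only [DP.smul_eq_C, map_add, map_mul, map_zero]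
      generalize DP.C K = C
      grind
  · rw [hf, fst_psi]
    simp only [blockM_inl_inl, blockM_inl_inr, altM]
    simp [DP.pd_one]
    abel
  · rw [hg, snd_psi]
    simp only [blockM_inl_inl, blockM_inr_inl, altM]
    simp [DP.pd_one]
    abel

/-- Every off-diagonal entry occurs as a coefficient of a square-free monomial and must vanish. The
linear fields force three diagonal entries of `a` to agree, and the trace condition adds the fourth.
-/
theorem eq_smul_one_of_theta_psi {M : Mat8 K} (hM : M ∈ oPiDer K) (h : theta K (psi K M) = 0) :
    ∃ c : K, M = c • 1 := by
  obtain ⟨a, β, w, γ, t, ha, rfl⟩ := exists_blockM hM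
  obtain ⟨hv, hf, hg⟩ := theta_eq_zero_iff.mp h
  have v0 := congrFun hv 0
  have v1 := congrFun hv 1
  have v2 := congrFun hv 2
  rw [vf_psi, psiVF_zero] at v0
  rw [vf_psi, psiVF_one] at v1
  rw [vf_psi, psiVF_two] at v2
  obtain ⟨cf, hf'⟩ : ∃ c : K, (psi K (blockM a β w γ t)).fst - c • 1 = 0 :=
    ⟨_, sub_eq_zero.mpr ((DP.eq_mono_of_pd hf).trans (DP.mono_eq_smul _ _))⟩
  obtain ⟨cg, hg'⟩ : ∃ c : K, (psi K (blockM a β w γ t)).snd - c • 1 = 0 :=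
    ⟨_, sub_eq_zero.mpr ((DP.eq_mono_of_pd hg).trans (DP.mono_eq_smul _ _))⟩
  rw [fst_psi] at hf'
  rw [snd_psi] at hg'
  have e0 := squareFree_eq_zero (K := K) (c := ![γ 0, a 0 0 + a 3 3, a 0 1, a 0 2, β 1, β 2, 0])
    (by simpa [blockM_inl_inl, blockM_inl_inr, blockM_inr_inl, altM] using v0)
  have e1 := squareFree_eq_zero (K := K) (c := ![γ 1, a 1 0, a 1 1 + a 3 3, a 1 2, β 0, 0, β 2])
    (by simpa [blockM_inl_inl, blockM_inl_inr, blockM_inr_inl, altM] using v1)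
  have e2 := squareFree_eq_zero (K := K) (c := ![γ 2, a 2 0, a 2 1, a 0 0 + a 1 1, 0, β 0, β 1])
    (by simpa [blockM_inl_inl, blockM_inl_inr, blockM_inr_inl, altM] using v2)
  have e3 := squareFree_eq_zero (K := K) (c := ![-cf, a 3 0, a 3 1, a 3 2, w 2, w 1, w 0]) (by
    refine Eq.trans ?_ hf'; simp [blockM_inl_inl, blockM_inl_inr, blockM_inr_inl, altM]; abel)
  have e4 := squareFree_eq_zero (K := K) (c := ![-cg, t 0, t 1, t 2, a 2 3, a 1 3, a 0 3]) (by
    refine Eq.trans ?_ hg'; simp [blockM_inl_inl, blockM_inl_inr, blockM_inr_inl, altM]; abel)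
  simp [Fin.forall_fin_succ] at e0 e1 e2 e3 e4
  have h2 : (2 : K) = 0 := CharTwo.two_eq_zero
  have ha1 : a 1 1 = a 0 0 := by grind
  have ha2 : a 2 2 = a 0 0 := by grind
  have ha3 : a 3 3 = a 0 0 := by grind
  clear ha h hf hg hf' hg' v0 v1 v2 hv hM
  obtain ⟨c, hA⟩ : ∃ c, a = c • (1 : Matrix (Fin 4) (Fin 4) K) := by
    refine ⟨a 0 0, ?_⟩
    ext i j
    fin_cases i <;> fin_cases j <;> simp [*]
  have hB : altM β w = 0 := by
    ext i j
    fin_cases i <;> fin_cases j <;> simp [altM, *]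
  have hC : altM γ t = 0 := by
    ext i j
    fin_cases i <;> fin_cases j <;> simp [altM, *]
  refine ⟨c, ?_⟩
  rw [blockM, hB, hC, hA, Matrix.transpose_smul, Matrix.transpose_one, ← Matrix.fromBlocks_one,
    Matrix.fromBlocks_smul, smul_zero]

variable (K) in
/-- The map from the second derived algebra of the orthogonal algebra to Brown's algebra. -/
noncomputable def oPiToD4 : oPi2 K →ₗ⁅K⁆ D4 K allOnes :=
  { toFun := fun M => d4Mk K allOnes ⟨psi K M.1.1, psi_mem_derPart _ (mem_oPi2_iff.mp M.2)⟩
    map_add' := fun M M' => by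
      apply thetaD4_injective
      simp only [map_add, thetaD4_d4Mk]
      exact map_add (theta K) _ _ ▸ congrArg (theta K) (map_add (psi K) M.1.1 M'.1.1)
    map_smul' := fun c M => by
      apply thetaD4_injective
      simp only [map_smul, thetaD4_d4Mk, RingHom.id_apply]
      exact map_smul (theta K) c _ ▸ congrArg (theta K) (map_smul (psi K) c M.1.1)
    map_lie' := fun {M M'} => by
      apply thetaD4_injective
      rw [LieHom.map_lie]
      simp only [thetaD4_d4Mk]
      rw [← LieHom.map_lie, theta_lie_psi (mem_oPi2_iff.mp M.2) (mem_oPi2_iff.mp M'.2)]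
      rfl }

theorem thetaD4_oPiToD4 (M : oPi2 K) : thetaD4 K allOnes (oPiToD4 K M) = theta K (psi K M.1.1) := rfl

theorem oPiToD4_surjective : Function.Surjective (oPiToD4 K) := fun x => by
  obtain ⟨y, rfl⟩ := d4Mk_surjective x
  obtain ⟨M, hM, e⟩ := exists_psi y.2
  exact ⟨⟨⟨M, oPiDer_le_oPi hM⟩, mem_oPi2_iff.mpr hM⟩, thetaD4_injective e⟩

/-- Elements of the kernel are scalar matrices, hence central. Conversely, a surjective homomorphism
carries the center into the center of the target, which is zero for a simple algebra. -/
theorem oPiToD4_eq_zero_iff {M : oPi2 K} :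
    oPiToD4 K M = 0 ↔ M ∈ LieAlgebra.center K (oPi2 K) := by
  rw [LieModule.mem_maxTrivSubmodule]
  refine ⟨fun h M' => ?_, fun h => ?_⟩
  · obtain ⟨c, hc⟩ := eq_smul_one_of_theta_psi (mem_oPi2_iff.mp M.2) <| by
      rw [← thetaD4_oPiToD4, h, map_zero]
    refine Subtype.ext (Subtype.ext ?_)
    change ⁅M'.1.1, M.1.1⁆ = 0
    rw [hc, Ring.lie_def]
    simp
  · have hmem : oPiToD4 K M ∈ LieAlgebra.center K (D4 K allOnes) := by
      rw [LieModule.mem_maxTrivSubmodule]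
      intro x
      obtain ⟨M', rfl⟩ := oPiToD4_surjective x
      rw [← LieHom.map_lie, h, map_zero]
    have hs := isSimple_D4 (K := K) (N := allOnes)
    rcases hs.eq_bot_or_eq_top (LieAlgebra.center K (D4 K allOnes)) with e | e
    · rw [e] at hmem
      exact (LieSubmodule.mem_bot _).mp hmem
    · refine absurd ⟨fun x y => ?_⟩ hs.non_abelian
      have hy : y ∈ LieAlgebra.center K (D4 K allOnes) := e ▸ LieSubmodule.mem_top y
      rw [LieModule.mem_maxTrivSubmodule] at hy
      exact hy x

variable (K) in
/-- The homomorphism induced on the quotient by the center. -/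
noncomputable def oPiQuotToD4 : oPi2ModCenter K →ₗ⁅K⁆ D4 K allOnes :=
  { (LieAlgebra.center K (oPi2 K)).toSubmodule.liftQ (oPiToD4 K).toLinearMap
      fun _ hx => oPiToD4_eq_zero_iff.mpr hx with
    map_lie' := by
      intro x y
      induction x using Submodule.Quotient.induction_on
      induction y using Submodule.Quotient.induction_on
      exact (oPiToD4 K).map_lie _ _ }

theorem oPiQuotToD4_bijective : Function.Bijective (oPiQuotToD4 K) := by
  refine ⟨(injective_iff_map_eq_zero _).mpr fun x h => ?_, fun x => ?_⟩
  · induction x using Submodule.Quotient.induction_on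
    exact (Submodule.Quotient.mk_eq_zero _).mpr (oPiToD4_eq_zero_iff.mp h)
  · obtain ⟨M, rfl⟩ := oPiToD4_surjective x
    exact ⟨LieSubmodule.Quotient.mk M, rfl⟩

/-- The realization of matrices is graded, so if the image is homogeneous, the components of all
other degrees contribute nothing. This replaces an arbitrary representative modulo the center by a
homogeneous one. -/
theorem theta_psi_wtProj {k : ℤ} {M : Mat8 K} (h : theta K (psi K M) ∈ VF.hom K wt k) :
    theta K (psi K (wtProj k M)) = theta K (psi K M) := by
  have hk : theta K (psi K (wtProj k M)) ∈ VF.hom K wt k := theta_hom (psi_hom (wtProj_mem k M))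
  rw [← sub_eq_zero]
  refine (Submodule.disjoint_def.mp (VF.iSupIndep_hom wt k)) _ (Submodule.sub_mem _ hk h) ?_
  have hT : ∀ l, l ≠ k → theta K (psi K (wtProj l M)) ∈ ⨆ (l) (_ : l ≠ k), VF.hom K wt l :=
    fun l hl => Submodule.mem_iSup_of_mem l (Submodule.mem_iSup_of_mem hl
      (theta_hom (psi_hom (wtProj_mem l M))))
  have e : M = ∑ l ∈ Finset.Icc (-2 : ℤ) 2, wtProj l M := (sum_wtProj M).symm
  by_cases hk2 : k ∈ Finset.Icc (-2 : ℤ) 2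
  · have e' : wtProj k M - M = -∑ l ∈ (Finset.Icc (-2 : ℤ) 2).erase k, wtProj l M := by
      rw [eq_neg_iff_add_eq_zero, sub_add_eq_add_sub,
        Finset.add_sum_erase _ (fun l => wtProj l M) hk2, sum_wtProj, sub_self]
    rw [← map_sub, ← map_sub, e', map_neg, map_neg, map_sum, map_sum]
    exact Submodule.neg_mem _ (Submodule.sum_mem _ fun l hl => hT l (Finset.ne_of_mem_erase hl))
  · have e' : wtProj k M = 0 := by
      have hb : ∀ i j, rowDeg i - rowDeg j ∈ Finset.Icc (-2 : ℤ) 2 := by decide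
      ext i j
      exact if_neg fun hij : _ = k => hk2 (hij ▸ hb i j)
    rw [e', map_zero, map_zero, zero_sub, e, map_sum, map_sum]
    exact Submodule.neg_mem _ (Submodule.sum_mem _ fun l hl => hT l fun e => hk2 (e ▸ hl))

theorem exists_equiv_oPi : ∃ φ : D4 K allOnes ≃ₗ⁅K⁆ oPi2ModCenter K,
    ∀ (k : ℤ) x, x ∈ D4Part K allOnes k ↔ oPiHom K ![0, 0, 1, 1] k (φ x) := by
  let E := LieEquiv.ofBijective (oPiQuotToD4 K) oPiQuotToD4_bijective
  refine ⟨E.symm, fun k x => ?_⟩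
  obtain ⟨y, rfl⟩ : ∃ y, E y = x := ⟨_, E.apply_symm_apply x⟩
  rw [E.symm_apply_apply, mem_D4Part_iff]
  constructor
  · intro h
    induction y using Submodule.Quotient.induction_on with | _ M
    have hM := wtProj_mem_oPiDer k (mem_oPi2_iff.mp M.2)
    refine ⟨⟨⟨_, oPiDer_le_oPi hM⟩, mem_oPi2_iff.mpr hM⟩, chevalley_of_mem hM (wtProj_mem k _), ?_⟩
    apply oPiQuotToD4_bijective.1
    apply thetaD4_injective
    exact theta_psi_wtProj h
  · rintro ⟨M, hM, rfl⟩
    exact theta_hom (psi_hom (mem_of_chevalley hM).1)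

end OrthogonalIsomorphism

/-! ## The complete prolong of the negative part -/

section DegreeZero

variable {K : Type*} [Field K]

variable (K) in
/-- The action of `𝔤𝔩(2)` by vector fields of degree 0. -/
noncomputable def rhoGl : Matrix (Fin 2) (Fin 2) K →ₗ[K] VF Idx K where
  toFun B := mkVF
    (fun i => (B 0 0 + B 1 1) • DP.var K (.inl i) + B 1 0 • hat (pVar K) i + B 0 1 • hat (qVar K) i)
    (fun i => B 0 0 • pVar K i + B 0 1 • qVar K i) (fun i => B 1 0 • pVar K i + B 1 1 • qVar K i)
  map_add' B C := VF.ext fun i => by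
    rcases i with i | i | i <;> simp [add_smul] <;> abel
  map_smul' c B := VF.ext fun i => by
    rcases i with i | i | i <;> simp [mul_smul, ← mul_add]

theorem rhoGl_def (B : Matrix (Fin 2) (Fin 2) K) : rhoGl K B = mkVF
    (fun i => (B 0 0 + B 1 1) • DP.var K (.inl i) + B 1 0 • hat (pVar K) i + B 0 1 • hat (qVar K) i)
    (fun i => B 0 0 • pVar K i + B 0 1 • qVar K i)
    (fun i => B 1 0 • pVar K i + B 1 1 • qVar K i) := rfl

theorem hat_mem_shear [CharP K 2] (N : Idx → WithTop ℕ+) {v : Fin 3 → DP Idx K}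
    (h : ∀ i, v i ∈ DP.shear K N) : ∀ i, hat v i ∈ DP.shear K N :=
  forall_fin_three (DP.shear_mul (h _) (h _)) (DP.shear_mul (h _) (h _)) (DP.shear_mul (h _) (h _))

theorem hat_mem_hom {v : Fin 3 → DP Idx K} {d : ℤ} (h : ∀ i, v i ∈ DP.hom K wt d) :
    ∀ i, hat v i ∈ DP.hom K wt (d + d) :=
  forall_fin_three (DP.hom_mul (h _) (h _)) (DP.hom_mul (h _) (h _)) (DP.hom_mul (h _) (h _))

theorem rhoGl_mem_hom (B : Matrix (Fin 2) (Fin 2) K) : rhoGl K B ∈ VF.hom K wt 0 := by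
  have hp : ∀ i, pVar K i ∈ DP.hom K wt 1 := fun i => var_hom K (.inr (.inl i))
  have hq : ∀ i, qVar K i ∈ DP.hom K wt 1 := fun i => var_hom K (.inr (.inr i))
  refine mkVF_mem_hom (fun i => ?_) (fun i => ?_) (fun i => ?_)
  · exact Submodule.add_mem _ (Submodule.add_mem _ (Submodule.smul_mem _ _ (var_hom K (.inl i)))
      (Submodule.smul_mem _ _ (hat_mem_hom hp i))) (Submodule.smul_mem _ _ (hat_mem_hom hq i))
  · exact Submodule.add_mem _ (Submodule.smul_mem _ _ (hp i)) (Submodule.smul_mem _ _ (hq i))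
  · exact Submodule.add_mem _ (Submodule.smul_mem _ _ (hp i)) (Submodule.smul_mem _ _ (hq i))

variable [CharP K 2]

theorem rhoGl_mem_shear (N : Idx → WithTop ℕ+) (B : Matrix (Fin 2) (Fin 2) K) :
    rhoGl K B ∈ VF.shear K N := by
  have hp : ∀ i, pVar K i ∈ DP.shear K N := fun i => var_shear K N (.inr (.inl i))
  have hq : ∀ i, qVar K i ∈ DP.shear K N := fun i => var_shear K N (.inr (.inr i))
  refine mkVF_mem_shear (fun i => ?_) (fun i => ?_) (fun i => ?_)
  · exact Submodule.add_mem _ (Submodule.add_mem _ (Submodule.smul_mem _ _ (var_shear K N (.inl i)))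
      (Submodule.smul_mem _ _ (hat_mem_shear N hp i))) (Submodule.smul_mem _ _ (hat_mem_shear N hq i))
  · exact Submodule.add_mem _ (Submodule.smul_mem _ _ (hp i)) (Submodule.smul_mem _ _ (hq i))
  · exact Submodule.add_mem _ (Submodule.smul_mem _ _ (hp i)) (Submodule.smul_mem _ _ (hq i))

/-- `𝔤𝔩(2)` mixes the two copies of `V`. The quadratic `z`-terms of `rhoGl` supply the nonconstant
coefficients `p × v` of `wq`, so that the bracket stays in `𝔤₋₁`. -/
theorem lie_rhoGl_wp (B : Matrix (Fin 2) (Fin 2) K) (v : Fin 3 → K) :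
    ⁅rhoGl K B, wp K v⁆ = wp K (B 0 0 • v) + wq K (B 1 0 • v) := by
  rw [← lie_skew, neg_eq_self_of_charTwo K]
  refine VF.ext fun i => ?_
  rw [lie_wp_apply, rhoGl_def, wp_def, wq_def]
  rcases i with i | i | i
  all_goals
    fin_cases i
    all_goals
      simp [Fin.sum_univ_three, DP.pd_mul, DP.pd_var, DP.pd_const, hat, cross_apply, pVar, qVar,
        DP.mul_const, DP.const_eq, CharTwo.sub_eq_add, DP.mul_smul, mul_smul]
      try module

theorem lie_rhoGl_wq (B : Matrix (Fin 2) (Fin 2) K) (v : Fin 3 → K) :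
    ⁅rhoGl K B, wq K v⁆ = wp K (B 0 1 • v) + wq K (B 1 1 • v) := by
  have h2 : (2 : DP Idx K) = 0 := CharTwo.two_eq_zero
  rw [← lie_skew, neg_eq_self_of_charTwo K]
  refine VF.ext fun i => ?_
  rcases i with i | i | i
  · rw [lie_wq_apply_inl, act_wq, rhoGl_def, wp_def, wq_def]
    fin_cases i
    all_goals
      simp [Fin.sum_univ_three, DP.pd_mul, DP.pd_var, DP.pd_const, hat, cross_apply, pVar, qVar,
        DP.mul_const, DP.const_eq, CharTwo.sub_eq_add, DP.mul_smul, mul_smul]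
      simp only [← DP.const_mul, map_add]
      grind
  · rw [lie_wq_apply_inr, act_wq, rhoGl_def, wp_def, wq_def]
    fin_cases i
    all_goals
      simp [Fin.sum_univ_three, DP.pd_mul, DP.pd_var, DP.pd_const, hat, cross_apply, pVar, qVar,
        DP.mul_const, DP.const_eq, CharTwo.sub_eq_add, DP.mul_smul, mul_smul]
      try module
  · rw [lie_wq_apply_inr, act_wq, rhoGl_def, wp_def, wq_def]
    fin_cases i
    all_goals
      simp [Fin.sum_univ_three, DP.pd_mul, DP.pd_var, DP.pd_const, hat, cross_apply, pVar, qVar,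
        DP.mul_const, DP.const_eq, CharTwo.sub_eq_add, DP.mul_smul, mul_smul]
      try module

end DegreeZero

/-! ### The largest `𝔤₀` is `𝔰𝔩(3) ⊕ 𝔤𝔩(2)` and acts irreducibly on `𝔤₋₁`. -/

section DegreeZero

variable {K : Type*} [Field K]

theorem DP.const_injective {σ : Type*} : Function.Injective (DP.const (σ := σ) K) :=
  Finsupp.single_injective (M := K) 0

theorem wp_add_wq_eq_zero {v w : Fin 3 → K} (h : wp K v + wq K w = 0) : v = 0 ∧ w = 0 := by
  refine ⟨funext fun i => DP.const_injective (σ := Idx) ?_,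
    funext fun i => DP.const_injective (σ := Idx) ?_⟩
  · have := congrFun h (.inr (.inl i))
    simpa [wp_def, wq_def] using this
  · have := congrFun h (.inr (.inr i))
    simpa [wp_def, wq_def] using this

theorem wp_add_wq_injective {v w v' w' : Fin 3 → K} (h : wp K v + wq K w = wp K v' + wq K w') :
    v = v' ∧ w = w' := by
  have e : wp K (v - v') + wq K (w - w') = 0 := by
    rw [map_sub, map_sub, sub_add_sub_comm, h, sub_self]
  simpa [sub_eq_zero] using wp_add_wq_eq_zero e

theorem wz_injective : Function.Injective (wz K) := fun _ _ h =>
  funext fun i => DP.const_injective (σ := Idx) (congrFun h (.inl i))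

theorem wp_injective : Function.Injective (wp K) := fun _ _ h =>
  (wp_add_wq_injective (w := 0) (w' := 0) (by rw [h])).1

theorem wq_injective : Function.Injective (wq K) := fun _ _ h =>
  (wp_add_wq_injective (v := 0) (v' := 0) (by rw [h])).2

theorem disjoint_wp_wq : Disjoint (LinearMap.range (wp K)) (LinearMap.range (wq K)) := by
  rw [Submodule.disjoint_def]
  rintro _ ⟨v, rfl⟩ ⟨w, h⟩
  have := (wp_add_wq_injective (v := v) (w := 0) (v' := 0) (w' := w) (by simp [h])).1
  rw [this, map_zero]

theorem mem_gm1_iff {X : VF Idx K} : X ∈ gm1 K ↔ ∃ v w, X = wp K v + wq K w := by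
  refine ⟨fun h => ?_, ?_⟩
  · obtain ⟨_, ⟨v, rfl⟩, _, ⟨w, rfl⟩, rfl⟩ := Submodule.mem_sup.mp h
    exact ⟨v, w, rfl⟩
  · rintro ⟨v, w, rfl⟩
    exact Submodule.add_mem_sup ⟨_, rfl⟩ ⟨_, rfl⟩

theorem exists_wz_eq_lie (i : Fin 3) :
    ∃ j k, ⁅wp K (Pi.single j 1), wq K (Pi.single k 1)⁆ = wz K (Pi.single i 1) := by
  refine ⟨i + 1, i + 2, ?_⟩
  rw [lie_wp_wq]
  congr 1
  revert i
  refine forall_fin_three ?_ ?_ ?_ <;> ext j <;> fin_cases j <;> simp [cross_apply]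

theorem lin_injective : Function.Injective (lin K) := fun A B h => by
  ext i j
  have e : ⁅lin K A, wp K (Pi.single j 1)⁆ = ⁅lin K B, wp K (Pi.single j 1)⁆ := by rw [h]
  rw [lie_lin_wp, lie_lin_wp] at e
  simpa using congrFun (wp_injective e) i

variable [CharP K 2]

/-- `𝔤₋₂` is generated by `𝔤₋₁`, so transitivity needs to be tested on `𝔤₋₁` only. -/
theorem lie_wz_eq_zero {X : VF Idx K} (hp : ∀ i, ⁅wp K (Pi.single i 1), X⁆ = 0)
    (hq : ∀ i, ⁅wq K (Pi.single i 1), X⁆ = 0) (i : Fin 3) : ⁅wz K (Pi.single i 1), X⁆ = 0 := by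
  obtain ⟨j, k, e⟩ := exists_wz_eq_lie (K := K) i
  rw [← e, lie_lie, hp, hq, lie_zero, lie_zero, sub_zero]

theorem eq_zero_of_lie_gm1 {X : VF Idx K} {k : ℤ} (hX : X ∈ VF.hom K wt k) (hk : 0 ≤ k)
    (hp : ∀ i, ⁅wp K (Pi.single i 1), X⁆ = 0) (hq : ∀ i, ⁅wq K (Pi.single i 1), X⁆ = 0) : X = 0 :=
  eq_zero_of_lie_negative_of_hom hX hk (lie_wz_eq_zero hp hq) hp hq

variable (K) in
/-- The action of `𝔰𝔩(3) ⊕ 𝔤𝔩(2)` by vector fields of degree 0, as a linear map. -/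
noncomputable def rhoLin :
    LieAlgebra.SpecialLinear.sl (Fin 3) K × Matrix (Fin 2) (Fin 2) K →ₗ[K] VF Idx K :=
  (lin K ∘ₗ (LieAlgebra.SpecialLinear.sl (Fin 3) K).toSubmodule.subtype).coprod (rhoGl K)

theorem rhoLin_apply (A : LieAlgebra.SpecialLinear.sl (Fin 3) K) (B : Matrix (Fin 2) (Fin 2) K) :
    rhoLin K (A, B) = lin K A + rhoGl K B := rfl

theorem trace_sl (A : LieAlgebra.SpecialLinear.sl (Fin 3) K) : A.1.trace = 0 := A.2

theorem lie_rhoLin_wp (A : LieAlgebra.SpecialLinear.sl (Fin 3) K) (B : Matrix (Fin 2) (Fin 2) K)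
    (v : Fin 3 → K) : ⁅rhoLin K (A, B), wp K v⁆ =
      wp K (A.1.mulVec v + B 0 0 • v) + wq K (B 1 0 • v) := by
  rw [rhoLin_apply, add_lie, lie_lin_wp, lie_rhoGl_wp, map_add, add_assoc]

theorem lie_rhoLin_wq (A : LieAlgebra.SpecialLinear.sl (Fin 3) K) (B : Matrix (Fin 2) (Fin 2) K)
    (v : Fin 3 → K) : ⁅rhoLin K (A, B), wq K v⁆ =
      wp K (B 0 1 • v) + wq K (A.1.mulVec v + B 1 1 • v) := by
  rw [rhoLin_apply, add_lie, lie_lin_wq K (trace_sl A), lie_rhoGl_wq, map_add]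
  abel

theorem rhoLin_mem_hom (y) : rhoLin K y ∈ VF.hom K wt 0 :=
  Submodule.add_mem _ (lin_shear_hom K (fun _ => ⊤) _).2 (rhoGl_mem_hom _)

/-- Both sides have degree 0 and act on `𝔤₋₁` in the same way, so they agree by transitivity; only
matrix identities have to be checked. -/
theorem rhoLin_lie (y y') : rhoLin K ⁅y, y'⁆ = ⁅rhoLin K y, rhoLin K y'⁆ := by
  obtain ⟨A, B⟩ := y
  obtain ⟨A', B'⟩ := y'
  have e : ⁅(A, B), (A', B')⁆ = (⁅A, A'⁆, ⁅B, B'⁆) := rfl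
  have hA : (⁅A, A'⁆ : LieAlgebra.SpecialLinear.sl (Fin 3) K).1 = A.1 * A'.1 - A'.1 * A.1 := rfl
  rw [← sub_eq_zero]
  refine eq_zero_of_lie_gm1 (k := 0) (Submodule.sub_mem _ (rhoLin_mem_hom _) ?_) le_rfl
    (fun i => ?_) (fun i => ?_)
  · exact VF.lie_hom (rhoLin_mem_hom _) (rhoLin_mem_hom _)
  · rw [← lie_skew, neg_eq_zero, sub_lie, lie_lie, e]
    simp only [lie_rhoLin_wp, lie_rhoLin_wq, lie_add]
    simp only [hA, map_add, map_smul, Matrix.mulVec_add, Matrix.mulVec_smul, Ring.lie_def,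
      Matrix.sub_mulVec, Matrix.mulVec_mulVec, Matrix.sub_apply, Matrix.mul_apply,
      Fin.sum_univ_two, map_sub]
    module
  · rw [← lie_skew, neg_eq_zero, sub_lie, lie_lie, e]
    simp only [lie_rhoLin_wp, lie_rhoLin_wq, lie_add]
    simp only [hA, map_add, map_smul, Matrix.mulVec_add, Matrix.mulVec_smul, Ring.lie_def,
      Matrix.sub_mulVec, Matrix.mulVec_mulVec, Matrix.sub_apply, Matrix.mul_apply,
      Fin.sum_univ_two, map_sub]
    module

variable (K) in
/-- The action of `𝔰𝔩(3) ⊕ 𝔤𝔩(2)` by vector fields of degree 0. -/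
noncomputable def rho :
    LieAlgebra.SpecialLinear.sl (Fin 3) K × Matrix (Fin 2) (Fin 2) K →ₗ⁅K⁆ VF Idx K :=
  { rhoLin K with map_lie' := fun {y y'} => rhoLin_lie y y' }

theorem rho_apply (y) : rho K y = rhoLin K y := rfl

theorem lie_rho_gm1 (y) {Y : VF Idx K} (hY : Y ∈ gm1 K) : ⁅rho K y, Y⁆ ∈ gm1 K := by
  obtain ⟨v, w, rfl⟩ := mem_gm1_iff.mp hY
  obtain ⟨A, B⟩ := y
  rw [rho_apply, lie_add, lie_rhoLin_wp, lie_rhoLin_wq]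
  exact Submodule.add_mem _ (mem_gm1_iff.mpr ⟨_, _, rfl⟩) (mem_gm1_iff.mpr ⟨_, _, rfl⟩)

theorem lie_gm2_of_lie_gm1 {X : VF Idx K} (h : ∀ Y ∈ gm1 K, ⁅X, Y⁆ ∈ gm1 K) :
    ∀ Y ∈ gm2 K, ⁅X, Y⁆ ∈ gm2 K := by
  have h1 : ∀ i, wp K (Pi.single i 1) ∈ gm1 K := fun i => Submodule.mem_sup_left ⟨_, rfl⟩
  have h2 : ∀ i, wq K (Pi.single i 1) ∈ gm1 K := fun i => Submodule.mem_sup_right ⟨_, rfl⟩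
  refine forall_gm2_iff.mpr fun i => lie_mem_comm K _ ?_
  obtain ⟨j, k, e⟩ := exists_wz_eq_lie (K := K) i
  rw [← e, leibniz_lie]
  exact Submodule.add_mem _ (lie_gm1_gm1 K (h _ (h1 j)) (h2 k)) (lie_gm1_gm1 K (h1 j) (h _ (h2 k)))

theorem rho_mem_g0max (N : Idx → WithTop ℕ+) (y) : rho K y ∈ g0max K N :=
  ⟨Submodule.add_mem _ (lin_shear_hom K N _).1 (rhoGl_mem_shear N _), rhoLin_mem_hom y,
    fun _ => lie_rho_gm1 y, lie_gm2_of_lie_gm1 fun _ => lie_rho_gm1 y⟩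

/-- An element acting trivially on `V ⊗ K²` has a scalar matrix `A`, and a traceless scalar matrix
of size 3 is zero because `3 = 1` in `K`. -/
theorem rho_injective : Function.Injective (rho K) := by
  refine (injective_iff_map_eq_zero _).mpr ?_
  rintro ⟨A, B⟩ h
  have hp := fun v => lie_rhoLin_wp A B v
  have hq := fun v => lie_rhoLin_wq A B v
  rw [← rho_apply, h] at hp hq
  simp only [zero_lie] at hp hq
  have ep := fun i => wp_add_wq_eq_zero (hp (Pi.single i 1)).symm
  have eq := fun i => wp_add_wq_eq_zero (hq (Pi.single i 1)).symm
  have hA : ∀ i j, A.1 i j = if i = j then B 0 0 else 0 := fun i j => by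
    have := congrFun (ep j).1 i
    simp [Pi.single_apply] at this
    rw [← sub_eq_zero, CharTwo.sub_eq_add]
    exact this
  have htr := trace_sl A
  have h3 : (3 : K) = 1 := by
    have : (2 : K) = 0 := CharTwo.two_eq_zero
    linear_combination this
  have h00 : B 0 0 = 0 := by
    simp [Matrix.trace_fin_three, hA] at htr
    linear_combination htr - B 0 0 * h3
  have hA0 : A.1 = 0 := by
    ext i j
    rw [hA, h00, ite_self]; rfl
  refine Prod.ext (Subtype.ext hA0) ?_
  ext i j
  have e1 := congrFun (ep 0).2 0
  have e2 := congrFun (eq 0).1 0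
  have e3 := congrFun (eq 0).2 0
  simp [hA0] at e1 e2 e3
  fin_cases i <;> fin_cases j <;> assumption

/-- The vector fields of degree 0 that preserve `𝔤₋₁`. -/
theorem exists_rho_eq {X : VF Idx K} (hX : X ∈ VF.hom K wt 0) (h : ∀ Y ∈ gm1 K, ⁅X, Y⁆ ∈ gm1 K) :
    ∃ y, rho K y = X := by
  -- The field acts on the sum of the two copies of `V` by four blocks with columns `P`, `R`, `Q`,
  -- `S`. Since each copy is commutative, the derivation property makes `R` and `Q` scalar; the
  -- bracket between the copies is the alternating cross product, which makes `S - P` scalar.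
  choose P R hPR using fun k => mem_gm1_iff.mp (h (wp K (Pi.single k 1))
    (Submodule.mem_sup_left ⟨_, rfl⟩))
  choose Q S hQS using fun k => mem_gm1_iff.mp (h (wq K (Pi.single k 1))
    (Submodule.mem_sup_right ⟨_, rfl⟩))
  have h2 : (2 : K) = 0 := CharTwo.two_eq_zero
  have hR : ∀ k l, crossProduct (Pi.single l 1) (R k) + crossProduct (Pi.single k 1) (R l) = 0 := by
    intro k l
    have e := (leibniz_lie X (wp K (Pi.single k 1)) (wp K (Pi.single l 1))).symm
    rw [hPR, hPR, add_lie, lie_add, lie_wp_wp, lie_wp_wp, lie_wp_wp, zero_add, zero_add, lie_zero,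
      ← lie_skew, neg_eq_self_of_charTwo K, lie_wp_wq, lie_wp_wq, ← map_add] at e
    exact wz_injective (e.trans (map_zero _).symm)
  have hQ : ∀ k l, crossProduct (Q k) (Pi.single l 1) + crossProduct (Q l) (Pi.single k 1) = 0 := by
    intro k l
    have e := (leibniz_lie X (wq K (Pi.single k 1)) (wq K (Pi.single l 1))).symm
    rw [hQS, hQS, add_lie, lie_add, lie_wq_wq, lie_wq_wq, lie_wq_wq, add_zero, add_zero, lie_zero,
      ← lie_skew (wq K _) (wp K _), neg_eq_self_of_charTwo K, lie_wp_wq, lie_wp_wq, ← map_add] at e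
    exact wz_injective (e.trans (map_zero _).symm)
  have hT : ∀ k l, ⁅X, wz K (crossProduct (Pi.single k 1) (Pi.single l 1))⁆ =
      wz K (crossProduct (P k) (Pi.single l 1) + crossProduct (Pi.single k 1) (S l)) := by
    intro k l
    rw [← lie_wp_wq, leibniz_lie, hPR, hQS, add_lie, lie_add, lie_wp_wp, lie_wq_wq, add_zero,
      zero_add, lie_wp_wq, lie_wp_wq, map_add]
  have hS1 : ∀ k, crossProduct (P k) (Pi.single k 1) + crossProduct (Pi.single k 1) (S k) = 0 := by
    intro k
    have e := hT k k
    rw [cross_self, map_zero, lie_zero] at e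
    exact wz_injective (e.symm.trans (map_zero _).symm)
  have hS2 : ∀ k l, crossProduct (P k) (Pi.single l 1) + crossProduct (Pi.single k 1) (S l) +
      (crossProduct (P l) (Pi.single k 1) + crossProduct (Pi.single l 1) (S k)) = 0 := by
    intro k l
    apply wz_injective
    rw [map_add, ← hT, ← hT, ← lie_add, ← map_add, cross_anticomm', map_zero, lie_zero]
  have hR01 := hR 0 1
  have hR02 := hR 0 2
  have hR12 := hR 1 2
  have hQ01 := hQ 0 1
  have hQ02 := hQ 0 2
  have hQ12 := hQ 1 2
  have hS01 := hS2 0 1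
  have hS02 := hS2 0 2
  have hS12 := hS2 1 2
  have hS0 := hS1 0
  have hS1' := hS1 1
  have hS2' := hS1 2
  clear hT hS1 hS2 hR hQ
  simp [cross_apply, funext_iff, Fin.forall_fin_succ] at hR01 hR02 hR12 hQ01 hQ02 hQ12 hS01 hS02 hS12 hS0 hS1' hS2'
  have hRs : ∀ k i, R k i = if i = k then R 0 0 else 0 := by
    simp [Fin.forall_fin_succ]
    grind
  have hQs : ∀ k i, Q k i = if i = k then Q 0 0 else 0 := by
    simp [Fin.forall_fin_succ]
    grind
  have hSs : ∀ k i, S k i = P k i + if i = k then P 0 0 + S 0 0 else 0 := by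
    simp [Fin.forall_fin_succ]
    grind
  clear hR01 hR02 hR12 hQ01 hQ02 hQ12 hS01 hS02 hS12 hS0 hS1' hS2'
  -- In characteristic 2 the matrix `P + t` has trace `t + 3 t = 0`, so the scalar part of `P` can
  -- be moved into `𝔤𝔩(2)`.
  set t := P 0 0 + P 1 1 + P 2 2 with ht
  have hA : (Matrix.of fun i j => P j i + if i = j then t else 0).trace = 0 := by
    simp [Matrix.trace_fin_three]
    grind
  refine ⟨(⟨Matrix.of fun i j => P j i + if i = j then t else 0, hA⟩,
    !![t, Q 0 0; R 0 0, P 0 0 + S 0 0 + t]), ?_⟩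
  rw [← sub_eq_zero]
  refine eq_zero_of_lie_gm1 (Submodule.sub_mem _ (rhoLin_mem_hom _) hX) le_rfl (fun k => ?_)
    (fun k => ?_)
  · rw [← lie_skew, neg_eq_zero, sub_lie, hPR, rho_apply, lie_rhoLin_wp, sub_eq_zero]
    congr 2
    · ext i
      simp [Pi.single_apply]
      grind
    · ext i
      simp [Pi.single_apply, hRs k i]
  · rw [← lie_skew, neg_eq_zero, sub_lie, hQS, rho_apply, lie_rhoLin_wq, sub_eq_zero]
    congr 2
    · ext i
      simp [Pi.single_apply, hQs k i]
    · ext i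
      simp [Pi.single_apply, hSs k i]
      grind

theorem mem_g0max_iff {N : Idx → WithTop ℕ+} {X : VF Idx K} :
    X ∈ g0max K N ↔ ∃ y, rho K y = X :=
  ⟨fun h => exists_rho_eq h.2.1 h.2.2.1, fun ⟨y, h⟩ => h ▸ rho_mem_g0max N y⟩

/-- `𝔤𝔩(2)` moves a nonzero vector into `V`, the matrix units of `𝔰𝔩(3)` then produce every basis
vector of `V`, and `𝔤𝔩(2)` carries these over to the other copy. -/
theorem gm1_irreducible {N : Idx → WithTop ℕ+} {W : Submodule K (VF Idx K)} (hW : W ≤ gm1 K)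
    (h : ∀ X ∈ g0max K N, ∀ Y ∈ W, ⁅X, Y⁆ ∈ W) : W = ⊥ ∨ W = gm1 K := by
  rw [or_iff_not_imp_left]
  intro hne
  obtain ⟨Y, hY, hY0⟩ := Submodule.exists_mem_ne_zero_of_ne_bot hne
  have hr : ∀ A B, ∀ Y ∈ W, ⁅rhoLin K (A, B), Y⁆ ∈ W := fun A B => h _ (rho_mem_g0max N (A, B))
  obtain ⟨u, hu, hu0⟩ : ∃ u, wp K u ∈ W ∧ u ≠ 0 := by
    obtain ⟨v, w, rfl⟩ := mem_gm1_iff.mp (hW hY)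
    by_cases hw : w = 0
    · refine ⟨v, by simpa [hw] using hY, fun hv => hY0 (by simp [hv, hw])⟩
    · refine ⟨w, ?_, hw⟩
      have := hr 0 !![0, 1; 0, 0] _ hY
      rw [lie_add, lie_rhoLin_wp, lie_rhoLin_wq] at this
      simpa using this
  have hE : ∀ i j, i ≠ j → ∀ u, wp K u ∈ W → u j ≠ 0 → wp K (Pi.single i 1) ∈ W := by
    intro i j hij u hu hu0
    have htr : (Matrix.single i j (u j)⁻¹ : Matrix (Fin 3) (Fin 3) K).trace = 0 := by
      rw [Matrix.trace_single_eq_of_ne _ _ _ hij]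
    have := hr ⟨_, htr⟩ 0 _ hu
    rw [lie_rhoLin_wp] at this
    simp only [Matrix.zero_apply, zero_smul, map_zero, add_zero] at this
    convert this using 2
    ext k
    simp [Matrix.mulVec, dotProduct, Matrix.single_apply, Pi.single_apply, ite_and, hu0, eq_comm]
  obtain ⟨j, hj⟩ := Function.ne_iff.mp hu0
  obtain ⟨i, hi⟩ := exists_ne j
  have hp : ∀ k, wp K (Pi.single k 1) ∈ W := fun k => by
    by_cases hk : k = j
    · subst hk
      exact hE k i hi.symm _ (hE i k hi u hu hj) (by simp)
    · exact hE k j hk u hu hj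
  refine le_antisymm hW (gm1_le_of_single hp fun k => ?_)
  have := hr 0 !![0, 0; 1, 0] _ (hp k)
  have e : (0 : LieAlgebra.SpecialLinear.sl (Fin 3) K).1.mulVec (Pi.single k 1) = 0 :=
    Matrix.zero_mulVec _
  rw [lie_rhoLin_wp, e] at this
  simpa using this

end DegreeZero

/-! ### Absence of divided powers of `p` and `q` in the prolong of the negative part. -/

section NegativeProlong

variable {K : Type*} [Field K] [CharP K 2]

/-- In characteristic 2 the square of `ad P` is a derivation; the only obstruction to its commuting
with `ad Y` is its value on `Y`, which the hypothesis sets to zero. -/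
theorem lie_lie_self_comm {L : Type*} [LieRing L] [LieAlgebra K L] {P X Y : L}
    (h : ⁅⁅Y, P⁆, P⁆ = 0) : ⁅Y, ⁅P, ⁅P, X⁆⁆⁆ = ⁅P, ⁅P, ⁅Y, X⁆⁆⁆ := by
  have e : ⁅⁅Y, P⁆, ⁅P, X⁆⁆ = ⁅P, ⁅⁅Y, P⁆, X⁆⁆ := by
    rw [leibniz_lie, h, zero_lie, zero_add]
  rw [leibniz_lie Y P, leibniz_lie Y P X, lie_add, e, ← add_assoc, add_self_of_charTwo K, zero_add]

theorem g0max_eq_inf (N : Idx → WithTop ℕ+) :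
    g0max K N = g0max K (fun _ => ⊤) ⊓ VF.shear K N := by
  ext X
  refine ⟨fun h => ⟨⟨?_, h.2⟩, h.1⟩, fun h => ⟨h.2, h.1.2⟩⟩
  exact fun _ _ _ _ _ hn => absurd hn (by simp)

/-- Transitivity in degree -1, where fields need not vanish at the origin; it reduces to the
nondegeneracy of the cross product. -/
theorem eq_zero_of_lie_gm1_of_mem {X : VF Idx K} (hX : X ∈ gm1 K)
    (hp : ∀ i, ⁅wp K (Pi.single i 1), X⁆ = 0) (hq : ∀ i, ⁅wq K (Pi.single i 1), X⁆ = 0) : X = 0 := by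
  obtain ⟨v, w, rfl⟩ := mem_gm1_iff.mp hX
  have h1 : ∀ i, crossProduct (Pi.single i 1) w = 0 := fun i => wz_injective <| by
    rw [← lie_wp_wq, map_zero, ← hp i, lie_add, lie_wp_wp, zero_add]
  have h2 : ∀ i, crossProduct v (Pi.single i 1) = 0 := fun i => wz_injective <| by
    rw [← lie_wp_wq, map_zero, ← lie_skew, neg_eq_zero, ← hq i, lie_add, lie_wq_wq, add_zero]
  have h10 := h1 0
  have h11 := h1 1
  have h20 := h2 0
  have h21 := h2 1
  simp [cross_apply, funext_iff, Fin.forall_fin_succ] at h10 h11 h20 h21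
  have hv : v = 0 := by ext i; fin_cases i <;> simp [*]
  have hw : w = 0 := by ext i; fin_cases i <;> simp [*]
  rw [hv, hw, map_zero, map_zero, add_zero]

/-- The squares of the elements of `𝔤₋₁` in the adjoint representation of the prolong vanish if
they do in degree 0. -/
theorem lie_lie_prolongAux {N : Idx → WithTop ℕ+} {P : VF Idx K} (hP : P ∈ gm1 K)
    (h0 : ∀ X ∈ g0max K N, ⁅P, ⁅P, X⁆⁆ = 0) : ∀ (n : ℕ) (X : VF Idx K),
      X ∈ prolongAux N (g0max K N) n → ⁅P, ⁅P, X⁆⁆ = 0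
  | 0, X, hX => by rw [← lie_skew P X, lie_gm2_gm1 K hX hP, neg_zero, lie_zero]
  | 1, X, hX => by rw [← lie_skew, lie_gm2_gm1 K (lie_gm1_gm1 K hP hX) hP, neg_zero]
  | 2, X, hX => h0 X hX
  | n + 3, X, hX => by
    have hd := isDegreeZero_g0max K N
    -- The square of `ad P` commutes with `ad Y`, so the induction hypothesis for `[Y, X]`, one
    -- degree lower, shows that `[P, [P, X]]` commutes with `𝔤₋₁`.
    have hcomm : ∀ Y ∈ gm1 K, ⁅Y, ⁅P, ⁅P, X⁆⁆⁆ = 0 := fun Y hY => by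
      rw [lie_lie_self_comm (K := K) (lie_gm2_gm1 K (lie_gm1_gm1 K hY hP) hP)]
      exact lie_lie_prolongAux hP h0 (n + 2) _ (lie_mem_comm K _ (prolongAux_lie_gm1 hd _ hX hY))
    have hp := fun i => hcomm (wp K (Pi.single i 1)) (Submodule.mem_sup_left ⟨_, rfl⟩)
    have hq := fun i => hcomm (wq K (Pi.single i 1)) (Submodule.mem_sup_right ⟨_, rfl⟩)
    have hmem : ⁅P, ⁅P, X⁆⁆ ∈ prolongAux N (g0max K N) (n + 1) :=
      lie_mem_comm K _ (prolongAux_lie_gm1 hd _ (lie_mem_comm K _ (prolongAux_lie_gm1 hd _ hX hP)) hP)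
    -- For `n = 0` the element `[P, [P, X]]` has degree -1 and needs the separate form of
    -- transitivity.
    match n, hmem with
    | 0, hmem => exact eq_zero_of_lie_gm1_of_mem hmem hp hq
    | n + 1, hmem =>
      exact eq_zero_of_lie_gm1 (prolongAux_le hd _ hmem).2 (by push_cast; omega) hp hq

/-- The bracket of `rho K y` with `w^p(v)` has its part in the second copy of `V` proportional to
`v`, and `v × v = 0`. -/
theorem lie_lie_wp_rho (i : Fin 3) (y) :
    ⁅wp K (Pi.single i 1), ⁅wp K (Pi.single i 1), rho K y⁆⁆ = 0 := by
  obtain ⟨A, B⟩ := y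
  rw [← lie_skew _ (rho K _), rho_apply, lie_rhoLin_wp, lie_neg, lie_add, lie_wp_wp, lie_wp_wq,
    map_smul, cross_self, smul_zero, map_zero, add_zero, neg_zero]

theorem lie_lie_wq_rho (i : Fin 3) (y) :
    ⁅wq K (Pi.single i 1), ⁅wq K (Pi.single i 1), rho K y⁆⁆ = 0 := by
  obtain ⟨A, B⟩ := y
  rw [← lie_skew _ (rho K _), rho_apply, lie_rhoLin_wq, lie_neg, lie_add, lie_wq_wq, ← lie_skew,
    lie_wp_wq, map_smul, LinearMap.smul_apply, cross_self, smul_zero, map_zero, add_zero, neg_zero,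
    neg_zero]

/-- On squaring the sum of a `q`-derivative and terms `p ∂_z`, mixed terms occur twice and pure ones
contain `pᵢ² = 0`. -/
theorem pd_wq_act (i : Fin 3) (f : DP Idx K) :
    (wq K (Pi.single i 1)).act ((wq K (Pi.single i 1)).act f) =
      DP.pd (.inr (.inr i)) (DP.pd (.inr (.inr i)) f) := by
  have h2 : (2 : DP Idx K) = 0 := CharTwo.two_eq_zero
  have hc := fun j k => DP.pd_comm (K := K) (σ := Idx) j k
  have h0 := pVar_sq (K := K) 0
  have h1 := pVar_sq (K := K) 1
  have h3 := pVar_sq (K := K) 2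
  revert i
  refine forall_fin_three ?_ ?_ ?_
  · simp [act_wq_zero, DP.pd_mul, DP.pd_var]
    grind
  · simp [act_wq_one, DP.pd_mul, DP.pd_var]
    grind
  · simp [act_wq_two, DP.pd_mul, DP.pd_var]
    grind

theorem crossProduct_wq (i j : Fin 3) (X : VF Idx K) :
    (wq K (Pi.single i 1)).act (crossProduct (fun j => X (.inr (.inl j)))
      (fun j => DP.const K ((Pi.single i 1 : Fin 3 → K) j)) j) =
    crossProduct (fun j => (wq K (Pi.single i 1)).act (X (.inr (.inl j))))
      (fun j => DP.const K ((Pi.single i 1 : Fin 3 → K) j)) j := by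
  have hc : ∀ (f : DP Idx K) (a : K), (wq K (Pi.single i 1)).act (f * DP.const K a) =
      (wq K (Pi.single i 1)).act f * DP.const K a := fun f a => by
    rw [DP.mul_const, DP.mul_const, map_smul]
  rw [cross_apply, cross_apply]
  fin_cases j <;> simp [hc, map_sub]

theorem lie_lie_wq_apply (i : Fin 3) (X : VF Idx K) (j : Idx) :
    ⁅wq K (Pi.single i 1), ⁅wq K (Pi.single i 1), X⁆⁆ j =
      DP.pd (.inr (.inr i)) (DP.pd (.inr (.inr i)) (X j)) := by
  rcases j with j | j
  · rw [lie_wq_apply_inl, lie_wq_apply_inl, map_sub, pd_wq_act, crossProduct_wq]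
    simp only [lie_wq_apply_inr]
    rw [sub_sub, add_self_of_charTwo K, sub_zero]
  · rw [lie_wq_apply_inr, lie_wq_apply_inr, pd_wq_act]

theorem mem_shear_withOnes_top {X : VF Idx K} (h : ∀ j (i : Fin 3 ⊕ Fin 3),
    DP.pd (.inr i) (DP.pd (.inr i) (X j)) = 0) : X ∈ VF.shear K (withOnes fun _ => ⊤) := by
  intro j r hr i n hn
  rcases i with i | i
  · exact absurd hn (by simp [withOnes])
  · obtain rfl : (1 : ℕ+) = n := WithTop.coe_injective hn
    by_contra hc
    obtain ⟨s, rfl⟩ := DP.eq_add_single (i := .inr i) (r := r) (by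
      intro e; rw [e] at hc; simp at hc)
    obtain ⟨t, rfl⟩ := DP.eq_add_single (i := .inr i) (r := s) (by
      intro e; simp [e] at hc)
    rw [← DP.coeff_pd, ← DP.coeff_pd, h, map_zero] at hr
    exact hr rfl

/-- Squares of the adjoint actions of the basis fields of `𝔤₋₁` are second derivatives of the
coefficients in `p` and in `q`. They vanish on `𝔤₀`, hence on the whole prolong, so no exponent of
`p` or `q` exceeds 1. -/
theorem prolongAux_g0max_le (N : Idx → WithTop ℕ+) (n : ℕ) :
    prolongAux N (g0max K N) n ≤ VF.shear K (withOnes fun _ => ⊤) := by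
  intro X hX
  refine mem_shear_withOnes_top fun j i => ?_
  rcases i with i | i
  · rw [← lie_wp_single, ← lie_wp_single, lie_lie_prolongAux (Submodule.mem_sup_left ⟨_, rfl⟩)
      (fun X hX => ?_) n X hX]
    · rfl
    · obtain ⟨y, rfl⟩ := mem_g0max_iff.mp hX
      exact lie_lie_wp_rho i y
  · rw [← lie_lie_wq_apply, lie_lie_prolongAux (Submodule.mem_sup_right ⟨_, rfl⟩)
      (fun X hX => ?_) n X hX]
    · rfl
    · obtain ⟨y, rfl⟩ := mem_g0max_iff.mp hX
      exact lie_lie_wq_rho i y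

theorem prolongAux_g0max_withOnes (N : Idx → WithTop ℕ+) (n : ℕ) :
    prolongAux N (g0max K N) n = prolongAux (withOnes fun i => N (.inl i))
      (g0max K (withOnes fun i => N (.inl i))) n :=
  prolongAux_withOnes (g0max_eq_inf _) (g0max_eq_inf _) (prolongAux_g0max_le _) n

theorem prolongAux_mono {N : Idx → WithTop ℕ+} {g0 g0' : Submodule K (VF Idx K)} (h : g0 ≤ g0') :
    ∀ n, prolongAux N g0 n ≤ prolongAux N g0' n
  | 0 => le_rfl
  | 1 => le_rfl
  | 2 => h
  | n + 3 => fun _ hX => ⟨hX.1, hX.2.1, fun Y hY => prolongAux_mono h (n + 2) (hX.2.2.1 Y hY),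
      fun Y hY => prolongAux_mono h (n + 1) (hX.2.2.2 Y hY)⟩

theorem brownProlong_le_vle (N : Fin 3 → WithTop ℕ+) : brownProlong K (withOnes N) ≤ vle K N :=
  iSup_mono fun n => prolongAux_mono (isDegreeZero_g0sl K (withOnes N)).le n

end NegativeProlong

/-! ### Explicit fields of degree 1 and their brackets with `𝔤₋₁`. -/

section DegreeOne

variable {K : Type*} [Field K]

/-- The vector that represents the alternating part of a matrix. -/
def altVec (M : Matrix (Fin 3) (Fin 3) K) : Fin 3 → K := ![M 1 2 + M 2 1, M 0 2 + M 2 0, M 0 1 + M 1 0]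

/-- The matrix of the cross product with a basis vector, up to signs. -/
def crossMat (K : Type*) [Field K] (k : Fin 3) : Matrix (Fin 3) (Fin 3) K :=
  Matrix.of fun i j => if i ≠ j ∧ i ≠ k ∧ j ≠ k then 1 else 0

variable (K) in
/-- The fields of degree 1 with `[w^z(v), X] = w^p(M v)`. -/
noncomputable def degOneP : Matrix (Fin 3) (Fin 3) K →ₗ[K] VF Idx K where
  toFun M := mkVF
    (fun i => (∑ j, altVec M j • pVar K j) * hat (qVar K) i)
    (fun i => ∑ j, M i j • DP.var K (.inl j) + (∑ j, altVec M j • pVar K j) * qVar K i)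
    (fun i => ∑ j, M j i • hat (qVar K) j)
  map_add' M M' := VF.ext fun i => by
    rcases i with i | i | i <;> simp [Fin.sum_univ_three, add_smul, altVec, add_mul] <;> abel
  map_smul' c M := VF.ext fun i => by
    rcases i with i | i | i <;>
      simp [Fin.sum_univ_three, altVec, add_smul, mul_smul, add_mul, DP.smul_mul]

variable (K) in
/-- The fields of degree 1 with `[w^z(v), X] = w^q(M v)`. -/
noncomputable def degOneQ : Matrix (Fin 3) (Fin 3) K →ₗ[K] VF Idx K where
  toFun M := mkVF
    (crossProduct (pVar K) fun i => ∑ j, M i j • DP.var K (.inl j))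
    (fun i => ∑ j, M j i • hat (pVar K) j)
    (fun i => ∑ j, M i j • DP.var K (.inl j) + ∑ j, M j i • crossProduct (pVar K) (qVar K) j +
      (∑ j, altVec M j • pVar K j) * qVar K i)
  map_add' M M' := VF.ext fun i => by
    rcases i with i | i | i
    · fin_cases i <;> simp [Fin.sum_univ_three, add_smul, altVec, add_mul, mul_add, cross_apply] <;> abel
    · simp [Fin.sum_univ_three, add_smul, altVec, add_mul] ; abel
    · simp [Fin.sum_univ_three, add_smul, altVec, add_mul] ; abel
  map_smul' c M := VF.ext fun i => by
    rcases i with i | i | i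
    · fin_cases i <;> simp [Fin.sum_univ_three, altVec, mul_smul, mul_add, cross_apply, DP.mul_smul, smul_sub]
    · simp [Fin.sum_univ_three, altVec, mul_smul]
    · simp [Fin.sum_univ_three, altVec, add_smul, mul_smul, add_mul, DP.smul_mul]

theorem degOneP_def (M : Matrix (Fin 3) (Fin 3) K) : degOneP K M = mkVF
    (fun i => (∑ j, altVec M j • pVar K j) * hat (qVar K) i)
    (fun i => ∑ j, M i j • DP.var K (.inl j) + (∑ j, altVec M j • pVar K j) * qVar K i)
    (fun i => ∑ j, M j i • hat (qVar K) j) := rfl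

theorem degOneQ_def (M : Matrix (Fin 3) (Fin 3) K) : degOneQ K M = mkVF
    (crossProduct (pVar K) fun i => ∑ j, M i j • DP.var K (.inl j))
    (fun i => ∑ j, M j i • hat (pVar K) j)
    (fun i => ∑ j, M i j • DP.var K (.inl j) + ∑ j, M j i • crossProduct (pVar K) (qVar K) j +
      (∑ j, altVec M j • pVar K j) * qVar K i) := rfl

variable [CharP K 2]

theorem degOneP_mem_shear (N : Idx → WithTop ℕ+) (M : Matrix (Fin 3) (Fin 3) K) :
    degOneP K M ∈ VF.shear K N := by
  have hp : ∀ i, pVar K i ∈ DP.shear K N := fun i => var_shear K N (.inr (.inl i))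
  have hq : ∀ i, qVar K i ∈ DP.shear K N := fun i => var_shear K N (.inr (.inr i))
  have hs : ∀ (c : Fin 3 → K) (f : Fin 3 → DP Idx K), (∀ j, f j ∈ DP.shear K N) →
      ∑ j, c j • f j ∈ DP.shear K N := fun c f hf =>
    Submodule.sum_mem _ fun j _ => Submodule.smul_mem _ _ (hf j)
  have hm := hs (altVec M) _ hp
  exact mkVF_mem_shear (fun i => DP.shear_mul hm (hat_mem_shear N hq i))
    (fun i => Submodule.add_mem _ (hs _ _ fun j => var_shear K N _) (DP.shear_mul hm (hq i)))
    (fun i => hs _ _ (hat_mem_shear N hq))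

theorem degOneQ_mem_shear (N : Idx → WithTop ℕ+) (M : Matrix (Fin 3) (Fin 3) K) :
    degOneQ K M ∈ VF.shear K N := by
  have hp : ∀ i, pVar K i ∈ DP.shear K N := fun i => var_shear K N (.inr (.inl i))
  have hq : ∀ i, qVar K i ∈ DP.shear K N := fun i => var_shear K N (.inr (.inr i))
  have hs : ∀ (c : Fin 3 → K) (f : Fin 3 → DP Idx K), (∀ j, f j ∈ DP.shear K N) →
      ∑ j, c j • f j ∈ DP.shear K N := fun c f hf =>
    Submodule.sum_mem _ fun j _ => Submodule.smul_mem _ _ (hf j)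
  have hz : ∀ i, ∑ j, M i j • DP.var K (.inl j) ∈ DP.shear K N := fun i =>
    hs _ _ fun j => var_shear K N _
  exact mkVF_mem_shear (cross_mem _ fun i j => DP.shear_mul (hp i) (hz j))
    (fun i => hs _ _ (hat_mem_shear N hp))
    (fun i => Submodule.add_mem _ (Submodule.add_mem _ (hz i)
      (hs _ _ (cross_mem _ fun i j => DP.shear_mul (hp i) (hq j)))) (DP.shear_mul (hs _ _ hp) (hq i)))

theorem degOneP_mem_hom (M : Matrix (Fin 3) (Fin 3) K) : degOneP K M ∈ VF.hom K wt 1 := by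
  have hp : ∀ i, pVar K i ∈ DP.hom K wt 1 := fun i => var_hom K (.inr (.inl i))
  have hq : ∀ i, qVar K i ∈ DP.hom K wt 1 := fun i => var_hom K (.inr (.inr i))
  have hs : ∀ (d : ℤ) (c : Fin 3 → K) (f : Fin 3 → DP Idx K), (∀ j, f j ∈ DP.hom K wt d) →
      ∑ j, c j • f j ∈ DP.hom K wt d := fun d c f hf =>
    Submodule.sum_mem _ fun j _ => Submodule.smul_mem _ _ (hf j)
  have hm := hs 1 (altVec M) _ hp
  exact mkVF_mem_hom (fun i => DP.hom_mul hm (hat_mem_hom hq i))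
    (fun i => Submodule.add_mem _ (hs 2 _ _ fun j => var_hom K (.inl j)) (DP.hom_mul hm (hq i)))
    (fun i => hs 2 _ _ (hat_mem_hom hq))

theorem degOneQ_mem_hom (M : Matrix (Fin 3) (Fin 3) K) : degOneQ K M ∈ VF.hom K wt 1 := by
  have hp : ∀ i, pVar K i ∈ DP.hom K wt 1 := fun i => var_hom K (.inr (.inl i))
  have hq : ∀ i, qVar K i ∈ DP.hom K wt 1 := fun i => var_hom K (.inr (.inr i))
  have hs : ∀ (d : ℤ) (c : Fin 3 → K) (f : Fin 3 → DP Idx K), (∀ j, f j ∈ DP.hom K wt d) →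
      ∑ j, c j • f j ∈ DP.hom K wt d := fun d c f hf =>
    Submodule.sum_mem _ fun j _ => Submodule.smul_mem _ _ (hf j)
  have hz : ∀ i, ∑ j, M i j • DP.var K (.inl j) ∈ DP.hom K wt 2 := fun i =>
    hs 2 _ _ fun j => var_hom K (.inl j)
  exact mkVF_mem_hom (cross_mem _ fun i j => DP.hom_mul (hp i) (hz j))
    (fun i => hs 2 _ _ (hat_mem_hom hp))
    (fun i => Submodule.add_mem _ (Submodule.add_mem _ (hz i)
      (hs 2 _ _ (cross_mem _ fun i j => DP.hom_mul (hp i) (hq j)))) (DP.hom_mul (hs 1 _ _ hp) (hq i)))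

/-- The first summand has trace `altVec M k`; the scalar matrix contributes it three more times, and
the total is even. -/
theorem trace_crossMat (M : Matrix (Fin 3) (Fin 3) K) (k : Fin 3) :
    (M.transpose * crossMat K k + altVec M k • (1 : Matrix (Fin 3) (Fin 3) K)).trace = 0 := by
  have h2 : (2 : K) = 0 := CharTwo.two_eq_zero
  revert k
  refine forall_fin_three ?_ ?_ ?_ <;>
    simp [Matrix.trace_fin_three, Matrix.mul_apply, Fin.sum_univ_three, crossMat, altVec] <;> grind

/-- The traceless matrix by which a field of degree 1 acts. -/
def slMat (M : Matrix (Fin 3) (Fin 3) K) (k : Fin 3) : LieAlgebra.SpecialLinear.sl (Fin 3) K :=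
  ⟨M.transpose * crossMat K k + altVec M k • 1, trace_crossMat M k⟩

/-- This identity and the next three show that both families bracket `𝔤₋₁` into `𝔤₀`, so that they
belong to the prolong. -/
theorem lie_wp_degOneP (M : Matrix (Fin 3) (Fin 3) K) (k : Fin 3) :
    ⁅wp K (Pi.single k 1), degOneP K M⁆ = rho K (0, !![0, altVec M k; 0, 0]) := by
  refine VF.ext fun j => ?_
  rw [lie_wp_single, rho_apply, rhoLin_apply, degOneP_def, rhoGl_def]
  revert k
  refine forall_fin_three ?_ ?_ ?_ <;> rcases j with j | j | j <;> fin_cases j <;>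
    simp [hat, DP.pd_mul, DP.pd_var, Fin.sum_univ_three, DP.smul_mul]

set_option maxHeartbeats 2000000 in
theorem lie_wq_degOneP (M : Matrix (Fin 3) (Fin 3) K) (k : Fin 3) :
    ⁅wq K (Pi.single k 1), degOneP K M⁆ = rho K (slMat M k, !![0, 0; 0, altVec M k]) := by
  have h2 : (2 : DP Idx K) = 0 := CharTwo.two_eq_zero
  refine VF.ext fun j => ?_
  rw [rho_apply, rhoLin_apply, degOneP_def, rhoGl_def, lin_def]
  revert k
  refine forall_fin_three ?_ ?_ ?_ <;> rcases j with j | j | j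
  all_goals
    first | rw [lie_wq_apply_inl] | rw [lie_wq_apply_inr]
    first | rw [act_wq_zero] | rw [act_wq_one] | rw [act_wq_two]
    fin_cases j
  all_goals
    simp [slMat, crossMat, altVec, Matrix.mul_apply, hat, DP.pd_mul, DP.pd_var, Fin.sum_univ_three,
      DP.smul_mul, cross_apply, Matrix.one_apply, const_one]
    try simp only [← DP.const_mul, map_add, neg_eq_self_of_charTwo K]
    try grind

set_option maxHeartbeats 2000000 in
theorem lie_wp_degOneQ (M : Matrix (Fin 3) (Fin 3) K) (k : Fin 3) :
    ⁅wp K (Pi.single k 1), degOneQ K M⁆ = rho K (slMat M k, !![altVec M k, 0; 0, 0]) := by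
  have h2 : (2 : DP Idx K) = 0 := CharTwo.two_eq_zero
  refine VF.ext fun j => ?_
  rw [lie_wp_single, rho_apply, rhoLin_apply, degOneQ_def, rhoGl_def, lin_def]
  revert k
  refine forall_fin_three ?_ ?_ ?_ <;> rcases j with j | j | j <;> fin_cases j
  all_goals
    simp [slMat, crossMat, altVec, Matrix.mul_apply, hat, DP.pd_mul, DP.pd_var, Fin.sum_univ_three,
      DP.smul_mul, cross_apply, Matrix.one_apply, const_one]
    try simp only [← DP.const_mul, map_add, neg_eq_self_of_charTwo K]
    try grind

set_option maxHeartbeats 2000000 in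
theorem lie_wq_degOneQ (M : Matrix (Fin 3) (Fin 3) K) (k : Fin 3) :
    ⁅wq K (Pi.single k 1), degOneQ K M⁆ = rho K (0, !![0, 0; altVec M k, 0]) := by
  have h2 : (2 : DP Idx K) = 0 := CharTwo.two_eq_zero
  have h0 := pVar_sq (K := K) 0
  have h1 := pVar_sq (K := K) 1
  have h3 := pVar_sq (K := K) 2
  refine VF.ext fun j => ?_
  rw [rho_apply, rhoLin_apply, degOneQ_def, rhoGl_def]
  revert k
  refine forall_fin_three ?_ ?_ ?_ <;> rcases j with j | j | j
  all_goals
    first | rw [lie_wq_apply_inl] | rw [lie_wq_apply_inr]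
    first | rw [act_wq_zero] | rw [act_wq_one] | rw [act_wq_two]
    fin_cases j
  all_goals
    simp [altVec, hat, DP.pd_mul, DP.pd_var, Fin.sum_univ_three,
      DP.smul_mul, cross_apply, const_one]
    try simp only [← DP.const_mul, map_add, neg_eq_self_of_charTwo K]
    try grind

end DegreeOne

/-! ### The dimension of the degree 1 component. -/

section FinrankDegreeOne

variable {K : Type*} [Field K] [CharP K 2]

theorem lie_rhoLin_wz (A : LieAlgebra.SpecialLinear.sl (Fin 3) K) (B : Matrix (Fin 2) (Fin 2) K)
    (v : Fin 3 → K) : ⁅rhoLin K (A, B), wz K v⁆ =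
      wz K (-A.1.transpose.mulVec v + (B 0 0 + B 1 1) • v) := by
  have e : ⁅rhoGl K B, wz K v⁆ = wz K ((B 0 0 + B 1 1) • v) := by
    rw [← lie_skew, neg_eq_self_of_charTwo K]
    refine VF.ext fun i => ?_
    rw [lie_wz_apply, rhoGl_def, wz_def]
    rcases i with i | i | i
    all_goals
      fin_cases i
      all_goals
        simp [Fin.sum_univ_three, DP.pd_mul, DP.pd_var, hat, DP.const_eq, mul_smul]
        try module
  rw [rhoLin_apply, add_lie, lie_lin_wz, e, map_add]

/-- The condition on brackets with `𝔤₋₂` is redundant, as `𝔤₋₂` consists of brackets of elements of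
`𝔤₋₁`. -/
theorem prolongAux_g0max_three_iff {N : Idx → WithTop ℕ+} {X : VF Idx K} :
    X ∈ prolongAux N (g0max K N) 3 ↔ X ∈ VF.shear K N ∧ X ∈ VF.hom K wt 1 ∧
      (∀ i, ∃ y, rho K y = ⁅wp K (Pi.single i 1), X⁆) ∧
      ∀ i, ∃ y, rho K y = ⁅wq K (Pi.single i 1), X⁆ := by
  have e : ((0 : ℕ) : ℤ) + 1 = 1 := rfl
  constructor
  · rintro ⟨h1, h2, h3, -⟩
    rw [e] at h2
    obtain ⟨h4, h5⟩ := forall_gm1_iff.mp h3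
    exact ⟨h1, h2, fun i => mem_g0max_iff.mp (h4 i), fun i => mem_g0max_iff.mp (h5 i)⟩
  · rintro ⟨h1, h2, h3, h4⟩
    have hg := forall_gm1_iff.mpr ⟨fun i => mem_g0max_iff (N := N).mpr (h3 i),
      fun i => mem_g0max_iff.mpr (h4 i)⟩
    refine ⟨h1, by rw [e]; exact h2, hg, forall_gm2_iff.mpr fun i => ?_⟩
    obtain ⟨j, k, e⟩ := exists_wz_eq_lie (K := K) i
    have hj : wp K (Pi.single j 1) ∈ gm1 K := Submodule.mem_sup_left ⟨_, rfl⟩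
    have hk : wq K (Pi.single k 1) ∈ gm1 K := Submodule.mem_sup_right ⟨_, rfl⟩
    rw [← e, lie_lie]
    refine Submodule.sub_mem _ (lie_mem_comm K _ ?_) (lie_mem_comm K _ ?_)
    · exact (lie_mem_comm K (g0max K N) (hg _ hk)).2.2.1 _ hj
    · exact (lie_mem_comm K (g0max K N) (hg _ hj)).2.2.1 _ hk

theorem degOneP_mem (N : Idx → WithTop ℕ+) (M : Matrix (Fin 3) (Fin 3) K) :
    degOneP K M ∈ prolongAux N (g0max K N) 3 :=
  prolongAux_g0max_three_iff.mpr ⟨degOneP_mem_shear N M, degOneP_mem_hom M,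
    fun i => ⟨_, (lie_wp_degOneP M i).symm⟩, fun i => ⟨_, (lie_wq_degOneP M i).symm⟩⟩

theorem degOneQ_mem (N : Idx → WithTop ℕ+) (M : Matrix (Fin 3) (Fin 3) K) :
    degOneQ K M ∈ prolongAux N (g0max K N) 3 :=
  prolongAux_g0max_three_iff.mpr ⟨degOneQ_mem_shear N M, degOneQ_mem_hom M,
    fun i => ⟨_, (lie_wp_degOneQ M i).symm⟩, fun i => ⟨_, (lie_wq_degOneQ M i).symm⟩⟩

theorem lie_gm2_of_wz {X : VF Idx K} (hz : ∀ i, ⁅wz K (Pi.single i 1), X⁆ = 0) (v : Fin 3 → K) :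
    ⁅wz K v, X⁆ = 0 := by
  rw [wz_eq_sum, sum_lie]
  exact Finset.sum_eq_zero fun i _ => by rw [smul_lie, hz, smul_zero]

/-- The pair acts on `𝔤₋₂` by `-Aᵀ` plus the trace of `B`. If this action vanishes, `A` is scalar
and traceless, hence zero, and then so is the trace of `B`. -/
theorem sl_eq_zero_of_lie_wz {A : LieAlgebra.SpecialLinear.sl (Fin 3) K}
    {B : Matrix (Fin 2) (Fin 2) K} (h : ∀ i, ⁅wz K (Pi.single i 1), rho K (A, B)⁆ = 0) :
    A = 0 ∧ B 1 1 = B 0 0 := by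
  have e : ∀ i j, A.1 i j = if i = j then B 0 0 + B 1 1 else 0 := fun i j => by
    have := h i
    rw [← lie_skew, neg_eq_zero, rho_apply, lie_rhoLin_wz] at this
    have := congrFun (wz_injective (this.trans (map_zero _).symm)) j
    simp [Pi.single_apply] at this
    rw [neg_add_eq_zero] at this
    rw [this]
    exact if_congr eq_comm rfl rfl
  have ht := trace_sl A
  have h2 : (2 : K) = 0 := CharTwo.two_eq_zero
  simp [Matrix.trace_fin_three, e] at ht
  have h0 : B 0 0 + B 1 1 = 0 := by linear_combination ht - (B 0 0 + B 1 1) * h2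
  refine ⟨Subtype.ext ?_, by linear_combination h0 - B 0 0 * h2⟩
  ext i j
  rw [e, h0, ite_self]; rfl

/-- A field of degree 1 in the prolong that commutes with `𝔤₋₂` vanishes. -/
theorem eq_zero_of_lie_wz {N : Idx → WithTop ℕ+} {X : VF Idx K}
    (hX : X ∈ prolongAux N (g0max K N) 3) (hz : ∀ i, ⁅wz K (Pi.single i 1), X⁆ = 0) : X = 0 := by
  obtain ⟨-, hom, hp, hq⟩ := prolongAux_g0max_three_iff.mp hX
  have hc : ∀ Y ∈ gm1 K, ∀ i, ⁅wz K (Pi.single i 1), ⁅Y, X⁆⁆ = 0 := fun Y hY i => by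
    rw [leibniz_lie, hz, lie_zero, add_zero, lie_gm2_gm1 K ⟨_, rfl⟩ hY, zero_lie]
  -- Brackets of `X` with `𝔤₋₁` commute with `𝔤₋₂`, so they lie in the part `𝔰𝔩(2)` of `𝔤₀`; the
  -- equality of diagonal entries is tracelessness in characteristic 2.
  have hP : ∀ k, ∃ B : Matrix (Fin 2) (Fin 2) K, rho K (0, B) = ⁅wp K (Pi.single k 1), X⁆ ∧
      B 1 1 = B 0 0 := fun k => by
    obtain ⟨⟨A, B⟩, e⟩ := hp k
    obtain ⟨rfl, hB⟩ := sl_eq_zero_of_lie_wz (A := A) (B := B) fun i => by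
      rw [e, hc _ (Submodule.mem_sup_left ⟨_, rfl⟩)]
    exact ⟨B, e, hB⟩
  have hQ : ∀ k, ∃ B : Matrix (Fin 2) (Fin 2) K, rho K (0, B) = ⁅wq K (Pi.single k 1), X⁆ ∧
      B 1 1 = B 0 0 := fun k => by
    obtain ⟨⟨A, B⟩, e⟩ := hq k
    obtain ⟨rfl, hB⟩ := sl_eq_zero_of_lie_wz (A := A) (B := B) fun i => by
      rw [e, hc _ (Submodule.mem_sup_right ⟨_, rfl⟩)]
    exact ⟨B, e, hB⟩
  choose B hB hB1 using hP
  choose C hC hC1 using hQ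
  have h0 : ∀ v : Fin 3 → K, (0 : LieAlgebra.SpecialLinear.sl (Fin 3) K).1.mulVec v = 0 :=
    Matrix.zero_mulVec
  have actp : ∀ (B : Matrix (Fin 2) (Fin 2) K) v, ⁅wp K v, rho K (0, B)⁆ =
      wp K (B 0 0 • v) + wq K (B 1 0 • v) := fun B v => by
    rw [← lie_skew, neg_eq_self_of_charTwo K, rho_apply, lie_rhoLin_wp, h0, zero_add]
  have actq : ∀ (B : Matrix (Fin 2) (Fin 2) K) v, ⁅wq K v, rho K (0, B)⁆ =
      wp K (B 0 1 • v) + wq K (B 1 1 • v) := fun B v => by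
    rw [← lie_skew, neg_eq_self_of_charTwo K, rho_apply, lie_rhoLin_wq, h0, zero_add]
  -- For distinct `k` and `l` the Jacobi identity equates vectors along the basis directions `k` and
  -- `l`, so both sides vanish. The three cases together annihilate all entries.
  have pp : ∀ k l, k ≠ l → B l 0 0 = 0 ∧ B l 1 0 = 0 := fun k l hkl => by
    have e := leibniz_lie (wp K (Pi.single k 1)) (wp K (Pi.single l 1)) X
    rw [lie_wp_wp, zero_lie, zero_add, ← hB, ← hB, actp, actp] at e
    obtain ⟨e1, e2⟩ := wp_add_wq_injective e
    have e1 := congrFun e1 k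
    have e2 := congrFun e2 k
    simp [hkl] at e1 e2
    exact ⟨e1, e2⟩
  have qq : ∀ k l, k ≠ l → C l 0 1 = 0 ∧ C l 1 1 = 0 := fun k l hkl => by
    have e := leibniz_lie (wq K (Pi.single k 1)) (wq K (Pi.single l 1)) X
    rw [lie_wq_wq, zero_lie, zero_add, ← hC, ← hC, actq, actq] at e
    obtain ⟨e1, e2⟩ := wp_add_wq_injective e
    have e1 := congrFun e1 k
    have e2 := congrFun e2 k
    simp [hkl] at e1 e2
    exact ⟨e1, e2⟩
  have pq : ∀ k l, k ≠ l → B k 0 1 = 0 ∧ C l 1 0 = 0 := fun k l hkl => by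
    have e := leibniz_lie (wp K (Pi.single k 1)) (wq K (Pi.single l 1)) X
    rw [lie_wp_wq, lie_gm2_of_wz hz, zero_add, ← hB, ← hC, actp, actq] at e
    obtain ⟨e1, e2⟩ := wp_add_wq_injective e
    have e1 := congrFun e1 l
    have e2 := congrFun e2 k
    simp [hkl, hkl.symm] at e1 e2
    exact ⟨e1.symm, e2⟩
  refine eq_zero_of_lie_gm1 hom (by decide) (fun k => ?_) (fun k => ?_)
  · obtain ⟨l, hl⟩ := exists_ne k
    have : B k = 0 := by
      have h1 := pp l k hl
      have h2 := pq k l hl.symm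
      have h3 := hB1 k
      ext i j
      fin_cases i <;> fin_cases j <;> simp [*]
    rw [← hB, this]
    exact map_zero (rho K)
  · obtain ⟨l, hl⟩ := exists_ne k
    have : C k = 0 := by
      have h1 := qq l k hl
      have h2 := pq l k hl
      have h3 := (hC1 k).symm.trans h1.2
      ext i j
      fin_cases i <;> fin_cases j <;> simp [h1, h2, h3]
    rw [← hC, this]
    exact map_zero (rho K)

theorem lie_wz_degOne (M M' : Matrix (Fin 3) (Fin 3) K) (k : Fin 3) :
    ⁅wz K (Pi.single k 1), degOneP K M + degOneQ K M'⁆ =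
      wp K (fun i => M i k) + wq K (fun i => M' i k) := by
  refine VF.ext fun j => ?_
  rw [lie_wz_single, degOneP_def, degOneQ_def, wp_def, wq_def]
  revert k
  refine forall_fin_three ?_ ?_ ?_ <;> rcases j with j | j | j <;> fin_cases j <;>
    simp [hat, DP.pd_mul, DP.pd_var, Fin.sum_univ_three, cross_apply, DP.mul_const, DP.mul_smul, DP.const_eq]

/-- By `eq_zero_of_lie_wz` a field of degree 1 is determined by its brackets with `𝔤₋₂`, that is, by
two matrices of size 3. The families `degOneP` and `degOneQ` realize every such pair, whence `9 +
9`. -/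
theorem finrank_prolongAux_g0max (N : Idx → WithTop ℕ+) :
    Module.finrank K (prolongAux N (g0max K N) 3) = 18 := by
  have hrange : LinearMap.range ((degOneP K).coprod (degOneQ K)) = prolongAux N (g0max K N) 3 := by
    refine le_antisymm ?_ fun X hX => ?_
    · rintro _ ⟨⟨M, M'⟩, rfl⟩
      exact Submodule.add_mem _ (degOneP_mem N M) (degOneQ_mem N M')
    · choose v w h using fun k => mem_gm1_iff.mp
        (forall_gm2_iff.mp (fun Y hY => prolongAux_lie_gm2 (isDegreeZero_g0max K N) 1 hX hY) k)
      refine ⟨(Matrix.of fun i k => v k i, Matrix.of fun i k => w k i), ?_⟩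
      have hmem := Submodule.add_mem _ (degOneP_mem N (Matrix.of fun i k => v k i))
        (degOneQ_mem N (Matrix.of fun i k => w k i))
      rw [LinearMap.coprod_apply, ← sub_eq_zero]
      refine eq_zero_of_lie_wz (Submodule.sub_mem _ hmem hX) fun k => ?_
      rw [lie_sub, h, lie_wz_degOne, sub_eq_zero]
      rfl
  have hinj : Function.Injective ((degOneP K).coprod (degOneQ K)) := by
    refine (injective_iff_map_eq_zero _).mpr ?_
    rintro ⟨M, M'⟩ h
    rw [LinearMap.coprod_apply] at h
    have e : ∀ k, (fun i => M i k) = 0 ∧ (fun i => M' i k) = 0 := fun k =>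
      wp_add_wq_eq_zero (by rw [← lie_wz_degOne, h, lie_zero])
    refine Prod.ext ?_ ?_
    · ext i k
      exact congrFun (e k).1 i
    · ext i k
      exact congrFun (e k).2 i
  rw [← hrange, LinearMap.finrank_range_of_inj hinj, Module.finrank_prod, Module.finrank_matrix]
  simp

end FinrankDegreeOne


/-! ## The squaring of odd vector fields -/

section Squaring

variable {K : Type*} [Field K]

namespace DP

/-- The functions of parity `ε`. -/
def ofParity (K : Type*) [Field K] (ε : ZMod 2) : Submodule K (DP Idx K) where
  carrier := {f | ∀ r, coeff r f ≠ 0 → ∑ i, parity i * r i = ε}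
  zero_mem' := fun r h => absurd (map_zero (coeff r)) h
  add_mem' := by
    intro f g hf hg r h
    by_cases h' : coeff r f = 0
    · exact hg r (by simpa [h'] using h)
    · exact hf r h'
  smul_mem' := by
    intro c f hf r h
    exact hf r (fun e => h (by simp [e]))

theorem ofParity_pd {ε : ZMod 2} {f : DP Idx K} (i : Idx) (hf : f ∈ ofParity K ε) :
    pd i f ∈ ofParity K (ε - parity i) := by
  intro r hr
  have := hf _ hr
  rw [← this]
  simp [mul_add, Finset.sum_add_distrib, Pi.single_apply]

theorem ofParity_mul {ε δ : ZMod 2} {f g : DP Idx K} (hf : f ∈ ofParity K ε)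
    (hg : g ∈ ofParity K δ) : f * g ∈ ofParity K (ε + δ) := by
  intro t ht
  obtain ⟨r, s, hr, hs, rfl⟩ := exists_coeff_mul ht
  rw [← hf r hr, ← hg s hs]
  simp [mul_add, Finset.sum_add_distrib]

end DP

theorem VF.mem_ofParity_iff {ε : ZMod 2} {X : VF Idx K} :
    X ∈ VF.ofParity K ε ↔ ∀ j, X j ∈ DP.ofParity K (ε + parity j) := by
  refine forall_congr' fun j => forall_congr' fun r => imp_congr_right fun _ => ?_
  rw [← CharTwo.sub_eq_add ε, eq_sub_iff_add_eq]

theorem VF.act_ofParity {ε δ : ZMod 2} {X : VF Idx K} {f : DP Idx K}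
    (hX : X ∈ VF.ofParity K ε) (hf : f ∈ DP.ofParity K δ) : X.act f ∈ DP.ofParity K (ε + δ) := by
  rw [VF.act_apply]
  refine Submodule.sum_mem _ fun i _ => ?_
  have := DP.ofParity_mul (VF.mem_ofParity_iff.mp hX i) (DP.ofParity_pd i hf)
  rwa [show ε + parity i + (δ - parity i) = ε + δ by ring] at this

theorem VF.lie_ofParity {ε δ : ZMod 2} {X Y : VF Idx K} (hX : X ∈ VF.ofParity K ε)
    (hY : Y ∈ VF.ofParity K δ) : ⁅X, Y⁆ ∈ VF.ofParity K (ε + δ) :=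
  VF.mem_ofParity_iff.mpr fun j => by
    refine Submodule.sub_mem _ ?_ ?_
    · have := VF.act_ofParity hX (VF.mem_ofParity_iff.mp hY j)
      rwa [← add_assoc] at this
    · have := VF.act_ofParity hY (VF.mem_ofParity_iff.mp hX j)
      rwa [← add_assoc, add_comm δ ε] at this

theorem VF.sq_mem_ofParity {X : VF Idx K} (hX : X ∈ VF.ofParity K 1) :
    VF.sq X ∈ VF.ofParity K 0 :=
  VF.mem_ofParity_iff.mpr fun j => by
    have := VF.act_ofParity hX (VF.mem_ofParity_iff.mp hX j)
    rwa [← add_assoc, show (1 + 1 : ZMod 2) = 0 from rfl] at this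

theorem VF.disjoint_ofParity : Disjoint (VF.ofParity K 0) (VF.ofParity K 1) := by
  refine Submodule.disjoint_def.mpr fun X h0 h1 => VF.ext fun j => DP.ext fun r => ?_
  by_contra h
  exact zero_ne_one ((h0 j r h).symm.trans (h1 j r h))

theorem parity_eq_wt (i : Idx) : parity i = (wt i : ZMod 2) := by
  rcases i with i | i
  · exact (ZMod.natCast_self 2).symm
  · exact Int.cast_one.symm

/-- The even indeterminates have degree 2 and the odd ones degree 1, so parity is the degree modulo
2. -/
theorem VF.hom_le_ofParity (k : ℤ) : VF.hom K wt k ≤ VF.ofParity K (k : ZMod 2) := by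
  intro X hX
  refine VF.mem_ofParity_iff.mpr fun j r hr => ?_
  have := congrArg (Int.cast : ℤ → ZMod 2) (hX j r hr)
  push_cast at this
  simpa only [parity_eq_wt] using this

theorem VF.sq_smul (a : K) (X : VF Idx K) : VF.sq (a • X) = a ^ 2 • VF.sq X :=
  VF.ext fun j => by
    change (a • X).act (a • X j) = a ^ 2 • X.act (X j)
    rw [VF.act_smul_left, map_smul, smul_smul, ← pow_two]

variable [CharP K 2]

theorem VF.sq_add (X Y : VF Idx K) : VF.sq (X + Y) = VF.sq X + VF.sq Y + ⁅X, Y⁆ :=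
  VF.ext fun j => by
    change (X + Y).act (X j + Y j) = X.act (X j) + Y.act (Y j) + (X.act (Y j) - Y.act (X j))
    rw [VF.act_add_left, map_add, map_add, sub_eq_add_of_charTwo K]
    abel

/-- For an even indeterminate the coefficient of an odd field is an odd function; it has no constant
term, so its square is zero. For an odd one the second derivative already kills functions without
divided powers. -/
theorem mul_self_mul_pd_pd {N : Fin 3 → WithTop ℕ+} {X : VF Idx K} (hX : X ∈ VF.ofParity K 1)
    {f : DP Idx K} (hf : f ∈ DP.shear K (withOnes N)) (i : Idx) :
    X i * X i * DP.pd i (DP.pd i f) = 0 := by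
  rcases i with i | i
  · rw [DP.mul_self, zero_mul]
    by_contra h
    have := hX _ _ h
    simp [parity] at this
  · have : DP.pd (.inr i) (DP.pd (.inr i) f) = 0 := (DP.mem_shear_iff _ _).mp hf (.inr i) 1 rfl
    rw [this, mul_zero]

/-- The second-order part of the composition is a symmetric sum: its off-diagonal terms cancel in
pairs, and the diagonal ones vanish by `mul_self_mul_pd_pd`. The first-order part is `VF.sq X`. -/
theorem act_act_of_odd {N : Fin 3 → WithTop ℕ+} {X : VF Idx K} (hX : X ∈ VF.ofParity K 1)
    {f : DP Idx K} (hf : f ∈ DP.shear K (withOnes N)) : X.act (X.act f) = (VF.sq X).act f := by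
  have key : ∑ p : Idx × Idx, X p.1 * X p.2 * DP.pd p.1 (DP.pd p.2 f) = 0 := by
    refine Finset.sum_involution (fun p _ => p.swap) (fun p _ => ?_) (fun p _ hp e => hp ?_)
      (fun _ _ => Finset.mem_univ _) (fun p _ => p.swap_swap)
    · rw [Prod.fst_swap, Prod.snd_swap, mul_comm (X p.2), DP.pd_comm p.2, add_self_of_charTwo K]
    · obtain ⟨i, j⟩ := p
      obtain rfl : j = i := congrArg Prod.fst e
      exact mul_self_mul_pd_pd hX hf j
  rw [Fintype.sum_prod_type_right] at key
  rw [VF.act_apply X f, map_sum, ← add_zero ((VF.sq X).act f), ← key, VF.act_apply,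
    ← Finset.sum_add_distrib]
  refine Finset.sum_congr rfl fun j _ => ?_
  rw [VF.act_mul, VF.act_apply X (DP.pd j f), Finset.mul_sum]
  refine congrArg _ (Finset.sum_congr rfl fun i _ => ?_)
  ring

theorem lie_sq {N : Fin 3 → WithTop ℕ+} {X Y : VF Idx K} (hX : X ∈ VF.ofParity K 1)
    (hY : Y ∈ VF.shear K (withOnes N)) :
    ⁅VF.sq X, Y⁆ = ⁅X, ⁅X, Y⁆⁆ :=
  VF.ext fun j => by
    have e := act_act_of_odd hX (hY j)
    have h2 : (2 : DP Idx K) = 0 := CharTwo.two_eq_zero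
    change (VF.sq X).act (Y j) - Y.act (X.act (X j)) =
      X.act (X.act (Y j) - Y.act (X j)) - ⁅X, Y⁆.act (X j)
    rw [VF.act_lie, map_sub, e]
    linear_combination (X.act (Y.act (X j)) - Y.act (X.act (X j))) * h2

end Squaring

/-! ### The Lie superalgebra structure on the prolong of the negative part. -/

section Superalgebra

variable {K : Type*} [Field K] [CharP K 2] (N : Fin 3 → WithTop ℕ+)

theorem prolongAux_le_ofParity (n : ℕ) :
    prolongAux (withOnes N) (g0max K (withOnes N)) n ≤ VF.ofParity K (n : ZMod 2) := by
  intro X hX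
  have := VF.hom_le_ofParity _ (prolongAux_le (isDegreeZero_g0max K _) n hX).2
  rwa [show (((n : ℤ) - 2 : ℤ) : ZMod 2) = n by
    push_cast; rw [show (2 : ZMod 2) = 0 from rfl, sub_zero]] at this

theorem vle_le_shear {X : VF Idx K} (hX : X ∈ vle K N) : X ∈ VF.shear K (withOnes N) :=
  (iSup_le fun n _ h => (prolongAux_le (isDegreeZero_g0max K _) n h).1 :
    ⨆ n, prolongAux (withOnes N) (g0max K (withOnes N)) n ≤ _) hX

theorem exists_even_add_odd {X : VF Idx K} (hX : X ∈ vle K N) : ∃ Y Z,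
    Y ∈ ⨆ m, prolongAux (withOnes N) (g0max K (withOnes N)) (2 * m) ∧
    Z ∈ ⨆ m, prolongAux (withOnes N) (g0max K (withOnes N)) (2 * m + 1) ∧ Y + Z = X := by
  have h : ⨆ n, prolongAux (withOnes N) (g0max K (withOnes N)) n ≤
      (⨆ m, prolongAux (withOnes N) (g0max K (withOnes N)) (2 * m)) ⊔
        ⨆ m, prolongAux (withOnes N) (g0max K (withOnes N)) (2 * m + 1) := by
    refine iSup_le fun n => ?_
    obtain ⟨m, rfl | rfl⟩ := Nat.even_or_odd' n
    · exact le_sup_of_le_left (le_iSup (fun m => prolongAux _ (g0max K (withOnes N)) (2 * m)) m)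
    · exact le_sup_of_le_right
        (le_iSup (fun m => prolongAux _ (g0max K (withOnes N)) (2 * m + 1)) m)
  obtain ⟨Y, hY, Z, hZ, e⟩ := Submodule.mem_sup.mp (h hX)
  exact ⟨Y, Z, hY, hZ, e⟩

theorem iSup_even_le : ⨆ m, prolongAux (withOnes N) (g0max K (withOnes N)) (2 * m) ≤
    (vle K N).toSubmodule ⊓ VF.ofParity K 0 := by
  refine iSup_le fun m => le_inf (le_iSup (prolongAux _ (g0max K (withOnes N))) (2 * m)) ?_
  refine (prolongAux_le_ofParity N _).trans_eq ?_
  push_cast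
  rw [show (2 : ZMod 2) = 0 from rfl, zero_mul]

theorem iSup_odd_le : ⨆ m, prolongAux (withOnes N) (g0max K (withOnes N)) (2 * m + 1) ≤
    (vle K N).toSubmodule ⊓ VF.ofParity K 1 := by
  refine iSup_le fun m => le_inf (le_iSup (prolongAux _ (g0max K (withOnes N))) (2 * m + 1)) ?_
  refine (prolongAux_le_ofParity N _).trans_eq ?_
  push_cast
  rw [show (2 : ZMod 2) = 0 from rfl, zero_mul, zero_add]

theorem mem_iSup_odd {X : VF Idx K} (hX : X ∈ vle K N) (h1 : X ∈ VF.ofParity K 1) :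
    X ∈ ⨆ m, prolongAux (withOnes N) (g0max K (withOnes N)) (2 * m + 1) := by
  obtain ⟨Y, Z, hY, hZ, rfl⟩ := exists_even_add_odd N hX
  have : Y ∈ VF.ofParity K 1 := by
    have := Submodule.sub_mem _ h1 (iSup_odd_le N hZ).2
    rwa [add_sub_cancel_right] at this
  rwa [Submodule.disjoint_def.mp VF.disjoint_ofParity Y (iSup_even_le N hY).2 this, zero_add]

/-- The fields `wp` and `wq` square to zero, so by polarization the square of their sum is their
bracket. -/
theorem sq_gm1 {X : VF Idx K} (hX : X ∈ gm1 K) : VF.sq X ∈ gm2 K := by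
  obtain ⟨v, w, rfl⟩ := mem_gm1_iff.mp hX
  have hp : VF.sq (wp K v) = 0 := VF.ext fun j => by
    change (wp K v).act (wp K v j) = 0
    rcases j with j | j | j <;> simp [VF.act_apply, wp_def, DP.pd_const]
  have hq : VF.sq (wq K w) = 0 := VF.ext fun j => by
    change (wq K w).act (wq K w j) = 0
    rcases j with j | j | j
    · rw [act_idx]
      fin_cases j <;>
        simp [wq_def, cross_apply, DP.pd_mul, DP.pd_const, DP.pd_var, Fin.sum_univ_three]
    · simp [VF.act_apply, wq_def, DP.pd_const]
    · simp [VF.act_apply, wq_def, DP.pd_const]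
  rw [VF.sq_add, hp, hq, zero_add, zero_add, lie_wp_wq]
  exact ⟨_, rfl⟩

/-- Component number `2 * m + 1` has degree `2 m - 1`, so squares have degree `4 m - 2`, which is
number `4 * m`. The prolong conditions follow from `[X², Y] = [X, [X, Y]]`, whose right side
consists of brackets inside the prolong. -/
theorem sq_prolongAux (m : ℕ) {X : VF Idx K}
    (hX : X ∈ prolongAux (withOnes N) (g0max K (withOnes N)) (2 * m + 1)) :
    VF.sq X ∈ prolongAux (withOnes N) (g0max K (withOnes N)) (4 * m) := by
  have hd := isDegreeZero_g0max K (withOnes N)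
  obtain ⟨hs, hh⟩ := prolongAux_le hd _ hX
  have hodd := (iSup_odd_le N (Submodule.mem_iSup_of_mem m hX)).2
  match m, hX, hh with
  | 0, hX, _ => exact sq_gm1 hX
  | m + 1, hX, hh =>
    refine ⟨fun j => VF.act_shear hs (hs j), fun j => ?_, fun Y hY => ?_, fun Y hY => ?_⟩
    · have := VF.act_hom hh (hh j)
      rwa [show ((2 * (m + 1) + 1 : ℕ) : ℤ) - 2 + (((2 * (m + 1) + 1 : ℕ) : ℤ) - 2 + wt j) =
        ((4 * m + 1 : ℕ) : ℤ) + 1 + wt j by push_cast; ring] at this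
    · rw [lie_sq (N := N) hodd (gm1_le K _ hY).1]
      have := prolongAux_lie hd _ _ _ rfl hX (prolongAux_lie_gm1 hd (2 * m + 1) hX hY)
      rwa [show 2 * (m + 1) + 1 + (2 * m + 1 + 1) - 2 = 4 * m + 1 + 2 by omega] at this
    · rw [lie_sq (N := N) hodd (gm2_le K _ hY).1]
      have := prolongAux_lie hd _ _ _ rfl hX (prolongAux_lie_gm2 hd (2 * m + 1) hX hY)
      rwa [show 2 * (m + 1) + 1 + (2 * m + 1) - 2 = 4 * m + 1 + 1 by omega] at this

/-- Squaring is not additive: a sum of homogeneous odd fields is handled by `VF.sq_add`, whose extra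
term is a bracket and stays in the prolong. -/
theorem sq_mem_vle {X : VF Idx K} (hX : X ∈ vle K N) (h1 : X ∈ VF.ofParity K 1) :
    VF.sq X ∈ vle K N := by
  have h := mem_iSup_odd N hX h1
  clear hX h1
  induction h using Submodule.iSup_induction' with
  | mem m X hX =>
    exact Submodule.mem_iSup_of_mem (p := prolongAux _ (g0max K (withOnes N))) _
      (sq_prolongAux N m hX)
  | zero =>
    rw [show VF.sq (0 : VF Idx K) = 0 from VF.ext fun j => map_zero _]
    exact zero_mem _
  | add X Y hX hY ihX ihY =>
    rw [VF.sq_add]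
    exact add_mem (add_mem ihX ihY) ((vle K N).lie_mem (iSup_odd_le N hX).1 (iSup_odd_le N hY).1)

variable (K) in
/-- The Lie superalgebra `𝔳𝔩𝔢(3; N|6)`. -/
noncomputable def vleSuper : LieSuperStructure K (vle K N) where
  even := (VF.ofParity K 0).comap (vle K N).toSubmodule.subtype
  odd := (VF.ofParity K 1).comap (vle K N).toSubmodule.subtype
  isCompl := by
    refine ⟨Submodule.disjoint_def.mpr fun x h0 h1 => Subtype.ext ?_,
      codisjoint_iff_le_sup.mpr fun x _ => ?_⟩
    · exact Submodule.disjoint_def.mp VF.disjoint_ofParity _ h0 h1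
    · obtain ⟨Y, Z, hY, hZ, e⟩ := exists_even_add_odd N x.2
      have hY := iSup_even_le N hY
      have hZ := iSup_odd_le N hZ
      exact Submodule.mem_sup.mpr ⟨⟨Y, hY.1⟩, hY.2, ⟨Z, hZ.1⟩, hZ.2, Subtype.ext e⟩
  even_lie_even _ hx _ hy := VF.lie_ofParity hx hy
  even_lie_odd _ hx _ hy := VF.lie_ofParity hx hy
  sq x := ⟨⟨VF.sq x.1.1, sq_mem_vle N x.1.2 x.2⟩, VF.sq_mem_ofParity x.2⟩
  sq_smul a x := Subtype.ext <| Subtype.ext <| VF.sq_smul a x.1.1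
  sq_add x y := Subtype.ext <| VF.sq_add x.1.1 y.1.1
  sq_lie x y := Subtype.ext <| lie_sq x.2 (vle_le_shear N y.2)

end Superalgebra

/-! ### Assembly of the theorem. -/

theorem mainTheorem4 (K : Type*) [Field K] [CharP K 2] :
    -- Brown's algebras: the center, the grading, simplicity
    (∀ N : Fin 3 → WithTop ℕ+,
      LieAlgebra.center K (brownL K N) = brownLow K N ∧
      IsLieGrading K (D4Part K N) ∧
      LieAlgebra.IsSimple K (D4 K N)) ∧
    D4 K (fun _ => ⊤) = ⊤ ∧
    -- `N = (1, 1, 1)` yields the orthogonal algebra with the grading `r = (0011)`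
    (∃ φ : D4 K (fun _ => ((1 : ℕ+) : WithTop ℕ+)) ≃ₗ⁅K⁆ oPi2ModCenter K,
      ∀ (k : ℤ) x, x ∈ D4Part K (fun _ => ((1 : ℕ+) : WithTop ℕ+)) k ↔
        oPiHom K ![0, 0, 1, 1] k (φ x)) ∧
    -- the non-positive part with `𝔤₀ = 𝔰𝔩(3)`
    (Function.Injective (wz K) ∧ Function.Injective (wp K) ∧ Function.Injective (wq K) ∧
      Disjoint (LinearMap.range (wp K)) (LinearMap.range (wq K)) ∧
      Function.Injective (lin K) ∧
      (∀ v w, ⁅wp K v, wp K w⁆ = 0 ∧ ⁅wq K v, wq K w⁆ = 0 ∧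
        ⁅wp K v, wq K w⁆ = wz K (crossProduct v w)) ∧
      (∀ v w, ⁅wz K v, wz K w⁆ = 0 ∧ ⁅wz K v, wp K w⁆ = 0 ∧ ⁅wz K v, wq K w⁆ = 0) ∧
      (∀ A B : LieAlgebra.SpecialLinear.sl (Fin 3) K, ⁅lin K A, lin K B⁆ = lin K ⁅A, B⁆.1) ∧
      ∀ (A : LieAlgebra.SpecialLinear.sl (Fin 3) K) (v : Fin 3 → K),
        ⁅lin K A, wp K v⁆ = wp K (A.1.mulVec v) ∧ ⁅lin K A, wq K v⁆ = wq K (A.1.mulVec v) ∧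
        ⁅lin K A, wz K v⁆ = wz K (-A.1ᵀ.mulVec v)) ∧
    -- its complete prolong does not depend on the last six coordinates of `N`
    (∀ (N : Idx → WithTop ℕ+) (n : ℕ),
      prolongAux N (g0sl K) n = prolongAux (withOnes fun i => N (.inl i)) (g0sl K) n) ∧
    -- its complete prolong without restrictions on `N` is Brown's algebra
    (∃ e : D4 K (fun _ => ⊤) ≃ₗ⁅K⁆ brownProlong K (fun _ => ⊤),
      ∀ (n : ℕ) x, x ∈ D4Part K (fun _ => ⊤) (n - 2) ↔
        (e x : VF Idx K) ∈ prolongAux (fun _ => ⊤) (g0sl K) n) ∧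
    -- the second derived algebra of its complete prolong for any `N` is Brown's algebra
    (∀ N : Fin 3 → WithTop ℕ+,
      Module.finrank K (prolongAux (withOnes N) (g0sl K) 3) = 12 ∧
      ∃ e : D4 K N ≃ₗ⁅K⁆ LieAlgebra.derivedSeries K (brownProlong K (withOnes N)) 2,
        (∀ (n : ℕ) x, x ∈ D4Part K N (n - 2) ↔
          ((e x).1 : VF Idx K) ∈ prolongAux (withOnes N) (g0sl K) n) ∧
        ∀ n ≤ 2, ∀ X ∈ prolongAux (withOnes N) (g0sl K) n, ∃ x, ((e x).1 : VF Idx K) = X) ∧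
    -- the complete prolong of the negative part depends on `N₁, N₂, N₃` only
    (∀ (N : Idx → WithTop ℕ+) (n : ℕ),
      prolongAux N (g0max K N) n =
        prolongAux (withOnes fun i => N (.inl i)) (g0max K (withOnes fun i => N (.inl i))) n) ∧
    -- the desuperization of `𝔳𝔩𝔢(3; N|6)`
    (∀ N : Fin 3 → WithTop ℕ+,
      (∃ ρ : LieAlgebra.SpecialLinear.sl (Fin 3) K × Matrix (Fin 2) (Fin 2) K →ₗ⁅K⁆ VF Idx K,
        Function.Injective ρ ∧ (∀ X, X ∈ g0max K (withOnes N) ↔ ∃ y, ρ y = X) ∧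
        (∀ A, ρ (A, 0) = lin K A) ∧
        ∀ A B v, ⁅ρ (A, B), wp K v⁆ = wp K (A.1.mulVec v + B 0 0 • v) + wq K (B 1 0 • v) ∧
          ⁅ρ (A, B), wq K v⁆ = wp K (B 0 1 • v) + wq K (A.1.mulVec v + B 1 1 • v)) ∧
      (∀ W ≤ gm1 K, (∀ X ∈ g0max K (withOnes N), ∀ Y ∈ W, ⁅X, Y⁆ ∈ W) → W = ⊥ ∨ W = gm1 K) ∧
      Module.finrank K (prolongAux (withOnes N) (g0max K (withOnes N)) 3) = 18 ∧
      (∃ S : LieSuperStructure K (vle K N),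
        (∀ x : vle K N, x ∈ S.even ↔ (x : VF Idx K) ∈ VF.ofParity K 0) ∧
        (∀ x : vle K N, x ∈ S.odd ↔ (x : VF Idx K) ∈ VF.ofParity K 1) ∧
        ∀ x : S.odd, ((S.sq x : vle K N) : VF Idx K) = VF.sq (x.1 : VF Idx K)) ∧
      (∀ n, prolongAux (withOnes N) (g0sl K) n ≤ prolongAux (withOnes N) (g0max K (withOnes N)) n) ∧
      brownProlong K (withOnes N) ≤ vle K N) := by
  refine ⟨fun N => ⟨center_brownL, isLieGrading_D4, isSimple_D4⟩, D4_top, exists_equiv_oPi,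
    ⟨wz_injective, wp_injective, wq_injective, disjoint_wp_wq, lin_injective,
      fun v w => ⟨lie_wp_wp K v w, lie_wq_wq K v w, lie_wp_wq K v w⟩,
      fun v w => ⟨lie_wz_wz K v w, lie_wz_wp K v w, lie_wz_wq K v w⟩,
      fun A B => lie_lin_lin K A.1 B.1,
      fun A v => ⟨lie_lin_wp K A.1 v, lie_lin_wq K (trace_sl A) v, lie_lin_wz K A.1 v⟩⟩,
    prolongAux_g0sl_withOnes K, exists_equiv_brownProlong K,
    fun N => ⟨finrank_prolongAux_g0sl N, ?_⟩, prolongAux_g0max_withOnes,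
    fun N => ⟨⟨rho K, rho_injective, fun _ => mem_g0max_iff, fun A => ?_,
        fun A B v => ⟨lie_rhoLin_wp A B v, lie_rhoLin_wq A B v⟩⟩,
      fun _ => gm1_irreducible, finrank_prolongAux_g0max _,
      ⟨vleSuper K N, fun _ => Iff.rfl, fun _ => Iff.rfl, fun _ => rfl⟩,
      prolongAux_mono (isDegreeZero_g0sl K (withOnes N)).le, brownProlong_le_vle N⟩⟩
  · obtain ⟨e, he⟩ := exists_equiv_derivedSeries (K := K) N
    refine ⟨e, fun n x => ?_, fun n hn X hX => ?_⟩
    · rw [he]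
      exact mem_D4Part_iff_prolongAux
    · obtain ⟨x, hx⟩ := exists_thetaD4_eq hn hX
      exact ⟨x, (he x).trans hx⟩
  · rw [rho_apply, rhoLin_apply, map_zero, add_zero]
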